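/- Let $p$ be a prime, let $F$ and $C$ be finite extensions of $\mathbb{Q}_p$, and let $S$ be the set of $\mathbb{Q}_p$-algebra embeddings $F\to C$. Let $\mathcal{O}_F,\mathcal{O}_C$ be the rings of integers, $\varpi$ a uniformizer of $F$, $q$ the number of elements of the residue field of $F$, $e$ the ramification index of $F/\mathbb{Q}_p$, and $v_F$ the valuation (on $F$ and on $C$) extending the $p$-adic one and normalized by $v_F(\varpi)=1$, $v_F(0)=\infty$. Assume that $|S|=[F:\mathbb{Q}_p]$ and that $C$ contains a square root $s_\tau$ of $\tau(\varpi)$ for each $\tau\in S$, and fix these square roots. Let $G=\mathrm{GL}_2(F)$, $K=\mathrm{GL}_2(\mathcal{O}_F)$, let $Z$ be the centre of $G$, let $B$ be the subgroup of upper triangular matrices, and $\alpha=\mathrm{diag}(1,\varpi)$. For $\underline{k}=(k_\tau)_{\tau\in S}\in\mathbb{Z}_{\ge0}^S$ let $\rho_{\underline{k}}=\bigotimes_{\tau\in S}\rho_{k_\tau}^\tau$, where $\rho_{m}^\tau$ is the space of homogeneous polynomials of degree $m$ over $C$ in $x_\tau,y_\tau$, on which $\begin{pmatrix}a&b\\c&d\end{pmatrix}\in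 G$ acts by $x_\tau\mapsto\tau(a)x_\tau+\tau(c)y_\tau$, $y_\tau\mapsto\tau(b)x_\tau+\tau(d)y_\tau$. Let $\underline{\rho}_{\underline{k}}$ be the twist of $\rho_{\underline{k}}$ by the character $g\mapsto\prod_{\tau}s_\tau^{-k_\tau v_F(\det g)}$, and let $\underline{\rho}_{\underline{k}}^0\subset\underline{\rho}_{\underline{k}}$ be the $KZ$-stable lattice spanned over $\mathcal{O}_C$ by the tensor products of monomials. Let $\mathrm{ind}_{KZ}^G$ denote compact induction: functions $f$ on $G$ with $f(hg)=h\cdot f(g)$ for $h\in KZ$ and with support compact modulo $Z$, with $G$ acting by right translation. Let $\psi:G\to\mathrm{End}_C(\underline{\rho}_{\underline{k}})$ be the function supported on $KZ\alpha^{-1}KZ$ with $\psi(h_1\alpha^{-1}h_2)=\underline{\rho}_{\underline{k}}(h_1)\,U\,\underline{\rho}_{\underline{k}}(h_2)$ for $h_1,h_2\in KZ$, where $U$ multiplies $\bigotimes_\tau x_\tau^{k_\tau-i_\tau}y_\tau^{i_\tau}$ by $\prod_\tau\tau(\varpi)^{k_\tau-i_\tau}$, and let $T$ be the Hecke operator $Tf(g)=\sum_{xKZ\in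 G/KZ}\psi(x)f(x^{-1}g)$ on $\mathrm{ind}_{KZ}^G\underline{\rho}_{\underline{k}}$. For $a\in C$ put $$\Pi_{\underline{k},a}=\mathrm{ind}_{KZ}^G\underline{\rho}_{\underline{k}}\big/(T-a)\,\mathrm{ind}_{KZ}^G\underline{\rho}_{\underline{k}},$$ and let $\Theta_{\underline{k},a}$ be the image of $\mathrm{ind}_{KZ}^G\underline{\rho}_{\underline{k}}^0$ in $\Pi_{\underline{k},a}$. A lattice in a $C$-vector space $V$ is an $\mathcal{O}_C$-submodule that contains a nonzero multiple of each vector of $V$; it is separated if it contains no $C$-line. A $G$-invariant norm is a nonarchimedean $C$-norm $\|\cdot\|$ with $\|gv\|=\|v\|$ for all $g\in G$. **Theorem.** Suppose that exactly one $\sigma\in S$ has $k_\sigma\neq0$, and write $k=k_\sigma=dq+r$ with $0\le r<q$. Let $a\in C$ satisfy one of the following conditions: (i) $k\le\frac12q^2$, $r<q-d$ and $v_F(a)\in[0,1]$; (ii) $k\le\frac12q^2$, $2v_F(a)-1\le r<q-d$ and $v_F(a)\in[1,e]$; (iii) $k\le\min(pq-1,\frac12q^2)$, $d-1\le r$ and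 $v_F(a)\ge d$. Then $\Theta_{\underline{k},a}$ is a separated lattice in $\Pi_{\underline{k},a}$, and $\Pi_{\underline{k},a}$ admits a $G$-invariant norm. Moreover, for all $\lambda_1,\lambda_2\in C^\times$ with $\lambda_1\lambda_2=\prod_{\tau}\tau(\varpi)^{k_\tau}$, $\lambda_1+q\lambda_2=a$ and $\lambda_1\lambda_2^{-1}\notin\{q^2,1\}$, the representation $\rho_{\underline{k}}\otimes\pi$ admits a $G$-invariant norm, where $\pi=\mathrm{Ind}_B^G(\mathrm{nr}(\lambda_1^{-1})\otimes\mathrm{nr}(\lambda_2^{-1}))$ is the (unnormalized) smooth induction and $\mathrm{nr}(\mu)$ is the unramified character $x\mapsto\mu^{v_F(x)}$ of $F^\times$. -/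

import Mathlib

open scoped TensorProduct

noncomputable section

namespace BreuilSchneider

/-! ### Norms, integers, uniformizers, valuations -/

/-- The ring of integers `{x | ‖x‖ ≤ 1}` of a nonarchimedean normed field. -/
abbrev ringOfInt (L : Type*) [NormedField L] [IsUltrametricDist L] : Subring L :=
  (NormedField.valuation (K := L)).integer

/-- The number of elements of the residue field. -/
def residueCard (L : Type*) [NormedField L] [IsUltrametricDist L] : ℕ :=
  Nat.card (IsLocalRing.ResidueField (ringOfInt L))

/-- `ϖ` is a nonzero generator of the maximal ideal `{x | ‖x‖ < 1}` of the ring of integers. -/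
structure IsUniformizer {L : Type*} [NormedField L] (ϖ : L) : Prop where
  ne_zero : ϖ ≠ 0
  norm_lt_one : ‖ϖ‖ < 1
  norm_le : ∀ x : L, ‖x‖ < 1 → ‖x‖ ≤ ‖ϖ‖

/-- The integer-valued valuation on `F`, normalized by `ord ϖ ϖ = 1`: for `x ≠ 0` it is the
unique `n` with `‖x‖ = ‖ϖ‖ ^ n`. -/
def ord {F : Type*} [NormedField F] (ϖ x : F) : ℤ :=
  open Classical in if h : ∃ n : ℤ, ‖x‖ = ‖ϖ‖ ^ n then h.choose else 0

/-- The valuation `v_F` on an extension of `F`, normalized by `v_F(ϖ) = 1`, with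
`v_F(0) = ∞`. Here `C` carries the unique norm that extends the `p`-adic absolute value,
so that every embedding of `F` into `C` is isometric. -/
def vF {F C : Type*} [NormedField F] [NormedField C] (ϖ : F) (x : C) : EReal :=
  open Classical in
  if x = 0 then ⊤ else ((Real.log ‖x‖ / Real.log ‖ϖ‖ : ℝ) : EReal)

section ord

variable {F : Type*} [NormedField F] {ϖ : F}

lemma norm_eq_zpow_ord (hϖ : IsUniformizer ϖ) {x : F} (hx : x ≠ 0) :
    ‖x‖ = ‖ϖ‖ ^ ord ϖ x := by
  have hp : 0 < ‖ϖ‖ := norm_pos_iff.2 hϖ.ne_zero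
  have h : ∃ n : ℤ, ‖x‖ = ‖ϖ‖ ^ n := by
    obtain ⟨n, hn1, hn2⟩ := exists_mem_Ico_zpow (norm_pos_iff.2 hx)
      ((one_lt_inv₀ hp).2 hϖ.norm_lt_one)
    refine ⟨-n, ?_⟩
    rw [inv_zpow'] at hn1 hn2
    refine le_antisymm ?_ hn1
    have h1 : ‖x * ϖ ^ (n + 1)‖ < 1 := by
      rw [norm_mul, norm_zpow]
      calc ‖x‖ * ‖ϖ‖ ^ (n + 1) < ‖ϖ‖ ^ (-(n + 1)) * ‖ϖ‖ ^ (n + 1) := by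
            gcongr
        _ = 1 := by rw [← zpow_add₀ hp.ne']; simp
    have h2 := hϖ.norm_le _ h1
    rw [norm_mul, norm_zpow, zpow_add₀ hp.ne', zpow_one, ← mul_assoc] at h2
    have h3 : ‖x‖ * ‖ϖ‖ ^ n ≤ 1 := by
      have := (mul_le_mul_iff_left₀ hp).1 (h2.trans_eq (one_mul _).symm)
      exact this
    rw [zpow_neg]
    rwa [← le_div_iff₀ (zpow_pos hp n), one_div] at h3
  unfold ord
  rw [dif_pos h]
  exact h.choose_spec

lemma ord_mul (hϖ : IsUniformizer ϖ) {x y : F} (hx : x ≠ 0) (hy : y ≠ 0) :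
    ord ϖ (x * y) = ord ϖ x + ord ϖ y := by
  have hp : 0 < ‖ϖ‖ := norm_pos_iff.2 hϖ.ne_zero
  have h := norm_eq_zpow_ord hϖ (mul_ne_zero hx hy)
  rw [norm_mul, norm_eq_zpow_ord hϖ hx, norm_eq_zpow_ord hϖ hy, ← zpow_add₀ hp.ne'] at h
  exact (zpow_right_injective₀ hp hϖ.norm_lt_one.ne h).symm

lemma ord_one (hϖ : IsUniformizer ϖ) : ord ϖ (1 : F) = 0 := by
  have := ord_mul hϖ (one_ne_zero (α := F)) (one_ne_zero (α := F))
  rw [one_mul] at this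
  omega

end ord

/-! ### The subgroup `KZ` of `GL₂(F)` and the matrix `α` -/

/-- `KZ`, where `K = GL₂(O_F)` and `Z` is the centre of `GL₂(F)`. -/
def KZ (F : Type*) [NormedField F] [IsUltrametricDist F] : Subgroup (GL (Fin 2) F) :=
  (Matrix.GeneralLinearGroup.map (n := Fin 2) (ringOfInt F).subtype).range ⊔ Subgroup.center _

/-- `α = diag(1, ϖ)`. -/
def alpha {F : Type*} [NormedField F] {ϖ : F} (hϖ : IsUniformizer ϖ) : GL (Fin 2) F :=
  Matrix.GeneralLinearGroup.mkOfDetNeZero !![1, 0; 0, ϖ] (by simp [hϖ.ne_zero])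

section coset

variable {F : Type*} [NormedField F] [IsUltrametricDist F]

lemma mem_ringOfInt {x : F} : x ∈ ringOfInt F ↔ ‖x‖ ≤ 1 := by
  rw [Valuation.mem_integer_iff, ← NNReal.coe_le_coe]
  simp

lemma norm_le_one_of_mem_K {g : GL (Fin 2) F}
    (hg : g ∈ (Matrix.GeneralLinearGroup.map (n := Fin 2) (ringOfInt F).subtype).range)
    (i j : Fin 2) : ‖g i j‖ ≤ 1 := by
  obtain ⟨u, rfl⟩ := hg
  exact mem_ringOfInt.1 (u i j).2

lemma mem_K_of_norm_le {g : GL (Fin 2) F} (hg : ∀ i j, ‖g i j‖ ≤ 1)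
    (hdet : ‖(g : Matrix (Fin 2) (Fin 2) F).det‖ = 1) :
    g ∈ (Matrix.GeneralLinearGroup.map (n := Fin 2) (ringOfInt F).subtype).range := by
  let A : Matrix (Fin 2) (Fin 2) (ringOfInt F) := fun i j => ⟨g i j, mem_ringOfInt.2 (hg i j)⟩
  have hA : (ringOfInt F).subtype.mapMatrix A = (g : Matrix (Fin 2) (Fin 2) F) := by
    ext i j; rfl
  have hd : ((A.det : ringOfInt F) : F) = (g : Matrix (Fin 2) (Fin 2) F).det := by
    rw [← hA, ← RingHom.map_det]; rfl
  have hne : (g : Matrix (Fin 2) (Fin 2) F).det ≠ 0 := by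
    intro h; rw [h, norm_zero] at hdet; exact zero_ne_one hdet
  have hu : IsUnit A.det := by
    refine IsUnit.of_mul_eq_one ⟨(g : Matrix (Fin 2) (Fin 2) F).det⁻¹, mem_ringOfInt.2 ?_⟩ ?_
    · rw [norm_inv, hdet, inv_one]
    · apply Subtype.ext
      change ((A.det : ringOfInt F) : F) * _ = 1
      rw [hd]
      exact mul_inv_cancel₀ hne
  refine ⟨Matrix.GeneralLinearGroup.mk'' A hu, ?_⟩
  ext i j
  rfl

lemma norm_det_of_mem_K {g : GL (Fin 2) F}
    (hg : g ∈ (Matrix.GeneralLinearGroup.map (n := Fin 2) (ringOfInt F).subtype).range) :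
    ‖(g : Matrix (Fin 2) (Fin 2) F).det‖ = 1 := by
  have key : ∀ h ∈ (Matrix.GeneralLinearGroup.map (n := Fin 2) (ringOfInt F).subtype).range,
      ‖(h : Matrix (Fin 2) (Fin 2) F).det‖ ≤ 1 := by
    rintro _ ⟨u, rfl⟩
    have : ((Matrix.GeneralLinearGroup.map (n := Fin 2) (ringOfInt F).subtype u :
        GL (Fin 2) F) : Matrix (Fin 2) (Fin 2) F).det =
        (((u : Matrix (Fin 2) (Fin 2) (ringOfInt F)).det : ringOfInt F) : F) := by
      have := RingHom.map_det (ringOfInt F).subtype (u : Matrix (Fin 2) (Fin 2) (ringOfInt F))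
      exact this.symm
    rw [this]
    exact mem_ringOfInt.1 (Subtype.property _)
  have h1 := key g hg
  have h2 := key g⁻¹ (inv_mem hg)
  have h3 : ‖(g : Matrix (Fin 2) (Fin 2) F).det‖ *
      ‖((g⁻¹ : GL (Fin 2) F) : Matrix (Fin 2) (Fin 2) F).det‖ = 1 := by
    rw [← norm_mul, ← Matrix.det_mul, ← Units.val_mul, mul_inv_cancel]
    simp
  nlinarith [norm_nonneg (g : Matrix (Fin 2) (Fin 2) F).det]

/-- `KZ α⁻¹ KZ` is a finite union of left cosets of `KZ`. -/
lemma finite_cosets [ProperSpace F] {ϖ : F} (hϖ : IsUniformizer ϖ) :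
    ((fun g : GL (Fin 2) F => (g : GL (Fin 2) F ⧸ KZ F)) ''
      DoubleCoset.doubleCoset (alpha hϖ)⁻¹ (KZ F) (KZ F)).Finite := by
  classical
  set K := (Matrix.GeneralLinearGroup.map (n := Fin 2) (ringOfInt F).subtype).range with hK
  have hp : 0 < ‖ϖ‖ := norm_pos_iff.2 hϖ.ne_zero
  -- a finite set approximating the integers modulo the maximal ideal
  obtain ⟨t, -, htf, ht⟩ := (isCompact_closedBall (0 : F) 1).finite_cover_balls hp
  have hex : ∀ (k : K) (i j : Fin 2), ∃ y : t, ‖(k : GL (Fin 2) F) i j - y‖ < ‖ϖ‖ := by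
    intro k i j
    have : (k : GL (Fin 2) F) i j ∈ Metric.closedBall (0 : F) 1 := by
      simpa using norm_le_one_of_mem_K k.2 i j
    obtain ⟨y, hy, h⟩ := Set.mem_iUnion₂.1 (ht this)
    exact ⟨⟨y, hy⟩, by simpa [dist_eq_norm] using h⟩
  choose c hc using hex
  let f : K → GL (Fin 2) F ⧸ KZ F := fun k => ((k : GL (Fin 2) F) * (alpha hϖ)⁻¹ : GL (Fin 2) F)
  have : Finite t := htf
  have hfac : Function.FactorsThrough f c := by
    intro k k' hkk
    have hdiff : ∀ i j, ‖(k' : GL (Fin 2) F) i j - (k : GL (Fin 2) F) i j‖ ≤ ‖ϖ‖ := by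
      intro i j
      have h1 := hc k i j
      have h2 := hc k' i j
      rw [← hkk] at h2
      have : (k' : GL (Fin 2) F) i j - (k : GL (Fin 2) F) i j =
        ((k' : GL (Fin 2) F) i j - c k i j) - ((k : GL (Fin 2) F) i j - c k i j) := by ring
      rw [this]
      rw [sub_eq_add_neg]
      refine (IsUltrametricDist.norm_add_le_max _ _).trans (max_le h2.le ?_)
      rw [norm_neg]
      exact h1.le
    change ((_ : GL (Fin 2) F) : GL (Fin 2) F ⧸ KZ F) = ((_ : GL (Fin 2) F) : GL (Fin 2) F ⧸ KZ F)
    rw [QuotientGroup.eq]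
    refine (le_sup_left : K ≤ KZ F) ?_
    set m : GL (Fin 2) F := (k : GL (Fin 2) F)⁻¹ * k' with hm
    have hmK : m ∈ K := mul_mem (inv_mem k.2) k'.2
    have h01 : ‖m 0 1‖ ≤ ‖ϖ‖ := by
      have hinv := norm_le_one_of_mem_K (inv_mem k.2 : (k : GL (Fin 2) F)⁻¹ ∈ K)
      have h0 : ((k : GL (Fin 2) F)⁻¹ * k : GL (Fin 2) F) 0 1 = 0 := by simp
      have e1 : m 0 1 = (k : GL (Fin 2) F)⁻¹ 0 0 * ((k' : GL (Fin 2) F) 0 1 - (k : GL (Fin 2) F) 0 1)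
          + (k : GL (Fin 2) F)⁻¹ 0 1 * ((k' : GL (Fin 2) F) 1 1 - (k : GL (Fin 2) F) 1 1) := by
        have e2 : m 0 1 = m 0 1 - ((k : GL (Fin 2) F)⁻¹ * k : GL (Fin 2) F) 0 1 := by
          rw [h0, sub_zero]
        rw [e2, hm, Matrix.GeneralLinearGroup.coe_mul, Matrix.GeneralLinearGroup.coe_mul,
          Matrix.mul_apply, Matrix.mul_apply, Fin.sum_univ_two, Fin.sum_univ_two]
        ring
      rw [e1]
      refine (IsUltrametricDist.norm_add_le_max _ _).trans (max_le ?_ ?_)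
      · rw [norm_mul]
        exact (mul_le_of_le_one_left (norm_nonneg _) (hinv 0 0)).trans (hdiff _ _)
      · rw [norm_mul]
        exact (mul_le_of_le_one_left (norm_nonneg _) (hinv 0 1)).trans (hdiff _ _)
    have hconj : ((k : GL (Fin 2) F) * (alpha hϖ)⁻¹)⁻¹ * (k' * (alpha hϖ)⁻¹) =
        alpha hϖ * m * (alpha hϖ)⁻¹ := by
      rw [hm]; group
    rw [hconj]
    have hal : ((alpha hϖ : GL (Fin 2) F) : Matrix (Fin 2) (Fin 2) F) = !![1, 0; 0, ϖ] := rfl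
    have hali : (((alpha hϖ)⁻¹ : GL (Fin 2) F) : Matrix (Fin 2) (Fin 2) F) = !![1, 0; 0, ϖ⁻¹] := by
      rw [Matrix.coe_units_inv, hal]
      apply Matrix.inv_eq_left_inv
      ext i j
      fin_cases i <;> fin_cases j <;> simp [Matrix.mul_apply, Fin.sum_univ_two, hϖ.ne_zero]
    have hent := norm_le_one_of_mem_K hmK
    refine mem_K_of_norm_le ?_ ?_
    · have hmat : ((alpha hϖ * m * (alpha hϖ)⁻¹ : GL (Fin 2) F) : Matrix (Fin 2) (Fin 2) F) =
          !![m 0 0, m 0 1 * ϖ⁻¹; ϖ * m 1 0, m 1 1] := by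
        rw [Matrix.GeneralLinearGroup.coe_mul, Matrix.GeneralLinearGroup.coe_mul, hal, hali]
        ext i j
        fin_cases i <;> fin_cases j <;>
          simp [Matrix.mul_apply, Matrix.vecMul, dotProduct, Fin.sum_univ_two, mul_comm ϖ,
            mul_assoc, hϖ.ne_zero]
      intro i j
      rw [hmat]
      fin_cases i <;> fin_cases j
      · simpa using hent 0 0
      · simpa [← div_eq_mul_inv] using (div_le_one₀ hp).2 h01
      · simpa using mul_le_one₀ hϖ.norm_lt_one.le (norm_nonneg _) (hent 1 0)
      · simpa using hent 1 1
    · rw [Matrix.GeneralLinearGroup.coe_mul, Matrix.GeneralLinearGroup.coe_mul,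
        Matrix.det_mul, Matrix.det_mul, hal, hali]
      simp only [Matrix.det_fin_two_of, mul_zero, sub_zero, one_mul]
      rw [mul_comm ϖ, mul_assoc, mul_inv_cancel₀ hϖ.ne_zero, mul_one]
      exact norm_det_of_mem_K hmK
  have hrange : (Set.range f).Finite := by
    rw [← hfac.extend_comp (fun _ => f 1)]
    exact (Set.finite_range _).subset (Set.range_comp_subset_range _ _)
  refine hrange.subset ?_
  rintro _ ⟨g, hg, rfl⟩
  obtain ⟨x, hx, y, hy, rfl⟩ := DoubleCoset.mem_doubleCoset.1 hg
  obtain ⟨k, hk, z, hz, rfl⟩ := Subgroup.mem_sup_of_normal_right.1 hx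
  refine ⟨⟨k, hk⟩, ?_⟩
  change ((_ : GL (Fin 2) F) : GL (Fin 2) F ⧸ KZ F) = ((_ : GL (Fin 2) F) : GL (Fin 2) F ⧸ KZ F)
  rw [QuotientGroup.eq]
  have hz' := Subgroup.mem_center_iff.1 hz
  have : (k * (alpha hϖ)⁻¹)⁻¹ * (k * z * (alpha hϖ)⁻¹ * y) = z * y := by
    rw [mul_assoc k z, ← hz' (alpha hϖ)⁻¹]
    group
  rw [this]
  exact mul_mem ((le_sup_right : Subgroup.center _ ≤ KZ F) hz) hy

lemma alpha_mem_doubleCoset {ϖ : F} (hϖ : IsUniformizer ϖ) :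
    alpha hϖ ∈ DoubleCoset.doubleCoset (alpha hϖ)⁻¹ (KZ F : Set (GL (Fin 2) F)) (KZ F) := by
  have hdet : (!![0, 1; 1, 0] : Matrix (Fin 2) (Fin 2) F).det ≠ 0 := by simp
  set w : GL (Fin 2) F := Matrix.GeneralLinearGroup.mkOfDetNeZero !![0, 1; 1, 0] hdet with hw
  have hwK : w ∈ KZ F := by
    refine (le_sup_left : _ ≤ KZ F) (mem_K_of_norm_le ?_ ?_)
    · intro i j
      change ‖(!![0, 1; 1, 0] : Matrix (Fin 2) (Fin 2) F) i j‖ ≤ 1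
      fin_cases i <;> fin_cases j <;> simp
    · change ‖(!![0, 1; 1, 0] : Matrix (Fin 2) (Fin 2) F).det‖ = 1
      simp
  have hwv : (w : Matrix (Fin 2) (Fin 2) F) = !![0, 1; 1, 0] := rfl
  have hal : ((alpha hϖ : GL (Fin 2) F) : Matrix (Fin 2) (Fin 2) F) = !![1, 0; 0, ϖ] := rfl
  set z : GL (Fin 2) F := alpha hϖ * w * alpha hϖ * w with hz
  have hzv : (z : Matrix (Fin 2) (Fin 2) F) = ϖ • (1 : Matrix (Fin 2) (Fin 2) F) := by
    rw [hz, Matrix.GeneralLinearGroup.coe_mul, Matrix.GeneralLinearGroup.coe_mul,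
      Matrix.GeneralLinearGroup.coe_mul, hwv, hal]
    ext i j
    fin_cases i <;> fin_cases j <;> simp [Matrix.mul_apply]
  have hzZ : z ∈ Subgroup.center (GL (Fin 2) F) := by
    refine Subgroup.mem_center_iff.2 fun g => Units.ext ?_
    change (g : Matrix (Fin 2) (Fin 2) F) * (z : Matrix (Fin 2) (Fin 2) F) =
      (z : Matrix (Fin 2) (Fin 2) F) * (g : Matrix (Fin 2) (Fin 2) F)
    rw [hzv]
    simp
  have hww : w * w = 1 := by
    refine Units.ext ?_
    rw [Units.val_mul, hwv]
    ext i j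
    fin_cases i <;> fin_cases j <;> simp [Matrix.mul_apply, Fin.sum_univ_two]
  refine DoubleCoset.mem_doubleCoset.2 ⟨w, hwK, w * z,
    mul_mem hwK ((le_sup_right : _ ≤ KZ F) hzZ), ?_⟩
  have h1 : w * (alpha hϖ)⁻¹ * (w * z) = w * ((alpha hϖ)⁻¹ * (w * z)) := by group
  have h2 : w * z = z * w := Subgroup.mem_center_iff.1 hzZ w
  rw [h1, h2, hz]
  have h3 : w * ((alpha hϖ)⁻¹ * (alpha hϖ * w * alpha hϖ * w * w)) =
      (w * w) * alpha hϖ * (w * w) := by group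
  rw [h3, hww]
  simp

/-- `KZ α⁻¹ KZ` is also a finite union of right cosets of `KZ`. -/
lemma finite_cosets_inv [ProperSpace F] {ϖ : F} (hϖ : IsUniformizer ϖ) :
    ((fun g : GL (Fin 2) F => ((g⁻¹ : GL (Fin 2) F) : GL (Fin 2) F ⧸ KZ F)) ''
      DoubleCoset.doubleCoset (alpha hϖ)⁻¹ (KZ F) (KZ F)).Finite := by
  refine (finite_cosets hϖ).subset ?_
  rintro _ ⟨g, hg, rfl⟩
  refine ⟨g⁻¹, ?_, rfl⟩
  obtain ⟨x, hx, y, hy, rfl⟩ := DoubleCoset.mem_doubleCoset.1 hg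
  obtain ⟨x', hx', y', hy', h⟩ := DoubleCoset.mem_doubleCoset.1 (alpha_mem_doubleCoset hϖ)
  refine DoubleCoset.mem_doubleCoset.2 ⟨y⁻¹ * x', mul_mem (inv_mem hy) hx', y' * x⁻¹,
    mul_mem hy' (inv_mem hx), ?_⟩
  have : (x * (alpha hϖ)⁻¹ * y)⁻¹ = y⁻¹ * alpha hϖ * x⁻¹ := by group
  rw [this]
  nth_rewrite 1 [h]
  group

end coset

/-! ### Compact induction and Hecke operators -/

section induction

variable {C G V : Type*} [Field C] [Group G] [AddCommGroup V] [Module C V]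

/-- The compact induction `ind_H^G ρ`, for an open subgroup `H` of `G`: the functions `f : G → V`
with `f (h g) = ρ h (f g)` for `h ∈ H` that are supported on finitely many cosets `H g`
(indexed by the class of `g⁻¹` in `G ⧸ H`). As `H` is open, this finiteness is compactness of
the support modulo `H`. -/
def compactInd (H : Subgroup G) (ρ : Representation C G V) : Submodule C (G → V) where
  carrier := {f | (∀ h ∈ H, ∀ g, f (h * g) = ρ h (f g)) ∧
    ((fun g : G => ((g⁻¹ : G) : G ⧸ H)) '' Function.support f).Finite}
  add_mem' := by
    rintro f f' ⟨h1, h2⟩ ⟨h1', h2'⟩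
    refine ⟨fun h hh g => by simp [h1 h hh, h1' h hh], ((h2.union h2').subset ?_)⟩
    rw [← Set.image_union]
    exact Set.image_mono (Function.support_add f f')
  zero_mem' := ⟨fun h hh g => by simp, by simp⟩
  smul_mem' := by
    rintro c f ⟨h1, h2⟩
    exact ⟨fun h hh g => by simp [h1 h hh],
      h2.subset (Set.image_mono (Function.support_const_smul_subset c f))⟩

/-- `G` acts on `ind_H^G ρ` by right translations. -/
def compactIndRep (H : Subgroup G) (ρ : Representation C G V) :
    Representation C G (compactInd H ρ) where
  toFun x :=
    { toFun := fun f => ⟨fun g => f.1 (g * x), by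
        refine ⟨fun h hh g => (congrArg f.1 (mul_assoc h g x)).trans (f.2.1 h hh _), ?_⟩
        refine (f.2.2.image (fun c => x • c)).subset ?_
        rintro _ ⟨g, hg, rfl⟩
        refine ⟨_, ⟨g * x, hg, rfl⟩, ?_⟩
        change (((x * (g * x)⁻¹ : G)) : G ⧸ H) = _
        congr 1
        group⟩
      map_add' := fun _ _ => rfl
      map_smul' := fun _ _ => rfl }
  map_one' := by ext f g; simp
  map_mul' x y := by ext f g; simp [mul_assoc]

/-- An element of the Hecke algebra of `(H, ρ)`: a function `φ : G → End V` with
`φ (h₁ g h₂) = ρ h₁ ∘ φ g ∘ ρ h₂` for `h₁, h₂ ∈ H`, supported on finitely many cosets of `H`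
(on either side). -/
structure HeckeKernel (H : Subgroup G) (ρ : Representation C G V) where
  toFun : G → Module.End C V
  equivariant : ∀ h₁ ∈ H, ∀ h₂ ∈ H, ∀ g, toFun (h₁ * g * h₂) = ρ h₁ * toFun g * ρ h₂
  finite_support : ((fun g : G => (g : G ⧸ H)) '' Function.support toFun).Finite
  finite_support_inv : ((fun g : G => ((g⁻¹ : G) : G ⧸ H)) '' Function.support toFun).Finite

namespace HeckeKernel

variable {H : Subgroup G} {ρ : Representation C G V} (φ : HeckeKernel H ρ)

/-- The summand `φ x (f (x⁻¹ g))` at the coset `x H`; it does not depend on the representative. -/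
def term (f : G → V) (g : G) (x : G ⧸ H) : V := φ.toFun x.out (f (x.out⁻¹ * g))

lemma term_mk (f : compactInd H ρ) (g x : G) :
    φ.term f.1 g (x : G ⧸ H) = φ.toFun x (f.1 (x⁻¹ * g)) := by
  obtain ⟨h, hh⟩ := QuotientGroup.mk_out_eq_mul H x
  have e1 := φ.equivariant 1 H.one_mem h h.2 x
  rw [one_mul, map_one, one_mul] at e1
  have e2 := f.2.1 (h : G)⁻¹ (H.inv_mem h.2) (x⁻¹ * g)
  unfold term
  rw [hh, e1, mul_inv_rev, mul_assoc, e2]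
  simp [← Module.End.mul_apply, mul_assoc, ← map_mul]

lemma finite_support_term (f : compactInd H ρ) (g : G) :
    (Function.support (φ.term f.1 g)).Finite := by
  refine φ.finite_support.subset ?_
  intro x hx
  refine ⟨x.out, ?_, QuotientGroup.out_eq' x⟩
  intro h0
  apply hx
  unfold term
  rw [h0]
  rfl

/-- The Hecke operator `T_φ f (g) = ∑_{x H ∈ G / H} φ x (f (x⁻¹ g))` on `ind_H^G ρ`. -/
def operator : Module.End C (compactInd H ρ) where
  toFun f := ⟨fun g => ∑ᶠ x : G ⧸ H, φ.term f.1 g x, by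
    constructor
    · intro h hh g
      change ∑ᶠ x : G ⧸ H, φ.term f.1 (h * g) x = ρ h (∑ᶠ x : G ⧸ H, φ.term f.1 g x)
      rw [← finsum_comp_equiv (MulAction.toPerm h : Equiv.Perm (G ⧸ H))]
      have : ∀ x : G ⧸ H, φ.term f.1 (h * g) (MulAction.toPerm h x) =
          ρ h (φ.term f.1 g x) := by
        intro x
        induction x using QuotientGroup.induction_on with
        | H x =>
          have hx : (MulAction.toPerm h ((x : G) : G ⧸ H) : G ⧸ H) = ((h * x : G) : G ⧸ H) := rfl
          have e1 := φ.equivariant h hh 1 H.one_mem x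
          rw [mul_one, map_one, mul_one] at e1
          rw [hx, term_mk, term_mk, e1, Module.End.mul_apply]
          congr 3
          group
      simp_rw [this]
      exact ((ρ h).toAddMonoidHom.map_finsum (φ.finite_support_term f g)).symm
    · refine (Set.Finite.image2 (fun d c : G ⧸ H => d.out • c) f.2.2
        φ.finite_support_inv).subset ?_
      rintro _ ⟨g, hg, rfl⟩
      obtain ⟨x, hx⟩ : ∃ x : G ⧸ H, φ.term f.1 g x ≠ 0 := by
        by_contra! h
        exact hg (by simp [h])
      have hx1 : φ.toFun x.out ≠ 0 := fun h0 => hx (by simp [term, h0])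
      have hx2 : f.1 (x.out⁻¹ * g) ≠ 0 := fun h0 => hx (by simp [term, h0])
      obtain ⟨h, hh⟩ := QuotientGroup.mk_out_eq_mul H (x.out⁻¹ * g)⁻¹
      refine ⟨_, ⟨_, hx2, rfl⟩, (((x.out * h)⁻¹ : G) : G ⧸ H), ⟨x.out * h, ?_, rfl⟩, ?_⟩
      · intro h0
        have e1 := φ.equivariant 1 H.one_mem h h.2 x.out
        rw [one_mul, map_one, one_mul, h0] at e1
        apply hx1
        have e2 : φ.toFun x.out * (ρ h * ρ (h : G)⁻¹) = 0 := by
          rw [← mul_assoc, ← e1, zero_mul]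
        rwa [← map_mul, mul_inv_cancel, map_one, mul_one] at e2
      · change ((Quotient.out _ * (x.out * h)⁻¹ : G) : G ⧸ H) = _
        rw [hh]
        congr 1
        group⟩
  map_add' f f' := by
    ext g
    change ∑ᶠ x : G ⧸ H, φ.term (f.1 + f'.1) g x = _ + _
    rw [← finsum_add_distrib (φ.finite_support_term f g) (φ.finite_support_term f' g)]
    simp [term]
  map_smul' c f := by
    ext g
    change ∑ᶠ x : G ⧸ H, φ.term (c • f.1) g x = c • ∑ᶠ x : G ⧸ H, φ.term f.1 g x
    rw [smul_finsum' c (φ.finite_support_term f g)]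
    simp [term]

lemma operator_comm (x : G) (f : compactInd H ρ) :
    φ.operator (compactIndRep H ρ x f) = compactIndRep H ρ x (φ.operator f) := by
  ext g
  change ∑ᶠ y : G ⧸ H, φ.term (fun g => f.1 (g * x)) g y = ∑ᶠ y : G ⧸ H, φ.term f.1 (g * x) y
  simp [term, mul_assoc]

/-- The subspace `(T_φ - a) ind_H^G ρ` of `ind_H^G ρ`. -/
def range (a : C) : Submodule C (compactInd H ρ) :=
  LinearMap.range (φ.operator - a • LinearMap.id)

/-- The quotient `ind_H^G ρ / (T_φ - a) ind_H^G ρ`. -/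
abbrev Quot (a : C) : Type _ := compactInd H ρ ⧸ φ.range a

/-- The action of `G` on `ind_H^G ρ / (T_φ - a) ind_H^G ρ`. -/
def quotRep (a : C) : Representation C G (φ.Quot a) where
  toFun x := (φ.range a).mapQ (φ.range a) (compactIndRep H ρ x) (by
    rintro _ ⟨f, rfl⟩
    refine ⟨compactIndRep H ρ x f, ?_⟩
    simp [operator_comm])
  map_one' := by
    ext f
    simp
  map_mul' x y := by
    ext f
    simp

end HeckeKernel

end induction

/-! ### Lattices and norms -/

section lattice

variable {C G V : Type*} [NormedField C] [IsUltrametricDist C] [Group G]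
  [AddCommGroup V] [Module C V]

/-- A lattice in a `C`-vector space: an `O_C`-submodule that contains a nonzero multiple of
every vector. -/
def IsLattice (L : Submodule (ringOfInt C) V) : Prop :=
  ∀ v : V, ∃ c : C, c ≠ 0 ∧ c • v ∈ L

/-- A lattice is separated if it contains no `C`-line. -/
def IsSeparated (L : Submodule (ringOfInt C) V) : Prop :=
  ∀ v : V, (∀ c : C, c • v ∈ L) → v = 0

/-- For an `O_C`-submodule `L` of `V`, the image in `ind_H^G ρ / (T_φ - a) ind_H^G ρ` of the
`O_C`-module of those elements of `ind_H^G ρ` that take values in `L`. -/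
def integralImage {H : Subgroup G} {ρ : Representation C G V} (φ : HeckeKernel H ρ) (a : C)
    (L : Submodule (ringOfInt C) V) : Submodule (ringOfInt C) (φ.Quot a) :=
  Submodule.map ((φ.range a).mkQ.restrictScalars (ringOfInt C))
    { carrier := {f : compactInd H ρ | ∀ g, f.1 g ∈ L}
      add_mem' := fun hf hf' g => L.add_mem (hf g) (hf' g)
      zero_mem' := fun _ => L.zero_mem
      smul_mem' := fun c _ hf g => L.smul_mem c (hf g) }

/-- The representation `τ` of `G` admits a `G`-invariant (nonarchimedean) norm. -/
def AdmitsInvariantNorm {W : Type*} [AddCommMonoid W] [Module C W]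
    (τ : Representation C G W) : Prop :=
  ∃ N : W → ℝ, (∀ v, N v = 0 ↔ v = 0) ∧ (∀ (c : C) (v : W), N (c • v) = ‖c‖ * N v) ∧
    (∀ v w, N (v + w) ≤ max (N v) (N w)) ∧ ∀ (g : G) (v : W), N (τ g v) = N v

end lattice

/-! ### The algebraic representations -/

section algebraic

variable {F C : Type*} [NormedField F] [NormedField C]

/-- The space of homogeneous polynomials of degree `k` in `x = X 0` and `y = X 1`. -/
abbrev Sym (C : Type*) [NormedField C] (k : ℕ) : Type _ :=
  MvPolynomial.homogeneousSubmodule (Fin 2) C k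

/-- The substitution `x ↦ σ(a) x + σ(c) y`, `y ↦ σ(b) x + σ(d) y` attached to
`g = (a b; c d)`. -/
def subst (σ : F →+* C) (g : GL (Fin 2) F) :
    MvPolynomial (Fin 2) C →ₐ[C] MvPolynomial (Fin 2) C :=
  MvPolynomial.aeval fun j => ∑ i, MvPolynomial.C (σ (g i j)) * MvPolynomial.X i

lemma subst_mem (σ : F →+* C) (g : GL (Fin 2) F) (k : ℕ) (P : MvPolynomial (Fin 2) C)
    (hP : P ∈ MvPolynomial.homogeneousSubmodule (Fin 2) C k) :
    subst σ g P ∈ MvPolynomial.homogeneousSubmodule (Fin 2) C k := by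
  have h := MvPolynomial.IsHomogeneous.aeval (n := 1) hP
    (fun j => ∑ i, MvPolynomial.C (σ (g i j)) * MvPolynomial.X i) (fun j =>
      MvPolynomial.IsHomogeneous.sum _ _ _ fun i _ => by
        simpa using (MvPolynomial.isHomogeneous_C (Fin 2) (σ (g i j))).mul
          (MvPolynomial.isHomogeneous_X C i))
  rwa [one_mul] at h

lemma subst_one (σ : F →+* C) : subst σ 1 = AlgHom.id C _ := by
  ext1 j
  fin_cases j <;> simp [subst, Fin.sum_univ_two]

lemma subst_mul (σ : F →+* C) (g h : GL (Fin 2) F) :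
    subst σ (g * h) = (subst σ g).comp (subst σ h) := by
  ext1 j
  simp only [subst, MvPolynomial.aeval_X, AlgHom.comp_apply, Fin.sum_univ_two, map_add, map_mul,
    Matrix.GeneralLinearGroup.coe_mul, Matrix.mul_apply, MvPolynomial.aeval_C,
    MvPolynomial.algebraMap_eq]
  ring

/-- The representation `ρ_k^σ` of `GL₂(F)` on homogeneous polynomials of degree `k`. -/
def rho (σ : F →+* C) (k : ℕ) : Representation C (GL (Fin 2) F) (Sym C k) where
  toFun g := (subst σ g).toLinearMap.restrict (subst_mem σ g k)
  map_one' := by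
    ext1 P
    apply Subtype.ext
    simp [subst_one]
  map_mul' g h := by
    ext1 P
    apply Subtype.ext
    change subst σ (g * h) P.1 = subst σ g (subst σ h P.1)
    rw [subst_mul]
    rfl

/-- The character `g ↦ s ^ (-v_F(det g))`. If `s ^ 2 = σ ϖ`, it is the square root
`(σ ∘ χ)^{1/2}` of `σ ∘ χ`, where `χ g = ϖ ^ (-v_F(det g))`. -/
def chiHalf {ϖ : F} (hϖ : IsUniformizer ϖ) (s : Cˣ) : GL (Fin 2) F →* Cˣ where
  toFun g := s ^ (-ord ϖ (g : Matrix (Fin 2) (Fin 2) F).det)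
  map_one' := by simp [ord_one hϖ]
  map_mul' g h := by
    have hg : (g : Matrix (Fin 2) (Fin 2) F).det ≠ 0 := g.det.ne_zero
    have hh : (h : Matrix (Fin 2) (Fin 2) F).det ≠ 0 := h.det.ne_zero
    rw [Matrix.GeneralLinearGroup.coe_mul, Matrix.det_mul, ord_mul hϖ hg hh, neg_add, zpow_add]

/-- The twisted representation `ρ_k^σ ⊗ (σ ∘ χ)^{k/2}`. -/
def rhoTw {ϖ : F} (hϖ : IsUniformizer ϖ) (σ : F →+* C) (s : Cˣ) (k : ℕ) :
    Representation C (GL (Fin 2) F) (Sym C k) where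
  toFun g := ((chiHalf hϖ s g ^ k : Cˣ) : C) • rho σ k g
  map_one' := by simp
  map_mul' g h := by
    rw [map_mul, map_mul, mul_pow, Units.val_mul, smul_mul_smul_comm]

end algebraic

section tensor

variable {p : ℕ} [Fact p.Prime] {F C : Type*}
  [NormedField F] [IsUltrametricDist F] [NormedAlgebra ℚ_[p] F] [FiniteDimensional ℚ_[p] F]
  [NormedField C] [IsUltrametricDist C] [NormedAlgebra ℚ_[p] C] [FiniteDimensional ℚ_[p] C]

/-- The space `⨂_σ Sym^{k_σ}` on which `ρ_k` and its twist act. -/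
abbrev Vk (k : (F →ₐ[ℚ_[p]] C) → ℕ) : Type _ := ⨂[C] σ, Sym C (k σ)

/-- The representation `ρ_k = ⨂_σ ρ_{k_σ}^σ` of `GL₂(F)`. -/
def rhoTensor (k : (F →ₐ[ℚ_[p]] C) → ℕ) : Representation C (GL (Fin 2) F) (Vk k) :=
  PiTensorProduct.mapMonoidHom.comp (MonoidHom.pi fun σ => rho σ.toRingHom (k σ))

/-- The representation `⨂_σ (ρ_{k_σ}^σ ⊗ (σ ∘ χ)^{k_σ/2})` of `GL₂(F)`. -/
def rhoTwTensor {ϖ : F} (hϖ : IsUniformizer ϖ) (s : (F →ₐ[ℚ_[p]] C) → Cˣ)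
    (k : (F →ₐ[ℚ_[p]] C) → ℕ) : Representation C (GL (Fin 2) F) (Vk k) :=
  PiTensorProduct.mapMonoidHom.comp
    (MonoidHom.pi fun σ => rhoTw hϖ σ.toRingHom (s σ) (k σ))

/-- The `O_C`-submodule of a `C`-vector space spanned by a set. -/
def integralSpan {V : Type*} [AddCommGroup V] [Module C V] (A : Set V) :
    Submodule (ringOfInt C) V :=
  Submodule.span (ringOfInt C) A

/-- The lattice `⨂_σ (⨁_i O_C x^{k_σ - i} y^i)` in `⨂_σ Sym^{k_σ}`. -/
def rhoLattice (k : (F →ₐ[ℚ_[p]] C) → ℕ) : Submodule (ringOfInt C) (Vk k) :=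
  integralSpan {t | ∃ w : (σ : F →ₐ[ℚ_[p]] C) → Sym C (k σ),
    (∀ σ n, ‖MvPolynomial.coeff n (w σ).1‖ ≤ 1) ∧ t = PiTensorProduct.tprod C w}

/-- The function `ψ` supported on `KZ α⁻¹ KZ` with
`ψ (h₁ α⁻¹ h₂) = ρ h₁ ∘ U ∘ ρ h₂`, where `ρ` is the twisted representation and
`U = ⨂_σ diag(σ(ϖ)^{k_σ}, …, σ(ϖ), 1)` in the monomial basis. As
`U = (∏_σ s_σ ^ k_σ) ρ(α⁻¹)` (see `heckePsi_alpha_inv`), it is a multiple of `ρ` there. -/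
def heckePsi {ϖ : F} (hϖ : IsUniformizer ϖ) (s : (F →ₐ[ℚ_[p]] C) → Cˣ)
    (k : (F →ₐ[ℚ_[p]] C) → ℕ) : HeckeKernel (V := Vk k) (KZ F) (rhoTwTensor hϖ s k) where
  toFun g := open Classical in
    if g ∈ DoubleCoset.doubleCoset (alpha hϖ)⁻¹ (KZ F) (KZ F) then
      ((∏ σ, (s σ : C) ^ k σ) • rhoTwTensor hϖ s k g) else 0
  equivariant h₁ hh₁ h₂ hh₂ g := by
    have hiff : h₁ * g * h₂ ∈ DoubleCoset.doubleCoset (alpha hϖ)⁻¹ (KZ F : Set (GL (Fin 2) F))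
        (KZ F) ↔ g ∈ DoubleCoset.doubleCoset (alpha hϖ)⁻¹ (KZ F : Set (GL (Fin 2) F)) (KZ F) := by
      simp only [DoubleCoset.mem_doubleCoset]
      constructor
      · rintro ⟨x, hx, y, hy, h⟩
        refine ⟨h₁⁻¹ * x, mul_mem (inv_mem hh₁) hx, y * h₂⁻¹, mul_mem hy (inv_mem hh₂), ?_⟩
        have : g = h₁⁻¹ * (h₁ * g * h₂) * h₂⁻¹ := by group
        rw [this, h]
        group
      · rintro ⟨x, hx, y, hy, rfl⟩
        exact ⟨h₁ * x, mul_mem hh₁ hx, y * h₂, mul_mem hy hh₂, by group⟩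
    classical
    change (if _ then _ else _) = _ * (if _ then _ else _) * _
    by_cases hg : g ∈ DoubleCoset.doubleCoset (alpha hϖ)⁻¹ (KZ F : Set (GL (Fin 2) F)) (KZ F)
    · rw [if_pos (hiff.2 hg), if_pos hg, map_mul, map_mul, mul_smul_comm, smul_mul_assoc]
    · rw [if_neg (fun h => hg (hiff.1 h)), if_neg hg, mul_zero, zero_mul]
  finite_support := by
    have : ProperSpace F := FiniteDimensional.proper ℚ_[p] F
    refine (finite_cosets hϖ).subset (Set.image_mono fun g hg => ?_)
    by_contra h
    exact hg (if_neg h)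
  finite_support_inv := by
    have : ProperSpace F := FiniteDimensional.proper ℚ_[p] F
    refine (finite_cosets_inv hϖ).subset (Set.image_mono fun g hg => ?_)
    by_contra h
    exact hg (if_neg h)

/-- On monomials, `ψ(α⁻¹)` is `U`: it multiplies `⨂_σ x^{k_σ - i_σ} y^{i_σ}` by
`∏_σ σ(ϖ)^{k_σ - i_σ}`. -/
lemma heckePsi_alpha_inv {ϖ : F} (hϖ : IsUniformizer ϖ) (s : (F →ₐ[ℚ_[p]] C) → Cˣ)
    (hs : ∀ σ, (s σ : C) ^ 2 = σ ϖ) (k i : (F →ₐ[ℚ_[p]] C) → ℕ) (hi : ∀ σ, i σ ≤ k σ)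
    (e : (σ : F →ₐ[ℚ_[p]] C) → Sym C (k σ))
    (he : ∀ σ, (e σ).1 = MvPolynomial.X 0 ^ (k σ - i σ) * MvPolynomial.X 1 ^ i σ) :
    (heckePsi hϖ s k).toFun (alpha hϖ)⁻¹ (PiTensorProduct.tprod C e) =
      (∏ σ : F →ₐ[ℚ_[p]] C, σ ϖ ^ (k σ - i σ)) • PiTensorProduct.tprod C e := by
  classical
  have hali : (((alpha hϖ)⁻¹ : GL (Fin 2) F) : Matrix (Fin 2) (Fin 2) F) = !![1, 0; 0, ϖ⁻¹] := by
    rw [Matrix.coe_units_inv]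
    apply Matrix.inv_eq_left_inv
    change !![1, 0; 0, ϖ⁻¹] * !![1, 0; 0, ϖ] = _
    ext i j
    fin_cases i <;> fin_cases j <;> simp [Matrix.mul_apply, Fin.sum_univ_two, hϖ.ne_zero]
  have hord : ord ϖ ϖ⁻¹ = -1 := by
    have h1 : ord ϖ ϖ = 1 := by
      have h := norm_eq_zpow_ord hϖ hϖ.ne_zero
      exact (zpow_right_injective₀ (norm_pos_iff.2 hϖ.ne_zero) hϖ.norm_lt_one.ne
        ((zpow_one _).trans h)).symm
    have h2 := ord_mul hϖ hϖ.ne_zero (inv_ne_zero hϖ.ne_zero)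
    rw [mul_inv_cancel₀ hϖ.ne_zero, ord_one hϖ] at h2
    omega
  have hchi : ∀ t : Cˣ, chiHalf hϖ t (alpha hϖ)⁻¹ = t := by
    intro t
    change t ^ (-ord ϖ (((alpha hϖ)⁻¹ : GL (Fin 2) F) : Matrix (Fin 2) (Fin 2) F).det) = t
    rw [hali, Matrix.det_fin_two_of]
    simp [hord]
  have hσ : ∀ σ : F →ₐ[ℚ_[p]] C, σ ϖ ≠ 0 := fun σ => (map_ne_zero σ).2 hϖ.ne_zero
  have hrho : ∀ σ : F →ₐ[ℚ_[p]] C, rhoTw hϖ σ.toRingHom (s σ) (k σ) (alpha hϖ)⁻¹ (e σ) =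
      ((s σ : C) ^ k σ * (σ ϖ)⁻¹ ^ i σ) • e σ := by
    intro σ
    apply Subtype.ext
    change ((chiHalf hϖ (s σ) (alpha hϖ)⁻¹ ^ k σ : Cˣ) : C) •
      subst σ.toRingHom (alpha hϖ)⁻¹ (e σ).1 = _ • (e σ).1
    rw [hchi, he, map_mul, map_pow, map_pow]
    simp only [subst, MvPolynomial.aeval_X, hali, Fin.sum_univ_two]
    simp only [Matrix.of_apply, Matrix.cons_val', Matrix.cons_val_zero, Matrix.cons_val_one,
      Matrix.cons_val_fin_one, map_one, map_zero, one_mul, zero_mul, add_zero, zero_add, mul_pow]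
    rw [MvPolynomial.smul_eq_C_mul, MvPolynomial.smul_eq_C_mul]
    simp only [map_inv₀, AlgHom.toRingHom_eq_coe, RingHom.coe_coe, Units.val_pow_eq_pow_val,
      MvPolynomial.C_mul, MvPolynomial.C_pow]
    ring
  have hmem : (alpha hϖ)⁻¹ ∈ DoubleCoset.doubleCoset (alpha hϖ)⁻¹
      (KZ F : Set (GL (Fin 2) F)) (KZ F) := DoubleCoset.mem_doubleCoset_self (KZ F) (KZ F) _
  have hpsi : (heckePsi hϖ s k).toFun (alpha hϖ)⁻¹ =
      (∏ σ, (s σ : C) ^ k σ) • rhoTwTensor hϖ s k (alpha hϖ)⁻¹ := if_pos hmem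
  have htens : rhoTwTensor hϖ s k (alpha hϖ)⁻¹ (PiTensorProduct.tprod C e) =
      (∏ σ, (s σ : C) ^ k σ * (σ ϖ)⁻¹ ^ i σ) • PiTensorProduct.tprod C e := by
    change PiTensorProduct.map _ (PiTensorProduct.tprod C e) = _
    rw [PiTensorProduct.map_tprod, ← MultilinearMap.map_smul_univ]
    congr 1
    funext σ
    exact hrho σ
  rw [hpsi, LinearMap.smul_apply, htens, smul_smul, ← Finset.prod_mul_distrib]
  congr 1
  refine Finset.prod_congr rfl fun σ _ => ?_
  rw [← mul_assoc, ← mul_pow, ← sq, hs, inv_pow, pow_sub₀ _ (hσ σ) (hi σ)]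

/-- The representation `Π_{k,a} = ind_{KZ}^G / (T - a) ind_{KZ}^G` of `GL₂(F)`, for the compact
induction of the twisted representation and the Hecke operator `T = T_ψ`. -/
def PiRep {ϖ : F} (hϖ : IsUniformizer ϖ) (s : (F →ₐ[ℚ_[p]] C) → Cˣ)
    (k : (F →ₐ[ℚ_[p]] C) → ℕ) (a : C) :
    Representation C (GL (Fin 2) F) ((heckePsi hϖ s k).Quot a) :=
  (heckePsi hϖ s k).quotRep a

/-- `Θ_{k,a}`, the image in `Π_{k,a}` of the compact induction of the lattice
`⨂_σ (⨁_i O_C x^{k_σ - i} y^i)`. -/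
def Theta {ϖ : F} (hϖ : IsUniformizer ϖ) (s : (F →ₐ[ℚ_[p]] C) → Cˣ)
    (k : (F →ₐ[ℚ_[p]] C) → ℕ) (a : C) :
    Submodule (ringOfInt C) ((heckePsi hϖ s k).Quot a) :=
  integralImage (heckePsi hϖ s k) a (rhoLattice k)

end tensor

/-! ### The unramified principal series -/

section principalSeries

variable {F C : Type*} [NormedField F] [NormedField C]

/-- The unramified character `nr(μ)` of `Fˣ` that sends `ϖ` to `μ`. -/
def nr (ϖ : F) (μ : Cˣ) (x : F) : C := ((μ ^ ord ϖ x : Cˣ) : C)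

/-- The smooth induction from the upper triangular Borel subgroup to `GL₂(F)` of the character
`(a b; 0 d) ↦ θ₁ a * θ₂ d`: the functions `f` with
`f (b g u) = θ₁ (b₀₀) θ₂ (b₁₁) f g` for `b` upper triangular and `u` in an open subgroup
depending on `f`. -/
def smoothInd (θ₁ θ₂ : F → C) : Submodule C (GL (Fin 2) F → C) where
  carrier := {f | ∃ U : Subgroup (GL (Fin 2) F), IsOpen (U : Set (GL (Fin 2) F)) ∧
    ∀ b : GL (Fin 2) F, b 1 0 = 0 → ∀ g, ∀ u ∈ U,
      f (b * g * u) = θ₁ (b 0 0) * θ₂ (b 1 1) * f g}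
  add_mem' := by
    rintro f f' ⟨U, hU, h⟩ ⟨U', hU', h'⟩
    refine ⟨U ⊓ U', hU.inter hU', fun b hb g u hu => ?_⟩
    simp [h b hb g u hu.1, h' b hb g u hu.2, mul_add]
  zero_mem' := ⟨⊤, isOpen_univ, by simp⟩
  smul_mem' := by
    rintro c f ⟨U, hU, h⟩
    refine ⟨U, hU, fun b hb g u hu => ?_⟩
    simp only [Pi.smul_apply, smul_eq_mul, h b hb g u hu]
    ring

/-- `GL₂(F)` acts on the smooth induction by right translations. -/
def smoothIndRep (θ₁ θ₂ : F → C) : Representation C (GL (Fin 2) F) (smoothInd θ₁ θ₂) where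
  toFun x :=
    { toFun := fun f => ⟨fun g => f.1 (g * x), by
        obtain ⟨U, hU, h⟩ := f.2
        refine ⟨U.comap (MulAut.conj x⁻¹).toMonoidHom, ?_, fun b hb g u hu => ?_⟩
        · refine hU.preimage ?_
          change Continuous fun g => x⁻¹ * g * x⁻¹⁻¹
          fun_prop
        · have := h b hb (g * x) _ hu
          change f.1 (b * g * u * x) = _ * f.1 (g * x)
          rw [← this]
          change f.1 _ = f.1 (b * (g * x) * (x⁻¹ * u * x⁻¹⁻¹))
          group⟩
      map_add' := fun _ _ => rfl
      map_smul' := fun _ _ => rfl }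
  map_one' := by ext f g; simp
  map_mul' x y := by ext f g; simp [mul_assoc]

/-- The unramified principal series `π = Ind_B^G (nr(λ₁⁻¹) ⊗ nr(λ₂⁻¹))`. -/
def piRep (ϖ : F) (l₁ l₂ : Cˣ) :
    Representation C (GL (Fin 2) F) (smoothInd (nr ϖ l₁⁻¹) (nr (C := C) ϖ l₂⁻¹)) :=
  smoothIndRep _ _

end principalSeries

end BreuilSchneider

end

set_option linter.unusedSectionVars false

/-! ### Gauss norms of polynomials and Hermite interpolation at residue points. -/

noncomputable section

namespace BreuilSchneider

section gauss

open Polynomial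

variable {C : Type*} [NormedField C] [IsUltrametricDist C]

/-! Elements of `Ind hϖ s k` are functions on the vertices of the tree of `PGL₂(F)`. Since only `σ`
carries weight, their values are polynomials in one variable of degree at most `k`, and the lattice
is the unit ball of the Gauss norm (`mem_rhoLattice_iff`).

Separatedness follows from one uniform estimate (`bd_of_bd_heckeSub`): a constant `B`, independent
of `R`, bounds at all vertices of radius at least `R` every `h` for which `(T - a) h` is integral at
all vertices of radius greater than `R`. Suppose that every multiple of `f` is integral modulo the
image of `T - a`, say `c f = x + (T - a) h`. Then `h` can be cut off to the ball that supports `f`,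
at the price of one fixed scalar. So all multiples of `f` are integral modulo `(T - a) Y`, where `Y`
is the finite-dimensional space of functions on that ball. A linear form that kills `(T - a) Y` but
not `f` would be bounded on all multiples of `f`, which is absurd; hence `f` lies in `(T - a) Y`.

For the estimate, `h` is restricted to a cone of vertices pointing away from the origin. It becomes
a family `P u`, indexed by words in the residue field and zero on long words, with `up (P u) - a P
(i :: u) + ∑ j, down (P (j :: i :: u))` integral (`ConeSolution`). Bounds travel from long words to
short ones. The map `up` multiplies the `j`-th Hasse derivative at `-t i` by `w ^ j`; as `k < (d +
1) q`, Hermite interpolation at the `q` points recovers `P u` from its images under `up` with a loss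
of only `w ^ d`. The map `down` damps the coefficient of degree `k - l` by `w ^ l`, so the top
coefficients of the farther vertices dominate. The regimes differ in how the sum of the `down` terms
is controlled. For small `a` (`bd_of_small`), a determinant of binomial coefficients that is a unit
modulo `p` expresses low coefficients through high ones. In the generic case (`bd_of_generic`), the
sum is expanded in powers of `X ^ q`, which `up` turns into a constant up to a small error, and the
Hasse derivatives bound the top block (`norm_top_coeff_le`). In the remaining cases with `k = d q`,
the top coefficients may exceed `A = ‖a‖⁻¹`, but up to an error of size `A` they are `κ` times those
of the parent, with `κ` depending only on the level (`exists_step_divisible`, and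
`exists_step_quadratic` for `q = 2`).

The gauge of `Θ` is then an invariant norm on `Π`. To transport it to `ρ_k ⊗ π`, a value `v` at a
vertex is sent to `v` tensor a translate of the spherical vector (`sphMap`). This vector is a Hecke
eigenvector with eigenvalue `λ₁ + q λ₂ = a`, and it generates `π` because `λ₁ ≠ λ₂`
(`sphSpan_eq_top`). The kernel of the map is the image of `T - a`: with vertices viewed as discs in
`F`, an element of the kernel takes equal values on the smallest discs with a common parent, so
subtracting `(T - a)` of a function on the parents erases the outermost level
(`mem_range_of_sphMap_eq_zero`). -/

lemma norm_add_le_of_le {x y : C} {c : ℝ} (hx : ‖x‖ ≤ c) (hy : ‖y‖ ≤ c) : ‖x + y‖ ≤ c :=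
  (IsUltrametricDist.norm_add_le_max x y).trans (max_le hx hy)

lemma norm_sub_le_of_le {x y : C} {c : ℝ} (hx : ‖x‖ ≤ c) (hy : ‖y‖ ≤ c) : ‖x - y‖ ≤ c := by
  rw [sub_eq_add_neg]
  exact norm_add_le_of_le hx (by rwa [norm_neg])

lemma norm_sum_le_of_le {ι : Type*} {s : Finset ι} {f : ι → C} {c : ℝ} (hc : 0 ≤ c)
    (h : ∀ i ∈ s, ‖f i‖ ≤ c) : ‖∑ i ∈ s, f i‖ ≤ c :=
  IsUltrametricDist.norm_sum_le_of_forall_le_of_nonneg hc h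

lemma norm_natCast_mul_le (n : ℕ) (x : C) : ‖(n : C) * x‖ ≤ ‖x‖ := by
  rw [norm_mul]
  exact mul_le_of_le_one_left (norm_nonneg _) (IsUltrametricDist.norm_natCast_le_one C n)

lemma norm_pow_le_one {x : C} (hx : ‖x‖ ≤ 1) (n : ℕ) : ‖x ^ n‖ ≤ 1 := by
  rw [norm_pow]
  exact pow_le_one₀ (norm_nonneg _) hx

lemma norm_mul_le_of_le_one_right {x y : C} {c : ℝ} (hx : ‖x‖ ≤ c) (hy : ‖y‖ ≤ 1) :
    ‖x * y‖ ≤ c := by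
  rw [norm_mul]
  exact (mul_le_of_le_one_right (norm_nonneg _) hy).trans hx

/-- All coefficients of `f` have norm at most `c`. -/
def Bd (c : ℝ) (f : C[X]) : Prop := ∀ i, ‖f.coeff i‖ ≤ c

namespace Bd

variable {c c' : ℝ} {f g : C[X]}

lemma nonneg (h : Bd c f) : 0 ≤ c := (norm_nonneg _).trans (h 0)

lemma mono (h : Bd c f) (hc : c ≤ c') : Bd c' f := fun i => (h i).trans hc

lemma zero (hc : 0 ≤ c) : Bd c (0 : C[X]) := fun i => by simpa using hc

lemma add (hf : Bd c f) (hg : Bd c g) : Bd c (f + g) := fun i => by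
  rw [coeff_add]
  exact norm_add_le_of_le (hf i) (hg i)

lemma sub (hf : Bd c f) (hg : Bd c g) : Bd c (f - g) := fun i => by
  rw [coeff_sub]
  exact norm_sub_le_of_le (hf i) (hg i)

lemma of_sub (hg : Bd c g) (h : Bd c (f - g)) : Bd c f := by
  simpa using h.add hg

lemma of_add (hg : Bd c g) (h : Bd c (f + g)) : Bd c f := by
  simpa using h.sub hg

lemma sum {ι : Type*} {s : Finset ι} {f : ι → C[X]} (hc : 0 ≤ c) (h : ∀ i ∈ s, Bd c (f i)) :
    Bd c (∑ i ∈ s, f i) := fun n => by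
  rw [finsetSum_coeff]
  exact norm_sum_le_of_le hc fun i hi => h i hi n

lemma mul (hf : Bd c f) (hg : Bd c' g) : Bd (c * c') (f * g) := fun n => by
  rw [coeff_mul]
  refine norm_sum_le_of_le (mul_nonneg hf.nonneg hg.nonneg) fun i _ => ?_
  rw [norm_mul]
  exact mul_le_mul (hf _) (hg _) (norm_nonneg _) hf.nonneg

lemma mul_one_right (hf : Bd c f) (hg : Bd 1 g) : Bd c (f * g) := by
  simpa using hf.mul hg

lemma one_mul_left (hf : Bd 1 f) (hg : Bd c g) : Bd c (f * g) := by
  simpa using hf.mul hg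

lemma const_iff {x : C} : Bd c (Polynomial.C x) ↔ 0 ≤ c ∧ ‖x‖ ≤ c := by
  refine ⟨fun h => ⟨h.nonneg, by simpa using h 0⟩, fun h i => ?_⟩
  rw [coeff_C]
  split_ifs
  · exact h.2
  · simpa using h.1

lemma const {x : C} (h : ‖x‖ ≤ c) : Bd c (Polynomial.C x) :=
  const_iff.2 ⟨(norm_nonneg _).trans h, h⟩

lemma one : Bd 1 (1 : C[X]) := by
  simpa using const (c := 1) (x := (1 : C)) (by simp)

lemma X : Bd 1 (X : C[X]) := fun i => by
  rw [coeff_X]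
  split_ifs <;> simp

lemma pow (hf : Bd c f) (n : ℕ) : Bd (c ^ n) (f ^ n) := by
  induction n with
  | zero => simpa using one
  | succ n ih => rw [pow_succ, pow_succ]; exact ih.mul hf

lemma pow_one (hf : Bd 1 f) (n : ℕ) : Bd 1 (f ^ n) := by
  simpa using hf.pow n

lemma prod {ι : Type*} {s : Finset ι} {f : ι → C[X]} (h : ∀ i ∈ s, Bd 1 (f i)) :
    Bd 1 (∏ i ∈ s, f i) :=
  Finset.prod_induction f (Bd 1) (fun _ _ => mul_one_right) one h

lemma X_add_C {t : C} (ht : ‖t‖ ≤ 1) : Bd 1 (Polynomial.X + Polynomial.C t : C[X]) :=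
  X.add (Bd.const ht)

lemma C_mul {x : C} (hf : Bd c f) : Bd (‖x‖ * c) (Polynomial.C x * f) :=
  (Bd.const le_rfl).mul hf

lemma eval {t : C} (hf : Bd c f) (ht : ‖t‖ ≤ 1) : ‖f.eval t‖ ≤ c := by
  rw [eval_eq_sum]
  refine norm_sum_le_of_le hf.nonneg fun i _ => ?_
  exact norm_mul_le_of_le_one_right (hf i) (norm_pow_le_one ht i)

lemma taylor {t : C} (hf : Bd c f) (ht : ‖t‖ ≤ 1) : Bd c (taylor t f) := by
  rw [taylor_apply, comp, eval₂_eq_sum]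
  exact sum hf.nonneg fun i _ => (Bd.const (hf i)).mul_one_right ((X_add_C ht).pow_one i)

/-- A congruence between integral polynomials is preserved by powers. -/
lemma pow_sub_pow (hf : Bd 1 f) (hg : Bd 1 g) (h : Bd c (f - g)) (n : ℕ) :
    Bd c (f ^ n - g ^ n) := by
  rw [← Commute.mul_geom_sum₂ (Commute.all f g) n]
  refine h.mul_one_right (sum zero_le_one fun i _ => (hf.pow_one i).mul_one_right (hg.pow_one _))

end Bd

/-- The substitution `z ↦ w z + t`. -/
def up (t w : C) (f : C[X]) : C[X] := (taylor t f).comp (Polynomial.C w * X)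

lemma coeff_up (t w : C) (f : C[X]) (j : ℕ) :
    (up t w f).coeff j = (taylor t f).coeff j * w ^ j := by
  rw [up, comp_C_mul_X_coeff]

lemma up_eq_comp (t w : C) (f : C[X]) :
    up t w f = f.comp (Polynomial.C w * X + Polynomial.C t) := by
  rw [up, taylor_apply, comp_assoc]
  simp

lemma up_add (t w : C) (f g : C[X]) : up t w (f + g) = up t w f + up t w g := by
  simp [up]

lemma up_sub (t w : C) (f g : C[X]) : up t w (f - g) = up t w f - up t w g := by
  simp [up]

lemma up_C_mul (t w x : C) (f : C[X]) :
    up t w (Polynomial.C x * f) = Polynomial.C x * up t w f := by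
  simp [up_eq_comp]

lemma up_pow (t w : C) (f : C[X]) (n : ℕ) : up t w (f ^ n) = up t w f ^ n := by
  simp [up_eq_comp]

lemma coeff_zero_up (t w : C) (f : C[X]) : (up t w f).coeff 0 = f.eval t := by
  rw [coeff_up]
  simp [taylor_coeff_zero]

lemma natDegree_up_le (t w : C) (f : C[X]) : (up t w f).natDegree ≤ f.natDegree := by
  rw [natDegree_le_iff_coeff_eq_zero]
  intro N hN
  rw [coeff_up, coeff_eq_zero_of_natDegree_lt (by rwa [natDegree_taylor]), zero_mul]

lemma Bd.up {c : ℝ} {f : C[X]} {t w : C} (hf : Bd c f) (ht : ‖t‖ ≤ 1) (hw : ‖w‖ ≤ 1) :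
    Bd c (up t w f) := fun j => by
  rw [coeff_up]
  exact norm_mul_le_of_le_one_right (hf.taylor ht j) (norm_pow_le_one hw j)

/-- The factor `w ^ j` makes coefficients of high degree harmless after the substitution, even if
`f` itself is only crudely bounded. -/
lemma norm_coeff_up_le {c : ℝ} {f : C[X]} {t w : C} (hf : Bd c f) (ht : ‖t‖ ≤ 1) (j : ℕ) :
    ‖(BreuilSchneider.up t w f).coeff j‖ ≤ c * ‖w‖ ^ j := by
  rw [coeff_up, norm_mul, norm_pow]
  exact mul_le_mul_of_nonneg_right (hf.taylor ht j) (by positivity)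

/-- The map `∑ fᵢ zⁱ ↦ ∑ fᵢ w^(k-i) (z + t)ⁱ` on polynomials of degree at most `k`. -/
def down (k : ℕ) (t w : C) (f : C[X]) : C[X] :=
  ∑ l ∈ Finset.range (k + 1), Polynomial.C (w ^ l * f.coeff (k - l)) *
    (X + Polynomial.C t) ^ (k - l)

lemma down_bd {k : ℕ} {t w : C} {f : C[X]} {c : ℝ} (hc : 0 ≤ c) (ht : ‖t‖ ≤ 1)
    (hf : ∀ l ≤ k, ‖w ^ l * f.coeff (k - l)‖ ≤ c) : Bd c (down k t w f) :=
  Bd.sum hc fun l hl => (Bd.const (hf l (by simpa [Nat.lt_succ_iff] using hl))).mul_one_right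
    ((Bd.X_add_C ht).pow_one _)

/-! ### Interpolation -/

variable {I : Type*} [Fintype I]

/-- A set of integral points that are distinct modulo the maximal ideal. -/
structure Spread (t : I → C) : Prop where
  le_one : ∀ i, ‖t i‖ ≤ 1
  sub : ∀ i j, i ≠ j → ‖t i - t j‖ = 1

lemma Spread.neg {t : I → C} (h : Spread t) : Spread (fun i => -t i) where
  le_one i := by simpa using h.le_one i
  sub i j hij := by rw [← norm_neg]; simpa [add_comm, sub_eq_add_neg] using h.sub i j hij

lemma Spread.injective {t : I → C} (h : Spread t) : Function.Injective t := by
  intro i j hij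
  by_contra hne
  have := h.sub i j hne
  simp [hij] at this

/-- Lagrange interpolation: the differences of the nodes are units, so the basis polynomials are
integral. -/
lemma Spread.bd_of_eval {t : I → C} (h : Spread t) {f : C[X]} {c : ℝ} (hc : 0 ≤ c)
    (hdeg : f.degree < Fintype.card I) (hf : ∀ i, ‖f.eval (t i)‖ ≤ c) : Bd c f := by
  classical
  rw [Lagrange.eq_interpolate_of_eval_eq (s := Finset.univ) (v := t) (fun i => f.eval (t i))
    h.injective.injOn (by simpa using hdeg) (fun i _ => rfl), Lagrange.interpolate_apply]
  refine Bd.sum hc fun i _ => (Bd.const (hf i)).mul_one_right ?_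
  unfold Lagrange.basis Lagrange.basisDivisor
  refine Bd.prod fun j hj => ?_
  have hij : ‖t i - t j‖ = 1 := h.sub i j (Finset.ne_of_mem_erase hj).symm
  refine (Bd.const ?_).mul_one_right (Bd.X.sub (Bd.const (h.le_one j)))
  rw [norm_inv, hij, inv_one]

/-- The monic polynomial with the given simple roots. -/
def nodePoly (t : I → C) : C[X] := ∏ i, (X - Polynomial.C (t i))

lemma nodePoly_monic (t : I → C) : (nodePoly t).Monic := monic_prod_X_sub_C _ _

lemma natDegree_nodePoly (t : I → C) : (nodePoly t).natDegree = Fintype.card I := by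
  unfold nodePoly
  rw [natDegree_finsetProd_X_sub_C_eq_card]
  rfl

lemma Spread.bd_nodePoly {t : I → C} (h : Spread t) : Bd 1 (nodePoly t) :=
  Bd.prod fun i _ => Bd.X.sub (Bd.const (h.le_one i))

lemma taylor_nodePoly {t : I → C} [DecidableEq I] (i : I) :
    taylor (t i) (nodePoly t) = X * taylor (t i) (∏ j ∈ Finset.univ.erase i, (X - Polynomial.C (t j))) := by
  unfold nodePoly
  rw [← Finset.mul_prod_erase _ _ (Finset.mem_univ i), taylor_mul]
  congr 1
  simp

/-- Hermite interpolation: a polynomial of degree less than `n * q` is bounded by its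
Hasse derivatives of order less than `n` at `q` integral points distinct modulo the
maximal ideal. -/
lemma Spread.bd_of_taylor {t : I → C} (h : Spread t) {c : ℝ} (hc : 0 ≤ c) (n : ℕ) :
    ∀ f : C[X], f.degree < (n * Fintype.card I : ℕ) →
      (∀ j < n, ∀ i, ‖(Polynomial.taylor (t i) f).coeff j‖ ≤ c) → Bd c f := by
  classical
  induction n with
  | zero =>
    intro f hf _
    have : f = 0 := by
      rw [← degree_eq_bot]
      simpa using hf
    rw [this]
    exact Bd.zero hc
  | succ n ih =>
    intro f hf hj
    have hmon := nodePoly_monic t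
    -- The remainder modulo the node polynomial is controlled by the values of `f`, the quotient by
    -- the remaining derivatives.
    have hdiv := modByMonic_add_div f (nodePoly t)
    set g := f /ₘ nodePoly t with hg
    set s := f %ₘ nodePoly t with hs
    have hroot : ∀ i, (nodePoly t).eval (t i) = 0 := by
      intro i
      unfold nodePoly
      rw [eval_prod]
      exact Finset.prod_eq_zero (Finset.mem_univ i) (by simp)
    have hsdeg : s.degree < Fintype.card I := by
      have := degree_modByMonic_lt f hmon
      rwa [degree_eq_natDegree hmon.ne_zero, natDegree_nodePoly] at this
    have hsb : Bd c s := by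
      refine h.bd_of_eval hc hsdeg fun i => ?_
      have h0 := hj 0 (Nat.succ_pos _) i
      rw [taylor_coeff_zero, ← hdiv] at h0
      simpa [hroot] using h0
    have hgdeg : g.degree < (n * Fintype.card I : ℕ) := by
      rcases eq_or_ne g 0 with h0 | h0
      · rw [h0, degree_zero]
        exact WithBot.bot_lt_coe _
      · have h1 : (nodePoly t).degree ≤ f.degree := by
          by_contra hlt
          exact h0 ((divByMonic_eq_zero_iff hmon).2 (not_le.1 hlt))
        have h2 := degree_add_divByMonic hmon h1
        rw [← hg, degree_eq_natDegree hmon.ne_zero, natDegree_nodePoly,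
          degree_eq_natDegree h0] at h2
        rw [← h2] at hf
        rw [degree_eq_natDegree h0]
        norm_cast at hf ⊢
        rw [Nat.succ_mul] at hf
        omega
    have hgb : Bd c g := by
      refine ih g hgdeg ?_
      -- The node polynomial vanishes to order exactly one at `t i`. So the derivative of order `j +
      -- 1` of the product is a unit times the `j`-th derivative of `g`, plus terms with derivatives
      -- of `g` of lower order, and the latter are bounded inductively.
      have key : ∀ i, ∀ j < n + 1, ‖(Polynomial.taylor (t i) (nodePoly t * g)).coeff j‖ ≤ c := by
        intro i j hjn
        have : nodePoly t * g = f - s := by rw [← hdiv]; ring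
        rw [this, map_sub, coeff_sub]
        exact norm_sub_le_of_le (hj j hjn i) (hsb.taylor (h.le_one i) j)
      intro j
      induction j using Nat.strong_induction_on with
      | _ j ihj =>
        intro hjn i
        have h1 := key i (j + 1) (by omega)
        rw [taylor_mul, taylor_nodePoly, mul_assoc, coeff_X_mul, coeff_mul,
          ← Finset.add_sum_erase _ _ (show ((0, j) : ℕ × ℕ) ∈ _ from Finset.HasAntidiagonal.mem_antidiagonal.2 (zero_add j))] at h1
        set e := ∏ j ∈ Finset.univ.erase i, (X - Polynomial.C (t j)) with he
        have heb : Bd 1 e := Bd.prod fun i _ => Bd.X.sub (Bd.const (h.le_one i))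
        have hrest : ‖∑ x ∈ (Finset.HasAntidiagonal.antidiagonal j).erase (0, j),
            (Polynomial.taylor (t i) e).coeff x.1 * (Polynomial.taylor (t i) g).coeff x.2‖ ≤ c := by
          refine norm_sum_le_of_le hc fun x hx => ?_
          rw [Finset.mem_erase, Finset.HasAntidiagonal.mem_antidiagonal] at hx
          have hx2 : x.2 < j := by
            rcases Nat.lt_or_ge x.2 j with h' | h'
            · exact h'
            · exact absurd (Prod.ext (by simp; omega) (by simp; omega)) hx.1
          rw [mul_comm]
          exact norm_mul_le_of_le_one_right (ihj _ hx2 (by omega) i)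
            (heb.taylor (h.le_one i) _)
        have h2 := norm_sub_le_of_le h1 hrest
        rw [add_sub_cancel_right, norm_mul, taylor_coeff_zero, he, eval_prod, norm_prod] at h2
        rwa [Finset.prod_eq_one, one_mul] at h2
        intro l hl
        simpa using h.sub i l (Finset.ne_of_mem_erase hl).symm
    rw [← hdiv]
    exact hsb.add (h.bd_nodePoly.one_mul_left hgb)

end gauss

end BreuilSchneider

end

/-! ### Residue data and binomial coefficients modulo `p`. -/

noncomputable section

namespace BreuilSchneider

section cone

open Polynomial

variable {E : Type*} [NormedField E] [IsUltrametricDist E] {I : Type*} [Fintype I]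

/-- The residual data of a `p`-adic field inside `E`: the image `w` of a uniformizer and a set
`t` of Teichmüller representatives of the residue field of `q` elements. -/
structure ResidueSystem (p q : ℕ) (w : E) (t : I → E) : Prop where
  prime : p.Prime
  card : Fintype.card I = q
  prime_pow : ∃ f, 0 < f ∧ q = p ^ f
  pow_eq : ∀ i, t i ^ q = t i
  spread : Spread t
  w_pos : 0 < ‖w‖
  w_lt : ‖w‖ < 1
  p_le : ‖(p : E)‖ ≤ ‖w‖
  norm_unit : ∀ n : ℕ, ¬ p ∣ n → ‖(n : E)‖ = 1

lemma degree_lt_of_natDegree_le {f : E[X]} {k n : ℕ} (hf : f.natDegree ≤ k) (hk : k < n) :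
    f.degree < n :=
  (degree_le_of_natDegree_le hf).trans_lt (by exact_mod_cast hk)

/-- Once the coefficients of degree at least `q` are split off, Lagrange interpolation applies to
the rest. -/
lemma Spread.bd_of_eval_of_coeff {t : I → E} (h : Spread t) {f : E[X]} {c : ℝ} (hc : 0 ≤ c)
    (hcoeff : ∀ j, Fintype.card I ≤ j → ‖f.coeff j‖ ≤ c) (hf : ∀ i, ‖f.eval (t i)‖ ≤ c) :
    Bd c f := by
  set g : E[X] := ∑ j ∈ Finset.range (Fintype.card I), monomial j (f.coeff j) with hg
  have hgc : ∀ j, g.coeff j = if j < Fintype.card I then f.coeff j else 0 := by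
    intro j
    simp [hg, finsetSum_coeff, coeff_monomial]
  have hfg : Bd c (f - g) := by
    intro j
    rw [coeff_sub, hgc]
    split_ifs with hj
    · simpa using hc
    · simpa using hcoeff j (not_lt.1 hj)
  have hgb : Bd c g := by
    refine h.bd_of_eval hc ?_ fun i => ?_
    · rw [degree_lt_iff_coeff_zero]
      intro m hm
      rw [hgc, if_neg (not_lt.2 hm)]
    · have := norm_sub_le_of_le (hf i) (hfg.eval (h.le_one i))
      simpa using this
  exact hfg.of_sub (f := f) (g := f - g) (by simpa using hgb)

/-- Coefficients of a polynomial written in base `X ^ q`. -/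
lemma coeff_sum_X_pow_mul {R : Type*} [CommRing R] {q N : ℕ} {g : ℕ → R[X]}
    (hg : ∀ i, (g i).natDegree < q) (i j : ℕ) (hj : j < q) :
    (∑ i ∈ Finset.range N, X ^ (q * i) * g i).coeff (q * i + j) =
      if i < N then (g i).coeff j else 0 := by
  rw [finsetSum_coeff]
  have key : ∀ i' ∈ Finset.range N, i' ≠ i → (X ^ (q * i') * g i').coeff (q * i + j) = 0 := by
    intro i' _ hne
    rw [coeff_X_pow_mul']
    split_ifs with hle
    · apply coeff_eq_zero_of_natDegree_lt
      have h1 : i' < i := by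
        rcases Nat.lt_or_ge i i' with h | h
        · have : q * (i + 1) ≤ q * i' := Nat.mul_le_mul_left _ h
          rw [mul_add] at this
          omega
        · omega
      have h2 : q * (i' + 1) ≤ q * i := Nat.mul_le_mul_left _ h1
      rw [mul_add] at h2
      have := hg i'
      omega
    · rfl
  split_ifs with hi
  · rw [Finset.sum_eq_single i key (fun h => absurd (Finset.mem_range.2 hi) h), coeff_X_pow_mul',
      if_pos (by omega)]
    congr 1
    omega
  · refine Finset.sum_eq_zero fun i' hi' => key i' hi' ?_
    rintro rfl
    exact hi (Finset.mem_range.1 hi')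

/-- Lucas' congruence for the prime power `q`. -/
lemma choose_mul_add_eq {p q f : ℕ} [hp : Fact p.Prime] (hq : q = p ^ f) (d s i j : ℕ)
    (hs : s < q) (hj : j < q) :
    (((d * q + s).choose (i * q + j) : ℕ) : ZMod p) = (d.choose i : ZMod p) * (s.choose j : ZMod p) := by
  -- By Frobenius `(1 + X) ^ (d q + s) = (1 + X ^ q) ^ d (1 + X) ^ s`, and the coefficients are read
  -- off in base `X ^ q` because `s < q`.
  have h1 : ((1 + X : (ZMod p)[X]) ^ (d * q + s)) =
      ∑ i ∈ Finset.range (d + 1), X ^ (q * i) * (C ((d.choose i : ℕ) : ZMod p) * (1 + X) ^ s) := by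
    rw [pow_add, mul_comm d q, pow_mul, hq, add_pow_char_pow, one_pow, add_comm 1, add_pow,
      Finset.sum_mul]
    refine Finset.sum_congr rfl fun i _ => ?_
    rw [one_pow, mul_one, ← hq, ← pow_mul, map_natCast]
    ring
  have h2 := congrArg (fun g => g.coeff (q * i + j)) h1
  rw [coeff_sum_X_pow_mul _ _ _ hj, coeff_one_add_X_pow, coeff_C_mul, coeff_one_add_X_pow] at h2
  · rw [mul_comm i q, h2]
    split_ifs with h
    · rfl
    · rw [Nat.choose_eq_zero_of_lt (by omega)]
      simp
  · intro i
    refine lt_of_le_of_lt (natDegree_C_mul_le _ _) (lt_of_le_of_lt (natDegree_pow_le) ?_)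
    have : (1 + X : (ZMod p)[X]).natDegree ≤ 1 := by
      rw [add_comm]
      simpa using (natDegree_X_add_C (1 : ZMod p)).le
    nlinarith

lemma X_pow_dvd_of_dvd_one_add_X_pow_mul {K : Type*} [Field K] {h : K[X]} {m n : ℕ}
    (hd : X ^ n ∣ (1 + X) ^ m * h) : X ^ n ∣ h := by
  refine IsCoprime.dvd_of_dvd_mul_left ?_ hd
  refine IsCoprime.pow ⟨-1, 1, by ring⟩

namespace ResidueSystem

variable {p q : ℕ} {w : E} {t : I → E} (S : ResidueSystem p q w t)

include S

lemma two_le : 2 ≤ q := by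
  obtain ⟨f, hf, rfl⟩ := S.prime_pow
  exact S.prime.two_le.trans (Nat.le_self_pow hf.ne' _)

lemma neg_spread : Spread (fun i => -t i) := S.spread.neg

lemma norm_neg_le (i : I) : ‖-t i‖ ≤ 1 := S.neg_spread.le_one i

lemma w_ne : w ≠ 0 := norm_pos_iff.1 S.w_pos

lemma w_pow_le_one (n : ℕ) : ‖w‖ ^ n ≤ 1 := pow_le_one₀ (norm_nonneg _) S.w_lt.le

/-- The coefficient of degree `j` of `up (-t i) w f` is `w ^ j` times a Hasse derivative of `f`.
Interpolation uses the orders `j < n`, whence the loss `w ^ (n - 1)`. -/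
lemma bd_of_up {n : ℕ} {f : E[X]} {c : ℝ} (hf : f.degree < (n * q : ℕ))
    (h : ∀ i, Bd c (up (-t i) w f)) (hc : 0 ≤ c) : Bd (c / ‖w‖ ^ (n - 1)) f := by
  refine S.neg_spread.bd_of_taylor (by positivity) n f (by rwa [S.card]) fun j hj i => ?_
  have h1 := h i j
  rw [coeff_up, norm_mul, norm_pow, ← le_div_iff₀ (pow_pos S.w_pos j)] at h1
  refine h1.trans (div_le_div_of_nonneg_left hc (pow_pos S.w_pos _) ?_)
  exact pow_le_pow_of_le_one S.w_pos.le S.w_lt.le (by omega)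

/-- Undoing both substitutions costs `w ^ (2 d)`. One substitution restores this loss in degrees at
least `q ≥ 2 d`, and below degree `q` the values at the points `-t j` suffice, which are the
constant terms after the second substitution. -/
lemma bd_up_of_bd_up_up {d k : ℕ} (hk : k < (d + 1) * q) (hd : 2 * d ≤ q) {R : E[X]}
    (hR : R.natDegree ≤ k) {c : ℝ} (hc : 0 ≤ c)
    (h : ∀ i j, Bd c (up (-t j) w (up (-t i) w R))) (i : I) : Bd c (up (-t i) w R) := by
  have hV : ∀ i, Bd (c / ‖w‖ ^ d) (up (-t i) w R) := fun i =>
    S.bd_of_up (n := d + 1) (degree_lt_of_natDegree_le ((natDegree_up_le _ _ _).trans hR) hk)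
      (h i) hc
  have hRb : Bd (c / ‖w‖ ^ d / ‖w‖ ^ d) R :=
    S.bd_of_up (n := d + 1) (degree_lt_of_natDegree_le hR hk) hV (by positivity)
  refine S.neg_spread.bd_of_eval_of_coeff hc (fun j hj => ?_) fun j => ?_
  · rw [S.card] at hj
    refine (norm_coeff_up_le hRb (S.norm_neg_le i) j).trans ?_
    have : ‖w‖ ^ j ≤ ‖w‖ ^ (d + d) := pow_le_pow_of_le_one S.w_pos.le S.w_lt.le (by omega)
    calc _ ≤ c / ‖w‖ ^ d / ‖w‖ ^ d * ‖w‖ ^ (d + d) := by gcongr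
      _ = c := by rw [pow_add]; field_simp [(pow_pos S.w_pos d).ne']
  · have := h i j 0
    rwa [coeff_zero_up] at this

/-- The inner binomial coefficients of a power of `p` are divisible by `p`. -/
lemma pow_sub_bd {s : E} (hs : ‖s‖ ≤ 1) :
    Bd ‖(p : E)‖ ((X + C s : E[X]) ^ q - (X ^ q + C (s ^ q))) := by
  obtain ⟨f, hf, hq⟩ := S.prime_pow
  intro j
  have h2 := S.two_le
  rw [coeff_sub, coeff_X_add_C_pow, coeff_add, coeff_X_pow, coeff_C]
  rcases eq_or_ne j q with rfl | hjq
  · rw [if_pos rfl, if_neg (by omega)]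
    simp
  rcases eq_or_ne j 0 with rfl | hj0
  · rw [if_neg (by omega), if_pos rfl]
    simp
  · rw [if_neg hjq, if_neg hj0]
    have hdvd : p ∣ q.choose j := by
      rw [hq]
      exact S.prime.dvd_choose_pow hj0 (by rwa [← hq])
    obtain ⟨m, hm⟩ := hdvd
    rw [hm, add_zero, sub_zero, Nat.cast_mul, mul_comm, mul_assoc]
    exact norm_mul_le_of_le_one_right le_rfl
      ((norm_natCast_mul_le _ _).trans (norm_pow_le_one hs _))

/-- As `t i ^ q = t i`, the Teichmüller representative survives the Frobenius congruence unchanged.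
-/
lemma pow_mul_sub_bd (i : I) (d s : ℕ) :
    Bd ‖(p : E)‖ ((X + C (t i) : E[X]) ^ (d * q + s) - (X ^ q + C (t i)) ^ d * (X + C (t i)) ^ s) := by
  have h := S.pow_sub_bd (S.spread.le_one i)
  rw [S.pow_eq] at h
  rw [pow_add, mul_comm d q, pow_mul, ← sub_mul]
  refine (Bd.pow_sub_pow ((Bd.X_add_C (S.spread.le_one i)).pow_one _) ?_ h d).mul_one_right
    ((Bd.X_add_C (S.spread.le_one i)).pow_one _)
  exact (Bd.X.pow_one _).add (Bd.const (S.spread.le_one i))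

/-! ### Small `a` -/

/-- Cramer's rule. By Lucas the matrix entries are `choose d (i + 1) * choose (r - l) (j - 1 - i)`
modulo `p`. The first factors are units as `d < p`, and the second ones form an invertible matrix,
since no nonzero combination of `(1 + X) ^ (r - l)`, `l < j`, is divisible by `X ^ j`. For `r < j`
the left-hand sides vanish modulo `p`, which makes the solution divisible by `p`. -/
lemma exists_choose_combination {d r j : ℕ} (hdp : d < p) (hr : r < q) (hdq : 2 * d ≤ q)
    (hdr : d ≤ r + 1) (hj : j ≤ d) :
    ∃ b : Fin j → E, (∀ i, ‖b i‖ ≤ if r < j then ‖(p : E)‖ else 1) ∧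
      ∀ l : Fin j, (((d * q + r - l).choose j : ℕ) : E) =
        ∑ i : Fin j, b i * (((d * q + r - l).choose (j + (i + 1) * (q - 1)) : ℕ) : E) := by
  classical
  obtain ⟨f, hf, hq⟩ := S.prime_pow
  have : Fact p.Prime := ⟨S.prime⟩
  have h2 := S.two_le
  set M : Matrix (Fin j) (Fin j) ℤ :=
    Matrix.of fun l i => (((d * q + r - l).choose (j + (i + 1) * (q - 1)) : ℕ) : ℤ) with hM
  set v : Fin j → ℤ := fun l => (((d * q + r - l).choose j : ℕ) : ℤ) with hv
  have hnorm_int : ∀ z : ℤ, ‖(z : E)‖ ≤ 1 := fun z => IsUltrametricDist.norm_intCast_le_one E z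
  -- the determinant is a unit modulo `p`
  have hdet : (M.det : ZMod p) ≠ 0 := by
    intro h0
    have h0' : (M.map (Int.cast : ℤ → ZMod p)).det = 0 := by
      rw [← h0]
      exact ((Int.castRingHom (ZMod p)).map_det M).symm
    obtain ⟨x, hx0, hx⟩ := Matrix.exists_vecMul_eq_zero_iff.2 h0'
    apply hx0
    -- The column `i = j - 1 - s` of the kernel relation, divided by the unit `choose d (j - s)`.
    have hsum : ∀ s < j, ∑ l : Fin j, x l * ((r - l).choose s : ZMod p) = 0 := by
      intro s hs
      have h1 : ∑ l : Fin j, x l * M.map (Int.cast : ℤ → ZMod p) l ⟨j - 1 - s, by omega⟩ = 0 :=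
        congrFun hx ⟨j - 1 - s, by omega⟩
      have h3 : ((d.choose (j - s) : ℕ) : ZMod p) ≠ 0 := by
        rw [Ne, ZMod.natCast_eq_zero_iff]
        intro hdvd
        have h4 : d.choose (j - s) ∣ d.factorial := by
          rw [← Nat.choose_mul_factorial_mul_factorial (show j - s ≤ d by omega), mul_assoc]
          exact dvd_mul_right _ _
        exact absurd ((S.prime.dvd_factorial).1 (hdvd.trans h4)) (by omega)
      have h5 : ((d.choose (j - s) : ℕ) : ZMod p) * ∑ l : Fin j, x l * ((r - l).choose s : ZMod p) = 0 := by
        rw [← h1, Finset.mul_sum]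
        refine Finset.sum_congr rfl fun l _ => ?_
        have hl := l.2
        have e1 : d * q + r - (l : ℕ) = d * q + (r - l) := by omega
        have e2 : j + (j - 1 - s + 1) * (q - 1) = (j - s) * q + s := by
          obtain ⟨q', rfl⟩ : ∃ q', q = q' + 1 := ⟨q - 1, by omega⟩
          obtain ⟨m, rfl⟩ : ∃ m, j = m + 1 + s := ⟨j - 1 - s, by omega⟩
          have e3 : m + 1 + s - 1 - s = m := by omega
          have e4 : m + 1 + s - s = m + 1 := by omega
          rw [e3, e4, Nat.add_sub_cancel]
          ring
        simp only [hM, Matrix.map_apply, Matrix.of_apply, Int.cast_natCast, e1, e2]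
        rw [choose_mul_add_eq hq d (r - l) (j - s) s (by omega) (by omega)]
        ring
      exact (mul_eq_zero.1 h5).resolve_left h3
    set g : (ZMod p)[X] := ∑ l : Fin j, C (x l) * (1 + X) ^ (j - 1 - l) with hg
    -- The product is `∑ x l (1 + X) ^ (r - l)`, whose coefficients of degree `s < j` are the sums
    -- in `hsum`. The exponent `r + 1 - j` is a true difference because `j ≤ d ≤ r + 1`.
    have hdvd : (X ^ j : (ZMod p)[X]) ∣ (1 + X) ^ (r + 1 - j) * g := by
      rw [X_pow_dvd_iff]
      intro s hs
      rw [← hsum s hs, hg, Finset.mul_sum, finsetSum_coeff]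
      refine Finset.sum_congr rfl fun l _ => ?_
      have hl := l.2
      rw [mul_left_comm, ← pow_add, coeff_C_mul, coeff_one_add_X_pow]
      congr 4
      omega
    have hg0 : g = 0 := by
      refine eq_zero_of_dvd_of_natDegree_lt (X_pow_dvd_of_dvd_one_add_X_pow_mul hdvd) ?_
      rw [natDegree_X_pow]
      rcases Nat.eq_zero_or_pos j with rfl | hj0
      · exact absurd (Subsingleton.elim x 0) hx0
      · refine lt_of_le_of_lt (natDegree_sum_le_of_forall_le (n := j - 1) _ _ fun l _ => ?_) (by omega)
        refine (natDegree_C_mul_le _ _).trans (natDegree_pow_le.trans ?_)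
        have : (1 + X : (ZMod p)[X]).natDegree ≤ 1 := by
          rw [add_comm]
          simpa using (natDegree_X_add_C (1 : ZMod p)).le
        calc _ ≤ (j - 1 - l) * 1 := Nat.mul_le_mul_left _ this
          _ ≤ j - 1 := by omega
    -- The substitution `X ↦ X - 1` turns `g` into a sum of distinct monomials with coefficients `x
    -- l`.
    funext l
    have h1 := congrArg (fun f => (f.comp (X - C 1)).coeff (j - 1 - l)) hg0
    simp only [hg, Polynomial.sum_comp, mul_comp, C_comp, pow_comp, add_comp, X_comp, one_comp,
      finsetSum_coeff, zero_comp, coeff_zero] at h1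
    rw [Finset.sum_eq_single l] at h1
    · simpa using h1
    · intro l' _ hne
      have hl := l.2
      have hl' := l'.2
      have hne' : (l' : ℕ) ≠ l := fun h => hne (Fin.ext h)
      simp only [map_one, add_sub_cancel, coeff_C_mul, coeff_X_pow]
      rw [if_neg (by omega), mul_zero]
    · simp
  have hdetC : ‖(M.det : E)‖ = 1 := by
    have h1 : ¬ (p ∣ M.det.natAbs) := by
      rw [← Int.natCast_dvd, ← ZMod.intCast_zmod_eq_zero_iff_dvd]
      exact hdet
    have h3 := S.norm_unit _ h1
    rcases Int.natAbs_eq M.det with h4 | h4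
    · rw [h4]; simpa using h3
    · rw [h4]; simpa using h3
  have hdet0 : (M.det : E) ≠ 0 := by
    intro h
    rw [h, norm_zero] at hdetC
    exact zero_ne_one hdetC
  -- The adjugate gives an integral solution up to the factor `det M`, which is a unit in `E`.
  set y : Fin j → ℤ := M.adjugate.mulVec v with hy
  have hMy : M.mulVec y = M.det • v := by
    rw [hy, Matrix.mulVec_mulVec, Matrix.mul_adjugate, Matrix.smul_mulVec, Matrix.one_mulVec]
  refine ⟨fun i => (M.det : E)⁻¹ * y i, fun i => ?_, fun l => ?_⟩
  · rw [norm_mul, norm_inv, hdetC, inv_one, one_mul]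
    split_ifs with hrj
    · have hdvd : (p : ℤ) ∣ y i := by
        change (p : ℤ) ∣ ∑ l, M.adjugate i l * v l
        refine Finset.dvd_sum fun l _ => Dvd.dvd.mul_left ?_ _
        rw [hv, ← ZMod.intCast_zmod_eq_zero_iff_dvd]
        have e : d * q + r - (l : ℕ) = d * q + (r - l) := by
          have := l.2
          omega
        have h3 := choose_mul_add_eq (p := p) hq d (r - l) 0 j (by omega) (by omega)
        rw [zero_mul, zero_add, Nat.choose_eq_zero_of_lt (show r - (l : ℕ) < j by omega)] at h3
        simpa [e] using h3
      obtain ⟨m, hm⟩ := hdvd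
      rw [hm]
      push_cast
      rw [norm_mul]
      exact mul_le_of_le_one_right (norm_nonneg _) (hnorm_int m)
    · exact hnorm_int _
  · have h3 := congrFun hMy l
    have h4 : (∑ i, M l i * y i : ℤ) = M.det * v l := h3
    have h5 := congrArg (fun z : ℤ => (z : E)) h4
    simp only [Int.cast_sum, Int.cast_mul] at h5
    have h6 : ((v l : ℤ) : E) = (((d * q + r - l).choose j : ℕ) : E) := by simp [hv]
    rw [← h6, ← inv_mul_cancel_left₀ hdet0 ((v l : ℤ) : E), ← h5, Finset.mul_sum]
    refine Finset.sum_congr rfl fun i _ => ?_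
    simp only [hM, Matrix.of_apply, Int.cast_natCast]
    ring

end ResidueSystem

end cone

end BreuilSchneider

end

/-! ### The cone equations for small `a`. -/

noncomputable section

namespace BreuilSchneider

section small

open Polynomial

variable {E : Type*} [NormedField E] [IsUltrametricDist E] {I : Type*} [Fintype I]

/-- Coefficients of `down`. -/
lemma coeff_down (k : ℕ) (t w : E) (f : E[X]) (j : ℕ) :
    (down k t w f).coeff j = ∑ l ∈ Finset.range (k + 1),
      w ^ l * f.coeff (k - l) * (t ^ (k - l - j) * ((k - l).choose j : E)) := by
  unfold down
  rw [finsetSum_coeff]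
  refine Finset.sum_congr rfl fun l _ => ?_
  rw [coeff_C_mul, coeff_X_add_C_pow]

/-- `P` solves the cone equations: the polynomials `P u`, indexed by the vertices `u` of a
rooted `q`-ary tree, satisfy `(T - a) P ≡ 0` modulo integral polynomials away from the root. -/
structure ConeSolution (k : ℕ) (w a : E) (t : I → E) (P : List I → E[X]) : Prop where
  natDegree_le : ∀ u, (P u).natDegree ≤ k
  finite : ∃ m, ∀ u, m ≤ u.length → P u = 0
  bd : ∀ i u, Bd 1 (up (-t i) w (P u) - C a * P (i :: u) +
    ∑ j, down k (t j) w (P (j :: i :: u)))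

/-- Bounds propagate towards the root, so the induction on the length of words descends; it starts
beyond the support of `P`. -/
lemma ConeSolution.induction {k : ℕ} {w a : E} {t : I → E} {P : List I → E[X]}
    (hP : ConeSolution k w a t P) {Q : ℕ → Prop} (n : ℕ)
    (hbase : ∀ m, (∀ u, m ≤ u.length → P u = 0) → Q m)
    (hstep : ∀ m, n ≤ m → Q (m + 1) → Q m) : Q n := by
  obtain ⟨m, hm⟩ := hP.finite
  have h1 : ∀ i, i ≤ m → n ≤ m + n - i → Q (m + n - i) := by
    intro i
    induction i with
    | zero => intro _ _; exact hbase _ fun u hu => hm u (by omega)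
    | succ i ih =>
      intro hi hn
      refine hstep _ hn ?_
      rw [show m + n - (i + 1) + 1 = m + n - i by omega]
      exact ih (by omega) (by omega)
  simpa using h1 m le_rfl (by omega)

namespace ResidueSystem

variable {p q : ℕ} {w : E} {t : I → E} (S : ResidueSystem p q w t)

include S

lemma pow_eq_pow_add_mul {i : I} (m n : ℕ) (hm : 0 < m) :
    t i ^ (m + n * (q - 1)) = t i ^ m := by
  induction n with
  | zero => simp
  | succ n ih =>
    have h2 := S.two_le
    have e : m + (n + 1) * (q - 1) = (m + n * (q - 1) - 1) + q := by
      rw [add_mul]; omega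
    rw [e, pow_add, S.pow_eq, ← pow_succ, ← ih]
    congr 1
    omega

/-- The coefficients of degree at least `q` are known to be integral, so a combination of those of
degree `j + (i + 1) (q - 1)` may be subtracted. The powers of `t i` involved depend on this degree
only modulo `q - 1`, hence the combination from `exists_choose_combination` cancels the
contributions of `l < j`. What remains carries a factor `w ^ l` with `l ≥ j`. -/
lemma norm_coeff_sum_down_le {d r k : ℕ} (hk : k = d * q + r) (hdp : d < p) (hr : r < q)
    (hdq : 2 * d ≤ q) (hdr : d ≤ r + 1) (Q : I → E[X]) (hQ : ∀ i, Bd (1 / ‖w‖ ^ d) (Q i))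
    (hW : ∀ j, q ≤ j → ‖(∑ i, down k (t i) w (Q i)).coeff j‖ ≤ 1) (j : ℕ) (hj : j ≤ d) :
    ‖(∑ i, down k (t i) w (Q i)).coeff j‖ ≤ ‖w‖ ^ j / ‖w‖ ^ d := by
  have h2 := S.two_le
  have hwj : (1 : ℝ) ≤ ‖w‖ ^ j / ‖w‖ ^ d := by
    rw [one_le_div (pow_pos S.w_pos d)]
    exact pow_le_pow_of_le_one S.w_pos.le S.w_lt.le hj
  have hnn : (0 : ℝ) ≤ ‖w‖ ^ j / ‖w‖ ^ d := zero_le_one.trans hwj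
  obtain ⟨b, hb, hbsum⟩ := S.exists_choose_combination hdp hr hdq hdr hj
  set W := ∑ i, down k (t i) w (Q i) with hWdef
  have hb1 : ∀ i, ‖b i‖ ≤ 1 := fun i => (hb i).trans (by
    split_ifs
    · exact S.p_le.trans S.w_lt.le
    · exact le_rfl)
  -- the combination of coefficients
  suffices h : ‖W.coeff j - ∑ i : Fin j, b i * W.coeff (j + (i + 1) * (q - 1))‖ ≤
      ‖w‖ ^ j / ‖w‖ ^ d by
    have h3 : ‖∑ i : Fin j, b i * W.coeff (j + (i + 1) * (q - 1))‖ ≤ ‖w‖ ^ j / ‖w‖ ^ d := by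
      refine norm_sum_le_of_le hnn fun i _ => ?_
      rw [mul_comm]
      refine (norm_mul_le_of_le_one_right (hW _ ?_) (hb1 i)).trans hwj
      have hi := i.2
      have : 1 * (q - 1) ≤ (i + 1) * (q - 1) := Nat.mul_le_mul_right _ (by omega)
      omega
    simpa using norm_add_le_of_le h h3
  have hcoeff : ∀ n, W.coeff n = ∑ i, ∑ l ∈ Finset.range (k + 1),
      w ^ l * (Q i).coeff (k - l) * (t i ^ (k - l - n) * ((k - l).choose n : E)) := by
    intro n
    rw [hWdef, finsetSum_coeff]
    exact Finset.sum_congr rfl fun i _ => coeff_down _ _ _ _ _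
  have heq : W.coeff j - ∑ i : Fin j, b i * W.coeff (j + (i + 1) * (q - 1)) =
      ∑ i, ∑ l ∈ Finset.range (k + 1), w ^ l * (Q i).coeff (k - l) *
        (t i ^ (k - l - j) * ((k - l).choose j : E) - ∑ i' : Fin j, b i' *
          (t i ^ (k - l - (j + (i' + 1) * (q - 1))) *
            ((k - l).choose (j + (i' + 1) * (q - 1)) : E))) := by
    simp only [hcoeff, Finset.mul_sum, mul_sub, Finset.sum_sub_distrib]
    congr 1
    rw [Finset.sum_comm]
    refine Finset.sum_congr rfl fun i _ => ?_
    rw [Finset.sum_comm]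
    refine Finset.sum_congr rfl fun l _ => Finset.sum_congr rfl fun i' _ => ?_
    ring
  rw [heq]
  refine norm_sum_le_of_le hnn fun i _ => norm_sum_le_of_le hnn fun l hl => ?_
  have hti := S.spread.le_one i
  have hwQ : ∀ l, ‖w ^ l * (Q i).coeff (k - l)‖ ≤ ‖w‖ ^ l / ‖w‖ ^ d := by
    intro l
    rw [norm_mul, norm_pow, div_eq_mul_one_div]
    exact mul_le_mul_of_nonneg_left (hQ i _) (by positivity)
  have hterm : ∀ n m, ‖t i ^ n * ((k - l).choose m : E)‖ ≤ 1 := fun n m => by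
    rw [mul_comm]
    exact (norm_natCast_mul_le _ _).trans (norm_pow_le_one hti _)
  rcases Nat.lt_or_ge l j with hlj | hlj
  · -- the bracket vanishes up to one exceptional term
    by_cases hexc : t i = 0 ∧ r = l
    -- Here `0 ^ 0 = 1` spoils the cancellation. But `r < j ≤ d ≤ r + 1` forces `j = d = r + 1`, and
    -- then the `b i` are divisible by `p`, which supplies the factor `w` missing from `w ^ r`.
    · obtain ⟨h0, rfl⟩ := hexc
      have hrj : r < j := hlj
      have hjd : j = d := by omega
      have hrd : d = r + 1 := by omega
      have hbr : ‖t i ^ (k - r - j) * ((k - r).choose j : E) - ∑ i' : Fin j, b i' *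
          (t i ^ (k - r - (j + (i' + 1) * (q - 1))) *
            ((k - r).choose (j + (i' + 1) * (q - 1)) : E))‖ ≤ ‖w‖ := by
        refine norm_sub_le_of_le ?_ (norm_sum_le_of_le (norm_nonneg _) fun i' _ => ?_)
        · rw [h0, zero_pow, zero_mul, norm_zero]
          · exact norm_nonneg _
          · have : d * 2 ≤ d * q := Nat.mul_le_mul_left _ h2
            omega
        · refine (norm_mul_le_of_le_one_right (hb i') (hterm _ _)).trans ?_
          rw [if_pos hrj]
          exact S.p_le
      rw [norm_mul]
      calc _ ≤ ‖w‖ ^ r / ‖w‖ ^ d * ‖w‖ := mul_le_mul (hwQ r) hbr (norm_nonneg _) (by positivity)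
        _ = ‖w‖ ^ j / ‖w‖ ^ d := by rw [hjd, hrd, pow_succ]; ring
    · have hbr : t i ^ (k - l - j) * ((k - l).choose j : E) - ∑ i' : Fin j, b i' *
          (t i ^ (k - l - (j + (i' + 1) * (q - 1))) *
            ((k - l).choose (j + (i' + 1) * (q - 1)) : E)) = 0 := by
        have hsum := hbsum ⟨l, hlj⟩
        simp only [← hk] at hsum
        rw [hsum, Finset.mul_sum, ← Finset.sum_sub_distrib]
        refine Finset.sum_eq_zero fun i' _ => ?_
        have hi' := i'.2
        set n := j + ((i' : ℕ) + 1) * (q - 1) with hn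
        rcases Nat.lt_or_ge (k - l) n with hlt | hge
        · rw [Nat.choose_eq_zero_of_lt hlt]
          simp
        · suffices hpow : t i ^ (k - l - j) = t i ^ (k - l - n) by rw [hpow]; ring
          have e : k - l - j = (k - l - n) + (i' + 1) * (q - 1) := by omega
          rcases Nat.eq_zero_or_pos (k - l - n) with hz | hz
          · have ht0 : t i ≠ 0 := by
              intro h0
              refine hexc ⟨h0, ?_⟩
              -- exponents: `d q + r - l = j + (i' + 1) (q - 1)`
              have e1 : d * q + r - l = j + (i' + 1) * (q - 1) := by omega
              have e2 : ((i' : ℕ) + 1) * (q - 1) + (i' + 1) = (i' + 1) * q := by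
                obtain ⟨q', rfl⟩ : ∃ q', q = q' + 1 := ⟨q - 1, by omega⟩
                rw [Nat.add_sub_cancel]
                ring
              rcases Nat.lt_or_ge (i' + 1 : ℕ) d with hlt | hge'
              · have e3 : ((i' : ℕ) + 1 + 1) * q ≤ d * q := Nat.mul_le_mul_right _ hlt
                rw [add_mul] at e3
                omega
              · have e3 : (i' : ℕ) + 1 = d := by omega
                rw [e3] at e1 e2
                omega
            rw [hz, pow_zero, e, hz, zero_add]
            have h3 : t i ^ (q - 1) = 1 := by
              have := S.pow_eq i
              rw [show q = (q - 1) + 1 by omega, pow_succ] at this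
              exact mul_right_cancel₀ ht0 (by rw [this, one_mul])
            rw [mul_comm, pow_mul, h3, one_pow]
          · rw [e, S.pow_eq_pow_add_mul _ _ hz]
      rw [hbr, mul_zero, norm_zero]
      exact hnn
  · refine (norm_mul_le_of_le_one_right (hwQ l) (norm_sub_le_of_le (hterm _ _)
      (norm_sum_le_of_le zero_le_one fun i' _ =>
        norm_mul_le_of_le_one_right (hb1 i') (hterm _ _)))).trans ?_
    have := pow_le_pow_of_le_one S.w_pos.le S.w_lt.le hlj
    gcongr

/-- Since `‖a‖ ≤ ‖w‖ ^ d`, the middle term of the cone equation is integral, and `up (P u)` agrees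
with minus the sum of the `down` terms. In degree `j ≤ d` that sum has size at most `‖w‖ ^ j / ‖w‖ ^
d`; dividing by `w ^ j` bounds the Hasse derivatives of `P u` by `1 / ‖w‖ ^ d` again, so nothing is
lost from one level to the next. -/
lemma bd_of_small {d r k : ℕ} (hk : k = d * q + r) (hdp : d < p) (hr : r < q)
    (hdq : 2 * d ≤ q) (hdr : d ≤ r + 1) {a : E} (ha : ‖a‖ ≤ ‖w‖ ^ d) {P : List I → E[X]}
    (hP : ConeSolution k w a t P) (u : List I) : Bd (1 / ‖w‖ ^ d) (P u) := by
  have hk1 : k < (d + 1) * q := by rw [hk, add_mul]; omega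
  have hwd : 0 < ‖w‖ ^ d := pow_pos S.w_pos d
  have h1d : (1 : ℝ) ≤ 1 / ‖w‖ ^ d := by
    rw [one_le_div hwd]
    exact S.w_pow_le_one d
  refine hP.induction (Q := fun m => ∀ u, m ≤ u.length → Bd (1 / ‖w‖ ^ d) (P u)) 0
    (fun m hm u hu => ?_) (fun m _ ih u hu => ?_) u (Nat.zero_le _)
  · rw [hm u hu]
    exact Bd.zero (by positivity)
  · have hQ : ∀ i j, Bd (1 / ‖w‖ ^ d) (P (j :: i :: u)) := fun i j => ih _ (by simp; omega)
    have haS : ∀ i, Bd 1 (C a * P (i :: u)) := fun i => by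
      refine (Bd.C_mul (ih (i :: u) (by simp; omega))).mono ?_
      calc ‖a‖ * (1 / ‖w‖ ^ d) ≤ ‖w‖ ^ d * (1 / ‖w‖ ^ d) := by gcongr
        _ = 1 := by field_simp
    set W : I → E[X] := fun i => ∑ j, down k (t j) w (P (j :: i :: u)) with hW
    have hWb : ∀ i, Bd (1 / ‖w‖ ^ d) (W i) := fun i =>
      Bd.sum (by positivity) fun j _ => down_bd (by positivity) (S.spread.le_one j) fun l _ => by
        rw [mul_comm]
        exact norm_mul_le_of_le_one_right (hQ i j _) (norm_pow_le_one S.w_lt.le l)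
    have heq : ∀ i, Bd 1 (up (-t i) w (P u) + W i) := fun i => by
      have := (hP.bd i u).add (haS i)
      have e : up (-t i) w (P u) - C a * P (i :: u) + W i + C a * P (i :: u) =
        up (-t i) w (P u) + W i := by ring
      rwa [e] at this
    have hup : ∀ i, Bd (1 / ‖w‖ ^ d) (up (-t i) w (P u)) := fun i =>
      (hWb i).of_add ((heq i).mono h1d)
    have hdeg : (P u).degree < ((d + 1) * q : ℕ) :=
      degree_lt_of_natDegree_le (hP.natDegree_le u) hk1
    -- A crude bound, used only for degrees `j ≥ q ≥ 2 d`, where the factor `w ^ j` of `up` absorbs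
    -- it.
    have hR : Bd (1 / ‖w‖ ^ d / ‖w‖ ^ d) (P u) :=
      S.bd_of_up (n := d + 1) hdeg hup (by positivity)
    have hWq : ∀ i j, q ≤ j → ‖(W i).coeff j‖ ≤ 1 := by
      intro i j hj
      have h3 : ‖(up (-t i) w (P u)).coeff j‖ ≤ 1 := by
        refine (norm_coeff_up_le hR (S.norm_neg_le i) j).trans ?_
        have : ‖w‖ ^ j ≤ ‖w‖ ^ (d + d) := pow_le_pow_of_le_one S.w_pos.le S.w_lt.le (by omega)
        calc _ ≤ 1 / ‖w‖ ^ d / ‖w‖ ^ d * ‖w‖ ^ (d + d) := by gcongr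
          _ = 1 := by rw [pow_add]; field_simp
      have h4 := heq i j
      rw [coeff_add] at h4
      simpa using norm_sub_le_of_le h4 h3
    refine S.neg_spread.bd_of_taylor (by positivity) (d + 1) _ (by rwa [S.card]) fun j hj i => ?_
    have h5 := S.norm_coeff_sum_down_le hk hdp hr hdq hdr _ (hQ i) (hWq i) j (by omega)
    have h6 := heq i j
    rw [coeff_add] at h6
    have hwj : (1 : ℝ) ≤ ‖w‖ ^ j / ‖w‖ ^ d := by
      rw [one_le_div hwd]
      exact pow_le_pow_of_le_one S.w_pos.le S.w_lt.le (by omega)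
    have h7 := norm_sub_le_of_le (h6.trans hwj) h5
    rw [add_sub_cancel_right, coeff_up, norm_mul, norm_pow, ← le_div_iff₀ (pow_pos S.w_pos j)] at h7
    refine h7.trans (le_of_eq ?_)
    have h8 := (pow_pos S.w_pos j).ne'
    rw [div_right_comm, div_self h8]

end ResidueSystem

end small

end BreuilSchneider

end

/-! ### Expansion in powers of `X ^ q` and the top block of coefficients. -/

noncomputable section

namespace BreuilSchneider

section generic

open Polynomial

variable {E : Type*} [NormedField E] [IsUltrametricDist E] {I : Type*} [Fintype I]

/-- The constant term of `(1 + X) ^ m` is one, so the coefficients of `h` solve a unitriangular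
system. -/
lemma norm_coeff_le_of_one_add_X_pow_mul {h : E[X]} {m l : ℕ} {c : ℝ} (hc : 0 ≤ c)
    (hG : ∀ j ≤ l, ‖((1 + X) ^ m * h).coeff j‖ ≤ c) : ∀ j ≤ l, ‖h.coeff j‖ ≤ c := by
  intro j
  induction j using Nat.strong_induction_on with
  | _ j ih =>
    intro hj
    have h1 := hG j hj
    rw [coeff_mul, ← Finset.add_sum_erase _ _ (show ((0, j) : ℕ × ℕ) ∈ _ from
      Finset.HasAntidiagonal.mem_antidiagonal.2 (zero_add j))] at h1
    have hrest : ‖∑ x ∈ (Finset.HasAntidiagonal.antidiagonal j).erase (0, j),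
        ((1 + X : E[X]) ^ m).coeff x.1 * h.coeff x.2‖ ≤ c := by
      refine norm_sum_le_of_le hc fun x hx => ?_
      rw [Finset.mem_erase, Finset.HasAntidiagonal.mem_antidiagonal] at hx
      have hx2 : x.2 < j := by
        rcases Nat.lt_or_ge x.2 j with h' | h'
        · exact h'
        · exact absurd (Prod.ext (by simp; omega) (by simp; omega)) hx.1
      rw [coeff_one_add_X_pow]
      exact (norm_natCast_mul_le _ _).trans (ih _ hx2 (by omega))
    have h2 := norm_sub_le_of_le h1 hrest
    rw [add_sub_cancel_right, coeff_one_add_X_pow] at h2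
    simpa using h2

namespace ResidueSystem

variable {p q : ℕ} {w : E} {t : I → E} (S : ResidueSystem p q w t)

include S

/-- Evaluating `pow_sub_bd` for `-t i` at `t i` treats both parities: the sum is zero for odd `q`
and `2 t i` for even `q`. -/
lemma norm_neg_pow_add_le (i : I) : ‖(-t i) ^ q + t i‖ ≤ ‖(p : E)‖ := by
  have h1 := (S.pow_sub_bd (S.norm_neg_le i)).eval (S.spread.le_one i)
  have h2 := S.two_le
  rw [← norm_neg]
  simpa [S.pow_eq, show q ≠ 0 by omega, add_comm, sub_eq_add_neg] using h1

/-- After the substitution the inner coefficients of `X ^ q` are divisible by `p` and the leading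
one is `w ^ q`; the constant term is `-t i` modulo `p`. -/
lemma up_X_pow_sub_bd {c : ℝ} (hp : ‖(p : E)‖ ≤ c) (hw : ‖w‖ ^ q ≤ c) (i : I) :
    Bd c (up (-t i) w (X ^ q) - C (-t i)) := by
  intro j
  have hc : 0 ≤ c := (norm_nonneg _).trans hp
  have h1 := S.pow_sub_bd (S.norm_neg_le i) j
  have h2 := S.two_le
  rw [coeff_sub, coeff_up, taylor_X_pow]
  rw [coeff_sub, coeff_add, coeff_X_pow, coeff_C] at h1
  rw [coeff_C]
  rcases eq_or_ne j 0 with rfl | hj0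
  · rw [if_neg (by omega), if_pos rfl, zero_add] at h1
    rw [if_pos rfl, pow_zero, mul_one]
    have h3 := norm_add_le_of_le h1 (S.norm_neg_pow_add_le i)
    refine le_trans (le_of_eq ?_) (h3.trans hp)
    congr 1
    ring
  · rw [if_neg hj0, add_zero] at h1
    rw [if_neg hj0, sub_zero]
    rcases eq_or_ne j q with rfl | hjq
    · rw [norm_mul, norm_pow]
      refine le_trans (mul_le_of_le_one_left (by positivity) ?_) hw
      exact (Bd.X_add_C (S.norm_neg_le i)).pow_one _ _
    · rw [if_neg hjq, sub_zero] at h1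
      exact norm_mul_le_of_le_one_right (h1.trans hp) (norm_pow_le_one S.w_lt.le j)

/-- If `V + ∑ᵢ X^(q i) gᵢ` becomes integral after each substitution `z ↦ w z - t`, then the top
coefficients of `g_d` are small. -/
lemma norm_top_coeff_le {d r : ℕ} (hdr : d + r < q) {A : ℝ} (hA : 1 ≤ A)
    (hAr : A * ‖w‖ ^ r ≤ 1) (hAp : A * ‖(p : E)‖ ≤ 1) {g : ℕ → E[X]} {V : E[X]}
    (hg : ∀ i, (g i).natDegree ≤ r) (hgb : ∀ i, Bd A (g i))
    (hV : ∀ j, ‖V.coeff j‖ ≤ A * ‖w‖ ^ j / ‖w‖ ^ d)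
    (h : ∀ i, Bd 1 (up (-t i) w (V + ∑ i ∈ Finset.range (d + 1), X ^ (q * i) * g i)))
    {l : ℕ} (hl : l ≤ r) : ‖(g d).coeff (r - l)‖ ≤ 1 / ‖w‖ ^ l := by
  have hA0 : 0 < A := zero_lt_one.trans_le hA
  have hw0 := S.w_pos
  have hwl := S.w_lt.le
  have hVr : ∀ n l, d + r ≤ n + l → ‖V.coeff n‖ ≤ 1 / ‖w‖ ^ l := by
    intro n l hn
    refine (hV n).trans ?_
    rw [div_le_div_iff₀ (pow_pos hw0 d) (pow_pos hw0 l), one_mul, mul_assoc, ← pow_add]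
    calc A * ‖w‖ ^ (n + l) ≤ A * ‖w‖ ^ (r + d) := by
          have := pow_le_pow_of_le_one hw0.le hwl (show r + d ≤ n + l by omega)
          gcongr
      _ = (A * ‖w‖ ^ r) * ‖w‖ ^ d := by rw [pow_add]; ring
      _ ≤ ‖w‖ ^ d := mul_le_of_le_one_left (by positivity) hAr
  -- the polynomials of Hasse derivatives
  set D : ℕ → E[X] := fun j =>
    (∑ i ∈ Finset.range (d + 1), X ^ i * hasseDeriv j (g i)) + hasseDeriv j V with hD
  -- Replacing the image of `X ^ q` by the constant `-t i` changes the hypothesis only by an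
  -- integral polynomial. The coefficient of degree `j` is then `w ^ j` times the value of `D j` at
  -- `-t i`.
  have hDeval : ∀ j i, ‖(D j).eval (-t i)‖ ≤ 1 / ‖w‖ ^ j := by
    intro j i
    have h1 : Bd 1 (up (-t i) w V + ∑ m ∈ Finset.range (d + 1), C (-t i) ^ m * up (-t i) w (g m)) := by
      have h2 : Bd 1 (∑ m ∈ Finset.range (d + 1),
          (up (-t i) w (X ^ q) ^ m - C (-t i) ^ m) * up (-t i) w (g m)) := by
        refine Bd.sum zero_le_one fun m _ => ?_
        have h3 : Bd (1 / A) (up (-t i) w (X ^ q) - C (-t i)) := by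
          refine S.up_X_pow_sub_bd ?_ ?_ i
          · rwa [le_div_iff₀' hA0]
          · rw [le_div_iff₀' hA0]
            refine le_trans ?_ hAr
            have := pow_le_pow_of_le_one hw0.le hwl (show r ≤ q by omega)
            gcongr
        have h4 := (Bd.pow_sub_pow (((Bd.X.pow_one q)).up (S.norm_neg_le i) hwl)
          (Bd.const (S.norm_neg_le i)) h3 m).mul ((hgb m).up (S.norm_neg_le i) hwl)
        rwa [one_div, inv_mul_cancel₀ hA0.ne'] at h4
      have h5 := (h i).sub h2
      refine (congrArg (Bd 1) ?_).mp h5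
      rw [up_add, show up (-t i) w (∑ i ∈ Finset.range (d + 1), X ^ (q * i) * g i) =
        ∑ m ∈ Finset.range (d + 1), up (-t i) w (X ^ q) ^ m * up (-t i) w (g m) by
          simp only [up_eq_comp, Polynomial.sum_comp, mul_comp, pow_comp, pow_mul]]
      simp only [sub_mul, Finset.sum_sub_distrib]
      ring
    have h2 := h1 j
    have h3 : (up (-t i) w V + ∑ m ∈ Finset.range (d + 1), C (-t i) ^ m * up (-t i) w (g m)).coeff j =
        (D j).eval (-t i) * w ^ j := by
      simp only [hD, coeff_add, finsetSum_coeff, ← C_pow, coeff_C_mul, coeff_up, taylor_coeff,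
        eval_add, eval_finsetSum, eval_mul, eval_pow, eval_X, add_mul, Finset.sum_mul]
      rw [add_comm]
      simp only [mul_assoc]
    rw [h3, norm_mul, norm_pow] at h2
    rwa [le_div_iff₀ (pow_pos hw0 j)]
  -- The sum in `D j` has degree at most `d + r < q`, and `V` contributes little in degrees at least
  -- `q`, so the `q` values determine the bound.
  have hDb : ∀ j, Bd (1 / ‖w‖ ^ j) (D j) := by
    intro j
    refine S.neg_spread.bd_of_eval_of_coeff (by positivity) (fun n hn => ?_) (hDeval j)
    rw [S.card] at hn
    simp only [hD, coeff_add, finsetSum_coeff]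
    rw [Finset.sum_eq_zero, zero_add, hasseDeriv_coeff]
    · exact (norm_natCast_mul_le _ _).trans (hVr _ _ (by omega))
    · intro i hi
      rw [Finset.mem_range] at hi
      apply coeff_eq_zero_of_natDegree_lt
      refine lt_of_le_of_lt (natDegree_mul_le.trans (add_le_add (natDegree_X_pow_le i)
        ((natDegree_hasseDeriv_le _ _).trans ((Nat.sub_le _ _).trans (hg i))))) (by omega)
  -- The coefficient of degree `d + r - l - j` of `D j` is, up to `V`, the coefficient of degree `j`
  -- of `(1 + X) ^ (r - l) * Φ`. Dividing out the power of `1 + X` bounds `Φ`, and at `-1` only the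
  -- term `i = d`, the wanted coefficient, survives.
  set Φ : E[X] := ∑ i ∈ Finset.range (d + 1), C ((g i).coeff (r - l + (d - i))) * (1 + X) ^ (d - i)
    with hΦ
  have hΦdeg : Φ.natDegree ≤ l := by
    refine natDegree_sum_le_of_forall_le _ _ fun i hi => ?_
    rcases Nat.lt_or_ge l (d - i) with hlt | hge
    · rw [coeff_eq_zero_of_natDegree_lt (lt_of_le_of_lt (hg i) (by omega))]
      simp
    · refine (natDegree_C_mul_le _ _).trans (natDegree_pow_le.trans ?_)
      have : (1 + X : E[X]).natDegree ≤ 1 := by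
        rw [add_comm]
        simpa using (natDegree_X_add_C (1 : E)).le
      calc _ ≤ (d - i) * 1 := Nat.mul_le_mul_left _ this
        _ ≤ l := by omega
  have hG : ∀ j ≤ l, ‖((1 + X) ^ (r - l) * Φ).coeff j‖ ≤ 1 / ‖w‖ ^ l := by
    intro j hj
    have hcoeff : ((1 + X) ^ (r - l) * Φ).coeff j = ∑ i ∈ Finset.range (d + 1),
        ((r - l + (d - i)).choose j : E) * (g i).coeff (r - l + (d - i)) := by
      rw [hΦ, Finset.mul_sum, finsetSum_coeff]
      refine Finset.sum_congr rfl fun i _ => ?_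
      rw [mul_left_comm, ← pow_add, coeff_C_mul, coeff_one_add_X_pow, mul_comm]
    rw [hcoeff]
    rcases Nat.lt_or_ge (d + r - l) j with hlt | hge
    · rw [Finset.sum_eq_zero, norm_zero]
      · positivity
      · intro i _
        rw [Nat.choose_eq_zero_of_lt (by omega)]
        simp
    · have h1 := (hDb j).mono (c' := 1 / ‖w‖ ^ l)
        (one_div_le_one_div_of_le (pow_pos hw0 l) (pow_le_pow_of_le_one hw0.le hwl hj))
        (d + r - l - j)
      simp only [hD, coeff_add, finsetSum_coeff] at h1
      rw [hasseDeriv_coeff] at h1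
      have h2 := norm_sub_le_of_le h1 ((norm_natCast_mul_le
        ((d + r - l - j + j).choose j) _).trans (hVr (d + r - l - j + j) l (by omega)))
      rw [add_sub_cancel_right] at h2
      refine le_trans (le_of_eq ?_) h2
      congr 1
      refine Finset.sum_congr rfl fun i hi => ?_
      rw [Finset.mem_range] at hi
      rw [coeff_X_pow_mul']
      split_ifs with hle
      · rw [hasseDeriv_coeff]
        have e : d + r - l - j - i + j = r - l + (d - i) := by omega
        rw [e]
      · rw [Nat.choose_eq_zero_of_lt (by omega)]
        simp
  have hΦb : Bd (1 / ‖w‖ ^ l) Φ := by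
    intro j
    rcases Nat.lt_or_ge l j with hlt | hge
    · rw [coeff_eq_zero_of_natDegree_lt (by omega), norm_zero]
      positivity
    · exact norm_coeff_le_of_one_add_X_pow_mul (by positivity) hG j hge
  have h1 := hΦb.eval (t := -1) (by simp)
  rw [hΦ, eval_finsetSum, Finset.sum_eq_single d] at h1
  · simpa using h1
  · intro i hi hne
    rw [Finset.mem_range] at hi
    simp [show d - i ≠ 0 by omega]
  · simp

end ResidueSystem

end generic

end BreuilSchneider

end

/-! ### The cone equations in the generic case. -/

noncomputable section

namespace BreuilSchneider

section generic2

open Polynomial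

variable {E : Type*} [NormedField E] [IsUltrametricDist E] {I : Type*} [Fintype I]

namespace ResidueSystem

variable {p q : ℕ} {w : E} {t : I → E} (S : ResidueSystem p q w t)

include S

/-- Expansion of `∑ᵢ down Qᵢ` in powers of `X ^ q`, modulo integral polynomials. -/
lemma exists_sum_down_expansion {d r k : ℕ} (hk : k = d * q + r) (hr : r < q) {A : ℝ}
    (hA : 0 ≤ A) (hAp : A * ‖(p : E)‖ ≤ 1) (Q : I → E[X])
    (hQ : ∀ i, ∀ l ≤ k, ‖w ^ l * (Q i).coeff (k - l)‖ ≤ A)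
    (hQ1 : ∀ i, ∀ l ≤ k, r < l → ‖w ^ l * (Q i).coeff (k - l)‖ ≤ 1) :
    ∃ g : ℕ → E[X], (∀ i, (g i).natDegree ≤ r) ∧ (∀ i, Bd A (g i)) ∧
      Bd 1 ((∑ i, down k (t i) w (Q i)) - ∑ i ∈ Finset.range (d + 1), X ^ (q * i) * g i) ∧
      (∀ i, g i = ∑ j, ∑ l ∈ Finset.range (r + 1), C (w ^ l * (Q j).coeff (k - l) *
        (t j ^ (d - i) * (d.choose i : E))) * (X + C (t j)) ^ (r - l)) := by
  refine ⟨_, fun i => ?_, fun i => ?_, ?_, fun i => rfl⟩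
  · refine natDegree_sum_le_of_forall_le _ _ fun j _ =>
      natDegree_sum_le_of_forall_le _ _ fun l _ => ?_
    refine (natDegree_C_mul_le _ _).trans (natDegree_pow_le.trans ?_)
    rw [natDegree_X_add_C]
    omega
  · refine Bd.sum hA fun j _ => Bd.sum hA fun l hl => ?_
    rw [Finset.mem_range] at hl
    refine Bd.mul_one_right (Bd.const ?_) ((Bd.X_add_C (S.spread.le_one j)).pow_one _)
    refine norm_mul_le_of_le_one_right (hQ j l ?_) ?_
    · omega
    · rw [mul_comm]
      exact (norm_natCast_mul_le _ _).trans (norm_pow_le_one (S.spread.le_one j) _)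
  · have e : ∑ i ∈ Finset.range (d + 1), X ^ (q * i) * (∑ j, ∑ l ∈ Finset.range (r + 1),
        C (w ^ l * (Q j).coeff (k - l) * (t j ^ (d - i) * (d.choose i : E))) *
          (X + C (t j)) ^ (r - l)) =
        ∑ j, ∑ l ∈ Finset.range (r + 1), C (w ^ l * (Q j).coeff (k - l)) *
          ((X ^ q + C (t j)) ^ d * (X + C (t j)) ^ (r - l)) := by
      simp only [Finset.mul_sum]
      rw [Finset.sum_comm]
      refine Finset.sum_congr rfl fun j _ => ?_
      rw [Finset.sum_comm]
      refine Finset.sum_congr rfl fun l _ => ?_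
      rw [add_pow (X ^ q) (C (t j)) d, Finset.sum_mul, Finset.mul_sum]
      refine Finset.sum_congr rfl fun i _ => ?_
      simp only [C_mul, C_pow, map_natCast, pow_mul]
      ring
    rw [e, ← Finset.sum_sub_distrib]
    refine Bd.sum zero_le_one fun j _ => ?_
    unfold down
    rw [← Finset.sum_range_add_sum_Ico _ (show r + 1 ≤ k + 1 by omega), add_sub_right_comm,
      ← Finset.sum_sub_distrib]
    -- For `l ≤ r` the power `(X + t) ^ (k - l)` is replaced by `(X ^ q + t) ^ d (X + t) ^ (r - l)`
    -- modulo `p`; for `l > r` the whole term is integral.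
    refine Bd.add (Bd.sum zero_le_one fun l hl => ?_) (Bd.sum zero_le_one fun l hl => ?_)
    · rw [Finset.mem_range] at hl
      rw [← mul_sub]
      have h1 := S.pow_mul_sub_bd j d (r - l)
      rw [show d * q + (r - l) = k - l by omega] at h1
      exact ((Bd.const (hQ j l (by omega))).mul h1).mono hAp
    · rw [Finset.mem_Ico] at hl
      exact (Bd.const (hQ1 j l (by omega) (by omega))).mul_one_right
        ((Bd.X_add_C (S.spread.le_one j)).pow_one _)

/-- One step up the tree: bounds for the vertices below a vertex `u` yield the same bounds
at `u`. -/
lemma bd_up_step {d k : ℕ} (hk : k < (d + 1) * q) (hdq : 2 * d ≤ q) {a : E} {A : ℝ}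
    (hA : 1 ≤ A) (haA : ‖a‖ * A = 1) {P : List I → E[X]} (hP : ConeSolution k w a t P)
    (u : List I) (h2 : ∀ i, Bd A (∑ j, down k (t j) w (P (j :: i :: u))))
    (hS : ∀ i j, Bd A (up (-t j) w (P (i :: u)))) :
    (∀ i j, Bd 1 (up (-t j) w (up (-t i) w (P u) + ∑ j, down k (t j) w (P (j :: i :: u))))) ∧
    (∀ i, Bd A (up (-t i) w (P u))) ∧ Bd (A / ‖w‖ ^ d) (P u) ∧ ∀ i, Bd (A ^ 2) (P (i :: u)) := by
  have hA0 : 0 < A := zero_lt_one.trans_le hA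
  -- A further substitution makes the term with `a` integral, since `up (P (i :: u))` is bounded by
  -- `A` and `‖a‖ * A = 1`.
  have h1 : ∀ i j, Bd 1 (up (-t j) w (up (-t i) w (P u) +
      ∑ j, down k (t j) w (P (j :: i :: u)))) := by
    intro i j
    have h2 := (hP.bd i u).up (S.norm_neg_le j) S.w_lt.le
    have h3 : Bd 1 (up (-t j) w (C a * P (i :: u))) := by
      rw [up_C_mul]
      refine ((Bd.const le_rfl).mul (hS i j)).mono haA.le
    have h4 := h2.add h3
    rw [← up_add] at h4
    refine (congrArg (fun f => Bd 1 (up (-t j) w f)) ?_).mp h4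
    ring
  have h3 : ∀ i, Bd A (up (-t i) w (P u)) := by
    refine S.bd_up_of_bd_up_up hk hdq (hP.natDegree_le u) hA0.le fun i j => ?_
    have h5 := (h1 i j).mono hA
    rw [up_add] at h5
    exact ((h2 i).up (S.norm_neg_le j) S.w_lt.le).of_add h5
  refine ⟨h1, h3, S.bd_of_up (n := d + 1)
    (degree_lt_of_natDegree_le (hP.natDegree_le u) hk) h3 hA0.le, fun i => ?_⟩
  have h6 : Bd A (C a * P (i :: u)) := by
    have h7 := ((h3 i).add (h2 i)).sub ((hP.bd i u).mono hA)
    refine (congrArg (Bd A) ?_).mp h7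
    ring
  have ha0 : a ≠ 0 := by
    rintro rfl
    simp at haA
  have h8 := h6.C_mul (x := a⁻¹)
  rw [← mul_assoc, ← C_mul, inv_mul_cancel₀ ha0, C_1, one_mul, norm_inv,
    ← eq_inv_of_mul_eq_one_right haA, ← sq] at h8
  exact h8

/-- The cone equation gives `a` times the coefficient of degree `k - l` as a sum of two terms, each
of size at most `1 / ‖w‖ ^ l`. For `up (P u)` this holds because the degree is high. For the `down`
sum it is trivial if `l > r`; if `l ≤ r` the coefficient belongs to the top block `g d`, and
`norm_top_coeff_le` applies. -/
lemma norm_coeff_succ_le {d r k : ℕ} (hk : k = d * q + r) (hdr : d + r < q) (hdq : 2 * d ≤ q)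
    {a : E} {A : ℝ} (hA : 1 ≤ A) (haA : ‖a‖ * A = 1) (hAr : A * ‖w‖ ^ r ≤ 1)
    (hA2 : A ^ 2 * ‖w‖ ^ (r + 1) ≤ 1) (hAp : A * ‖(p : E)‖ ≤ 1)
    {P : List I → E[X]} (hP : ConeSolution k w a t P)
    (u : List I) (hQ : ∀ i j, ∀ l ≤ k, ‖w ^ l * (P (j :: i :: u)).coeff (k - l)‖ ≤ A)
    (hQ2 : ∀ i j, Bd (A ^ 2) (P (j :: i :: u)))
    (hS : ∀ i j, Bd A (up (-t j) w (P (i :: u)))) (i : I) :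
    ∀ l ≤ k, ‖w ^ l * (P (i :: u)).coeff (k - l)‖ ≤ A := by
  have hA0 : 0 < A := zero_lt_one.trans_le hA
  have hk1 : k < (d + 1) * q := by rw [hk, add_mul]; omega
  have h2 := S.two_le
  have hW : ∀ i, Bd A (∑ j, down k (t j) w (P (j :: i :: u))) := fun i =>
    Bd.sum hA0.le fun j _ => down_bd hA0.le (S.spread.le_one j) (hQ i j)
  obtain ⟨h1, hV, hR, -⟩ := S.bd_up_step hk1 hdq hA haA hP u hW hS
  set W := ∑ j, down k (t j) w (P (j :: i :: u)) with hWdef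
  have hw0 := S.w_pos
  have hwl := S.w_lt.le
  have hVj : ∀ j, ‖(up (-t i) w (P u)).coeff j‖ ≤ A * ‖w‖ ^ j / ‖w‖ ^ d := fun j => by
    refine (norm_coeff_up_le hR (S.norm_neg_le i) j).trans (le_of_eq ?_)
    ring
  have hQ1 : ∀ j, ∀ l ≤ k, r < l → ‖w ^ l * (P (j :: i :: u)).coeff (k - l)‖ ≤ 1 := by
    intro j l _ hl
    rw [norm_mul, norm_pow]
    have h3 := pow_le_pow_of_le_one hw0.le hwl (show r + 1 ≤ l by omega)
    calc _ ≤ ‖w‖ ^ (r + 1) * A ^ 2 := mul_le_mul h3 (hQ2 i j _) (norm_nonneg _) (by positivity)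
      _ ≤ 1 := by rwa [mul_comm]
  obtain ⟨g, hg, hgb, hgW, -⟩ := S.exists_sum_down_expansion hk (by omega) hA0.le hAp
    (fun j => P (j :: i :: u)) (hQ i) hQ1
  rw [← hWdef] at hgW
  have hup : ∀ j, Bd 1 (up (-t j) w (up (-t i) w (P u) +
      ∑ i ∈ Finset.range (d + 1), X ^ (q * i) * g i)) := by
    intro j
    have h3 := (h1 i j).sub (hgW.up (S.norm_neg_le j) hwl)
    rw [← up_sub] at h3
    refine (congrArg (fun f => Bd 1 (up (-t j) w f)) ?_).mp h3
    rw [← hWdef]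
    ring
  have htop := fun l (hl : l ≤ r) => S.norm_top_coeff_le hdr hA hAr hAp hg hgb hVj hup hl
  have hWtop : ∀ l ≤ k, ‖W.coeff (k - l)‖ ≤ 1 / ‖w‖ ^ l := by
    intro l hlk
    have hl1 : 1 ≤ 1 / ‖w‖ ^ l := by
      rw [one_le_div (pow_pos hw0 l)]
      exact S.w_pow_le_one l
    rcases Nat.lt_or_ge r l with hl | hl
    · refine (hW i _).trans ?_
      rw [le_div_iff₀ (pow_pos hw0 l)]
      refine le_trans ?_ hAr
      have := pow_le_pow_of_le_one hw0.le hwl hl.le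
      gcongr
    · have h3 := hgW (k - l)
      rw [coeff_sub, show k - l = q * d + (r - l) by rw [hk, mul_comm]; omega,
        coeff_sum_X_pow_mul (fun i => lt_of_le_of_lt (hg i) (by omega)) _ _ (by omega),
        if_pos (Nat.lt_succ_self d)] at h3
      have h4 := norm_add_le_of_le (h3.trans hl1) (htop l hl)
      rwa [sub_add_cancel, ← show k - l = q * d + (r - l) by rw [hk, mul_comm]; omega] at h4
  intro l hl
  have hl1 : 1 ≤ 1 / ‖w‖ ^ l := by
    rw [one_le_div (pow_pos hw0 l)]
    exact S.w_pow_le_one l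
  have hVtop : ‖(up (-t i) w (P u)).coeff (k - l)‖ ≤ 1 / ‖w‖ ^ l := by
    refine (hVj _).trans ?_
    rw [div_le_div_iff₀ (pow_pos hw0 d) (pow_pos hw0 l), one_mul, mul_assoc, ← pow_add]
    have hdd : d * 1 ≤ d * q := Nat.mul_le_mul_left _ (by omega)
    calc A * ‖w‖ ^ (k - l + l) ≤ A * ‖w‖ ^ (r + d) := by
          have := pow_le_pow_of_le_one hw0.le hwl (show r + d ≤ k - l + l by omega)
          gcongr
      _ = (A * ‖w‖ ^ r) * ‖w‖ ^ d := by rw [pow_add]; ring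
      _ ≤ ‖w‖ ^ d := mul_le_of_le_one_left (by positivity) hAr
  have h5 := (hP.bd i u (k - l)).trans hl1
  rw [← hWdef, coeff_add, coeff_sub, coeff_C_mul] at h5
  have h6 := norm_sub_le_of_le (norm_add_le_of_le hVtop (hWtop l hl)) h5
  have h7 : (up (-t i) w (P u)).coeff (k - l) + W.coeff (k - l) -
    ((up (-t i) w (P u)).coeff (k - l) - a * (P (i :: u)).coeff (k - l) + W.coeff (k - l)) =
      a * (P (i :: u)).coeff (k - l) := by ring
  rw [h7, norm_mul, le_div_iff₀ (pow_pos hw0 l)] at h6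
  rw [norm_mul, norm_pow]
  have h8 : A * (‖a‖ * ‖(P (i :: u)).coeff (k - l)‖ * ‖w‖ ^ l) ≤ A * 1 := by gcongr
  calc _ = (‖a‖ * A) * (‖w‖ ^ l * ‖(P (i :: u)).coeff (k - l)‖) := by rw [haA, one_mul]
    _ = A * (‖a‖ * ‖(P (i :: u)).coeff (k - l)‖ * ‖w‖ ^ l) := by ring
    _ ≤ A := by rwa [mul_one] at h8

/-- Three bounds are carried along: `A ^ 2` for all coefficients, `A` for the coefficients weighted
as in `down`, and `A` after one substitution `up`. -/
lemma bd_of_generic {d r k : ℕ} (hk : k = d * q + r) (hdr : d + r < q) (hdq : 2 * d ≤ q)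
    {a : E} {A : ℝ} (hA : 1 ≤ A) (haA : ‖a‖ * A = 1) (hAr : A * ‖w‖ ^ r ≤ 1)
    (hA2 : A ^ 2 * ‖w‖ ^ (r + 1) ≤ 1) (hAp : A * ‖(p : E)‖ ≤ 1)
    {P : List I → E[X]} (hP : ConeSolution k w a t P) (u : List I) :
    Bd (A / ‖w‖ ^ d) (P u) := by
  have hk1 : k < (d + 1) * q := by rw [hk, add_mul]; omega
  have hA0 : 0 < A := zero_lt_one.trans_le hA
  -- The first two bounds start one level farther out, because the equation that yields them for `P
  -- (i :: u)` is the one along the edge from `u` to `i :: u`.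
  have key := hP.induction (Q := fun m => (∀ u, m + 1 ≤ u.length → Bd (A ^ 2) (P u) ∧
    ∀ l ≤ k, ‖w ^ l * (P u).coeff (k - l)‖ ≤ A) ∧
    ∀ u, m ≤ u.length → ∀ i, Bd A (up (-t i) w (P u))) 0 ?_ ?_
  · exact S.bd_of_up (n := d + 1) (degree_lt_of_natDegree_le (hP.natDegree_le u) hk1)
      (key.2 u (Nat.zero_le _)) hA0.le
  · intro m hm
    refine ⟨fun u hu => ?_, fun u hu i => ?_⟩
    · rw [hm u (by omega)]
      exact ⟨Bd.zero (by positivity), fun l _ => by simpa using hA0.le⟩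
    · rw [hm u hu]
      simpa [up] using Bd.zero hA0.le
  · rintro m - ⟨h1, h2⟩
    have hQ : ∀ u : List I, m ≤ u.length →
        ∀ i j, ∀ l ≤ k, ‖w ^ l * (P (j :: i :: u)).coeff (k - l)‖ ≤ A :=
      fun u hu i j => (h1 _ (by simp; omega)).2
    have hW : ∀ u : List I, m ≤ u.length →
        ∀ i, Bd A (∑ j, down k (t j) w (P (j :: i :: u))) := fun u hu i =>
      Bd.sum hA0.le fun j _ => down_bd hA0.le (S.spread.le_one j) (hQ u hu i j)
    have hS : ∀ u : List I, m ≤ u.length → ∀ i j, Bd A (up (-t j) w (P (i :: u))) :=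
      fun u hu i j => h2 _ (by simp; omega) j
    refine ⟨fun u hu => ?_, fun u hu =>
      (S.bd_up_step hk1 hdq hA haA hP u (hW u hu) (hS u hu)).2.1⟩
    cases u with
    | nil => simp at hu
    | cons i u =>
      have hu' : m ≤ u.length := by simpa using hu
      exact ⟨(S.bd_up_step hk1 hdq hA haA hP u (hW u hu') (hS u hu')).2.2.2 i,
        S.norm_coeff_succ_le hk hdr hdq hA haA hAr hA2 hAp hP u (hQ u hu')
          (fun i j => (h1 _ (by simp; omega)).1) (hS u hu') i⟩

end ResidueSystem

end generic2

end BreuilSchneider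

end

/-! ### Tools for `k = d q`: division, power sums and the polynomial `X ^ q - X`. -/

noncomputable section

namespace BreuilSchneider

section divisible

open Polynomial

variable {E : Type*} [NormedField E] [IsUltrametricDist E] {I : Type*} [Fintype I]

/-- Long division by an integral monic polynomial only subtracts integral multiples of coefficients
already present. -/
lemma bd_divModByMonic {c : ℝ} {f g : E[X]} (hc : 0 ≤ c) (hf : Bd c f) (hg : Bd 1 g)
    (hm : g.Monic) : Bd c (f %ₘ g) ∧ Bd c (f /ₘ g) := by
  induction hn : f.natDegree using Nat.strong_induction_on generalizing f with
  | _ n ih =>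
    by_cases hlt : f.degree < g.degree
    · rw [(modByMonic_eq_self_iff hm).2 hlt, (divByMonic_eq_zero_iff hm).2 hlt]
      exact ⟨hf, Bd.zero hc⟩
    · by_cases hn0 : f.natDegree = 0
      · have hg1 : g = 1 := by
          refine hm.natDegree_eq_zero.1 ?_
          have := natDegree_le_natDegree (not_lt.1 hlt)
          omega
        rw [hg1, modByMonic_one, divByMonic_one]
        exact ⟨Bd.zero hc, hf⟩
      · set h : E[X] := C f.leadingCoeff * X ^ (f.natDegree - g.natDegree) with hh
        have hhb : Bd c h := (Bd.const (hf _)).mul_one_right (Bd.X.pow_one _)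
        have hf0 : f ≠ 0 := by rintro rfl; simp at hn0
        have hlt' : (f - g * h).degree < f.degree := div_wf_lemma ⟨not_lt.1 hlt, hf0⟩ hm
        have hfb : Bd c (f - g * h) := hf.sub (hg.one_mul_left hhb)
        have hdeg : (f - g * h).natDegree < n := by
          by_cases h0 : f - g * h = 0
          · rw [h0, natDegree_zero]; omega
          · rw [← hn]
            exact natDegree_lt_natDegree h0 hlt'
        obtain ⟨h1, h2⟩ := ih _ hdeg hfb rfl
        have e : f = (f - g * h) + g * h := by ring
        have e1 : f %ₘ g = (f - g * h) %ₘ g := by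
          conv_lhs => rw [e]
          rw [add_modByMonic, mul_comm, mul_self_modByMonic, add_zero]
          exact hm
        refine ⟨e1 ▸ h1, ?_⟩
        have e2 : f /ₘ g = (f - g * h) /ₘ g + h := by
          have h3 := modByMonic_add_div f g
          have h4 := modByMonic_add_div (f - g * h) g
          apply mul_left_cancel₀ hm.ne_zero
          rw [e1] at h3
          linear_combination h3 - h4
        rw [e2]
        exact h2.add hhb

namespace ResidueSystem

variable {p q : ℕ} {w : E} {t : I → E} (S : ResidueSystem p q w t)

include S

/-- The `t i` are all the roots of `X ^ q - X`, so multiplication by a nonzero `t g` permutes them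
and multiplies the sum by `t g ^ n`. As `n < q - 1`, some `t g ^ n` differs from one. -/
lemma sum_pow_eq_zero {n : ℕ} (hn0 : 0 < n) (hn : n < q - 1) : ∑ i, t i ^ n = 0 := by
  classical
  have hq := S.two_le
  set s := Finset.univ.image t with hs
  have hcard : s.card = q := by
    rw [hs, Finset.card_image_of_injective _ S.spread.injective, Finset.card_univ, S.card]
  obtain ⟨g, hg0, hg1⟩ : ∃ g, t g ≠ 0 ∧ t g ^ n ≠ 1 := by
    by_contra! h
    have hsub : s.erase 0 ⊆ (nthRoots n (1 : E)).toFinset := by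
      intro x hx
      rw [Finset.mem_erase, hs, Finset.mem_image] at hx
      obtain ⟨hx0, i, -, rfl⟩ := hx
      rw [Multiset.mem_toFinset, mem_nthRoots hn0]
      exact h i hx0
    have h1 := Finset.card_le_card hsub
    have h2 := (Multiset.toFinset_card_le (nthRoots n (1 : E))).trans (card_nthRoots n 1)
    have h3 := Finset.pred_card_le_card_erase (s := s) (a := 0)
    omega
  set R := (X ^ q - X : E[X]).roots.toFinset with hR
  have hne : (X ^ q - X : E[X]) ≠ 0 := FiniteField.X_pow_card_sub_X_ne_zero E (by omega)
  have hRcard : R.card ≤ q := by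
    refine (Multiset.toFinset_card_le _).trans ((card_roots' _).trans ?_)
    rw [FiniteField.X_pow_card_sub_X_natDegree_eq E (by omega)]
  have hmem : ∀ x : E, x ^ q = x → x ∈ R := by
    intro x hx
    rw [hR, Multiset.mem_toFinset, mem_roots hne]
    simp [hx]
  have hsR : s = R := Finset.eq_of_subset_of_card_le (by
    intro x hx
    rw [hs, Finset.mem_image] at hx
    obtain ⟨i, -, rfl⟩ := hx
    exact hmem _ (S.pow_eq i)) (by omega)
  have hinj : Function.Injective (fun x : E => t g * x) := mul_right_injective₀ hg0
  have hsg : s.image (fun x => t g * x) = s := by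
    apply Finset.eq_of_subset_of_card_le
    · intro x hx
      rw [Finset.mem_image] at hx
      obtain ⟨y, hy, rfl⟩ := hx
      rw [hs, Finset.mem_image] at hy
      obtain ⟨i, -, rfl⟩ := hy
      rw [hsR]
      exact hmem _ (by rw [mul_pow, S.pow_eq, S.pow_eq])
    · rw [Finset.card_image_of_injective _ hinj]
  have h1 : ∑ x ∈ s, x ^ n = t g ^ n * ∑ x ∈ s, x ^ n := by
    conv_lhs => rw [← hsg]
    rw [Finset.sum_image hinj.injOn, Finset.mul_sum]
    simp [mul_pow]
  have h2 : ∑ x ∈ s, x ^ n = 0 := by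
    have h3 : (1 - t g ^ n) * ∑ x ∈ s, x ^ n = 0 := by linear_combination h1
    exact (mul_eq_zero.1 h3).resolve_left (sub_ne_zero.2 (Ne.symm hg1))
  rwa [hs, Finset.sum_image S.spread.injective.injOn] at h2

lemma norm_q_le : ‖(q : E)‖ ≤ ‖w‖ := by
  obtain ⟨f, hf, rfl⟩ := S.prime_pow
  obtain ⟨m, rfl⟩ : ∃ m, f = m + 1 := ⟨f - 1, by omega⟩
  rw [pow_succ, Nat.cast_mul]
  exact (norm_natCast_mul_le _ _).trans S.p_le

/-- Modulo `p` the sum is `∑ j, (X ^ q + t j) ^ d`. Its expansion involves only the power sums of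
the `t j`, which vanish except for the zeroth, equal to `q`. -/
lemma bd_sum_pow {d k : ℕ} (hk : k = d * q) (hdq : d < q - 1) :
    Bd ‖w‖ (∑ j, (X + C (t j)) ^ k) := by
  have h1 : ∑ j, (X + C (t j)) ^ k = ∑ j, ((X + C (t j)) ^ k - (X ^ q + C (t j)) ^ d) +
      ∑ i ∈ Finset.range (d + 1), (X ^ q) ^ i * (C (∑ j, t j ^ (d - i)) * ((d.choose i : ℕ) : E[X])) := by
    simp only [Finset.sum_sub_distrib, add_pow (X ^ q) (C (t _)) d]
    rw [Finset.sum_comm (s := Finset.univ) (t := Finset.range (d + 1))]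
    simp only [map_sum, map_pow, Finset.sum_mul, Finset.mul_sum, mul_assoc]
    ring
  rw [h1]
  refine Bd.add (Bd.sum (norm_nonneg _) fun j _ => ?_) (Bd.sum (norm_nonneg _) fun i hi => ?_)
  · have h2 := S.pow_mul_sub_bd j d 0
    rw [add_zero, pow_zero, mul_one, ← hk] at h2
    exact h2.mono S.p_le
  · refine ((Bd.X.pow_one q).pow_one i).one_mul_left (Bd.mul_one_right (Bd.const ?_) ?_)
    · rcases Nat.eq_zero_or_pos (d - i) with h0 | h0
      · rw [h0]
        simpa [S.card] using S.norm_q_le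
      · rw [S.sum_pow_eq_zero h0 (by omega), norm_zero]
        exact norm_nonneg _
    · rw [← C_eq_natCast]
      exact Bd.const (IsUltrametricDist.norm_natCast_le_one E _)

/-- Comparison of the top coefficient of a polynomial of degree `d q` with its Hasse derivatives
of order `d` at the points `-t i`. -/
lemma norm_coeff_up_sub_le {d k : ℕ} (hk : k = d * q) (hd : 1 ≤ d) {A : ℝ} (hA : 1 ≤ A)
    (hAw : A * ‖w‖ ≤ 1) {R : E[X]} (hR : R.natDegree ≤ k) (hRb : Bd (A / ‖w‖ ^ d) R)
    (hV : ∀ i, Bd A (up (-t i) w R)) (i : I) :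
    ‖(up (-t i) w R).coeff d - (-w) ^ d * R.coeff k‖ ≤ 1 := by
  have hq := S.two_le
  have hA0 : 0 < A := zero_lt_one.trans_le hA
  have hw0 := S.w_pos
  have hwl := S.w_lt.le
  set θ := R.coeff k with hθ
  have hθb : ‖θ‖ ≤ A / ‖w‖ ^ d := hRb k
  have hθw : ‖θ‖ * ‖w‖ ^ d ≤ A := by
    rwa [le_div_iff₀ (pow_pos hw0 d)] at hθb
  -- Removing the leading term brings the degree below `d q`, so that interpolation for `g` costs
  -- only `w ^ (d - 1)`.
  set g := R - C θ * (X ^ q - X) ^ d with hg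
  have hmon : (X ^ q - X : E[X]).Monic := monic_X_pow_sub (by rw [degree_X]; exact_mod_cast hq)
  have hnat : (X ^ q - X : E[X]).natDegree = q :=
    FiniteField.X_pow_card_sub_X_natDegree_eq E (by omega)
  have hmond : ((X ^ q - X : E[X]) ^ d).Monic := hmon.pow d
  have hnatd : ((X ^ q - X : E[X]) ^ d).natDegree = k := by
    rw [hmon.natDegree_pow, hnat, hk]
  have hgdeg : g.degree < (d * q : ℕ) := by
    rw [degree_lt_iff_coeff_zero]
    intro m hm
    rw [← hk] at hm
    rw [hg, coeff_sub, coeff_C_mul]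
    rcases hm.eq_or_lt with rfl | hlt
    · have : ((X ^ q - X : E[X]) ^ d).coeff k = 1 := by
        rw [← hnatd]; exact hmond
      rw [this, mul_one, sub_self]
    · rw [coeff_eq_zero_of_natDegree_lt (lt_of_le_of_lt hR hlt),
        coeff_eq_zero_of_natDegree_lt (hnatd.le.trans_lt hlt), mul_zero, sub_zero]
  -- After `z ↦ w z - t i`, the polynomial `X ^ q - X` is `w` times a polynomial congruent to `-(X -
  -- x)` modulo `w`. The point `x` is integral because `(-t i) ^ q + t i` is divisible by `p`.
  have hY : ∀ i, ∃ Z : E[X], up (-t i) w (X ^ q - X) = C w * Z ∧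
      ∃ x : E, ‖x‖ ≤ 1 ∧ Bd ‖w‖ (Z - -(X - C x)) := by
    intro i
    refine ⟨C w⁻¹ * up (-t i) w (X ^ q - X), ?_, ((-t i) ^ q + t i) / w, ?_, ?_⟩
    · rw [← mul_assoc, ← C_mul, mul_inv_cancel₀ S.w_ne, C_1, one_mul]
    · rw [norm_div]
      exact div_le_one_of_le₀ ((S.norm_neg_pow_add_le i).trans S.p_le) hw0.le
    · intro j
      have hX : Bd 1 (X ^ q : E[X]) := Bd.X.pow_one q
      have hwi : ‖w⁻¹‖ * ‖w‖ = 1 := by rw [norm_inv, inv_mul_cancel₀ hw0.ne']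
      rcases j with _ | _ | j
      · have : (C w⁻¹ * up (-t i) w (X ^ q - X) - -(X - C (((-t i) ^ q + t i) / w))).coeff 0 = 0 := by
          simp only [coeff_sub, coeff_neg, coeff_C_mul, coeff_zero_up, coeff_X_zero, coeff_C_zero,
            eval_sub, eval_pow, eval_X]
          field_simp [S.w_ne]
          ring
        rw [this, norm_zero]
        exact norm_nonneg _
      · have : (C w⁻¹ * up (-t i) w (X ^ q - X) - -(X - C (((-t i) ^ q + t i) / w))).coeff 1 =
            (q : E) * (-t i) ^ (q - 1) := by
          have h1 : (C ((-t i) ^ q + t i) / C w : E[X]).coeff 1 = 0 := by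
            rw [← C_div, coeff_C_of_ne_zero one_ne_zero]
          simp only [coeff_sub, coeff_neg, coeff_C_mul, coeff_up, coeff_X_one,
            coeff_C_of_ne_zero one_ne_zero, map_sub, taylor_coeff_one, derivative_sub,
            derivative_X_pow, derivative_X, eval_sub, eval_mul, eval_pow, eval_X, eval_natCast,
            eval_one]
          field_simp [S.w_ne]
          simp [mul_comm]
        rw [this, norm_mul]
        exact (mul_le_of_le_one_right (norm_nonneg _)
          (norm_pow_le_one (S.norm_neg_le i) _)).trans S.norm_q_le
      · have h1 : (X - C (((-t i) ^ q + t i) / w)).coeff (j + 2) = 0 := by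
          rw [coeff_sub, coeff_X, if_neg (by omega), coeff_C_of_ne_zero (by omega), sub_zero]
        rw [coeff_sub, coeff_neg, h1, neg_zero, sub_zero, coeff_C_mul, norm_mul]
        have h2 := norm_coeff_up_le (w := w) (hX.sub Bd.X) (S.norm_neg_le i) (j + 2)
        calc ‖w⁻¹‖ * _ ≤ ‖w⁻¹‖ * (1 * ‖w‖ ^ (j + 2)) := by gcongr
          _ = (‖w⁻¹‖ * ‖w‖) * (‖w‖ * ‖w‖ ^ j) := by ring
          _ ≤ ‖w‖ := by
            rw [hwi, one_mul]
            exact mul_le_of_le_one_right hw0.le (S.w_pow_le_one j)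
  have hgup : ∀ j, Bd A (up (-t j) w g) := by
    intro j
    obtain ⟨Z, hZ, x, hx, hZx⟩ := hY j
    have hZ1 : Bd 1 Z := Bd.of_sub (by rw [neg_sub]; exact (Bd.const hx).sub Bd.X)
      (hZx.mono hwl)
    rw [hg, up_sub, up_C_mul, up_pow, hZ, mul_pow, ← mul_assoc, ← C_pow, ← C_mul]
    refine (hV j).sub (Bd.mul_one_right (Bd.const ?_) (hZ1.pow_one d))
    rwa [norm_mul, norm_pow]
  obtain ⟨Z, hZ, x, hx, hZx⟩ := hY i
  have hXx : Bd 1 (-(X - C x)) := by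
    rw [neg_sub]
    exact (Bd.const hx).sub Bd.X
  have hZ1 : Bd 1 Z := hXx.of_sub (hZx.mono hwl)
  have hZd : ‖(Z ^ d).coeff d - (-1) ^ d‖ ≤ ‖w‖ := by
    have h1 := Bd.pow_sub_pow hZ1 hXx hZx d d
    have h2 : ((-(X - C x) : E[X]) ^ d).coeff d = (-1) ^ d := by
      have h3 : ((X - C x : E[X]) ^ d).coeff d = 1 := by
        have := ((monic_X_sub_C x).pow d).coeff_natDegree
        rwa [(monic_X_sub_C x).natDegree_pow, natDegree_X_sub_C, mul_one] at this
      rw [neg_pow, ← C_1, ← C_neg, ← C_pow, coeff_C_mul, h3, mul_one]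
    rwa [coeff_sub, h2] at h1
  have hupΦ : up (-t i) w ((X ^ q - X) ^ d) = C (w ^ d) * Z ^ d := by
    rw [up_pow, hZ, mul_pow, C_pow]
  have hgb := S.bd_of_up hgdeg hgup hA0.le
  -- The coefficient of degree `d` gains `w ^ d` against a loss of `w ^ (d - 1)`; the factor left
  -- over is at most `A * ‖w‖ ≤ 1`.
  have h1 : ‖(up (-t i) w g).coeff d‖ ≤ 1 := by
    refine (norm_coeff_up_le hgb (S.norm_neg_le i) d).trans (le_trans (le_of_eq ?_) hAw)
    obtain ⟨m, rfl⟩ : ∃ m, d = m + 1 := ⟨d - 1, by omega⟩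
    rw [Nat.add_sub_cancel, pow_succ]
    field_simp
  have h2 : (up (-t i) w R).coeff d - (-w) ^ d * θ =
      (up (-t i) w g).coeff d + θ * w ^ d * ((Z ^ d).coeff d - (-1) ^ d) := by
    rw [hg, up_sub, up_C_mul, hupΦ, coeff_sub, coeff_C_mul, coeff_C_mul, neg_pow]
    ring
  rw [h2]
  refine norm_add_le_of_le h1 ?_
  rw [norm_mul, norm_mul, norm_pow]
  exact (mul_le_mul hθw hZd (norm_nonneg _) hA0.le).trans hAw

end ResidueSystem

end divisible

end BreuilSchneider

end

/-! ### The cone equations for `k = d q`, `q > 2`. -/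

noncomputable section

namespace BreuilSchneider

section divisibleCone

open Polynomial

variable {E : Type*} [NormedField E] [IsUltrametricDist E] {I : Type*} [Fintype I]

lemma down_sub_top_bd {k : ℕ} {s w : E} {f : E[X]} (hs : ‖s‖ ≤ 1)
    (hf : ∀ l ≤ k, 0 < l → ‖w ^ l * f.coeff (k - l)‖ ≤ 1) :
    Bd 1 (down k s w f - C (f.coeff k) * (X + C s) ^ k) := by
  have h : down k s w f - C (f.coeff k) * (X + C s) ^ k =
      ∑ l ∈ Finset.range k, C (w ^ (l + 1) * f.coeff (k - (l + 1))) * (X + C s) ^ (k - (l + 1)) := by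
    rw [down, Finset.sum_range_succ']
    simp
  rw [h]
  refine Bd.sum zero_le_one fun l hl => ?_
  rw [Finset.mem_range] at hl
  exact (Bd.const (hf (l + 1) hl (Nat.succ_pos _))).mul_one_right ((Bd.X_add_C hs).pow_one _)

namespace ResidueSystem

variable {p q : ℕ} {w : E} {t : I → E} (S : ResidueSystem p q w t)

include S

/-- Only the top coefficients matter. Their common part `c` is allowed to be large, so it keeps the
exact sum of powers, which `bd_sum_pow` shows to be divisible by `w`; the deviations from `c` are at
most `A`, and there the powers may be replaced modulo `p`. -/
lemma sum_down_sub_bd {d k : ℕ} (hk : k = d * q) {A : ℝ} (hA : 0 ≤ A)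
    (hAp : A * ‖(p : E)‖ ≤ 1) {Q : I → E[X]} {c : E} (hc : ∀ j, ‖(Q j).coeff k - c‖ ≤ A)
    (hl : ∀ j, ∀ l ≤ k, 0 < l → ‖w ^ l * (Q j).coeff (k - l)‖ ≤ 1) :
    Bd 1 (∑ j, down k (t j) w (Q j) - (C c * ∑ j, (X + C (t j)) ^ k +
      ∑ j, C ((Q j).coeff k - c) * (X ^ q + C (t j)) ^ d)) := by
  have h : ∑ j, down k (t j) w (Q j) - (C c * ∑ j, (X + C (t j)) ^ k +
      ∑ j, C ((Q j).coeff k - c) * (X ^ q + C (t j)) ^ d) =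
      ∑ j, ((down k (t j) w (Q j) - C ((Q j).coeff k) * (X + C (t j)) ^ k) +
        C ((Q j).coeff k - c) * ((X + C (t j)) ^ k - (X ^ q + C (t j)) ^ d)) := by
    rw [Finset.mul_sum, ← Finset.sum_add_distrib, ← Finset.sum_sub_distrib]
    refine Finset.sum_congr rfl fun j _ => ?_
    rw [C_sub]
    ring
  rw [h]
  refine Bd.sum zero_le_one fun j _ => (down_sub_top_bd (S.spread.le_one j) (hl j)).add ?_
  have h2 := S.pow_mul_sub_bd j d 0
  rw [add_zero, pow_zero, mul_one, ← hk] at h2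
  exact ((Bd.const (hc j)).mul h2).mono hAp

/-- The modulus `X ^ q - X` takes values divisible by `p` at the points `-t i`. -/
lemma eval_modByMonic_sub_le {f : E[X]} {c : ℝ} (hc : 0 ≤ c) (hf : Bd c f) (i : I) :
    ‖(f %ₘ (X ^ q - X)).eval (-t i) - f.eval (-t i)‖ ≤ c * ‖w‖ := by
  have hmon : (X ^ q - X : E[X]).Monic :=
    monic_X_pow_sub (by rw [degree_X]; exact_mod_cast S.two_le)
  have hb : Bd 1 (X ^ q - X : E[X]) := (Bd.X.pow_one q).sub Bd.X
  have h1 := congrArg (eval (-t i)) (modByMonic_add_div f (X ^ q - X))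
  rw [eval_add, eval_mul] at h1
  have h2 : (f %ₘ (X ^ q - X)).eval (-t i) - f.eval (-t i) =
      - (((-t i) ^ q + t i) * (f /ₘ (X ^ q - X)).eval (-t i)) := by
    simp only [eval_sub, eval_pow, eval_X] at h1
    linear_combination h1
  rw [h2, norm_neg, norm_mul, mul_comm]
  exact mul_le_mul ((bd_divModByMonic hc hf hb hmon).2.eval (S.norm_neg_le i))
    ((S.norm_neg_pow_add_le i).trans S.p_le) (norm_nonneg _) hc

/-- One step towards the root of the tree when `k = d q` and `q ≠ 2`. -/
lemma exists_step_divisible {d k : ℕ} (hk : k = d * q) (hd : 1 ≤ d) (hdq : 2 * d ≤ q)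
    (hq2 : 2 < q) {a : E} {A : ℝ} (hA : 1 ≤ A) (haA : ‖a‖ * A = 1) (hAw : A * ‖w‖ ≤ 1)
    (hA2 : A ^ 2 * ‖w‖ ^ (d + 1) < 1) {κ : E} (hκ : ‖κ‖ ≤ ‖w‖ ^ d * A) :
    ∃ κ' : E, ‖κ'‖ ≤ ‖w‖ ^ d * A ∧ ∀ {P : List I → E[X]} (_ : ConeSolution k w a t P)
      (u : List I), (∀ i j, Bd (A ^ 2) (P (j :: i :: u))) →
      (∀ i j, ‖(P (j :: i :: u)).coeff (k - 1)‖ ≤ A) →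
      (∀ i j, Bd A (up (-t j) w (P (i :: u)))) →
      (∀ i j, ‖(P (j :: i :: u)).coeff k - κ * (P (i :: u)).coeff k‖ ≤ A) →
      (∀ i, Bd A (up (-t i) w (P u))) ∧ Bd (A / ‖w‖ ^ d) (P u) ∧ (∀ i, Bd (A ^ 2) (P (i :: u))) ∧
      (∀ i, ‖(P (i :: u)).coeff (k - 1)‖ ≤ A) ∧
      ∀ i, ‖(P (i :: u)).coeff k - κ' * (P u).coeff k‖ ≤ A := by
  have hA0 : 0 < A := zero_lt_one.trans_le hA
  have hw0 := S.w_pos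
  have hwl := S.w_lt.le
  have ha0 : 0 < ‖a‖ := pos_of_mul_pos_left (haA ▸ zero_lt_one) hA0.le
  have hAinv : A = 1 / ‖a‖ := by field_simp; linarith
  have hAp : A * ‖(p : E)‖ ≤ 1 := (mul_le_mul_of_nonneg_left S.p_le hA0.le).trans hAw
  set F : E[X] := ∑ j, (X + C (t j)) ^ k with hF
  set Φ : E[X] := X ^ q - X with hΦ
  have hmon : Φ.Monic := monic_X_pow_sub (by rw [degree_X]; exact_mod_cast S.two_le)
  have hΦb : Bd 1 Φ := (Bd.X.pow_one q).sub Bd.X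
  have hΦdeg : Φ.degree = q := by
    rw [hΦ, degree_eq_natDegree hmon.ne_zero, FiniteField.X_pow_card_sub_X_natDegree_eq E (by omega)]
  have hFb : Bd ‖w‖ F := S.bd_sum_pow hk (by omega)
  set B := (F %ₘ Φ).coeff d with hB
  have hBb : ‖B‖ ≤ ‖w‖ := (bd_divModByMonic hw0.le hFb hΦb hmon).1 d
  -- Both `q` and `B` are divisible by `w`, so this correction is strictly smaller than `a` by
  -- `hA2`, and the denominator of the new factor has the norm of `a`.
  have hqB : ‖κ * (q - B)‖ < ‖a‖ := by
    rw [norm_mul]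
    have h1 : ‖(q : E) - B‖ ≤ ‖w‖ := norm_sub_le_of_le S.norm_q_le hBb
    calc ‖κ‖ * ‖(q : E) - B‖ ≤ (‖w‖ ^ d * A) * ‖w‖ := by gcongr
      _ = (A ^ 2 * ‖w‖ ^ (d + 1)) * ‖a‖ := by
        rw [pow_succ ‖w‖]
        linear_combination (-‖w‖ ^ d * ‖w‖ * A) * haA
      _ < ‖a‖ := mul_lt_of_lt_one_left ha0 hA2
  have hden : ‖a - κ * (q - B)‖ = ‖a‖ := by
    rw [sub_eq_add_neg, IsUltrametricDist.norm_add_eq_max_of_norm_ne_norm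
      (by rw [norm_neg]; exact hqB.ne'), norm_neg, max_eq_left hqB.le]
  have hden0 : a - κ * (q - B) ≠ 0 := norm_pos_iff.1 (hden ▸ ha0)
  -- The factor comes from eliminating the sum of the deviations of the top coefficients. That sum
  -- occurs in the coefficient of degree `k` of the cone equation, together with `κ q`, and in the
  -- coefficient of degree `d` of the polynomial `D` below, together with `κ B` and `(-w) ^ d` times
  -- the top coefficient of `P u`.
  refine ⟨-(-w) ^ d / (a - κ * (q - B)), ?_, ?_⟩
  · rw [norm_div, norm_neg, norm_pow, norm_neg, hden, hAinv, mul_one_div]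
  intro P hP u hQ2 hQ1 hS hκQ
  have hkd : d + 1 ≤ k := by
    rw [hk]; nlinarith
  have hk1 : d + 1 ≤ k - 1 := by
    have : d * 3 ≤ k := by rw [hk]; exact Nat.mul_le_mul_left d hq2
    omega
  have hSb : ∀ i, Bd (A / ‖w‖ ^ d) (P (i :: u)) := fun i => by
    have := S.bd_of_up (n := d + 1) (degree_lt_of_natDegree_le (hP.natDegree_le (i :: u))
      (by rw [hk]; nlinarith)) (hS i) hA0.le
    simpa using this
  have hc : ∀ i, ‖κ * (P (i :: u)).coeff k‖ ≤ A ^ 2 := fun i => by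
    rw [norm_mul]
    calc _ ≤ (‖w‖ ^ d * A) * (A / ‖w‖ ^ d) := by gcongr; exact hSb i k
      _ = A ^ 2 := by field_simp
  have hl : ∀ i j, ∀ l ≤ k, 0 < l → ‖w ^ l * (P (j :: i :: u)).coeff (k - l)‖ ≤ 1 := by
    intro i j l hlk hl0
    rw [norm_mul, norm_pow]
    obtain rfl | ⟨m, rfl⟩ : l = 1 ∨ ∃ m, l = m + 2 := by
      rcases l with _ | _ | l
      · omega
      · exact Or.inl rfl
      · exact Or.inr ⟨l, rfl⟩
    · rw [pow_one, mul_comm]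
      exact (mul_le_mul_of_nonneg_right (hQ1 i j) hw0.le).trans hAw
    · calc ‖w‖ ^ (m + 2) * _ ≤ ‖w‖ ^ (m + 2) * A ^ 2 := by gcongr; exact hQ2 i j _
        _ = ‖w‖ ^ m * (A * ‖w‖) ^ 2 := by ring
        _ ≤ 1 * 1 := by
          gcongr
          · exact S.w_pow_le_one m
          · exact pow_le_one₀ (by positivity) hAw
        _ = 1 := one_mul 1
  have hW := fun i => S.sum_down_sub_bd hk hA0.le hAp (hκQ i) (hl i)
  have hdF : ∀ i, Bd A (C (κ * (P (i :: u)).coeff k) * F) := fun i => by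
    refine ((Bd.const (hc i)).mul hFb).mono ?_
    calc A ^ 2 * ‖w‖ = A * (A * ‖w‖) := by ring
      _ ≤ A := mul_le_of_le_one_right hA0.le hAw
  have hXt : ∀ j, Bd 1 ((X ^ q + C (t j) : E[X]) ^ d) := fun j =>
    ((Bd.X.pow_one q).add (Bd.const (S.spread.le_one j))).pow_one d
  have hWA : ∀ i, Bd A (∑ j, down k (t j) w (P (j :: i :: u))) := fun i =>
    Bd.of_sub ((hdF i).add (Bd.sum hA0.le fun j _ =>
      (Bd.const (hκQ i j)).mul_one_right (hXt j))) ((hW i).mono hA)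
  obtain ⟨h1, h2, h3, h4⟩ := S.bd_up_step (by rw [hk]; nlinarith [S.two_le]) hdq hA haA hP u hWA hS
  have hVj : ∀ i j, d + 1 ≤ j → ‖(up (-t i) w (P u)).coeff j‖ ≤ 1 := by
    intro i j hj
    refine (norm_coeff_up_le h3 (S.norm_neg_le i) j).trans ?_
    obtain ⟨m, rfl⟩ : ∃ m, j = d + 1 + m := ⟨j - (d + 1), by omega⟩
    calc A / ‖w‖ ^ d * ‖w‖ ^ (d + 1 + m) = (A * ‖w‖) * ‖w‖ ^ m := by
          rw [pow_add, pow_add]; field_simp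
      _ ≤ 1 * 1 := by gcongr; exact S.w_pow_le_one m
      _ = 1 := one_mul 1
  have hVd := S.norm_coeff_up_sub_le hk hd hA hAw (hP.natDegree_le u) h3 h2
  have hcoeff : ∀ i n, ‖(up (-t i) w (P u)).coeff n - a * (P (i :: u)).coeff n +
      (κ * (P (i :: u)).coeff k * F.coeff n +
        ∑ j, ((P (j :: i :: u)).coeff k - κ * (P (i :: u)).coeff k) *
          ((X ^ q + C (t j) : E[X]) ^ d).coeff n)‖ ≤ 1 := by
    intro i n
    have := (hP.bd i u).sub (hW i) n
    rw [add_sub_assoc, sub_sub_cancel] at this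
    rw [coeff_add, coeff_sub, coeff_add, coeff_C_mul, coeff_C_mul, finsetSum_coeff _ fun j =>
      C ((P (j :: i :: u)).coeff k - κ * (P (i :: u)).coeff k) * (X ^ q + C (t j)) ^ d] at this
    simpa only [coeff_C_mul] using this
  have hpow : ∀ x : E, (X ^ q + C x : E[X]) ^ d = expand E q ((X + C x) ^ d) := fun x => by
    simp
  have hmonx : ∀ x : E, ((X + C x : E[X]) ^ d).coeff d = 1 := fun x => by
    have := ((monic_X_add_C x).pow d).coeff_natDegree
    rwa [(monic_X_add_C x).natDegree_pow, natDegree_X_add_C, mul_one] at this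
  have hck : ∀ x : E, ((X ^ q + C x : E[X]) ^ d).coeff k = 1 := fun x => by
    rw [hpow, hk, coeff_expand_mul (by omega), hmonx]
  have hck1 : ∀ x : E, ((X ^ q + C x : E[X]) ^ d).coeff (k - 1) = 0 := fun x => by
    rw [hpow, coeff_expand (by omega), if_neg]
    rintro ⟨m, hm⟩
    have h5 : d * q = m * q + 1 := by
      rw [mul_comm m]; omega
    have h6 : q ∣ 1 := (Nat.dvd_add_right (Dvd.intro_left m rfl)).1 (h5 ▸ Dvd.intro_left d rfl)
    have := Nat.le_of_dvd one_pos h6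
    omega
  have hFk : F.coeff k = q := by
    rw [hF, finsetSum_coeff, Finset.sum_congr rfl fun j _ => coeff_X_add_C_pow (t j) k k]
    simp [S.card]
  have hFk1 : F.coeff (k - 1) = 0 := by
    rw [hF, finsetSum_coeff, Finset.sum_congr rfl fun j _ => coeff_X_add_C_pow (t j) k (k - 1),
      ← Finset.sum_mul, show k - (k - 1) = 1 by omega, S.sum_pow_eq_zero one_pos (by omega),
      zero_mul]
  refine ⟨h2, h3, h4, fun i => ?_, fun i => ?_⟩
  -- In degree `k - 1` the powers `(X ^ q + t j) ^ d` have no term, and `F` has none because the sum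
  -- of the `t j` vanishes; the latter needs `q > 2`.
  · have h5 := hcoeff i (k - 1)
    simp only [hck1, hFk1, mul_zero, Finset.sum_const_zero, add_zero] at h5
    have h6 : ‖a * (P (i :: u)).coeff (k - 1)‖ ≤ 1 := by
      have := norm_sub_le_of_le (hVj i (k - 1) hk1) h5
      rwa [sub_sub_cancel] at this
    rw [norm_mul] at h6
    rw [hAinv, le_div_iff₀ ha0]
    linarith
  · set c := κ * (P (i :: u)).coeff k with hcdef
    -- At the points `-t l` this polynomial differs by integers from `up (P u)` plus the `down` sum:
    -- `F` is reduced modulo `X ^ q - X`, and `X ^ q + t j` is replaced by `X + t j`. Only `up (P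
    -- u)` has terms of degree at least `q`, and they are integral, so `D` is integral by
    -- interpolation.
    set D := up (-t i) w (P u) + C c * (F %ₘ Φ) +
      ∑ j, C ((P (j :: i :: u)).coeff k - c) * (X + C (t j)) ^ d with hD
    have hDeval : ∀ l, ‖D.eval (-t l)‖ ≤ 1 := by
      intro l
      have h5 := h1 i l 0
      have h6 := ((hW i).eval (S.norm_neg_le l))
      rw [coeff_zero_up, eval_add] at h5
      have h7 : ‖c * ((F %ₘ Φ).eval (-t l) - F.eval (-t l))‖ ≤ 1 := by
        rw [norm_mul]
        calc _ ≤ A ^ 2 * (‖w‖ * ‖w‖) :=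
              mul_le_mul (hc i) (S.eval_modByMonic_sub_le hw0.le hFb l) (norm_nonneg _)
                (by positivity)
          _ = (A * ‖w‖) ^ 2 := by ring
          _ ≤ 1 := pow_le_one₀ (by positivity) hAw
      have h8 : ‖∑ j, ((P (j :: i :: u)).coeff k - c) *
          (((-t l) + t j) ^ d - ((-t l) ^ q + t j) ^ d)‖ ≤ 1 := by
        refine norm_sum_le_of_le zero_le_one fun j _ => ?_
        rw [norm_mul]
        refine (mul_le_mul (hκQ i j) (?_ : _ ≤ ‖(p : E)‖) (norm_nonneg _) hA0.le).trans hAp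
        have h9 := Bd.pow_sub_pow (f := C (-t l + t j)) (g := C ((-t l) ^ q + t j))
          (c := ‖(p : E)‖)
          (Bd.const (norm_add_le_of_le (S.norm_neg_le l) (S.spread.le_one j)))
          (Bd.const (norm_add_le_of_le (norm_pow_le_one (S.norm_neg_le l) q) (S.spread.le_one j)))
          (by
            rw [← C_sub]
            refine Bd.const ?_
            have := S.norm_neg_pow_add_le l
            rw [← norm_neg] at this
            refine le_of_eq_of_le (congrArg _ ?_) this
            ring) d 0
        simpa only [← C_pow, ← C_sub, coeff_C_zero] using h9
      have h9 : D.eval (-t l) = (eval (-t l) (up (-t i) w (P u)) +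
          eval (-t l) (∑ j, down k (t j) w (P (j :: i :: u)))) -
          eval (-t l) (∑ j, down k (t j) w (P (j :: i :: u)) - (C c * F +
            ∑ j, C ((P (j :: i :: u)).coeff k - c) * (X ^ q + C (t j)) ^ d)) +
          c * ((F %ₘ Φ).eval (-t l) - F.eval (-t l)) +
          ∑ j, ((P (j :: i :: u)).coeff k - c) *
            (((-t l) + t j) ^ d - ((-t l) ^ q + t j) ^ d) := by
        simp only [hD, eval_add, eval_sub, eval_mul, eval_C, eval_finsetSum, eval_pow, eval_X,
          mul_sub, Finset.sum_sub_distrib]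
        ring
      rw [h9]
      exact norm_add_le_of_le (norm_add_le_of_le (norm_sub_le_of_le h5 h6) h7) h8
    have hDb : Bd 1 D := by
      refine S.neg_spread.bd_of_eval_of_coeff zero_le_one (fun j hj => ?_) hDeval
      rw [S.card] at hj
      have h5 : (F %ₘ Φ).coeff j = 0 := by
        apply coeff_eq_zero_of_degree_lt
        refine (degree_modByMonic_lt F hmon).trans_le ?_
        rw [hΦdeg]
        exact_mod_cast hj
      have h6 : ∀ x : E, ((X + C x) ^ d).coeff j = 0 := fun x => by
        rw [coeff_X_add_C_pow, Nat.choose_eq_zero_of_lt (by omega), Nat.cast_zero, mul_zero]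
      rw [hD, coeff_add, coeff_add, coeff_C_mul, h5, mul_zero, add_zero, finsetSum_coeff,
        Finset.sum_eq_zero fun j _ => by rw [coeff_C_mul, h6, mul_zero], add_zero]
      exact hVj i j (by omega)
    have hDd := hDb d
    rw [hD, coeff_add, coeff_add, coeff_C_mul, finsetSum_coeff,
      Finset.sum_congr rfl fun j _ => by rw [coeff_C_mul, hmonx, mul_one], ← hB] at hDd
    have h5 := hcoeff i k
    simp only [hck, hFk, mul_one, ← hcdef] at h5
    -- Degree `d` of `D` minus degree `k` of the cone equation: the sum of the deviations cancels.
    have h6 : ‖(a - κ * (q - B)) * (P (i :: u)).coeff k + (-w) ^ d * (P u).coeff k‖ ≤ 1 := by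
      have h7 := norm_sub_le_of_le (norm_add_le_of_le h5 (hVd i)) (norm_add_le_of_le (hVj i k hkd) hDd)
      rw [← norm_neg] at h7
      refine le_of_eq_of_le (congrArg _ ?_) h7
      rw [hcdef]
      ring
    rw [hAinv, le_div_iff₀ ha0, mul_comm, ← hden, ← norm_mul]
    refine le_of_eq_of_le (congrArg _ ?_) h6
    field_simp
    ring

/-- Besides the bounds, the induction carries a factor `κ` relating the top coefficients at the
current level to those of its children. It starts with `κ = 0` and is the same for all vertices of a
level. -/
lemma bd_of_divisible {d k : ℕ} (hk : k = d * q) (hd : 1 ≤ d) (hdq : 2 * d ≤ q)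
    (hq2 : 2 < q) {a : E} {A : ℝ} (hA : 1 ≤ A) (haA : ‖a‖ * A = 1) (hAw : A * ‖w‖ ≤ 1)
    (hA2 : A ^ 2 * ‖w‖ ^ (d + 1) < 1) {P : List I → E[X]} (hP : ConeSolution k w a t P)
    (u : List I) : Bd (A / ‖w‖ ^ d) (P u) := by
  have hA0 : 0 < A := zero_lt_one.trans_le hA
  have key : (∀ v : List I, u.length + 1 ≤ v.length →
        Bd (A ^ 2) (P v) ∧ ‖(P v).coeff (k - 1)‖ ≤ A) ∧
      (∀ v : List I, u.length ≤ v.length →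
        (∀ i, Bd A (up (-t i) w (P v))) ∧ Bd (A / ‖w‖ ^ d) (P v)) ∧
      ∃ κ : E, ‖κ‖ ≤ ‖w‖ ^ d * A ∧ ∀ v : List I, v.length = u.length → ∀ i,
        ‖(P (i :: v)).coeff k - κ * (P v).coeff k‖ ≤ A := by
    refine hP.induction (Q := fun n => (∀ v : List I, n + 1 ≤ v.length →
        Bd (A ^ 2) (P v) ∧ ‖(P v).coeff (k - 1)‖ ≤ A) ∧
      (∀ v : List I, n ≤ v.length → (∀ i, Bd A (up (-t i) w (P v))) ∧ Bd (A / ‖w‖ ^ d) (P v)) ∧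
      ∃ κ : E, ‖κ‖ ≤ ‖w‖ ^ d * A ∧ ∀ v : List I, v.length = n → ∀ i,
        ‖(P (i :: v)).coeff k - κ * (P v).coeff k‖ ≤ A) u.length ?_ ?_
    · intro m hm
      refine ⟨fun v hv => ?_, fun v hv => ?_, 0, by rw [norm_zero]; positivity, fun v hv i => ?_⟩
      · rw [hm v (by omega)]
        exact ⟨Bd.zero (by positivity), by simpa using hA0.le⟩
      · rw [hm v hv]
        exact ⟨fun i => by simpa [up] using Bd.zero hA0.le, Bd.zero (by positivity)⟩
      · rw [hm v hv.ge, hm (i :: v) (by rw [List.length_cons]; omega)]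
        simpa using hA0.le
    · rintro m - ⟨h1, h2, κ, hκ, h3⟩
      obtain ⟨κ', hκ', h⟩ := S.exists_step_divisible hk hd hdq hq2 hA haA hAw hA2 hκ
      have step := fun (v : List I) (hv : v.length = m) => h hP v
        (fun i j => (h1 (j :: i :: v) (by simp [hv])).1)
        (fun i j => (h1 (j :: i :: v) (by simp [hv])).2)
        (fun i j => (h2 (i :: v) (by simp [hv])).1 j)
        (fun i j => h3 (i :: v) (by simp [hv]) j)
      refine ⟨fun v hv => ?_, fun v hv => ?_, κ', hκ', fun v hv i => (step v hv).2.2.2.2 i⟩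
      · rcases hv.eq_or_lt with heq | hlt
        · obtain _ | ⟨i, v⟩ := v
          · simp at heq
          · have := step v (by simpa using heq.symm)
            exact ⟨this.2.2.1 i, this.2.2.2.1 i⟩
        · exact h1 v hlt
      · rcases hv.eq_or_lt with heq | hlt
        · exact ⟨(step v heq.symm).1, (step v heq.symm).2.1⟩
        · exact h2 v hlt
  exact (key.2.1 u le_rfl).2

end ResidueSystem

end divisibleCone

end BreuilSchneider

end

/-! ### The cone equations for `q = k = 2`. -/

noncomputable section

namespace BreuilSchneider

section quadraticCone

open Polynomial

variable {E : Type*} [NormedField E] [IsUltrametricDist E] {I : Type*} [Fintype I]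

namespace ResidueSystem

variable {p : ℕ} {w : E} {t : I → E} (S : ResidueSystem p 2 w t)

include S

lemma exists_eq_zero_one : ∃ i₀ i₁ : I, t i₀ = 0 ∧ t i₁ = 1 ∧ (∀ i, i = i₀ ∨ i = i₁) ∧
    ∀ f : I → E[X], ∑ i, f i = f i₀ + f i₁ := by
  classical
  have h01 : ∀ i, t i = 0 ∨ t i = 1 := fun i => by
    have h := S.pow_eq i
    have h2 : t i * (t i - 1) = 0 := by linear_combination h
    rcases mul_eq_zero.1 h2 with h3 | h3
    · exact Or.inl h3
    · exact Or.inr (sub_eq_zero.1 h3)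
  have hcard := S.card
  obtain ⟨x, y, hxy, huniv⟩ := Finset.card_eq_two.1 (Finset.card_univ.trans hcard)
  have hmem : ∀ i, i = x ∨ i = y := fun i => by
    have := Finset.mem_univ i
    rw [huniv] at this
    simpa using this
  have hne : t x ≠ t y := fun h => hxy (S.spread.injective h)
  rcases h01 x with hx | hx
  · refine ⟨x, y, hx, (h01 y).resolve_left fun h => hne (hx.trans h.symm), hmem, fun f => ?_⟩
    rw [huniv, Finset.sum_pair hxy]
  · refine ⟨y, x, (h01 y).resolve_right fun h => hne (hx.trans h.symm), hx,
      fun i => (hmem i).symm, fun f => ?_⟩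
    rw [huniv, Finset.sum_pair hxy, add_comm]

/-- For `q = 2` the representatives are `0` and `1`, whose sum does not vanish, so the coefficient
of degree one is not bounded by `A` as before. It follows the top coefficient instead, and the
difference of the two takes its place in the induction. -/
lemma exists_step_quadratic {a : E} {A : ℝ} (hA : 1 ≤ A) (haA : ‖a‖ * A = 1)
    (hAw : A * ‖w‖ < 1) {κ : E} (hκ : ‖κ‖ ≤ ‖w‖ * A) :
    ∃ κ' : E, ‖κ'‖ ≤ ‖w‖ * A ∧ ∀ {P : List I → E[X]} (_ : ConeSolution 2 w a t P)
      (u : List I), (∀ v : List I, u.length + 1 ≤ v.length → ‖(P v).coeff 2‖ ≤ A / ‖w‖ ∧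
        ‖(P v).coeff 1 - (P v).coeff 2‖ ≤ A ∧ ‖(P v).coeff 0‖ ≤ A ^ 2) →
      (∀ i j, ‖(P (j :: i :: u)).coeff 2 - κ * (P (i :: u)).coeff 2‖ ≤ A) →
      (‖(P u).coeff 2‖ ≤ A / ‖w‖ ∧ ‖(P u).coeff 1 - (P u).coeff 2‖ ≤ A ∧
        ‖(P u).coeff 0‖ ≤ A ^ 2) ∧
      ∀ i, ‖(P (i :: u)).coeff 2 - κ' * (P u).coeff 2‖ ≤ A := by
  have hA0 : 0 < A := zero_lt_one.trans_le hA
  have hw0 := S.w_pos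
  have hwl := S.w_lt.le
  have ha0 : 0 < ‖a‖ := pos_of_mul_pos_left (haA ▸ zero_lt_one) hA0.le
  have hAinv : A = 1 / ‖a‖ := by field_simp; linarith
  have h2w : ‖(2 : E)‖ ≤ ‖w‖ := by simpa using S.norm_q_le
  have h2κ : ‖2 * κ‖ < ‖a‖ := by
    rw [norm_mul]
    calc ‖(2 : E)‖ * ‖κ‖ ≤ ‖w‖ * (‖w‖ * A) := by gcongr
      _ = (A * ‖w‖) ^ 2 * ‖a‖ := by linear_combination (-‖w‖ ^ 2 * A) * haA
      _ < ‖a‖ := mul_lt_of_lt_one_left ha0 (pow_lt_one₀ (by positivity) hAw two_ne_zero)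
  have hden : ‖a - 2 * κ‖ = ‖a‖ := by
    rw [sub_eq_add_neg, IsUltrametricDist.norm_add_eq_max_of_norm_ne_norm
      (by rw [norm_neg]; exact h2κ.ne'), norm_neg, max_eq_left h2κ.le]
  have hden0 : a - 2 * κ ≠ 0 := norm_pos_iff.1 (hden ▸ ha0)
  obtain ⟨i₀, i₁, ht0, ht1, hall, hsum⟩ := S.exists_eq_zero_one
  -- By `H2` below, `(a - 2 κ)` times the top coefficient of a child is the coefficient of degree
  -- one of `up (P u)`, which is `w` times the top coefficient of `P u`, all modulo integers.
  refine ⟨w / (a - 2 * κ), ?_, ?_⟩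
  · rw [norm_div, hden, hAinv, mul_one_div]
  intro P hP u hb hκQ
  -- multiplication by elements of small norm
  have hwA : ∀ x : E, ‖x‖ ≤ A → ‖w * x‖ ≤ 1 := fun x hx => by
    rw [norm_mul, mul_comm]
    exact (mul_le_mul_of_nonneg_right hx hw0.le).trans hAw.le
  have h2A : ∀ x : E, ‖x‖ ≤ A → ‖2 * x‖ ≤ 1 := fun x hx => by
    rw [norm_mul]
    refine (mul_le_mul h2w hx (norm_nonneg _) hw0.le).trans ?_
    rw [mul_comm]; exact hAw.le
  have hwA2 : ∀ x : E, ‖x‖ ≤ A ^ 2 → ‖w * x‖ ≤ A := fun x hx => by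
    rw [norm_mul]
    calc ‖w‖ * ‖x‖ ≤ ‖w‖ * A ^ 2 := by gcongr
      _ = (A * ‖w‖) * A := by ring
      _ ≤ A := mul_le_of_le_one_left hA0.le hAw.le
  have haA2 : ∀ x : E, ‖x‖ ≤ A ^ 2 → ‖a * x‖ ≤ A := fun x hx => by
    rw [norm_mul]
    calc ‖a‖ * ‖x‖ ≤ ‖a‖ * A ^ 2 := by gcongr
      _ = A := by rw [pow_two, ← mul_assoc, haA, one_mul]
  have haA1 : ∀ x : E, ‖x‖ ≤ A → ‖a * x‖ ≤ 1 := fun x hx => by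
    rw [norm_mul, ← haA]
    gcongr
  have hdiv : ∀ x : E, ‖(a - 2 * κ) * x‖ ≤ 1 → ‖x‖ ≤ A := fun x hx => by
    rw [norm_mul, hden] at hx
    rw [hAinv, le_div_iff₀ ha0, mul_comm]
    exact hx
  have hκ2 : ∀ x : E, ‖x‖ ≤ A → ‖κ * x‖ ≤ A := fun x hx => by
    rw [norm_mul]
    calc ‖κ‖ * ‖x‖ ≤ (‖w‖ * A) * A := by gcongr
      _ = (A * ‖w‖) * A := by ring
      _ ≤ A := mul_le_of_le_one_left hA0.le hAw.le
  have hup0 : ∀ (x : E) (f : E[X]), f.natDegree ≤ 2 →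
      (up x w f).coeff 0 = f.coeff 0 + x * f.coeff 1 + x ^ 2 * f.coeff 2 ∧
      (up x w f).coeff 1 = w * (f.coeff 1 + 2 * x * f.coeff 2) ∧
      (up x w f).coeff 2 = w ^ 2 * f.coeff 2 := by
    intro x f hf
    have h1 : up x w f = C (w ^ 2 * f.coeff 2) * X ^ 2 +
        C (w * (f.coeff 1 + 2 * x * f.coeff 2)) * X +
        C (f.coeff 0 + x * f.coeff 1 + x ^ 2 * f.coeff 2) := by
      conv_lhs => rw [up_eq_comp, f.as_sum_range_C_mul_X_pow' (n := 3) (by omega)]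
      simp only [Finset.sum_range_succ, Finset.sum_range_zero, add_comp, mul_comp, C_comp,
        pow_comp, X_comp, zero_comp, C_add, C_mul, C_pow, C_ofNat]
      ring
    rw [h1]
    generalize w ^ 2 * f.coeff 2 = x₂
    generalize w * (f.coeff 1 + 2 * x * f.coeff 2) = x₁
    generalize f.coeff 0 + x * f.coeff 1 + x ^ 2 * f.coeff 2 = x₀
    refine ⟨?_, ?_, ?_⟩ <;> simp [coeff_X, coeff_C]
  have hdown : ∀ (f g : E[X]), f.natDegree ≤ 2 → g.natDegree ≤ 2 →
      (down 2 0 w f + down 2 1 w g).coeff 0 =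
        w ^ 2 * f.coeff 0 + g.coeff 2 + w * g.coeff 1 + w ^ 2 * g.coeff 0 ∧
      (down 2 0 w f + down 2 1 w g).coeff 1 =
        w * f.coeff 1 + 2 * g.coeff 2 + w * g.coeff 1 ∧
      (down 2 0 w f + down 2 1 w g).coeff 2 = f.coeff 2 + g.coeff 2 := by
    intro f g hf hg
    refine ⟨?_, ?_, ?_⟩ <;>
      simp [coeff_down, Finset.sum_range_succ, Nat.choose] <;> ring
  have hc : ∀ i, ‖κ * (P (i :: u)).coeff 2‖ ≤ A ^ 2 := fun i => by
    rw [norm_mul]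
    calc _ ≤ (‖w‖ * A) * (A / ‖w‖) := by gcongr; exact (hb (i :: u) (by simp)).1
      _ = A ^ 2 := by field_simp
  have hbQ : ∀ i j, ‖(P (j :: i :: u)).coeff 1 - (P (j :: i :: u)).coeff 2‖ ≤ A := fun i j =>
    (hb (j :: i :: u) (by simp)).2.1
  have hQ0 : ∀ i j, ‖w ^ 2 * (P (j :: i :: u)).coeff 0‖ ≤ 1 := fun i j => by
    rw [pow_two, mul_assoc]
    exact hwA _ (hwA2 _ (hb (j :: i :: u) (by simp)).2.2)
  have hE : ∀ i n, ‖(up (-t i) w (P u)).coeff n - a * (P (i :: u)).coeff n +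
      (down 2 0 w (P (i₀ :: i :: u)) + down 2 1 w (P (i₁ :: i :: u))).coeff n‖ ≤ 1 := by
    intro i n
    have := hP.bd i u n
    rwa [hsum, ht0, ht1, coeff_add, coeff_sub, coeff_C_mul] at this
  have hD := fun i => hdown (P (i₀ :: i :: u)) (P (i₁ :: i :: u)) (hP.natDegree_le _)
    (hP.natDegree_le _)
  have hc2 : ∀ i, ‖κ * (P (i :: u)).coeff 2 * 2‖ ≤ A := fun i => by
    rw [norm_mul, mul_comm]
    calc ‖(2 : E)‖ * _ ≤ ‖w‖ * A ^ 2 := by gcongr; exact hc i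
      _ = (A * ‖w‖) * A := by ring
      _ ≤ A := mul_le_of_le_one_left hA0.le hAw.le
  -- Degree one minus degree two of the cone equation. The terms with `w` are integral because the
  -- lower coefficients of the grandchildren follow their top ones, and these follow `κ` times the
  -- top coefficient of the child.
  have H1 : ∀ i, ‖(up (-t i) w (P u)).coeff 1 - (up (-t i) w (P u)).coeff 2 -
      ((P (i₀ :: i :: u)).coeff 2 - (P (i₁ :: i :: u)).coeff 2)‖ ≤ 1 := by
    intro i
    have h1 := norm_sub_le_of_le (hE i 1) (hE i 2)
    rw [(hD i).2.1, (hD i).2.2] at h1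
    have h2 := haA1 _ (hb (i :: u) (by simp)).2.1
    have h3 := norm_add_le_of_le (hwA _ (hbQ i i₀)) (hwA _ (hbQ i i₁))
    have h4 := norm_add_le_of_le (hwA _ (hκQ i i₀)) (hwA _ (hκQ i i₁))
    refine le_of_eq_of_le (congrArg _ ?_) (norm_add_le_of_le (norm_sub_le_of_le h1
      (norm_add_le_of_le (norm_add_le_of_le h3 h4) (hwA _ (hc2 i)))) h2)
    ring
  have H2 : ∀ i, ‖(a - 2 * κ) * (P (i :: u)).coeff 2 - (up (-t i) w (P u)).coeff 1‖ ≤ 1 := by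
    intro i
    have h1 := hE i 2
    rw [(hD i).2.2] at h1
    refine le_of_eq_of_le (congrArg _ ?_) (norm_sub_le_of_le (norm_sub_le_of_le
      (h2A _ (hκQ i i₁)) (H1 i)) h1)
    ring
  have H0 : ∀ i, ‖(up (-t i) w (P u)).coeff 0 + (1 + w) * (κ * (P (i :: u)).coeff 2)‖ ≤ A := by
    intro i
    have h1 := hE i 0
    rw [(hD i).1] at h1
    have h2 := norm_add_le_of_le (norm_add_le_of_le (hQ0 i i₀) (hQ0 i i₁))
      (norm_add_le_of_le (hwA _ (hbQ i i₁)) (hwA _ (hκQ i i₁)))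
    refine le_of_eq_of_le (congrArg _ ?_) (norm_add_le_of_le (norm_sub_le_of_le
      ((norm_sub_le_of_le h1 h2).trans hA) (hκQ i i₁)) (haA2 _ (hb (i :: u) (by simp)).2.2))
    ring
  obtain ⟨h00, h01, h02⟩ := hup0 (-t i₀) (P u) (hP.natDegree_le u)
  obtain ⟨h10, h11, h12⟩ := hup0 (-t i₁) (P u) (hP.natDegree_le u)
  have hAA : A ≤ A ^ 2 := le_self_pow₀ hA two_ne_zero
  have h1w : ‖1 + w‖ ≤ 1 := norm_add_le_of_le norm_one.le hwl
  have hV0 : ∀ i, ‖(up (-t i) w (P u)).coeff 0‖ ≤ A ^ 2 := fun i => by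
    have h1 := norm_mul_le_of_le_one_right (hc i) h1w
    refine le_of_eq_of_le (congrArg _ ?_) (norm_sub_le_of_le ((H0 i).trans hAA) h1)
    ring
  have hR0 : ‖(P u).coeff 0‖ ≤ A ^ 2 := by
    have := hV0 i₀
    rwa [h00, ht0, neg_zero, zero_mul, add_zero, zero_pow two_ne_zero, zero_mul, add_zero] at this
  -- A preliminary bound. It yields `hR2`, hence `hdiff` for the two children, which in turn
  -- improves the bound to `A` in `hR1'`.
  have hR1 : ‖(P u).coeff 1 - (P u).coeff 2‖ ≤ A ^ 2 := by
    refine le_of_eq_of_le (congrArg _ ?_) (norm_sub_le_of_le (hV0 i₀) (hV0 i₁))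
    rw [h00, h10, ht0, ht1]
    ring
  have hR2 : ‖w * (P u).coeff 2‖ ≤ A := by
    have h1 := norm_add_le_of_le ((H1 i₀).trans hA) (norm_sub_le_of_le (hκQ i₀ i₀) (hκQ i₀ i₁))
    have h2 := norm_sub_le_of_le h1 (hwA2 _ hR1)
    have h3 : ‖(1 - w) * (w * (P u).coeff 2)‖ ≤ A := by
      refine le_of_eq_of_le (congrArg _ ?_) h2
      rw [h01, h02, ht0]
      ring
    have h4 : ‖(1 - w : E)‖ = 1 := by
      rw [sub_eq_add_neg, IsUltrametricDist.norm_add_eq_max_of_norm_ne_norm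
        (by rw [norm_neg, norm_one]; exact S.w_lt.ne'), norm_neg, norm_one, max_eq_left hwl]
    rwa [norm_mul, h4, one_mul] at h3
  have hdiff : ‖(P (i₀ :: u)).coeff 2 - (P (i₁ :: u)).coeff 2‖ ≤ A := by
    refine hdiv _ (le_of_eq_of_le (congrArg _ ?_)
      (norm_add_le_of_le (norm_sub_le_of_le (H2 i₀) (H2 i₁)) (h2A _ hR2)))
    rw [h01, h11, ht0, ht1]
    ring
  have hR1' : ‖(P u).coeff 1 - (P u).coeff 2‖ ≤ A := by
    have h1 := norm_mul_le_of_le_one_right (hκ2 _ hdiff) h1w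
    refine le_of_eq_of_le (congrArg _ ?_) (norm_sub_le_of_le (norm_sub_le_of_le (H0 i₀) (H0 i₁)) h1)
    rw [h00, h10, ht0, ht1]
    ring
  have hwR := hwA _ hR1'
  refine ⟨⟨?_, hR1', hR0⟩, fun i => hdiv _ ?_⟩
  · rw [norm_mul] at hR2
    rw [le_div_iff₀ hw0, mul_comm]
    exact hR2
  · rw [mul_sub, ← mul_assoc, mul_div_cancel₀ _ hden0]
    rcases hall i with rfl | rfl
    · refine le_of_eq_of_le (congrArg _ ?_) (norm_add_le_of_le (H2 i) hwR)
      rw [h01, ht0]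
      ring
    · refine le_of_eq_of_le (congrArg _ ?_) (norm_sub_le_of_le (norm_add_le_of_le (H2 i) hwR)
        (h2A _ hR2))
      rw [h11, ht1]
      ring

lemma bd_of_quadratic {a : E} {A : ℝ} (hA : 1 ≤ A) (haA : ‖a‖ * A = 1)
    (hAw : A * ‖w‖ < 1) {P : List I → E[X]} (hP : ConeSolution 2 w a t P) (u : List I) :
    Bd (max (A / ‖w‖) (A ^ 2)) (P u) := by
  have hA0 : 0 < A := zero_lt_one.trans_le hA
  have key : (∀ v : List I, u.length ≤ v.length → ‖(P v).coeff 2‖ ≤ A / ‖w‖ ∧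
      ‖(P v).coeff 1 - (P v).coeff 2‖ ≤ A ∧ ‖(P v).coeff 0‖ ≤ A ^ 2) ∧
      ∃ κ : E, ‖κ‖ ≤ ‖w‖ * A ∧ ∀ v : List I, v.length = u.length → ∀ i,
        ‖(P (i :: v)).coeff 2 - κ * (P v).coeff 2‖ ≤ A := by
    refine hP.induction (Q := fun n => (∀ v : List I, n ≤ v.length → ‖(P v).coeff 2‖ ≤ A / ‖w‖ ∧
      ‖(P v).coeff 1 - (P v).coeff 2‖ ≤ A ∧ ‖(P v).coeff 0‖ ≤ A ^ 2) ∧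
      ∃ κ : E, ‖κ‖ ≤ ‖w‖ * A ∧ ∀ v : List I, v.length = n → ∀ i,
        ‖(P (i :: v)).coeff 2 - κ * (P v).coeff 2‖ ≤ A) u.length ?_ ?_
    · intro m hm
      refine ⟨fun v hv => ?_, 0, by rw [norm_zero]; positivity, fun v hv i => ?_⟩
      · rw [hm v hv]
        simpa using ⟨by positivity, hA0.le, by positivity⟩
      · rw [hm v hv.ge, hm (i :: v) (by rw [List.length_cons]; omega)]
        simpa using hA0.le
    · rintro m - ⟨h1, κ, hκ, h2⟩
      obtain ⟨κ', hκ', h⟩ := S.exists_step_quadratic hA haA hAw hκ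
      have step := fun (v : List I) (hv : v.length = m) => h hP v
        (fun v' hv' => h1 v' (by omega)) (fun i j => h2 (i :: v) (by simp [hv]) j)
      refine ⟨fun v hv => ?_, κ', hκ', fun v hv i => (step v hv).2 i⟩
      rcases hv.eq_or_lt with heq | hlt
      · exact (step v heq.symm).1
      · exact h1 v hlt
  obtain ⟨h2, h1, h0⟩ := key.1 u le_rfl
  have hw : A ≤ A / ‖w‖ := le_div_self hA0.le S.w_pos S.w_lt.le
  intro j
  rcases j with _ | _ | _ | j
  · exact h0.trans (le_max_right _ _)
  · have := norm_add_le_of_le (h1.trans hw) h2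
    rw [sub_add_cancel] at this
    exact this.trans (le_max_left _ _)
  · exact h2.trans (le_max_left _ _)
  · rw [coeff_eq_zero_of_natDegree_lt ((hP.natDegree_le u).trans_lt (by omega)), norm_zero]
    positivity

end ResidueSystem

end quadraticCone

end BreuilSchneider

end

/-! ### The uniform bound in all cases. -/

noncomputable section

namespace BreuilSchneider

section coneBound

variable {E : Type*} [NormedField E] [IsUltrametricDist E] {I : Type*} [Fintype I]

/-- The solutions of the cone congruences are uniformly bounded. -/
theorem ResidueSystem.exists_bd {p q : ℕ} {w : E} {t : I → E} (S : ResidueSystem p q w t)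
    {e d r k : ℕ} (hp : ‖(p : E)‖ = ‖w‖ ^ e) (hk : k = d * q + r) (hr : r < q) (hk0 : 0 < k)
    (hkq : 2 * k ≤ q ^ 2) {a : E}
    (h : (d + r < q ∧ ‖w‖ ≤ ‖a‖ ∧ ‖a‖ ≤ 1) ∨
      (d + r < q ∧ ‖w‖ ^ e ≤ ‖a‖ ∧ ‖a‖ ≤ ‖w‖ ∧ ‖w‖ ^ (r + 1) ≤ ‖a‖ ^ 2) ∨
      (k < p * q ∧ d ≤ r + 1 ∧ ‖a‖ ≤ ‖w‖ ^ d)) :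
    ∃ B : ℝ, ∀ P : List I → Polynomial E, ConeSolution k w a t P → ∀ u, Bd B (P u) := by
  have hq := S.two_le
  have hw0 := S.w_pos
  have hw1 := S.w_lt
  have hdq : 2 * d ≤ q := by
    have h1 : 2 * d * q ≤ q * q := by
      rw [hk] at hkq; nlinarith
    exact Nat.le_of_mul_le_mul_right h1 (by omega)
  rcases h with ⟨hdr, hwa, ha1⟩ | ⟨hdr, hea, haw, hra⟩ | ⟨hkp, hdr, had⟩
  · have ha0 : 0 < ‖a‖ := hw0.trans_le hwa
    have hA : 1 ≤ ‖a‖⁻¹ := (one_le_inv₀ ha0).2 ha1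
    have haA : ‖a‖ * ‖a‖⁻¹ = 1 := mul_inv_cancel₀ ha0.ne'
    have hAw : ‖a‖⁻¹ * ‖w‖ ≤ 1 := (inv_mul_le_one₀ ha0).2 hwa
    have hAp : ‖a‖⁻¹ * ‖(p : E)‖ ≤ 1 :=
      (mul_le_mul_of_nonneg_left S.p_le (by positivity)).trans hAw
    -- With `A = ‖a‖⁻¹ ≤ ‖w‖⁻¹`, the inequalities of the generic case hold as soon as `r ≥ 1` or `A
    -- = 1`; otherwise `k = d q`.
    by_cases hgen : 1 ≤ r ∨ ‖a‖ = 1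
    · refine ⟨_, fun P hP u => S.bd_of_generic hk hdr hdq hA haA ?_ ?_ hAp hP u⟩
      · rcases hgen with hr1 | ha
        · calc ‖a‖⁻¹ * ‖w‖ ^ r ≤ ‖a‖⁻¹ * ‖w‖ ^ 1 := by
                gcongr ?_ * ?_
                exact pow_le_pow_of_le_one hw0.le hw1.le hr1
            _ ≤ 1 := by rwa [pow_one]
        · rw [ha, inv_one, one_mul]
          exact S.w_pow_le_one r
      · rcases hgen with hr1 | ha
        · calc ‖a‖⁻¹ ^ 2 * ‖w‖ ^ (r + 1) ≤ ‖a‖⁻¹ ^ 2 * ‖w‖ ^ 2 := by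
                gcongr ?_ * ?_
                exact pow_le_pow_of_le_one hw0.le hw1.le (by omega)
            _ = (‖a‖⁻¹ * ‖w‖) ^ 2 := by ring
            _ ≤ 1 := pow_le_one₀ (by positivity) hAw
        · rw [ha, inv_one, one_pow, one_mul]
          exact S.w_pow_le_one _
    · push Not at hgen
      obtain ⟨hr0, hane⟩ := hgen
      obtain rfl : r = 0 := by omega
      rw [add_zero] at hk
      have hd1 : 1 ≤ d := by
        rcases Nat.eq_zero_or_pos d with rfl | h
        · simp at hk; omega
        · exact h
      -- The strict inequality `A ^ 2 * ‖w‖ ^ (d + 1) < 1` fails only in this case, which satisfies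
      -- the requirements for small `a` with `r = 0` and `d = 1`.
      by_cases hd : d = 1 ∧ ‖a‖ ≤ ‖w‖
      · obtain ⟨rfl, haw⟩ := hd
        exact ⟨_, fun P hP u => S.bd_of_small (r := 0) (by simpa using hk) S.prime.one_lt hr
          hdq le_rfl (by simpa using haw) hP u⟩
      · have hA2 : ‖a‖⁻¹ ^ 2 * ‖w‖ ^ (d + 1) < 1 := by
          by_cases hd1' : d = 1
          · have haw : ‖w‖ < ‖a‖ := not_le.1 fun h => hd ⟨hd1', h⟩
            rw [hd1', ← mul_pow]
            exact pow_lt_one₀ (by positivity) ((inv_mul_lt_one₀ ha0).2 haw) two_ne_zero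
          · calc ‖a‖⁻¹ ^ 2 * ‖w‖ ^ (d + 1) ≤ ‖a‖⁻¹ ^ 2 * ‖w‖ ^ 3 := by
                  gcongr ?_ * ?_
                  exact pow_le_pow_of_le_one hw0.le hw1.le (by omega)
              _ = (‖a‖⁻¹ * ‖w‖) ^ 2 * ‖w‖ := by ring
              _ ≤ ‖w‖ := mul_le_of_le_one_left hw0.le (pow_le_one₀ (by positivity) hAw)
              _ < 1 := hw1
        rcases hq.eq_or_lt with rfl | hq2
        · obtain rfl : d = 1 := by omega
          subst hk
          have haw : ‖w‖ < ‖a‖ := not_le.1 fun h => hd ⟨rfl, h⟩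
          exact ⟨_, fun P hP u => S.bd_of_quadratic hA haA ((inv_mul_lt_one₀ ha0).2 haw) hP u⟩
        · exact ⟨_, fun P hP u => S.bd_of_divisible hk hd1 hdq hq2 hA haA hAw hA2 hP u⟩
  · have ha0 : 0 < ‖a‖ := (pow_pos hw0 e).trans_le hea
    have hA : 1 ≤ ‖a‖⁻¹ := (one_le_inv₀ ha0).2 (haw.trans hw1.le)
    have hA2 : ‖a‖⁻¹ ^ 2 * ‖w‖ ^ (r + 1) ≤ 1 := by
      rw [inv_pow]
      exact (inv_mul_le_one₀ (pow_pos ha0 2)).2 hra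
    refine ⟨_, fun P hP u => S.bd_of_generic hk hdr hdq hA (mul_inv_cancel₀ ha0.ne') ?_ hA2 ?_ hP u⟩
    · refine (inv_mul_le_one₀ ha0).2 (le_of_mul_le_mul_right ?_ ha0)
      calc ‖w‖ ^ r * ‖a‖ ≤ ‖w‖ ^ r * ‖w‖ := by gcongr
        _ = ‖w‖ ^ (r + 1) := (pow_succ _ _).symm
        _ ≤ ‖a‖ ^ 2 := hra
        _ = ‖a‖ * ‖a‖ := pow_two _
    · rw [hp]
      exact (inv_mul_le_one₀ ha0).2 hea
  · have hdp : d < p := by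
      by_contra! hle
      have := Nat.mul_le_mul_right q hle
      omega
    exact ⟨_, fun P hP u => S.bd_of_small hk hdp hr hdq hdr had hP u⟩

end coneBound

end BreuilSchneider

end

/-! ### Residue fields and Teichmüller representatives. -/

noncomputable section

namespace BreuilSchneider

section residueField

variable {L : Type*} [NormedField L] [IsUltrametricDist L]

lemma isUnit_ringOfInt_iff {x : ringOfInt L} : IsUnit x ↔ ‖(x : L)‖ = 1 := by
  constructor
  · rintro ⟨u, rfl⟩
    have h1 := mem_ringOfInt.1 (u : ringOfInt L).2
    have h2 := mem_ringOfInt.1 ((u⁻¹ : (ringOfInt L)ˣ) : ringOfInt L).2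
    have h3 : ‖((u : ringOfInt L) : L)‖ * ‖(((u⁻¹ : (ringOfInt L)ˣ) : ringOfInt L) : L)‖ = 1 := by
      rw [← norm_mul]
      have := congrArg (Subtype.val) u.mul_inv
      rw [← norm_one (α := L)]
      exact congrArg _ this
    nlinarith [norm_nonneg ((u : ringOfInt L) : L)]
  · intro h
    have hx : (x : L) ≠ 0 := by
      intro h0; rw [h0, norm_zero] at h; exact zero_ne_one h
    refine IsUnit.of_mul_eq_one ⟨(x : L)⁻¹, mem_ringOfInt.2 (by rw [norm_inv, h, inv_one])⟩ ?_
    exact Subtype.ext (mul_inv_cancel₀ hx)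

lemma residue_eq_iff {x y : ringOfInt L} :
    IsLocalRing.residue (ringOfInt L) x = IsLocalRing.residue (ringOfInt L) y ↔
      ‖(x : L) - y‖ < 1 := by
  rw [← sub_eq_zero, ← map_sub, IsLocalRing.residue_eq_zero_iff, IsLocalRing.mem_maximalIdeal,
    mem_nonunits_iff, isUnit_ringOfInt_iff]
  have h := mem_ringOfInt.1 (x - y).2
  exact ⟨fun h' => lt_of_le_of_ne h h', fun h' => h'.ne⟩

/-- Finitely many open unit balls cover the integers, and a unit ball meets only one residue class.
-/
lemma finite_residueField [ProperSpace L] : Finite (IsLocalRing.ResidueField (ringOfInt L)) := by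
  obtain ⟨s, -, hs, hcov⟩ := (isCompact_closedBall (0 : L) 1).finite_cover_balls zero_lt_one
  have hex : ∀ x : IsLocalRing.ResidueField (ringOfInt L), ∃ y : s, ∃ z : ringOfInt L,
      IsLocalRing.residue _ z = x ∧ ‖(z : L) - y‖ < 1 := by
    intro x
    obtain ⟨z, rfl⟩ := IsLocalRing.residue_surjective x
    have : (z : L) ∈ Metric.closedBall (0 : L) 1 := by simpa using mem_ringOfInt.1 z.2
    obtain ⟨y, hy, h⟩ := Set.mem_iUnion₂.1 (hcov this)
    exact ⟨⟨y, hy⟩, z, rfl, by simpa [dist_eq_norm] using h⟩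
  choose f z hz hf using hex
  have : Finite s := hs
  refine Finite.of_injective f fun x y hxy => ?_
  rw [← hz x, ← hz y, residue_eq_iff]
  have h1 := hf x
  have h2 := hf y
  rw [← hxy] at h2
  have h3 : (z x : L) - z y = ((z x : L) - f x) + (f x - z y) := by ring
  rw [h3]
  exact (IsUltrametricDist.norm_add_le_max _ _).trans_lt (max_lt h1 (by rwa [norm_sub_rev]))

/-- The cofactor of `x - y` in `x ^ q - y ^ q` is congruent to `q y ^ (q - 1)` modulo elements of
norm at most `ε`. Thus the `q`-th power contracts distances inside a residue class. -/
lemma norm_pow_sub_pow_le {x y : L} {q : ℕ} {ε : ℝ} (hx : ‖x‖ ≤ 1) (hy : ‖y‖ ≤ 1)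
    (hq : ‖(q : L)‖ ≤ ε) (hxy : ‖x - y‖ ≤ ε) : ‖x ^ q - y ^ q‖ ≤ ε * ‖x - y‖ := by
  have hε : 0 ≤ ε := (norm_nonneg _).trans hq
  rw [← geom_sum₂_mul, norm_mul]
  gcongr
  have h : ∑ i ∈ Finset.range q, x ^ i * y ^ (q - 1 - i) =
      ∑ i ∈ Finset.range q, (x ^ i - y ^ i) * y ^ (q - 1 - i) + q * y ^ (q - 1) := by
    simp only [sub_mul, Finset.sum_sub_distrib]
    have : ∑ i ∈ Finset.range q, y ^ i * y ^ (q - 1 - i) = q * y ^ (q - 1) := by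
      rw [Finset.sum_congr rfl (g := fun _ => y ^ (q - 1)) fun i hi => by
        rw [Finset.mem_range] at hi
        rw [← pow_add]; congr 1; omega]
      simp
    rw [this]; ring
  rw [h]
  refine norm_add_le_of_le (norm_sum_le_of_le hε fun i _ => ?_)
    (norm_mul_le_of_le_one_right hq (norm_pow_le_one hy _))
  refine norm_mul_le_of_le_one_right ?_ (norm_pow_le_one hy _)
  rw [← geom_sum₂_mul, norm_mul]
  refine (mul_le_of_le_one_left (norm_nonneg _) (norm_sum_le_of_le zero_le_one fun j _ => ?_)).trans
    hxy
  exact norm_mul_le_of_le_one_right (norm_pow_le_one hx _) (norm_pow_le_one hy _)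

/-- Teichmüller representatives. -/
lemma exists_pow_eq_self [CompleteSpace L] {q : ℕ} {ε : ℝ} (hε : ε < 1) (hq : ‖(q : L)‖ ≤ ε)
    {x : L} (hx : ‖x‖ ≤ 1) (hxq : ‖x ^ q - x‖ ≤ ε) :
    ∃ y : L, y ^ q = y ∧ ‖y‖ ≤ 1 ∧ ‖y - x‖ ≤ ε := by
  have hε0 : 0 ≤ ε := (norm_nonneg _).trans hq
  -- The representative is the limit of the iterated `q`-th powers, which form a Cauchy sequence by
  -- contraction.
  set f : ℕ → L := fun n => x ^ q ^ n with hf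
  have hf1 : ∀ n, f (n + 1) = f n ^ q := fun n => by rw [hf]; simp only; rw [pow_succ, pow_mul]
  have hfb : ∀ n, ‖f n‖ ≤ 1 := fun n => norm_pow_le_one hx _
  have hd : ∀ n, ‖f (n + 1) - f n‖ ≤ ε * ε ^ n := by
    intro n
    induction n with
    | zero => simpa [hf] using hxq
    | succ n ih =>
      have h1 : ‖f (n + 1) - f n‖ ≤ ε :=
        ih.trans (mul_le_of_le_one_right hε0 (pow_le_one₀ hε0 hε.le))
      have h2 := norm_pow_sub_pow_le (hfb (n + 1)) (hfb n) hq h1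
      rw [← hf1, ← hf1] at h2
      calc _ ≤ ε * ‖f (n + 1) - f n‖ := h2
        _ ≤ ε * (ε * ε ^ n) := by gcongr
        _ = ε * ε ^ (n + 1) := by ring
  have hc : CauchySeq f := cauchySeq_of_le_geometric ε ε hε fun n => by
    rw [dist_comm, dist_eq_norm]; exact hd n
  obtain ⟨y, hy⟩ := cauchySeq_tendsto_of_complete hc
  have hfx : ∀ n, ‖f n - x‖ ≤ ε := by
    intro n
    induction n with
    | zero => simpa [hf] using hε0
    | succ n ih =>
      have : f (n + 1) - x = (f (n + 1) - f n) + (f n - x) := by ring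
      rw [this]
      exact norm_add_le_of_le
        ((hd n).trans (mul_le_of_le_one_right hε0 (pow_le_one₀ hε0 hε.le))) ih
  refine ⟨y, ?_, le_of_tendsto' hy.norm hfb, le_of_tendsto' (hy.sub_const x).norm hfx⟩
  have h1 : Filter.Tendsto (fun n => f (n + 1)) Filter.atTop (nhds (y ^ q)) := by
    simp only [hf1]; exact hy.pow q
  exact tendsto_nhds_unique h1 ((Filter.tendsto_add_atTop_iff_nat 1).2 hy)

end residueField

section localField

variable {p : ℕ} [Fact p.Prime] {F C : Type*}
  [NormedField F] [IsUltrametricDist F] [NormedAlgebra ℚ_[p] F] [FiniteDimensional ℚ_[p] F]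
  [NormedField C] [IsUltrametricDist C] [NormedAlgebra ℚ_[p] C] [FiniteDimensional ℚ_[p] C]

/-- Both norms are spectral norms over `ℚ_[p]`, hence determined by the minimal polynomial. -/
lemma norm_algHom (σ : F →ₐ[ℚ_[p]] C) (x : F) : ‖σ x‖ = ‖x‖ := by
  rw [NormedAlgebra.norm_eq_spectralNorm ℚ_[p] x, NormedAlgebra.norm_eq_spectralNorm ℚ_[p] (σ x),
    spectralNorm, spectralNorm, minpoly.algHom_eq σ σ.toRingHom.injective]

lemma norm_natCast_of_not_dvd (n : ℕ) (hn : ¬ p ∣ n) : ‖(n : F)‖ = 1 := by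
  have h1 : ‖(n : ℚ_[p])‖ = 1 := by
    rw [Padic.norm_natCast_eq_one_iff]
    exact ((Nat.Prime.coprime_iff_not_dvd Fact.out).2 hn)
  have h2 := norm_algebraMap' F (n : ℚ_[p])
  rwa [map_natCast, h1] at h2

lemma norm_prime_lt_one : ‖(p : F)‖ < 1 := by
  have h2 := norm_algebraMap' F (p : ℚ_[p])
  rw [map_natCast] at h2
  rw [h2]
  exact Padic.norm_p_lt_one

variable (p) in
/-- Teichmüller representatives of the residue field of `F`. -/
lemma exists_residueSystem {ϖ : F} (hϖ : IsUniformizer ϖ) :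
    ∃ (_ : Fintype (IsLocalRing.ResidueField (ringOfInt F)))
      (t : IsLocalRing.ResidueField (ringOfInt F) → F),
      ResidueSystem p (residueCard F) ϖ t ∧
      ∀ x : F, ‖x‖ ≤ 1 → ∃ i, ‖x - t i‖ < 1 := by
  have : ProperSpace F := FiniteDimensional.proper ℚ_[p] F
  have : Finite (IsLocalRing.ResidueField (ringOfInt F)) := finite_residueField
  let _ := Fintype.ofFinite (IsLocalRing.ResidueField (ringOfInt F))
  set q := residueCard F with hq
  have hcard : Fintype.card (IsLocalRing.ResidueField (ringOfInt F)) = q :=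
    (Nat.card_eq_fintype_card).symm
  have hp0 : ((p : ℕ) : IsLocalRing.ResidueField (ringOfInt F)) = 0 := by
    have : IsLocalRing.residue (ringOfInt F) (p : ringOfInt F) = IsLocalRing.residue _ 0 := by
      rw [residue_eq_iff]
      simpa using norm_prime_lt_one (p := p) (F := F)
    simpa using this
  have hchar : CharP (IsLocalRing.ResidueField (ringOfInt F)) p :=
    (CharP.charP_iff_prime_eq_zero Fact.out).2 hp0
  obtain ⟨f, -, hf⟩ := FiniteField.card (IsLocalRing.ResidueField (ringOfInt F)) p
  rw [hcard] at hf
  have hqn : ‖(q : F)‖ ≤ ‖ϖ‖ := by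
    refine hϖ.norm_le _ ?_
    rw [hf, Nat.cast_pow, norm_pow]
    exact pow_lt_one₀ (norm_nonneg _) norm_prime_lt_one f.pos.ne'
  have hex : ∀ x : IsLocalRing.ResidueField (ringOfInt F), ∃ y : ringOfInt F,
      IsLocalRing.residue _ y = x ∧ (y : F) ^ q = y := by
    intro x
    obtain ⟨z, rfl⟩ := IsLocalRing.residue_surjective x
    have h1 : IsLocalRing.residue _ (z ^ q) = IsLocalRing.residue (ringOfInt F) z := by
      rw [map_pow, ← hcard, FiniteField.pow_card]
    rw [residue_eq_iff] at h1
    obtain ⟨y, hy, hy1, hyz⟩ := exists_pow_eq_self hϖ.norm_lt_one hqn (mem_ringOfInt.1 z.2)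
      (hϖ.norm_le _ h1)
    exact ⟨⟨y, mem_ringOfInt.2 hy1⟩, residue_eq_iff.2 (hyz.trans_lt hϖ.norm_lt_one), hy⟩
  choose t ht htq using hex
  refine ⟨inferInstance, fun i => t i, ?_, ?_⟩
  · refine ⟨Fact.out, hcard, ⟨f, f.pos, hf⟩, htq, ⟨fun i => mem_ringOfInt.1 (t i).2, ?_⟩,
      norm_pos_iff.2 hϖ.ne_zero, hϖ.norm_lt_one, hϖ.norm_le _ norm_prime_lt_one,
      norm_natCast_of_not_dvd⟩
    intro i j hij
    have h1 : ¬ ‖(t i : F) - t j‖ < 1 := fun h => hij (by rw [← ht i, ← ht j, residue_eq_iff.2 h])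
    exact le_antisymm (norm_sub_le_of_le (mem_ringOfInt.1 (t i).2) (mem_ringOfInt.1 (t j).2))
      (not_lt.1 h1)
  · intro x hx
    refine ⟨IsLocalRing.residue _ ⟨x, mem_ringOfInt.2 hx⟩, ?_⟩
    have := residue_eq_iff.1 (ht (IsLocalRing.residue _ ⟨x, mem_ringOfInt.2 hx⟩)).symm
    exact this

lemma ResidueSystem.map {I : Type*} [Fintype I] {q : ℕ} {w : F} {t : I → F}
    (S : ResidueSystem p q w t) (σ : F →ₐ[ℚ_[p]] C) :
    ResidueSystem p q (σ w) (fun i => σ (t i)) where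
  prime := S.prime
  card := S.card
  prime_pow := S.prime_pow
  pow_eq i := by rw [← map_pow, S.pow_eq]
  spread := ⟨fun i => by rw [norm_algHom]; exact S.spread.le_one i,
    fun i j hij => by rw [← map_sub, norm_algHom]; exact S.spread.sub i j hij⟩
  w_pos := by rw [norm_algHom]; exact S.w_pos
  w_lt := by rw [norm_algHom]; exact S.w_lt
  p_le := by rw [norm_algHom, ← map_natCast σ, norm_algHom]; exact S.p_le
  norm_unit := norm_natCast_of_not_dvd

end localField

end BreuilSchneider

end

/-! ### From conditions on `v_F` to conditions on norms. -/

noncomputable section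

namespace BreuilSchneider

section valuation

variable {F C : Type*} [NormedField F] [NormedField C] {ϖ : F}

lemma natCast_le_vF_iff (hϖ : IsUniformizer ϖ) {a : C} {n : ℕ} :
    (n : EReal) ≤ vF ϖ a ↔ ‖a‖ ≤ ‖ϖ‖ ^ n := by
  have hp := norm_pos_iff.2 hϖ.ne_zero
  unfold vF
  split_ifs with ha
  · simp [ha]
  · have ha0 := norm_pos_iff.2 ha
    have h : (n : EReal) = ((n : ℝ) : EReal) := rfl
    rw [h, EReal.coe_le_coe_iff, le_div_iff_of_neg (Real.log_neg hp hϖ.norm_lt_one),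
      ← Real.log_pow, Real.log_le_log_iff ha0 (pow_pos hp n)]

lemma vF_le_natCast_iff (hϖ : IsUniformizer ϖ) {a : C} {n : ℕ} :
    vF ϖ a ≤ (n : EReal) ↔ ‖ϖ‖ ^ n ≤ ‖a‖ := by
  have hp := norm_pos_iff.2 hϖ.ne_zero
  have h : (n : EReal) = ((n : ℝ) : EReal) := rfl
  unfold vF
  split_ifs with ha
  · rw [ha, norm_zero, h]
    exact iff_of_false (by rw [top_le_iff]; exact EReal.coe_ne_top _) (not_le.2 (pow_pos hp n))
  · have ha0 := norm_pos_iff.2 ha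
    rw [h, EReal.coe_le_coe_iff, div_le_iff_of_neg (Real.log_neg hp hϖ.norm_lt_one),
      ← Real.log_pow, Real.log_le_log_iff (pow_pos hp n) ha0]

lemma pow_succ_le_of_vF (hϖ : IsUniformizer ϖ) {a : C} {r : ℕ}
    (h : 2 * vF ϖ a - 1 ≤ (r : EReal)) : ‖ϖ‖ ^ (r + 1) ≤ ‖a‖ ^ 2 := by
  have hp := norm_pos_iff.2 hϖ.ne_zero
  have hr : (r : EReal) = ((r : ℝ) : EReal) := rfl
  unfold vF at h
  split_ifs at h with ha
  -- The case `a = 0` is contradictory, because its valuation is infinite.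
  · rw [hr, EReal.mul_top_of_pos (by norm_num)] at h
    exact absurd h (by rw [← EReal.coe_one, EReal.top_sub_coe, top_le_iff]; exact EReal.coe_ne_top _)
  · have ha0 := norm_pos_iff.2 ha
    have h2 : (2 : EReal) = ((2 : ℝ) : EReal) := rfl
    rw [h2, hr, ← EReal.coe_one, ← EReal.coe_mul, ← EReal.coe_sub, EReal.coe_le_coe_iff,
      sub_le_iff_le_add, ← mul_div_assoc, div_le_iff_of_neg (Real.log_neg hp hϖ.norm_lt_one)] at h
    rw [← Real.log_le_log_iff (pow_pos hp _) (pow_pos ha0 _), Real.log_pow, Real.log_pow]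
    push_cast
    exact h

end valuation

section localField

variable {p : ℕ} [Fact p.Prime] {F C : Type*}
  [NormedField F] [IsUltrametricDist F] [NormedAlgebra ℚ_[p] F] [FiniteDimensional ℚ_[p] F]
  [NormedField C] [IsUltrametricDist C] [NormedAlgebra ℚ_[p] C] [FiniteDimensional ℚ_[p] C]

lemma exists_cone_bound {ϖ : F} (hϖ : IsUniformizer ϖ) (σ : F →ₐ[ℚ_[p]] C)
    {q e d r k : ℕ} (he : (e : ℤ) = ord ϖ (p : F)) (hk0 : 0 < k)
    (hk : k = d * q + r) (hr : r < q) (a : C)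
    (hcond :
      ((k : ℝ) ≤ (q : ℝ) ^ 2 / 2 ∧ (r : ℤ) < (q : ℤ) - d ∧ 0 ≤ vF ϖ a ∧ vF ϖ a ≤ 1) ∨
      ((k : ℝ) ≤ (q : ℝ) ^ 2 / 2 ∧ 2 * vF ϖ a - 1 ≤ (r : EReal) ∧
        (r : ℤ) < (q : ℤ) - d ∧ 1 ≤ vF ϖ a ∧ vF ϖ a ≤ (e : EReal)) ∨
      ((k : ℝ) ≤ min ((p : ℝ) * q - 1) ((q : ℝ) ^ 2 / 2) ∧ (d : ℤ) - 1 ≤ r ∧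
        (d : EReal) ≤ vF ϖ a)) {I : Type*} [Fintype I] {t : I → C}
    (S : ResidueSystem p q (σ ϖ) t) :
    ∃ B : ℝ, ∀ P : List I → Polynomial C, ConeSolution k (σ ϖ) a t P → ∀ u, Bd B (P u) := by
  have hkq : (k : ℝ) ≤ (q : ℝ) ^ 2 / 2 := by
    rcases hcond with h | h | h
    · exact h.1
    · exact h.1
    · exact h.1.trans (min_le_right _ _)
  have hkq' : 2 * k ≤ q ^ 2 := by
    have : (2 : ℝ) * k ≤ (q : ℝ) ^ 2 := by linarith
    exact_mod_cast this
  have hpC : ‖(p : C)‖ = ‖σ ϖ‖ ^ e := by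
    have hp0 : (p : F) ≠ 0 := by
      have := (map_ne_zero (algebraMap ℚ_[p] F)).2
        (Nat.cast_ne_zero.2 (Fact.out : p.Prime).ne_zero : (p : ℚ_[p]) ≠ 0)
      rwa [map_natCast] at this
    rw [← map_natCast σ, norm_algHom, norm_algHom, norm_eq_zpow_ord hϖ hp0, ← he, zpow_natCast]
  have h0 : (0 : EReal) = ((0 : ℕ) : EReal) := by simp
  have h1 : (1 : EReal) = ((1 : ℕ) : EReal) := by simp
  refine S.exists_bd hpC hk hr hk0 hkq' ?_
  rcases hcond with ⟨-, hdr, ha0, ha1⟩ | ⟨-, hra, hdr, ha1, hae⟩ | ⟨hkp, hdr, had⟩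
  · rw [h0, natCast_le_vF_iff hϖ, pow_zero] at ha0
    rw [h1, vF_le_natCast_iff hϖ, pow_one] at ha1
    exact Or.inl ⟨by omega, by rwa [norm_algHom], ha0⟩
  · rw [h1, natCast_le_vF_iff hϖ, pow_one] at ha1
    rw [vF_le_natCast_iff hϖ] at hae
    refine Or.inr (Or.inl ⟨by omega, ?_⟩)
    rw [norm_algHom]
    exact ⟨hae, ha1, pow_succ_le_of_vF hϖ hra⟩
  · rw [natCast_le_vF_iff hϖ] at had
    refine Or.inr (Or.inr ⟨?_, by omega, by rwa [norm_algHom]⟩)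
    have h := hkp.trans (min_le_left _ _)
    have : (k : ℝ) < (p : ℝ) * q := by linarith
    exact_mod_cast this

end localField

end BreuilSchneider

end

/-! ### Triangular matrices, distances in the tree and the Cartan decomposition. -/

noncomputable section

namespace BreuilSchneider

section triangular

variable {F : Type*} [Field F]

/-- The matrix `(a b; 0 d)`. -/
def tri (a : Fˣ) (b : F) (d : Fˣ) : GL (Fin 2) F where
  val := !![(a : F), b; 0, (d : F)]
  inv := !![((a⁻¹ : Fˣ) : F), -((a⁻¹ : Fˣ) : F) * b * ((d⁻¹ : Fˣ) : F); 0, ((d⁻¹ : Fˣ) : F)]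
  val_inv := by
    ext i j
    fin_cases i <;> fin_cases j <;> simp [Matrix.mul_apply, Fin.sum_univ_two, mul_assoc]
  inv_val := by
    ext i j
    fin_cases i <;> fin_cases j <;> simp [Matrix.mul_apply, Fin.sum_univ_two]

lemma coe_tri (a : Fˣ) (b : F) (d : Fˣ) :
    (tri a b d : Matrix (Fin 2) (Fin 2) F) = !![(a : F), b; 0, (d : F)] := rfl

lemma tri_mul (a a' : Fˣ) (b b' : F) (d d' : Fˣ) :
    tri a b d * tri a' b' d' = tri (a * a') (a * b' + b * d') (d * d') := by
  refine Units.ext ?_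
  rw [Units.val_mul, coe_tri, coe_tri, coe_tri]
  ext i j
  fin_cases i <;> fin_cases j <;> simp [Matrix.mul_apply, Fin.sum_univ_two]

lemma tri_one : tri (1 : Fˣ) 0 1 = 1 := by
  refine Units.ext ?_
  rw [coe_tri]
  ext i j
  fin_cases i <;> fin_cases j <;> simp

lemma tri_inv (a : Fˣ) (b : F) (d : Fˣ) :
    (tri a b d)⁻¹ = tri a⁻¹ (-((a⁻¹ : Fˣ) : F) * b * ((d⁻¹ : Fˣ) : F)) d⁻¹ := Units.ext rfl

lemma det_tri (a : Fˣ) (b : F) (d : Fˣ) :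
    (tri a b d : Matrix (Fin 2) (Fin 2) F).det = a * d := by
  rw [coe_tri, Matrix.det_fin_two_of, mul_zero, sub_zero]

lemma tri_scalar_mem_center (a : Fˣ) : tri a 0 a ∈ Subgroup.center (GL (Fin 2) F) := by
  rw [Matrix.GeneralLinearGroup.mem_center_iff_val_mem_range_scalar]
  refine ⟨a, ?_⟩
  change _ = !![(a : F), 0; 0, (a : F)]
  ext i j
  fin_cases i <;> fin_cases j <;> simp

lemma tri_scalar_comm (a : Fˣ) (g : GL (Fin 2) F) : tri a 0 a * g = g * tri a 0 a :=
  (Subgroup.mem_center_iff.1 (tri_scalar_mem_center a) g).symm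

lemma exists_tri_of_mem_center {z : GL (Fin 2) F} (hz : z ∈ Subgroup.center (GL (Fin 2) F)) :
    ∃ a : Fˣ, z = tri a 0 a := by
  rw [Matrix.GeneralLinearGroup.mem_center_iff_val_mem_range_scalar] at hz
  obtain ⟨a, ha⟩ := hz
  have hdet : (z : Matrix (Fin 2) (Fin 2) F).det ≠ 0 := z.det.ne_zero
  have ha0 : a ≠ 0 := by
    rintro rfl
    rw [← ha] at hdet
    simp at hdet
  refine ⟨Units.mk0 a ha0, Units.ext ?_⟩
  rw [← ha, coe_tri]
  ext i j
  fin_cases i <;> fin_cases j <;> simp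

end triangular

section localGroup

variable {F : Type*} [NormedField F] [IsUltrametricDist F]

variable (F) in
/-- `GL₂` of the ring of integers. -/
abbrev maxCompact : Subgroup (GL (Fin 2) F) :=
  (Matrix.GeneralLinearGroup.map (n := Fin 2) (ringOfInt F).subtype).range

lemma maxCompact_le_KZ : maxCompact F ≤ KZ F := le_sup_left

lemma tri_scalar_mem_KZ (a : Fˣ) : tri a 0 a ∈ KZ F :=
  (le_sup_right : Subgroup.center _ ≤ KZ F) (tri_scalar_mem_center a)

lemma exists_of_mem_KZ {g : GL (Fin 2) F} (hg : g ∈ KZ F) :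
    ∃ (a : Fˣ) (k : GL (Fin 2) F), k ∈ maxCompact F ∧ g = tri a 0 a * k := by
  obtain ⟨k, hk, z, hz, rfl⟩ := Subgroup.mem_sup_of_normal_right.1 hg
  obtain ⟨a, rfl⟩ := exists_tri_of_mem_center hz
  exact ⟨a, k, hk, (tri_scalar_comm a k).symm⟩

lemma tri_mem_maxCompact {a d : Fˣ} {b : F} (ha : ‖(a : F)‖ = 1) (hb : ‖b‖ ≤ 1)
    (hd : ‖(d : F)‖ = 1) : tri a b d ∈ maxCompact F := by
  refine mem_K_of_norm_le ?_ (by rw [det_tri, norm_mul, ha, hd, mul_one])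
  intro i j
  rw [coe_tri]
  fin_cases i <;> fin_cases j <;> simp [ha, hb, hd]

/-- The largest norm of an entry. -/
def entryNorm (g : GL (Fin 2) F) : ℝ :=
  max (max ‖g 0 0‖ ‖g 0 1‖) (max ‖g 1 0‖ ‖g 1 1‖)

lemma norm_le_entryNorm (g : GL (Fin 2) F) (i j : Fin 2) : ‖g i j‖ ≤ entryNorm g := by
  unfold entryNorm
  fin_cases i <;> fin_cases j <;> simp

lemma entryNorm_le {g : GL (Fin 2) F} {c : ℝ} (h : ∀ i j, ‖g i j‖ ≤ c) : entryNorm g ≤ c :=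
  max_le (max_le (h 0 0) (h 0 1)) (max_le (h 1 0) (h 1 1))

lemma entryNorm_nonneg (g : GL (Fin 2) F) : 0 ≤ entryNorm g :=
  (norm_nonneg _).trans (norm_le_entryNorm g 0 0)

lemma entryNorm_mul_le_of_left {g k : GL (Fin 2) F} (hk : ∀ i j, ‖k i j‖ ≤ 1) :
    entryNorm (k * g) ≤ entryNorm g := by
  refine entryNorm_le fun i j => ?_
  rw [Matrix.GeneralLinearGroup.coe_mul, Matrix.mul_apply]
  refine norm_sum_le_of_le (entryNorm_nonneg g) fun l _ => ?_
  rw [norm_mul]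
  exact (mul_le_of_le_one_left (norm_nonneg _) (hk i l)).trans (norm_le_entryNorm g l j)

lemma entryNorm_mul_le_of_right {g k : GL (Fin 2) F} (hk : ∀ i j, ‖k i j‖ ≤ 1) :
    entryNorm (g * k) ≤ entryNorm g := by
  refine entryNorm_le fun i j => ?_
  rw [Matrix.GeneralLinearGroup.coe_mul, Matrix.mul_apply]
  refine norm_sum_le_of_le (entryNorm_nonneg g) fun l _ => ?_
  exact norm_mul_le_of_le_one_right (norm_le_entryNorm g i l) (hk l j)

/-- The exponential of the distance, in the tree of `PGL₂(F)`, of the vertices defined by `g`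
and `1`. -/
def radius (g : GL (Fin 2) F) : ℝ :=
  entryNorm g ^ 2 / ‖(g : Matrix (Fin 2) (Fin 2) F).det‖

lemma norm_det_pos (g : GL (Fin 2) F) : 0 < ‖(g : Matrix (Fin 2) (Fin 2) F).det‖ :=
  norm_pos_iff.2 g.det.ne_zero

lemma radius_mul_left {k : GL (Fin 2) F} (hk : k ∈ KZ F) (g : GL (Fin 2) F) :
    radius (k * g) = radius g := by
  obtain ⟨a, k, hkK, rfl⟩ := exists_of_mem_KZ hk
  have h1 : ∀ k ∈ maxCompact F, ∀ g, radius (k * g) = radius g := by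
    intro k hk g
    have h2 : entryNorm (k * g) = entryNorm g := by
      refine le_antisymm (entryNorm_mul_le_of_left (norm_le_one_of_mem_K hk)) ?_
      have := entryNorm_mul_le_of_left (g := k * g) (norm_le_one_of_mem_K (inv_mem hk))
      rwa [inv_mul_cancel_left] at this
    rw [radius, radius, h2, Matrix.GeneralLinearGroup.coe_mul, Matrix.det_mul, norm_mul,
      norm_det_of_mem_K hk, one_mul]
  have h2 : ∀ g, radius (tri a 0 a * g) = radius g := by
    intro g
    have ha := norm_pos_iff.2 a.ne_zero
    have hent : ∀ i j, (tri a 0 a * g) i j = a * g i j := by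
      intro i j
      rw [Matrix.GeneralLinearGroup.coe_mul, coe_tri]
      fin_cases i <;> fin_cases j <;> simp [Matrix.mul_apply, Fin.sum_univ_two]
    have h3 : entryNorm (tri a 0 a * g) = ‖(a : F)‖ * entryNorm g := by
      unfold entryNorm
      simp only [hent, norm_mul]
      rw [mul_max_of_nonneg _ _ ha.le, mul_max_of_nonneg _ _ ha.le, mul_max_of_nonneg _ _ ha.le]
    rw [radius, radius, h3, Matrix.GeneralLinearGroup.coe_mul, Matrix.det_mul, norm_mul,
      det_tri, norm_mul]
    have := norm_det_pos g
    field_simp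
  rw [mul_assoc, h2, h1 k hkK]

lemma radius_mul_right {k : GL (Fin 2) F} (hk : k ∈ KZ F) (g : GL (Fin 2) F) :
    radius (g * k) = radius g := by
  obtain ⟨a, k, hkK, rfl⟩ := exists_of_mem_KZ hk
  have h2 : ∀ g, entryNorm (g * k) = entryNorm g := fun g => by
    refine le_antisymm (entryNorm_mul_le_of_right (norm_le_one_of_mem_K hkK)) ?_
    have := entryNorm_mul_le_of_right (g := g * k) (norm_le_one_of_mem_K (inv_mem hkK))
    rwa [mul_inv_cancel_right] at this
  have h3 : ∀ g, radius (g * k) = radius g := fun g => by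
    rw [radius, radius, h2, Matrix.GeneralLinearGroup.coe_mul, Matrix.det_mul, norm_mul,
      norm_det_of_mem_K hkK, mul_one]
  rw [← mul_assoc, h3, ← tri_scalar_comm, radius_mul_left (tri_scalar_mem_KZ a)]

lemma radius_tri (a d : Fˣ) (b : F) :
    radius (tri a b d) = max (max ‖(a : F)‖ ‖b‖) ‖(d : F)‖ ^ 2 / (‖(a : F)‖ * ‖(d : F)‖) := by
  rw [radius, det_tri, norm_mul, entryNorm, coe_tri]
  simp

lemma radius_one : radius (1 : GL (Fin 2) F) = 1 := by
  rw [← tri_one, radius_tri]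
  simp

lemma radius_of_mem_KZ {k : GL (Fin 2) F} (hk : k ∈ KZ F) : radius k = 1 := by
  rw [← mul_one k, radius_mul_left hk, radius_one]

end localGroup

section cartan

variable {F : Type*} [NormedField F] [IsUltrametricDist F] {ϖ : Fˣ} (hϖ : IsUniformizer (ϖ : F))

lemma swap_mem_maxCompact : ∃ s ∈ maxCompact F,
    (s : Matrix (Fin 2) (Fin 2) F) = !![0, 1; 1, 0] := by
  refine ⟨Matrix.GeneralLinearGroup.mkOfDetNeZero !![0, 1; 1, 0] (by simp), ?_, rfl⟩
  refine mem_K_of_norm_le ?_ ?_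
  · intro i j
    change ‖(!![0, 1; 1, 0] : Matrix (Fin 2) (Fin 2) F) i j‖ ≤ 1
    fin_cases i <;> fin_cases j <;> simp
  · change ‖(!![0, 1; 1, 0] : Matrix (Fin 2) (Fin 2) F).det‖ = 1
    simp

/-- A lower unipotent matrix. -/
lemma exists_lower {x : F} (hx : ‖x‖ ≤ 1) : ∃ s ∈ maxCompact F,
    (s : Matrix (Fin 2) (Fin 2) F) = !![1, 0; x, 1] := by
  refine ⟨Matrix.GeneralLinearGroup.mkOfDetNeZero !![1, 0; x, 1] (by simp), ?_, rfl⟩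
  refine mem_K_of_norm_le ?_ ?_
  · intro i j
    change ‖(!![1, 0; x, 1] : Matrix (Fin 2) (Fin 2) F) i j‖ ≤ 1
    fin_cases i <;> fin_cases j <;> simp [hx]
  · change ‖(!![1, 0; x, 1] : Matrix (Fin 2) (Fin 2) F).det‖ = 1
    simp

include hϖ

lemma exists_unit_mul_zpow (x : Fˣ) : ∃ u : Fˣ, ‖(u : F)‖ = 1 ∧ x = u * ϖ ^ ord (ϖ : F) (x : F) := by
  refine ⟨x * (ϖ ^ ord (ϖ : F) (x : F))⁻¹, ?_, by group⟩
  have h := norm_eq_zpow_ord hϖ x.ne_zero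
  have h0 : (0 : ℝ) < ‖(ϖ : F)‖ ^ ord (ϖ : F) (x : F) := zpow_pos (norm_pos_iff.2 ϖ.ne_zero) _
  rw [Units.val_mul, norm_mul, ← zpow_neg, Units.val_zpow_eq_zpow_val, norm_zpow, zpow_neg, h,
    mul_inv_cancel₀ h0.ne']

/-- The Cartan decomposition. -/
lemma cartan (g : GL (Fin 2) F) : ∃ κ ∈ KZ F, ∃ n : ℕ, ∃ k ∈ maxCompact F,
    g = κ * tri (ϖ⁻¹ ^ n) 0 1 * k := by
  have hp := norm_pos_iff.2 ϖ.ne_zero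
  -- If the upper left entry is the largest, its row and column are cleared by integral unipotent
  -- matrices.
  have key : ∀ g : GL (Fin 2) F, (∀ i j, ‖g i j‖ ≤ ‖g 0 0‖) → ∃ κ ∈ KZ F, ∃ n : ℕ,
      ∃ k ∈ maxCompact F, g = κ * tri (ϖ⁻¹ ^ n) 0 1 * k := by
    intro g hg
    have ha : g 0 0 ≠ 0 := by
      intro h0
      have h1 : ∀ i j, g i j = 0 := fun i j => by
        have := hg i j
        rw [h0, norm_zero] at this
        exact norm_le_zero_iff.1 this
      apply g.det.ne_zero
      change (g : Matrix (Fin 2) (Fin 2) F).det = 0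
      rw [Matrix.det_fin_two, h1, h1 0 1]
      simp
    have ha0 := norm_pos_iff.2 ha
    have hdet : (g : Matrix (Fin 2) (Fin 2) F).det ≠ 0 := g.det.ne_zero
    rw [Matrix.det_fin_two] at hdet
    have hd : g 1 1 - g 0 1 * g 1 0 / g 0 0 ≠ 0 := by
      intro h
      apply hdet
      field_simp at h
      linear_combination h
    have hdn : ‖g 1 1 - g 0 1 * g 1 0 / g 0 0‖ ≤ ‖g 0 0‖ := by
      refine norm_sub_le_of_le (hg 1 1) ?_
      rw [norm_div, norm_mul, div_le_iff₀ ha0]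
      exact mul_le_mul (hg 0 1) (hg 1 0) (norm_nonneg _) ha0.le
    obtain ⟨s, hs, hsv⟩ := exists_lower (F := F) (x := g 1 0 / g 0 0)
      (by rw [norm_div]; exact div_le_one_of_le₀ (hg 1 0) ha0.le)
    set a := Units.mk0 _ ha
    set d := Units.mk0 _ hd
    -- As `‖d‖ ≤ ‖a‖`, the valuation of `a / d` is `-n` for a natural number `n`; the scalar `d`
    -- goes to the left factor and the unit `u` to the right one.
    obtain ⟨u, hu, hau⟩ := exists_unit_mul_zpow hϖ (a * d⁻¹)
    have hn : ord (ϖ : F) ((a * d⁻¹ : Fˣ) : F) ≤ 0 := by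
      by_contra! h
      have h1 := norm_eq_zpow_ord hϖ (a * d⁻¹).ne_zero
      have h2 : ‖((a * d⁻¹ : Fˣ) : F)‖ < 1 := by
        rw [h1]
        exact zpow_lt_one₀ hp hϖ.norm_lt_one h
      rw [Units.val_mul, norm_mul, Units.val_inv_eq_inv_val, norm_inv, ← div_eq_mul_inv,
        div_lt_one (norm_pos_iff.2 d.ne_zero)] at h2
      exact absurd h2 (not_lt.2 hdn)
    obtain ⟨n, hn'⟩ : ∃ n : ℕ, ord (ϖ : F) ((a * d⁻¹ : Fˣ) : F) = -n :=
      ⟨_, (by rw [Int.toNat_of_nonneg (neg_nonneg.2 hn), neg_neg] :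
        _ = -((-ord (ϖ : F) ((a * d⁻¹ : Fˣ) : F)).toNat : ℤ))⟩
    refine ⟨s * tri d 0 d, mul_mem (maxCompact_le_KZ hs) (tri_scalar_mem_KZ d), n,
      tri u (u * (g 0 1 / g 0 0)) 1, tri_mem_maxCompact hu ?_ (by simp), ?_⟩
    · rw [norm_mul, hu, one_mul, norm_div]
      exact div_le_one_of_le₀ (hg 0 1) ha0.le
    · have had : a = d * (ϖ⁻¹ ^ n) * u := by
        have h3 : ϖ⁻¹ ^ n = ϖ ^ (-(n : ℤ)) := by simp
        rw [hn'] at hau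
        rw [h3, mul_assoc, mul_comm _ u, ← hau, mul_comm a, mul_inv_cancel_left]
      rw [mul_assoc, mul_assoc, tri_mul, tri_mul]
      refine Units.ext ?_
      rw [Units.val_mul, hsv, coe_tri]
      have had' : ((d * (ϖ⁻¹ ^ n * u) : Fˣ) : F) = g 0 0 := by
        rw [← mul_assoc, ← had]; rfl
      have hdv : ((d * (1 * 1) : Fˣ) : F) = g 1 1 - g 0 1 * g 1 0 / g 0 0 := by
        rw [mul_one, mul_one]; rfl
      have hb : (d : F) * (((ϖ⁻¹ ^ n : Fˣ) : F) * (u * (g 0 1 / g 0 0)) + 0 * ((1 : Fˣ) : F)) +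
          0 * ((1 * 1 : Fˣ) : F) = g 0 1 := by
        have : (d : F) * (((ϖ⁻¹ ^ n : Fˣ) : F) * (u * (g 0 1 / g 0 0)) + 0 * ((1 : Fˣ) : F)) +
          0 * ((1 * 1 : Fˣ) : F) = ((d * (ϖ⁻¹ ^ n * u) : Fˣ) : F) * (g 0 1 / g 0 0) := by
          push_cast; ring
        rw [this, had']
        field_simp
      rw [had', hdv, hb]
      ext i j
      fin_cases i <;> fin_cases j
      · simp [Matrix.mul_apply, Fin.sum_univ_two]
      · simp [Matrix.mul_apply, Fin.sum_univ_two]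
      · simp [Matrix.mul_apply, Fin.sum_univ_two, ha]
      · simp only [Fin.mk_one, Fin.isValue, Matrix.mul_apply, Fin.sum_univ_two, Matrix.of_apply,
          Matrix.cons_val', Matrix.cons_val_zero, Matrix.cons_val_one, Matrix.cons_val_fin_one]
        field_simp
        ring
  -- Swapping rows and columns moves a largest entry to the upper left corner.
  have hpre : ∀ (s t g : GL (Fin 2) F), s ∈ maxCompact F → t ∈ maxCompact F →
      (∃ κ ∈ KZ F, ∃ n : ℕ, ∃ k ∈ maxCompact F, s * g * t = κ * tri (ϖ⁻¹ ^ n) 0 1 * k) →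
      ∃ κ ∈ KZ F, ∃ n : ℕ, ∃ k ∈ maxCompact F, g = κ * tri (ϖ⁻¹ ^ n) 0 1 * k := by
    rintro s t g hs ht ⟨κ, hκ, n, k, hk, h⟩
    refine ⟨s⁻¹ * κ, mul_mem (inv_mem (maxCompact_le_KZ hs)) hκ, n, k * t⁻¹,
      mul_mem hk (inv_mem ht), ?_⟩
    have : g = s⁻¹ * (s * g * t) * t⁻¹ := by group
    rw [this, h]
    group
  obtain ⟨s, hs, hsv⟩ := swap_mem_maxCompact (F := F)
  have hsg : ∀ (g : GL (Fin 2) F) i j, (s * g) i j = g (1 - i) j := fun g i j => by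
    rw [Matrix.GeneralLinearGroup.coe_mul, hsv]
    fin_cases i <;> fin_cases j <;> simp [Matrix.mul_apply, Fin.sum_univ_two]
  have hgs : ∀ (g : GL (Fin 2) F) i j, (g * s) i j = g i (1 - j) := fun g i j => by
    rw [Matrix.GeneralLinearGroup.coe_mul, hsv]
    fin_cases i <;> fin_cases j <;> simp [Matrix.mul_apply, Fin.sum_univ_two]
  obtain ⟨ij, hij⟩ := Finite.exists_max fun ij : Fin 2 × Fin 2 => ‖g ij.1 ij.2‖
  obtain ⟨i₀, j₀⟩ := ij
  have hm : ∀ i j, ‖g i j‖ ≤ ‖g i₀ j₀‖ := fun i j => hij (i, j)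
  rcases Fin.exists_fin_two.1 ⟨i₀, rfl⟩ with rfl | rfl <;>
    rcases Fin.exists_fin_two.1 ⟨j₀, rfl⟩ with rfl | rfl
  · exact key g hm
  · refine hpre 1 s g (one_mem _) hs (key _ fun i j => ?_)
    rw [one_mul, hgs, hgs]
    exact hm _ _
  · refine hpre s 1 g hs (one_mem _) (key _ fun i j => ?_)
    rw [mul_one, hsg, hsg]
    exact hm _ _
  · refine hpre s s g hs hs (key _ fun i j => ?_)
    rw [hgs, hgs, hsg, hsg]
    exact hm _ _

end cartan

end BreuilSchneider

end

/-! ### Coset representatives of the Hecke operator and finiteness of balls. -/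

noncomputable section

namespace BreuilSchneider

section hecke

variable {C G V : Type*} [Field C] [Group G] [AddCommGroup V] [Module C V]

lemma HeckeKernel.operator_apply_eq_sum {H : Subgroup G} {ρ : Representation C G V}
    (φ : HeckeKernel H ρ) {O : Type*} [Fintype O] (x : O → G)
    (hinj : Function.Injective fun o => (x o : G ⧸ H))
    (hsupp : ∀ g, φ.toFun g ≠ 0 → ∃ o, (x o : G ⧸ H) = g) (f : compactInd H ρ) (g : G) :
    (φ.operator f).1 g = ∑ o, φ.toFun (x o) (f.1 ((x o)⁻¹ * g)) := by
  classical
  change ∑ᶠ y : G ⧸ H, φ.term f.1 g y = _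
  rw [finsum_eq_sum_of_support_subset (s := Finset.univ.image fun o => (x o : G ⧸ H)),
    Finset.sum_image hinj.injOn]
  · exact Finset.sum_congr rfl fun o _ => φ.term_mk f g (x o)
  · intro y hy
    have h : φ.toFun y.out ≠ 0 := fun h0 => hy (by simp [HeckeKernel.term, h0])
    obtain ⟨o, ho⟩ := hsupp _ h
    rw [Finset.coe_image, Finset.coe_univ, Set.image_univ]
    exact ⟨o, by rw [← QuotientGroup.out_eq' y]; exact ho⟩

end hecke

section doubleCoset

variable {F : Type*} [NormedField F] [IsUltrametricDist F] {ϖ : Fˣ} (hϖ : IsUniformizer (ϖ : F))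
  {I : Type*} {t : I → F}

/-- Representatives of the left cosets of `KZ` in `KZ α⁻¹ KZ`. -/
def heckeRep (ϖ : Fˣ) (t : I → F) : Option I → GL (Fin 2) F
  | none => tri 1 0 ϖ
  | some i => tri ϖ (t i) 1

include hϖ in
lemma alpha_eq : alpha hϖ = tri 1 0 ϖ := Units.ext rfl

lemma tri_eq_alpha_inv (x : F) : tri ϖ x 1 = tri ϖ (x * ϖ) ϖ * (alpha hϖ)⁻¹ := by
  rw [alpha_eq hϖ, tri_inv, tri_mul]
  simp

lemma heckeRep_mem (ht : ∀ i, ‖t i‖ ≤ 1) (o : Option I) :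
    heckeRep ϖ t o ∈ DoubleCoset.doubleCoset (alpha hϖ)⁻¹ (KZ F : Set (GL (Fin 2) F)) (KZ F) := by
  rcases o with _ | i
  · have := alpha_mem_doubleCoset hϖ
    rwa [alpha_eq hϖ] at this ⊢
  · refine DoubleCoset.mem_doubleCoset.2 ⟨tri ϖ (t i * ϖ) ϖ, ?_, 1, one_mem _, ?_⟩
    · have : tri ϖ (t i * ϖ) ϖ = tri ϖ 0 ϖ * tri 1 (t i) 1 := by
        rw [tri_mul]; simp [mul_comm]
      rw [this]
      exact mul_mem (tri_scalar_mem_KZ ϖ)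
        (maxCompact_le_KZ (tri_mem_maxCompact (by simp) (ht i) (by simp)))
    · rw [mul_one]
      exact tri_eq_alpha_inv hϖ (t i)

include hϖ

/-- The radius separates the cosets: it is one on `KZ`, but greater than one on the quotient of two
different representatives, which has an entry of norm at least `‖ϖ‖⁻¹` and determinant of norm one
up to centre. -/
lemma heckeRep_injective (hsp : ∀ i j, i ≠ j → ‖t i - t j‖ = 1) :
    Function.Injective fun o => (heckeRep ϖ t o : GL (Fin 2) F ⧸ KZ F) := by
  have hp := norm_pos_iff.2 ϖ.ne_zero
  have hp1 := hϖ.norm_lt_one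
  have hval : ∀ x : ℝ, ‖(ϖ : F)‖⁻¹ ≤ x → x ^ 2 / 1 ≠ 1 := by
    intro x hx h
    have h1 : 1 < x := ((one_lt_inv₀ hp).2 hp1).trans_le hx
    nlinarith
  have h1 : ∀ i j, i ≠ j → (tri ϖ (t i) 1)⁻¹ * tri ϖ (t j) 1 ∉ KZ F := by
    intro i j hij h
    have h2 := radius_of_mem_KZ h
    rw [tri_inv, tri_mul, radius_tri] at h2
    simp only [inv_mul_cancel, inv_one, Units.val_one, norm_one, mul_one] at h2
    refine hval _ ?_ h2
    refine le_trans (le_of_eq ?_) ((le_max_right _ _).trans (le_max_left _ _))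
    have : ((ϖ⁻¹ : Fˣ) : F) * t j + -((ϖ⁻¹ : Fˣ) : F) * t i = (ϖ : F)⁻¹ * (t j - t i) := by
      rw [Units.val_inv_eq_inv_val]; ring
    rw [this, norm_mul, hsp j i hij.symm, mul_one, norm_inv]
  have h2 : ∀ i, (tri ϖ (t i) 1)⁻¹ * tri 1 0 ϖ ∉ KZ F := by
    intro i h
    have h2 := radius_of_mem_KZ h
    rw [tri_inv, tri_mul, radius_tri] at h2
    simp only [mul_one, inv_one, one_mul, Units.val_one, Units.val_inv_eq_inv_val, norm_inv,
      inv_mul_cancel₀ hp.ne'] at h2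
    refine hval _ ?_ h2
    exact (le_max_left _ _).trans (le_max_left _ _)
  intro o o' h
  rw [QuotientGroup.eq] at h
  rcases o with _ | i <;> rcases o' with _ | j
  · rfl
  · have := inv_mem h
    rw [mul_inv_rev, inv_inv] at this
    exact absurd this (h2 j)
  · exact absurd h (h2 i)
  · by_contra hne
    exact h1 i j (fun hij => hne (by rw [hij])) h

/-- The cosets correspond to the points of the projective line over the residue field: the second
column of the integral matrix `k`, modulo `ϖ`, selects the representative. -/
lemma exists_heckeRep_eq (ht : ∀ i, ‖t i‖ ≤ 1)
    (hcov : ∀ x : F, ‖x‖ ≤ 1 → ∃ i, ‖x - t i‖ < 1) {g : GL (Fin 2) F}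
    (hg : g ∈ DoubleCoset.doubleCoset (alpha hϖ)⁻¹ (KZ F : Set (GL (Fin 2) F)) (KZ F)) :
    ∃ o, (heckeRep ϖ t o : GL (Fin 2) F ⧸ KZ F) = g := by
  have hp := norm_pos_iff.2 ϖ.ne_zero
  obtain ⟨x, hx, y, hy, rfl⟩ := DoubleCoset.mem_doubleCoset.1 hg
  obtain ⟨a, k, hk, rfl⟩ := exists_of_mem_KZ hx
  have hent := norm_le_one_of_mem_K hk
  have hdet := norm_det_of_mem_K hk
  have hred : ∀ o, (heckeRep ϖ t o)⁻¹ * (k * tri ϖ 0 1) ∈ maxCompact F →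
      (heckeRep ϖ t o : GL (Fin 2) F ⧸ KZ F) =
        ((tri a 0 a * k * (alpha hϖ)⁻¹ * y : GL (Fin 2) F) : GL (Fin 2) F ⧸ KZ F) := by
    intro o h
    rw [QuotientGroup.eq]
    have e : (heckeRep ϖ t o)⁻¹ * (tri a 0 a * k * (alpha hϖ)⁻¹ * y) =
        tri a 0 a * ((heckeRep ϖ t o)⁻¹ * (k * tri ϖ 0 1)) * tri ϖ⁻¹ 0 ϖ⁻¹ * y := by
      have h1 : (alpha hϖ)⁻¹ = tri ϖ 0 1 * tri ϖ⁻¹ 0 ϖ⁻¹ := by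
        rw [alpha_eq hϖ, tri_inv, tri_mul]; simp
      rw [h1, ← mul_assoc (tri a 0 a), tri_scalar_comm a (heckeRep ϖ t o)⁻¹]
      group
    rw [e]
    exact mul_mem (mul_mem (mul_mem (tri_scalar_mem_KZ a) (maxCompact_le_KZ h))
      (tri_scalar_mem_KZ _)) hy
  have hdetm : ∀ o, ‖(((heckeRep ϖ t o)⁻¹ * (k * tri ϖ 0 1) : GL (Fin 2) F) :
      Matrix (Fin 2) (Fin 2) F).det‖ = 1 := by
    intro o
    rw [Matrix.GeneralLinearGroup.coe_mul, Matrix.GeneralLinearGroup.coe_mul, Matrix.det_mul,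
      Matrix.det_mul, norm_mul, norm_mul, hdet, det_tri]
    rcases o with _ | i
    · change ‖((tri 1 0 ϖ)⁻¹ : GL (Fin 2) F).1.det‖ * _ = 1
      rw [tri_inv, det_tri]
      simp [hp.ne']
    · change ‖((tri ϖ (t i) 1)⁻¹ : GL (Fin 2) F).1.det‖ * _ = 1
      rw [tri_inv, det_tri]
      simp [hp.ne']
  by_cases hd : ‖k 1 1‖ < 1
  · refine ⟨none, hred _ (mem_K_of_norm_le ?_ (hdetm _))⟩
    have hv : (((heckeRep ϖ t none)⁻¹ * (k * tri ϖ 0 1) : GL (Fin 2) F) :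
        Matrix (Fin 2) (Fin 2) F) = !![ϖ * k 0 0, k 0 1; k 1 0, (ϖ : F)⁻¹ * k 1 1] := by
      change (((tri 1 0 ϖ)⁻¹ * (k * tri ϖ 0 1) : GL (Fin 2) F) : Matrix (Fin 2) (Fin 2) F) = _
      rw [tri_inv, Matrix.GeneralLinearGroup.coe_mul, Matrix.GeneralLinearGroup.coe_mul, coe_tri,
        coe_tri]
      ext i j
      fin_cases i <;> fin_cases j <;>
        simp [Matrix.mul_apply, Matrix.vecMul, dotProduct, Fin.sum_univ_two, mul_comm]
    intro i j
    rw [hv]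
    fin_cases i <;> fin_cases j
    · simpa using mul_le_one₀ hϖ.norm_lt_one.le (norm_nonneg _) (hent 0 0)
    · simpa using hent 0 1
    · simpa using hent 1 0
    · simpa using (inv_mul_le_one₀ hp).2 (hϖ.norm_le _ hd)
  · have hd1 : ‖k 1 1‖ = 1 := le_antisymm (hent 1 1) (not_lt.1 hd)
    have hd0 : k 1 1 ≠ 0 := by
      intro h0; rw [h0, norm_zero] at hd1; exact zero_ne_one hd1
    obtain ⟨i, hi⟩ := hcov (k 0 1 / k 1 1) (by rw [norm_div, hd1, div_one]; exact hent 0 1)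
    refine ⟨some i, hred _ (mem_K_of_norm_le ?_ (hdetm _))⟩
    have hv : (((heckeRep ϖ t (some i))⁻¹ * (k * tri ϖ 0 1) : GL (Fin 2) F) :
        Matrix (Fin 2) (Fin 2) F) =
        !![k 0 0 - t i * k 1 0, (ϖ : F)⁻¹ * ((k 0 1 / k 1 1 - t i) * k 1 1);
          ϖ * k 1 0, k 1 1] := by
      change (((tri ϖ (t i) 1)⁻¹ * (k * tri ϖ 0 1) : GL (Fin 2) F) : Matrix (Fin 2) (Fin 2) F) = _
      rw [tri_inv, Matrix.GeneralLinearGroup.coe_mul, Matrix.GeneralLinearGroup.coe_mul, coe_tri,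
        coe_tri]
      have hϖ0 := ϖ.ne_zero
      ext i j
      fin_cases i <;> fin_cases j <;>
        simp [Matrix.mul_apply, Matrix.vecMul, dotProduct, Fin.sum_univ_two] <;> field_simp <;> ring
    intro i' j
    rw [hv]
    fin_cases i' <;> fin_cases j
    · refine norm_sub_le_of_le (hent 0 0) ?_
      exact norm_mul_le_of_le_one_right (ht i) (hent 1 0)
    · simpa [hd1] using (inv_mul_le_one₀ hp).2 (hϖ.norm_le _ hi)
    · simpa using mul_le_one₀ hϖ.norm_lt_one.le (norm_nonneg _) (hent 1 0)
    · simpa using hent 1 1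

end doubleCoset

section balls

variable {F : Type*} [NormedField F] [IsUltrametricDist F] {ϖ : Fˣ} (hϖ : IsUniformizer (ϖ : F))

lemma radius_tri_pow (hϖ : IsUniformizer (ϖ : F)) (n : ℕ) :
    radius (tri (ϖ⁻¹ ^ n) 0 1) = ‖(ϖ : F)‖⁻¹ ^ n := by
  have hp := norm_pos_iff.2 ϖ.ne_zero
  have h1 : 1 ≤ ‖(ϖ : F)‖⁻¹ ^ n := one_le_pow₀ ((one_le_inv₀ hp).2 hϖ.norm_lt_one.le)
  rw [radius_tri]
  simp only [Units.val_pow_eq_pow_val, Units.val_inv_eq_inv_val, norm_pow, norm_inv, norm_zero,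
    Units.val_one, norm_one, mul_one]
  have h0 : 0 < ‖(ϖ : F)‖⁻¹ ^ n := zero_lt_one.trans_le h1
  rw [max_eq_left h0.le, max_eq_left h1, pow_two, mul_div_assoc, div_self h0.ne', mul_one]

include hϖ

/-- By the Cartan decomposition a ball is a finite union of spheres, and each sphere is reached from
the previous one by one of the finitely many cosets in `KZ α⁻¹ KZ`. -/
lemma finite_ball [ProperSpace F] (c : ℝ) :
    ((fun g : GL (Fin 2) F => ((g⁻¹ : GL (Fin 2) F) : GL (Fin 2) F ⧸ KZ F)) ''
      {g | radius g ≤ c}).Finite := by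
  have hp := norm_pos_iff.2 ϖ.ne_zero
  set S : ℕ → Set (GL (Fin 2) F) := fun n => {g | ∃ κ ∈ KZ F, ∃ k ∈ maxCompact F,
    g = κ * tri (ϖ⁻¹ ^ n) 0 1 * k} with hS
  have hfin : ∀ n, ((fun g : GL (Fin 2) F => ((g⁻¹ : GL (Fin 2) F) : GL (Fin 2) F ⧸ KZ F)) ''
      S n).Finite := by
    intro n
    induction n with
    | zero =>
      refine (Set.finite_singleton ((1 : GL (Fin 2) F) : GL (Fin 2) F ⧸ KZ F)).subset ?_
      rintro _ ⟨_, ⟨κ, hκ, k, hk, rfl⟩, rfl⟩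
      rw [Set.mem_singleton_iff, eq_comm]
      refine QuotientGroup.eq.2 ?_
      rw [pow_zero, tri_one, mul_one, inv_one, one_mul]
      exact inv_mem (mul_mem hκ (maxCompact_le_KZ hk))
    | succ n ih =>
      refine (Set.Finite.image2 (fun d c : GL (Fin 2) F ⧸ KZ F => d.out • c) ih
        (finite_cosets hϖ)).subset ?_
      rintro _ ⟨_, ⟨κ, hκ, k, hk, rfl⟩, rfl⟩
      obtain ⟨h, hh⟩ := QuotientGroup.mk_out_eq_mul (KZ F) (tri (ϖ⁻¹ ^ n) 0 1 * k)⁻¹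
      refine ⟨_, ⟨_, ⟨1, one_mem _, k, hk, rfl⟩, rfl⟩,
        (((h : GL (Fin 2) F)⁻¹ * tri ϖ 0 1 : GL (Fin 2) F) : GL (Fin 2) F ⧸ KZ F),
        ⟨_, ?_, rfl⟩, ?_⟩
      · refine DoubleCoset.mem_doubleCoset.2 ⟨(h : GL (Fin 2) F)⁻¹ * tri ϖ 0 ϖ,
          mul_mem (inv_mem h.2) (tri_scalar_mem_KZ ϖ), 1, one_mem _, ?_⟩
        have := tri_eq_alpha_inv hϖ 0
        rw [zero_mul] at this
        rw [mul_one, this, mul_assoc]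
      · change ((Quotient.out _ * _ : GL (Fin 2) F) : GL (Fin 2) F ⧸ KZ F) = _
        simp only [one_mul]
        rw [hh, QuotientGroup.eq]
        have e : tri (ϖ⁻¹ ^ (n + 1)) 0 1 = (tri ϖ 0 1)⁻¹ * tri (ϖ⁻¹ ^ n) 0 1 := by
          rw [tri_inv, tri_mul, pow_succ']; simp
        rw [e]
        have : ((tri (ϖ⁻¹ ^ n) 0 1 * k)⁻¹ * (h : GL (Fin 2) F) * ((h : GL (Fin 2) F)⁻¹ * tri ϖ 0 1))⁻¹ *
            (κ * ((tri ϖ 0 1)⁻¹ * tri (ϖ⁻¹ ^ n) 0 1) * k)⁻¹ = κ⁻¹ := by group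
        rw [this]
        exact inv_mem hκ
  obtain ⟨N, hN⟩ := pow_unbounded_of_one_lt c ((one_lt_inv₀ hp).2 hϖ.norm_lt_one)
  refine ((Set.finite_lt_nat N).biUnion fun n _ => hfin n).subset ?_
  rintro _ ⟨g, hg, rfl⟩
  obtain ⟨κ, hκ, n, k, hk, rfl⟩ := cartan hϖ g
  refine Set.mem_biUnion (x := n) ?_ ⟨_, ⟨κ, hκ, k, hk, rfl⟩, rfl⟩
  rw [Set.mem_ofPred_eq, radius_mul_right (maxCompact_le_KZ hk), radius_mul_left hκ,
    radius_tri_pow hϖ] at hg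
  have h1 := hg.trans_lt hN
  exact (pow_lt_pow_iff_right₀ ((one_lt_inv₀ hp).2 hϖ.norm_lt_one)).1 h1

end balls

end BreuilSchneider

end

/-! ### Polynomials in one variable as coordinates on the weight space. -/

noncomputable section

namespace BreuilSchneider

section dehomogenize

variable {C : Type*} [NormedField C]

/-- The substitution `x ↦ 1`, `y ↦ X`. -/
def deh (C : Type*) [NormedField C] : MvPolynomial (Fin 2) C →ₐ[C] Polynomial C :=
  MvPolynomial.aeval ![1, Polynomial.X]

/-- The homogeneous polynomial of degree `m` with given dehomogenization. -/
def homog (m : ℕ) (f : Polynomial C) : Sym C m :=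
  ⟨∑ i ∈ Finset.range (m + 1),
    MvPolynomial.C (f.coeff i) * (MvPolynomial.X 0 ^ (m - i) * MvPolynomial.X 1 ^ i), by
    refine Submodule.sum_mem _ fun i hi => ?_
    rw [Finset.mem_range] at hi
    have h := ((MvPolynomial.isHomogeneous_C (Fin 2) (f.coeff i)).mul
      (((MvPolynomial.isHomogeneous_X C (0 : Fin 2)).pow (m - i)).mul
        ((MvPolynomial.isHomogeneous_X C (1 : Fin 2)).pow i)))
    rw [one_mul, one_mul, zero_add, Nat.sub_add_cancel (by omega)] at h
    exact h⟩

lemma deh_X_zero : deh C (MvPolynomial.X 0) = 1 := by simp [deh]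

lemma deh_X_one : deh C (MvPolynomial.X 1) = Polynomial.X := by simp [deh]

lemma deh_C (x : C) : deh C (MvPolynomial.C x) = Polynomial.C x := by simp [deh]

/-- The exponent `(m - i, i)`. -/
def expo (m i : ℕ) : Fin 2 →₀ ℕ := Finsupp.single 0 (m - i) + Finsupp.single 1 i

lemma deh_coeff {m : ℕ} {P : MvPolynomial (Fin 2) C}
    (hP : P ∈ MvPolynomial.homogeneousSubmodule (Fin 2) C m) (i : ℕ) :
    (deh C P).coeff i = if i ≤ m then P.coeff (expo m i) else 0 := by
  have h1 : ∀ n ∈ P.support, n 0 + n 1 = m := by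
    intro n hn
    have := hP (MvPolynomial.mem_support_iff.1 hn)
    rw [Finsupp.weight_apply, Finsupp.sum_fintype _ _ (by simp)] at this
    simpa [Fin.sum_univ_two] using this
  have h2 : (deh C P).coeff i = ∑ n ∈ P.support, if n 1 = i then P.coeff n else 0 := by
    conv_lhs => rw [P.as_sum]
    rw [map_sum, Polynomial.finsetSum_coeff]
    refine Finset.sum_congr rfl fun n _ => ?_
    rw [deh, MvPolynomial.aeval_monomial, Finsupp.prod_fintype _ _ (by simp), Fin.prod_univ_two]
    simp only [Matrix.cons_val_zero, one_pow, one_mul, Matrix.cons_val_one]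
    rw [← Polynomial.C_eq_algebraMap, Polynomial.coeff_C_mul, Polynomial.coeff_X_pow]
    simp [eq_comm]
  rw [h2]
  split_ifs with hi
  · rw [Finset.sum_eq_single (expo m i)]
    · simp [expo]
    · intro n hn hne
      rw [if_neg]
      intro hni
      apply hne
      have := h1 n hn
      ext j
      fin_cases j
      · simp [expo]; omega
      · simp [expo, hni]
    · intro hn
      rw [MvPolynomial.notMem_support_iff.1 hn, ite_self]
  · refine Finset.sum_eq_zero fun n hn => if_neg fun hni => hi ?_
    have := h1 n hn
    omega

lemma natDegree_deh_le {m : ℕ} (P : Sym C m) : (deh C P.1).natDegree ≤ m := by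
  rw [Polynomial.natDegree_le_iff_coeff_eq_zero]
  intro i hi
  rw [deh_coeff P.2, if_neg (by omega)]

lemma homog_deh {m : ℕ} (P : Sym C m) : homog m (deh C P.1) = P := by
  apply Subtype.ext
  ext n
  simp only [homog, MvPolynomial.coeff_sum, MvPolynomial.coeff_C_mul]
  have hX : ∀ i, (MvPolynomial.X 0 ^ (m - i) * MvPolynomial.X 1 ^ i : MvPolynomial (Fin 2) C) =
      MvPolynomial.monomial (expo m i) 1 := fun i => by
    rw [expo, MvPolynomial.X_pow_eq_monomial, MvPolynomial.X_pow_eq_monomial,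
      MvPolynomial.monomial_mul, one_mul]
  simp only [hX, MvPolynomial.coeff_monomial]
  by_cases hn : ∃ i ≤ m, expo m i = n
  · obtain ⟨i, hi, rfl⟩ := hn
    rw [Finset.sum_eq_single i]
    · rw [if_pos rfl, mul_one, deh_coeff P.2, if_pos hi]
    · intro j _ hj
      rw [if_neg, mul_zero]
      intro h
      have := DFunLike.congr_fun h 1
      simp [expo] at this
      exact hj this
    · intro h
      rw [Finset.mem_range] at h
      omega
  · rw [Finset.sum_eq_zero fun i hi => by
      rw [if_neg fun h => hn ⟨i, by rw [Finset.mem_range] at hi; omega, h⟩, mul_zero]]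
    by_contra hne
    apply hn
    have := P.2 (Ne.symm hne)
    rw [Finsupp.weight_apply, Finsupp.sum_fintype _ _ (by simp)] at this
    simp [Fin.sum_univ_two] at this
    refine ⟨n 1, by omega, ?_⟩
    ext j
    fin_cases j
    · simp [expo]; omega
    · simp [expo]

lemma deh_homog {m : ℕ} {f : Polynomial C} (hf : f.natDegree ≤ m) : deh C (homog m f).1 = f := by
  conv_rhs => rw [f.as_sum_range_C_mul_X_pow' (n := m + 1) (by omega)]
  simp only [homog, map_sum, map_mul, map_pow, deh_C, deh_X_zero, deh_X_one, one_pow, one_mul]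

lemma bd_deh {m : ℕ} {P : Sym C m} {c : ℝ} (hc : 0 ≤ c) (hP : ∀ n, ‖MvPolynomial.coeff n P.1‖ ≤ c) :
    Bd c (deh C P.1) := by
  intro i
  rw [deh_coeff P.2]
  split_ifs
  · exact hP _
  · simpa using hc

lemma norm_coeff_homog_le {m : ℕ} {f : Polynomial C} {c : ℝ} (hc : 0 ≤ c) (hf : f.natDegree ≤ m)
    (hb : Bd c f) (n : Fin 2 →₀ ℕ) : ‖MvPolynomial.coeff n (homog m f).1‖ ≤ c := by
  by_cases h0 : MvPolynomial.coeff n (homog m f).1 = 0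
  · rw [h0, norm_zero]; exact hc
  · have h := (homog m f).2 h0
    rw [Finsupp.weight_apply, Finsupp.sum_fintype _ _ (by simp)] at h
    simp [Fin.sum_univ_two] at h
    have hn : n = expo m (n 1) := by
      ext j
      fin_cases j
      · simp [expo]; omega
      · simp [expo]
    have h2 := deh_coeff (homog m f).2 (n 1)
    rw [deh_homog hf, if_pos (by omega), ← hn] at h2
    rw [← h2]
    exact hb _

end dehomogenize

section coordinates

variable {p : ℕ} [Fact p.Prime] {F C : Type*}
  [NormedField F] [IsUltrametricDist F] [NormedAlgebra ℚ_[p] F] [FiniteDimensional ℚ_[p] F]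
  [NormedField C] [IsUltrametricDist C] [NormedAlgebra ℚ_[p] C] [FiniteDimensional ℚ_[p] C]
  {k : (F →ₐ[ℚ_[p]] C) → ℕ}

/-- Products of dehomogenizations of pure tensors. -/
def toPoly (k : (F →ₐ[ℚ_[p]] C) → ℕ) : Vk k →ₗ[C] Polynomial C :=
  PiTensorProduct.lift ((MultilinearMap.mkPiAlgebra C (F →ₐ[ℚ_[p]] C) (Polynomial C)).compLinearMap
    fun τ => (deh C).toLinearMap ∘ₗ (MvPolynomial.homogeneousSubmodule (Fin 2) C (k τ)).subtype)

lemma toPoly_tprod (w : ∀ τ, Sym C (k τ)) :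
    toPoly k (PiTensorProduct.tprod C w) = ∏ τ, deh C (w τ).1 := by
  rw [toPoly, PiTensorProduct.lift.tprod]
  simp

/-- The monomials `x ^ k`. -/
def oneSym (k : (F →ₐ[ℚ_[p]] C) → ℕ) (τ : F →ₐ[ℚ_[p]] C) : Sym C (k τ) :=
  ⟨MvPolynomial.X 0 ^ k τ, by
    have := (MvPolynomial.isHomogeneous_X C (0 : Fin 2)).pow (k τ)
    rwa [one_mul] at this⟩

open Classical in
/-- The inverse of `toPoly` on polynomials of degree at most `k σ`. -/
def ofPoly (k : (F →ₐ[ℚ_[p]] C) → ℕ) (σ : F →ₐ[ℚ_[p]] C) (f : Polynomial C) : Vk k :=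
  PiTensorProduct.tprod C (Function.update (oneSym k) σ (homog (k σ) f))

variable {σ : F →ₐ[ℚ_[p]] C} (hσ : ∀ τ, k τ ≠ 0 ↔ τ = σ)

include hσ

lemma natDegree_toPoly_le (v : Vk k) : (toPoly k v).natDegree ≤ k σ := by
  have hsum : ∑ τ, k τ = k σ :=
    Finset.sum_eq_single σ (fun τ _ h => by_contra fun h' => h ((hσ τ).1 h')) (by simp)
  induction v using PiTensorProduct.induction_on with
  | smul_tprod c w =>
    rw [map_smul, toPoly_tprod]
    refine (Polynomial.natDegree_smul_le _ _).trans ((Polynomial.natDegree_prod_le _ _).trans ?_)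
    rw [← hsum]
    exact Finset.sum_le_sum fun τ _ => natDegree_deh_le (w τ)
  | add x y hx hy =>
    rw [map_add]
    exact Polynomial.natDegree_add_le_of_degree_le hx hy

lemma toPoly_ofPoly {f : Polynomial C} (hf : f.natDegree ≤ k σ) : toPoly k (ofPoly k σ f) = f := by
  classical
  rw [ofPoly, toPoly_tprod, Finset.prod_eq_single σ]
  · rw [Function.update_self, deh_homog hf]
  · intro τ _ h
    rw [Function.update_of_ne h, oneSym, map_pow, deh_X_zero, one_pow]
  · simp

/-- The factors at `τ ≠ σ` have degree zero, so they are scalars that can be moved to the factor at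
`σ`. -/
lemma ofPoly_toPoly (v : Vk k) : ofPoly k σ (toPoly k v) = v := by
  classical
  have hlin : ∃ L : Polynomial C →ₗ[C] Vk k, ∀ f, L f = ofPoly k σ f :=
    ⟨{ toFun := ofPoly k σ
       map_add' := fun f g => by
        have : homog (k σ) (f + g) = homog (k σ) f + homog (k σ) g := by
          apply Subtype.ext
          simp [homog, add_mul, Finset.sum_add_distrib]
        rw [ofPoly, this, MultilinearMap.map_update_add, ofPoly, ofPoly]
       map_smul' := fun c f => by
        have : homog (k σ) (c • f) = c • homog (k σ) f := by
          apply Subtype.ext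
          simp [homog, mul_assoc, Finset.mul_sum, MvPolynomial.smul_eq_C_mul]
        rw [ofPoly, this, MultilinearMap.map_update_smul, ofPoly, RingHom.id_apply] }, fun _ => rfl⟩
  obtain ⟨L, hL⟩ := hlin
  suffices h : L ∘ₗ toPoly k = LinearMap.id by
    have := LinearMap.congr_fun h v
    rwa [LinearMap.comp_apply, hL] at this
  refine PiTensorProduct.ext (MultilinearMap.ext fun w => ?_)
  simp only [LinearMap.compMultilinearMap_apply, LinearMap.comp_apply, LinearMap.id_apply]
  rw [toPoly_tprod]
  set c : (F →ₐ[ℚ_[p]] C) → C := fun τ => if τ = σ then 1 else (deh C (w τ).1).coeff 0 with hc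
  have hw : w = fun τ => c τ • Function.update (oneSym k) σ (w σ) τ := by
    funext τ
    by_cases h : τ = σ
    · subst h
      simp [hc]
    · rw [Function.update_of_ne h, hc]
      simp only [h, if_false]
      have hk0 : k τ = 0 := by_contra fun h' => h ((hσ τ).1 h')
      conv_lhs => rw [← homog_deh (w τ)]
      apply Subtype.ext
      simp [homog, oneSym, hk0, MvPolynomial.smul_eq_C_mul]
  have hprod : ∏ τ, deh C (w τ).1 = (∏ τ, c τ) • deh C (w σ).1 := by
    have h1 : ∀ τ, deh C (w τ).1 = Polynomial.C (c τ) * if τ = σ then deh C (w σ).1 else 1 := by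
      intro τ
      by_cases h : τ = σ
      · subst h; simp [hc]
      · conv_lhs => rw [hw]
        simp only [Function.update_of_ne h, if_neg h, mul_one]
        rw [SetLike.val_smul, map_smul, oneSym, map_pow, deh_X_zero, one_pow,
          Polynomial.smul_eq_C_mul, mul_one]
    rw [Finset.prod_congr rfl fun τ _ => h1 τ, Finset.prod_mul_distrib, ← map_prod,
      Polynomial.smul_eq_C_mul]
    simp
  rw [hprod, map_smul, hL, ofPoly, homog_deh]
  conv_rhs => rw [hw]
  rw [MultilinearMap.map_smul_univ]

lemma toPoly_injective : Function.Injective (toPoly k) :=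
  Function.LeftInverse.injective (ofPoly_toPoly hσ)

/-- This turns every integrality question about values in the tensor product into one about the
Gauss norm. -/
lemma mem_rhoLattice_iff (v : Vk k) : v ∈ rhoLattice k ↔ Bd 1 (toPoly k v) := by
  classical
  constructor
  · intro hv
    refine Submodule.span_induction ?_ ?_ ?_ ?_ hv
    · rintro _ ⟨w, hw, rfl⟩
      rw [toPoly_tprod]
      exact Bd.prod fun τ _ => bd_deh zero_le_one (hw τ)
    · rw [map_zero]; exact Bd.zero zero_le_one
    · intro x y _ _ hx hy
      rw [map_add]
      exact hx.add hy
    · intro c x _ hx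
      have : c • x = (c : C) • x := rfl
      rw [this, map_smul, Polynomial.smul_eq_C_mul]
      exact (Bd.const (mem_ringOfInt.1 c.2)).one_mul_left hx
  · intro hv
    rw [← ofPoly_toPoly hσ v]
    refine Submodule.subset_span ⟨_, fun τ n => ?_, rfl⟩
    by_cases h : τ = σ
    · subst h
      rw [Function.update_self]
      exact norm_coeff_homog_le zero_le_one (natDegree_toPoly_le hσ v) hv n
    · rw [Function.update_of_ne h, oneSym, MvPolynomial.coeff_X_pow]
      split_ifs <;> simp

end coordinates

end BreuilSchneider

end

/-! ### The group action and the Hecke kernel on these coordinates. -/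

noncomputable section

namespace BreuilSchneider

section action

variable {p : ℕ} [Fact p.Prime] {F C : Type*}
  [NormedField F] [IsUltrametricDist F] [NormedAlgebra ℚ_[p] F] [FiniteDimensional ℚ_[p] F]
  [NormedField C] [IsUltrametricDist C] [NormedAlgebra ℚ_[p] C] [FiniteDimensional ℚ_[p] C]
  {k : (F →ₐ[ℚ_[p]] C) → ℕ}

/-- The action of a matrix with entries `a b c d` on dehomogenized polynomials of degree `k`. -/
def matAct (k : ℕ) (a b c d : C) (f : Polynomial C) : Polynomial C :=
  ∑ i ∈ Finset.range (k + 1), Polynomial.C (f.coeff i) *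
    ((Polynomial.C a + Polynomial.C c * Polynomial.X) ^ (k - i) *
      (Polynomial.C b + Polynomial.C d * Polynomial.X) ^ i)

lemma matAct_bd {k : ℕ} {a b c d : C} (ha : ‖a‖ ≤ 1) (hb : ‖b‖ ≤ 1) (hc : ‖c‖ ≤ 1) (hd : ‖d‖ ≤ 1)
    {f : Polynomial C} {B : ℝ} (hf : Bd B f) : Bd B (matAct k a b c d f) := by
  have h : ∀ {x y : C}, ‖x‖ ≤ 1 → ‖y‖ ≤ 1 →
      Bd 1 (Polynomial.C x + Polynomial.C y * Polynomial.X) := fun hx hy =>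
    (Bd.const hx).add ((Bd.const hy).mul_one_right Bd.X)
  exact Bd.sum hf.nonneg fun i _ => (Bd.const (hf i)).mul_one_right
    (((h ha hc).pow_one _).mul_one_right ((h hb hd).pow_one _))

lemma matAct_down (k : ℕ) (w t : C) (f : Polynomial C) : matAct k w t 0 1 f = down k t w f := by
  rw [matAct, down, ← Finset.sum_range_reflect]
  refine Finset.sum_congr rfl fun l hl => ?_
  rw [Finset.mem_range] at hl
  rw [Nat.add_sub_cancel, Nat.sub_sub_self (by omega), map_zero, zero_mul, add_zero, map_one,
    one_mul, Polynomial.C_mul, Polynomial.C_pow, add_comm (Polynomial.C t)]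
  ring

/-- The inverse triangular matrix has denominators `w⁻¹`. The factor `w ^ k`, supplied by the
normalization of `ψ`, clears them and leaves the substitution `z ↦ w z + t`. -/
lemma matAct_up {k : ℕ} {w t : C} (hw : w ≠ 0) {f : Polynomial C} (hf : f.natDegree ≤ k) :
    Polynomial.C (w ^ k) * matAct k w⁻¹ (w⁻¹ * t) 0 1 f = up t w f := by
  rw [up_eq_comp]
  conv_rhs => rw [f.as_sum_range_C_mul_X_pow' (n := k + 1) (by omega)]
  rw [Polynomial.sum_comp, matAct, Finset.mul_sum]
  refine Finset.sum_congr rfl fun i hi => ?_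
  rw [Finset.mem_range] at hi
  rw [Polynomial.mul_comp, Polynomial.C_comp, Polynomial.X_pow_comp]
  have h1 : (Polynomial.C w * Polynomial.X + Polynomial.C t : Polynomial C) =
      Polynomial.C w * (Polynomial.C (w⁻¹ * t) + Polynomial.C 1 * Polynomial.X) := by
    rw [mul_add, ← Polynomial.C_mul, mul_inv_cancel_left₀ hw, map_one, one_mul]
    ring
  have h2 : (Polynomial.C (w ^ k) * Polynomial.C w⁻¹ ^ (k - i) : Polynomial C) =
      Polynomial.C w ^ i := by
    rw [← Polynomial.C_pow, ← Polynomial.C_mul, ← Polynomial.C_pow, inv_pow]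
    congr 1
    rw [← Nat.sub_add_cancel (show i ≤ k by omega), pow_add, Nat.add_sub_cancel]
    field_simp
  rw [h1, mul_pow, ← h2, map_zero, zero_mul, add_zero]
  ring

lemma matAct_scalar {k : ℕ} (a : C) {f : Polynomial C} (hf : f.natDegree ≤ k) :
    matAct k a 0 0 a f = Polynomial.C (a ^ k) * f := by
  conv_rhs => rw [f.as_sum_range_C_mul_X_pow' (n := k + 1) (by omega)]
  rw [matAct, Finset.mul_sum]
  refine Finset.sum_congr rfl fun i hi => ?_
  rw [Finset.mem_range] at hi
  have h2 : (Polynomial.C (a ^ k) : Polynomial C) = Polynomial.C a ^ (k - i) * Polynomial.C a ^ i := by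
    rw [← pow_add, Nat.sub_add_cancel (by omega), Polynomial.C_pow]
  rw [h2, map_zero, zero_mul, zero_add, add_zero, mul_pow]
  ring

lemma rhoTensor_tprod (g : GL (Fin 2) F) (w : ∀ τ, Sym C (k τ)) :
    rhoTensor k g (PiTensorProduct.tprod C w) =
      PiTensorProduct.tprod C fun τ => rho τ.toRingHom (k τ) g (w τ) := by
  change PiTensorProduct.map _ (PiTensorProduct.tprod C w) = _
  rw [PiTensorProduct.map_tprod]
  rfl

lemma rhoTwTensor_apply {ϖ : F} (hϖ : IsUniformizer ϖ) (s : (F →ₐ[ℚ_[p]] C) → Cˣ)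
    (g : GL (Fin 2) F) :
    rhoTwTensor hϖ s k g = (∏ τ, ((chiHalf hϖ (s τ) g ^ k τ : Cˣ) : C)) • rhoTensor k g := by
  refine PiTensorProduct.ext (MultilinearMap.ext fun w => ?_)
  simp only [LinearMap.compMultilinearMap_apply, LinearMap.smul_apply]
  rw [rhoTensor_tprod, ← MultilinearMap.map_smul_univ]
  change PiTensorProduct.map _ (PiTensorProduct.tprod C w) = _
  rw [PiTensorProduct.map_tprod]
  rfl

section single

variable {σ : F →ₐ[ℚ_[p]] C} (hσ : ∀ τ, k τ ≠ 0 ↔ τ = σ)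

include hσ

lemma prod_pow_eq {M : Type*} [CommMonoid M] (f : (F →ₐ[ℚ_[p]] C) → M) :
    ∏ τ, f τ ^ k τ = f σ ^ k σ :=
  Finset.prod_eq_single σ
    (fun τ _ h => by rw [by_contra fun h' => h ((hσ τ).1 h'), pow_zero]) (by simp)

lemma toPoly_rhoTensor (g : GL (Fin 2) F) (v : Vk k) :
    toPoly k (rhoTensor k g v) =
      matAct (k σ) (σ (g 0 0)) (σ (g 0 1)) (σ (g 1 0)) (σ (g 1 1)) (toPoly k v) := by
  classical
  conv_lhs => rw [← ofPoly_toPoly hσ v]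
  rw [ofPoly, rhoTensor_tprod, toPoly_tprod, Finset.prod_eq_single σ]
  · rw [Function.update_self]
    change deh C (subst σ.toRingHom g (homog (k σ) (toPoly k v)).1) = _
    simp only [homog, map_sum, map_mul, map_pow, matAct]
    refine Finset.sum_congr rfl fun i _ => ?_
    have hC : ∀ x : C, deh C (subst σ.toRingHom g (MvPolynomial.C x)) = Polynomial.C x := fun x => by
      rw [subst, MvPolynomial.aeval_C, MvPolynomial.algebraMap_eq, deh_C]
    have hX : ∀ j, deh C (subst σ.toRingHom g (MvPolynomial.X j)) =
        Polynomial.C (σ (g 0 j)) + Polynomial.C (σ (g 1 j)) * Polynomial.X := fun j => by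
      rw [subst, MvPolynomial.aeval_X, Fin.sum_univ_two, map_add, map_mul, map_mul, deh_C, deh_C,
        deh_X_zero, deh_X_one, mul_one]
      rfl
    rw [hC, hX, hX]
  · intro τ _ h
    have hk0 : k τ = 0 := by_contra fun h' => h ((hσ τ).1 h')
    rw [Function.update_of_ne h]
    change deh C (subst τ.toRingHom g (MvPolynomial.X 0 ^ k τ)) = 1
    rw [hk0, pow_zero, map_one, map_one]
  · simp

lemma toPoly_rhoTensor_tri (a d : Fˣ) (b : F) (v : Vk k) :
    toPoly k (rhoTensor k (tri a b d) v) =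
      matAct (k σ) (σ a) (σ b) 0 (σ d) (toPoly k v) := by
  rw [toPoly_rhoTensor hσ, coe_tri]
  simp

variable {ϖ : Fˣ} (hϖ : IsUniformizer (ϖ : F)) {s : (F →ₐ[ℚ_[p]] C) → Cˣ}
  (hs : ∀ τ, (s τ : C) ^ 2 = τ ϖ)

lemma toPoly_rhoTw (g : GL (Fin 2) F) (v : Vk k) :
    toPoly k (rhoTwTensor hϖ s k g v) =
      Polynomial.C ((((s σ) ^ (-ord (ϖ : F) (g : Matrix (Fin 2) (Fin 2) F).det)) ^ k σ : Cˣ) : C) *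
        toPoly k (rhoTensor k g v) := by
  rw [rhoTwTensor_apply, LinearMap.smul_apply, map_smul, ← Units.coe_prod,
    prod_pow_eq hσ (fun τ => chiHalf hϖ (s τ) g), Polynomial.smul_eq_C_mul]
  rfl

omit hσ in
lemma ord_eq_zero_of_norm {ϖ : F} (hϖ : IsUniformizer ϖ) {x : F} (hx : ‖x‖ = 1) :
    ord ϖ x = 0 := by
  have hx0 : x ≠ 0 := by
    rintro rfl; rw [norm_zero] at hx; exact zero_ne_one hx
  have h := norm_eq_zpow_ord hϖ hx0
  rw [hx, ← zpow_zero ‖ϖ‖] at h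
  exact (zpow_right_injective₀ (norm_pos_iff.2 hϖ.ne_zero) hϖ.norm_lt_one.ne h).symm

omit hσ in
lemma ord_self {ϖ : F} (hϖ : IsUniformizer ϖ) : ord ϖ ϖ = 1 := by
  have h := norm_eq_zpow_ord hϖ hϖ.ne_zero
  exact (zpow_right_injective₀ (norm_pos_iff.2 hϖ.ne_zero) hϖ.norm_lt_one.ne
    ((zpow_one _).trans h)).symm

include hs in
-- Integral matrices preserve the Gauss bound. A central `a` acts by the `k`-th power of `σ a` times
-- a power of `s σ`, and `‖s σ‖ ^ 2 = ‖ϖ‖` makes this a scalar of norm one; this is the purpose of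
-- the twist.
lemma bd_rhoTw_of_mem_KZ {g : GL (Fin 2) F} (hg : g ∈ KZ F) {v : Vk k} {B : ℝ}
    (hv : Bd B (toPoly k v)) : Bd B (toPoly k (rhoTwTensor hϖ s k g v)) := by
  obtain ⟨a, g, hgK, rfl⟩ := exists_of_mem_KZ hg
  have h1 : Bd B (toPoly k (rhoTwTensor hϖ s k g v)) := by
    rw [toPoly_rhoTw hσ, ord_eq_zero_of_norm hϖ (norm_det_of_mem_K hgK), neg_zero, zpow_zero,
      one_pow, Units.val_one, map_one, one_mul, toPoly_rhoTensor hσ]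
    have := norm_le_one_of_mem_K hgK
    exact matAct_bd (by rw [norm_algHom]; exact this _ _) (by rw [norm_algHom]; exact this _ _)
      (by rw [norm_algHom]; exact this _ _) (by rw [norm_algHom]; exact this _ _) hv
  rw [map_mul, Module.End.mul_apply, toPoly_rhoTw hσ, toPoly_rhoTensor_tri hσ, map_zero,
    matAct_scalar _ (natDegree_toPoly_le hσ _), ← mul_assoc, ← Polynomial.C_mul]
  refine Bd.one_mul_left (Bd.const (le_of_eq ?_)) h1
  have ha := norm_pos_iff.2 a.ne_zero
  have hs2 : ‖(s σ : C)‖ ^ 2 = ‖(ϖ : F)‖ := by rw [← norm_pow, hs, norm_algHom]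
  have hsn : ‖(((s σ) ^ (-ord (ϖ : F) (a * a : F)) : Cˣ) : C)‖ * ‖(a : F)‖ = 1 := by
    rw [ord_mul hϖ a.ne_zero a.ne_zero, Units.val_zpow_eq_zpow_val, norm_zpow,
      show -(ord (ϖ : F) (a : F) + ord (ϖ : F) (a : F)) = 2 * (-ord (ϖ : F) (a : F)) by ring,
      zpow_mul]
    have h2 : ‖(s σ : C)‖ ^ (2 : ℤ) = ‖(ϖ : F)‖ := hs2
    rw [h2]
    calc _ = ‖(ϖ : F)‖ ^ (-ord (ϖ : F) (a : F)) * ‖(ϖ : F)‖ ^ ord (ϖ : F) (a : F) := by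
          rw [← norm_eq_zpow_ord hϖ a.ne_zero]
      _ = 1 := by rw [← zpow_add₀ (norm_pos_iff.2 ϖ.ne_zero).ne', neg_add_cancel, zpow_zero]
  rw [det_tri, Units.val_pow_eq_pow_val, ← mul_pow, norm_pow, norm_mul, norm_algHom, hsn, one_pow]

include hs in
lemma bd_rhoTw_iff {g : GL (Fin 2) F} (hg : g ∈ KZ F) {v : Vk k} {B : ℝ} :
    Bd B (toPoly k (rhoTwTensor hϖ s k g v)) ↔ Bd B (toPoly k v) := by
  refine ⟨fun h => ?_, bd_rhoTw_of_mem_KZ hσ hϖ hs hg⟩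
  have := bd_rhoTw_of_mem_KZ hσ hϖ hs (inv_mem hg) h
  rwa [← Module.End.mul_apply, ← map_mul, inv_mul_cancel, map_one, Module.End.one_apply] at this

omit hσ in
lemma heckePsi_of_mem (s : (F →ₐ[ℚ_[p]] C) → Cˣ) {g : GL (Fin 2) F}
    (hg : g ∈ DoubleCoset.doubleCoset (alpha hϖ)⁻¹ (KZ F : Set (GL (Fin 2) F)) (KZ F)) :
    (heckePsi hϖ s k).toFun g = (∏ τ, (s τ : C) ^ k τ) • rhoTwTensor hϖ s k g := if_pos hg

omit hσ in
/-- On the standard representatives, `ψ` is the untwisted representation. -/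
lemma heckePsi_heckeRep {I : Type*} {t : I → F} (s : (F →ₐ[ℚ_[p]] C) → Cˣ)
    (ht : ∀ i, ‖t i‖ ≤ 1) (o : Option I) :
    (heckePsi hϖ s k).toFun (heckeRep ϖ t o) = rhoTensor k (heckeRep ϖ t o) := by
  have hdet : ord (ϖ : F) ((heckeRep ϖ t o : GL (Fin 2) F) : Matrix (Fin 2) (Fin 2) F).det = 1 := by
    rcases o with _ | i
    · change ord (ϖ : F) (tri 1 0 ϖ : GL (Fin 2) F).1.det = 1
      rw [det_tri, Units.val_one, one_mul, ord_self hϖ]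
    · change ord (ϖ : F) (tri ϖ (t i) 1 : GL (Fin 2) F).1.det = 1
      rw [det_tri, Units.val_one, mul_one, ord_self hϖ]
  rw [heckePsi_of_mem hϖ s (heckeRep_mem hϖ ht o), rhoTwTensor_apply, smul_smul,
    ← Finset.prod_mul_distrib, Finset.prod_eq_one, one_smul]
  intro τ _
  have : chiHalf hϖ (s τ) (heckeRep ϖ t o) = (s τ)⁻¹ := by
    change (s τ) ^ (-ord (ϖ : F) _) = _
    rw [hdet, zpow_neg_one]
  rw [this, Units.val_pow_eq_pow_val, ← mul_pow, Units.mul_inv, one_pow]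

lemma toPoly_heckePsi_some {I : Type*} {t : I → F} (ht : ∀ i, ‖t i‖ ≤ 1) (i : I) (v : Vk k) :
    toPoly k ((heckePsi hϖ s k).toFun (heckeRep ϖ t (some i)) v) =
      down (k σ) (σ (t i)) (σ ϖ) (toPoly k v) := by
  rw [heckePsi_heckeRep hϖ s ht, heckeRep, toPoly_rhoTensor_tri hσ, Units.val_one, map_one,
    matAct_down]

include hs in
/-- The edge of the tree that leads back to the root. -/
lemma toPoly_heckePsi_none {I : Type*} {t : I → F} (ht : ∀ i, ‖t i‖ ≤ 1) (i : I)
    (f : compactInd (KZ F) (rhoTwTensor hϖ s k)) (g : GL (Fin 2) F) :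
    toPoly k ((heckePsi hϖ s k).toFun (heckeRep ϖ t none)
      (f.1 ((heckeRep ϖ t none)⁻¹ * ((heckeRep ϖ t (some i))⁻¹ * g)))) =
      up (-σ (t i)) (σ ϖ) (toPoly k (f.1 g)) := by
  -- Stepping along an edge and back returns to the same vertex: the product of the two
  -- representatives lies in `KZ`.
  have hκ : (heckeRep ϖ t none)⁻¹ * (heckeRep ϖ t (some i))⁻¹ ∈ KZ F := by
    rw [← mul_inv_rev]
    refine inv_mem ?_
    have : heckeRep ϖ t (some i) * heckeRep ϖ t none = tri ϖ 0 ϖ * tri 1 (t i) 1 := by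
      simp only [heckeRep]
      rw [tri_mul, tri_mul]
      simp [mul_comm]
    rw [this]
    exact mul_mem (tri_scalar_mem_KZ ϖ)
      (maxCompact_le_KZ (tri_mem_maxCompact (by simp) (ht i) (by simp)))
  have hw : σ (ϖ : F) ≠ 0 := (map_ne_zero σ).2 ϖ.ne_zero
  rw [← mul_assoc, f.2.1 _ hκ, heckePsi_of_mem hϖ s (heckeRep_mem hϖ ht none),
    LinearMap.smul_apply, ← Module.End.mul_apply, ← map_mul, mul_inv_cancel_left, map_smul,
    prod_pow_eq hσ (fun τ => (s τ : C)), toPoly_rhoTw hσ, Polynomial.smul_eq_C_mul, ← mul_assoc,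
    ← Polynomial.C_mul]
  have hx : (heckeRep ϖ t (some i))⁻¹ = tri ϖ⁻¹ (-((ϖ⁻¹ : Fˣ) : F) * t i) 1 := by
    simp only [heckeRep]
    rw [tri_inv]
    simp
  have hord : ord (ϖ : F) ((ϖ⁻¹ : Fˣ) : F) = -1 := by
    have h2 := ord_mul hϖ ϖ.ne_zero (ϖ⁻¹).ne_zero
    rw [Units.mul_inv, ord_one hϖ, ord_self hϖ] at h2
    omega
  rw [hx, toPoly_rhoTensor_tri hσ, det_tri, Units.val_one, mul_one, hord, neg_neg, zpow_one,
    Units.val_pow_eq_pow_val, ← mul_pow, ← pow_two, hs, map_mul, map_neg, Units.val_inv_eq_inv_val,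
    map_inv₀, map_one, neg_mul, ← mul_neg, matAct_up hw (natDegree_toPoly_le hσ _)]

end single

end action

end BreuilSchneider

end

/-! ### From functions on the tree to solutions of the cone equations. -/

noncomputable section

namespace BreuilSchneider

section radius

variable {F : Type*} [NormedField F] [IsUltrametricDist F] {ϖ : Fˣ}

lemma radius_mul_le (g h : GL (Fin 2) F) : radius (g * h) ≤ radius g * radius h := by
  have h1 : entryNorm (g * h) ≤ entryNorm g * entryNorm h := by
    refine entryNorm_le fun i j => ?_
    rw [Matrix.GeneralLinearGroup.coe_mul, Matrix.mul_apply]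
    refine norm_sum_le_of_le (mul_nonneg (entryNorm_nonneg g) (entryNorm_nonneg h)) fun l _ => ?_
    rw [norm_mul]
    exact mul_le_mul (norm_le_entryNorm g i l) (norm_le_entryNorm h l j) (norm_nonneg _)
      (entryNorm_nonneg g)
  rw [radius, radius, radius, Matrix.GeneralLinearGroup.coe_mul, Matrix.det_mul, norm_mul,
    div_mul_div_comm, ← mul_pow]
  have := entryNorm_nonneg (g * h)
  gcongr

lemma radius_out_inv (g : GL (Fin 2) F) :
    radius ((g⁻¹ : GL (Fin 2) F) : GL (Fin 2) F ⧸ KZ F).out⁻¹ = radius g := by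
  obtain ⟨h, hh⟩ := QuotientGroup.mk_out_eq_mul (KZ F) g⁻¹
  rw [hh, mul_inv_rev, inv_inv, radius_mul_left (inv_mem h.2)]

lemma radius_heckeRep (hϖ : IsUniformizer (ϖ : F)) {I : Type*} {t : I → F} (ht : ∀ i, ‖t i‖ ≤ 1)
    (o : Option I) : radius (heckeRep ϖ t o) = ‖(ϖ : F)‖⁻¹ := by
  have h1 := hϖ.norm_lt_one.le
  rcases o with _ | i
  · rw [heckeRep, radius_tri]
    simp [h1]
  · rw [heckeRep, radius_tri]
    have h2 : max ‖(ϖ : F)‖ ‖t i‖ ≤ 1 := max_le h1 (ht i)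
    simp [h2]

end radius

section subScalar

variable {C G V : Type*} [Field C] [Group G] [AddCommGroup V] [Module C V]
  {H : Subgroup G} {ρ : Representation C G V}

/-- The operator `T_φ - a`. -/
def HeckeKernel.subScalar (φ : HeckeKernel H ρ) (a : C) : Module.End C (compactInd H ρ) :=
  φ.operator - a • LinearMap.id

lemma HeckeKernel.subScalar_apply (φ : HeckeKernel H ρ) (a : C) (f : compactInd H ρ) (g : G) :
    (φ.subScalar a f).1 g = (φ.operator f).1 g - a • f.1 g := rfl

end subScalar

section cone

variable {p : ℕ} [Fact p.Prime] {F C : Type*}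
  [NormedField F] [IsUltrametricDist F] [NormedAlgebra ℚ_[p] F] [FiniteDimensional ℚ_[p] F]
  [NormedField C] [IsUltrametricDist C] [NormedAlgebra ℚ_[p] C] [FiniteDimensional ℚ_[p] C]
  {k : (F →ₐ[ℚ_[p]] C) → ℕ} {σ : F →ₐ[ℚ_[p]] C} (hσ : ∀ τ, k τ ≠ 0 ↔ τ = σ)
  {ϖ : Fˣ} (hϖ : IsUniformizer (ϖ : F)) {s : (F →ₐ[ℚ_[p]] C) → Cˣ}
  (hs : ∀ τ, (s τ : C) ^ 2 = τ ϖ) {q : ℕ} {I : Type*} [Fintype I] {t : I → F}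
  (S : ResidueSystem p q (ϖ : F) t) (hcov : ∀ x : F, ‖x‖ ≤ 1 → ∃ i, ‖x - t i‖ < 1)

/-- The compact induction of the twisted representation. -/
abbrev Ind (hϖ : IsUniformizer (ϖ : F)) (s : (F →ₐ[ℚ_[p]] C) → Cˣ)
    (k : (F →ₐ[ℚ_[p]] C) → ℕ) : Type _ :=
  compactInd (V := Vk k) (KZ F) (rhoTwTensor hϖ s k)

include S hcov in
lemma operator_apply (f : Ind hϖ s k) (g : GL (Fin 2) F) :
    ((heckePsi hϖ s k).operator f).1 g = ∑ o : Option I,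
      (heckePsi hϖ s k).toFun (heckeRep ϖ t o) (f.1 ((heckeRep ϖ t o)⁻¹ * g)) := by
  refine (heckePsi hϖ s k).operator_apply_eq_sum _ (heckeRep_injective hϖ S.spread.sub) ?_ f g
  intro g hg
  refine exists_heckeRep_eq hϖ S.spread.le_one hcov ?_
  by_contra h
  exact hg (if_neg h)

lemma exists_radius_le (f : Ind hϖ s k) :
    ∃ R : ℝ, 0 ≤ R ∧ ∀ g, R < radius g → f.1 g = 0 := by
  obtain ⟨R, hR⟩ := (f.2.2.image fun x => radius x.out⁻¹).bddAbove
  refine ⟨max R 0, le_max_right _ _, fun g hg => ?_⟩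
  by_contra h
  have := hR ⟨_, ⟨g, h, rfl⟩, rfl⟩
  simp only [radius_out_inv] at this
  exact absurd ((le_max_left R 0).trans_lt hg) (not_lt.2 this)

include hσ hs in
lemma exists_bd_toPoly (f : Ind hϖ s k) :
    ∃ B : ℝ, 0 ≤ B ∧ ∀ g, Bd B (toPoly k (f.1 g)) := by
  have hfin : ∀ P : Polynomial C, ∃ B : ℝ, 0 ≤ B ∧ Bd B P := fun P => by
    refine ⟨∑ i ∈ P.support, ‖P.coeff i‖, by positivity, fun i => ?_⟩
    by_cases hi : i ∈ P.support
    · exact Finset.single_le_sum (f := fun i => ‖P.coeff i‖) (fun _ _ => norm_nonneg _) hi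
    · rw [Polynomial.notMem_support_iff.1 hi, norm_zero]; positivity
  choose b hb0 hb using hfin
  obtain ⟨B, hB⟩ := (f.2.2.image fun x => b (toPoly k (f.1 x.out⁻¹))).bddAbove
  refine ⟨max B 0, le_max_right _ _, fun g => ?_⟩
  by_cases h : f.1 g = 0
  · rw [h, map_zero]
    exact Bd.zero (le_max_right _ _)
  · have h1 := hB ⟨_, ⟨g, h, rfl⟩, rfl⟩
    obtain ⟨κ, hκ⟩ := QuotientGroup.mk_out_eq_mul (KZ F) g⁻¹
    have h2 : f.1 ((g⁻¹ : GL (Fin 2) F) : GL (Fin 2) F ⧸ KZ F).out⁻¹ =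
        rhoTwTensor hϖ s k (κ : GL (Fin 2) F)⁻¹ (f.1 g) := by
      rw [hκ, mul_inv_rev, inv_inv, f.2.1 _ (inv_mem κ.2)]
    have h3 := (hb _).mono (h1.trans (le_max_left B 0))
    simp only [h2] at h3
    exact (bd_rhoTw_iff hσ hϖ hs (inv_mem κ.2)).1 h3

/-- The operator `T - a`. -/
abbrev heckeSub (hϖ : IsUniformizer (ϖ : F)) (s : (F →ₐ[ℚ_[p]] C) → Cˣ)
    (k : (F →ₐ[ℚ_[p]] C) → ℕ) (a : C) : Module.End C (Ind hϖ s k) :=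
  (heckePsi hϖ s k).subScalar a

include hσ S hcov in
-- On the representatives `ψ` is the untwisted action of integral matrices, so `T` preserves
-- integral functions.
lemma bd_heckeSub {a : C} (ha : ‖a‖ ≤ 1) {f : Ind hϖ s k} {B : ℝ}
    (hf : ∀ g, Bd B (toPoly k (f.1 g))) (g : GL (Fin 2) F) :
    Bd B (toPoly k ((heckeSub hϖ s k a f).1 g)) := by
  have h : (heckeSub hϖ s k a f).1 g = ((heckePsi hϖ s k).operator f).1 g - a • f.1 g :=
    HeckeKernel.subScalar_apply _ _ _ _
  rw [h, operator_apply hϖ S hcov, map_sub, map_sum, map_smul, Polynomial.smul_eq_C_mul]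
  have hϖ1 := hϖ.norm_lt_one.le
  refine Bd.sub (Bd.sum (hf g).nonneg fun o _ => ?_) ((Bd.const ha).one_mul_left (hf g))
  rw [heckePsi_heckeRep hϖ s S.spread.le_one]
  rcases o with _ | i
  · rw [heckeRep, toPoly_rhoTensor_tri hσ]
    exact matAct_bd (by simp) (by simp) (by simp) (by rw [norm_algHom]; exact hϖ1) (hf _)
  · rw [heckeRep, toPoly_rhoTensor_tri hσ]
    exact matAct_bd (by rw [norm_algHom]; exact hϖ1)
      (by rw [norm_algHom]; exact S.spread.le_one i) (by simp) (by simp) (hf _)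

include S hcov in
-- Neighbouring vertices have radii that differ by a factor of at most `‖ϖ‖⁻¹`, so `T` spreads the
-- support by one step.
lemma heckeSub_eq_zero {a : C} {f : Ind hϖ s k} {R : ℝ}
    (hR : 0 ≤ R) (hf : ∀ g, R < radius g → f.1 g = 0) (g : GL (Fin 2) F)
    (hg : ‖(ϖ : F)‖⁻¹ * R < radius g) : (heckeSub hϖ s k a f).1 g = 0 := by
  have hp := norm_pos_iff.2 ϖ.ne_zero
  have h : (heckeSub hϖ s k a f).1 g = ((heckePsi hϖ s k).operator f).1 g - a • f.1 g :=
    HeckeKernel.subScalar_apply _ _ _ _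
  have h1 : R ≤ ‖(ϖ : F)‖⁻¹ * R :=
    le_mul_of_one_le_left hR ((one_le_inv₀ hp).2 hϖ.norm_lt_one.le)
  rw [h, operator_apply hϖ S hcov, hf g (h1.trans_lt hg), smul_zero, sub_zero]
  refine Finset.sum_eq_zero fun o _ => ?_
  rw [hf, map_zero]
  have h2 := radius_mul_le (heckeRep ϖ t o) ((heckeRep ϖ t o)⁻¹ * g)
  rw [mul_inv_cancel_left, radius_heckeRep hϖ S.spread.le_one] at h2
  exact lt_of_mul_lt_mul_left (hg.trans_le h2) (by positivity)

/-- The vertices of the cone with top `g`. -/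
def coneVertex (ϖ : Fˣ) (t : I → F) (g : GL (Fin 2) F) : List I → GL (Fin 2) F
  | [] => g
  | i :: u => (heckeRep ϖ t (some i))⁻¹ * coneVertex ϖ t g u

omit [Fintype I] in
-- The unipotent part of each step has integral entries after it is moved past the diagonal matrix,
-- and is absorbed in `K`. Each letter therefore increases the distance from the origin by exactly
-- one.
lemma coneVertex_eq (hϖ : IsUniformizer (ϖ : F)) (ht : ∀ i, ‖t i‖ ≤ 1) (n : ℕ)
    {g : GL (Fin 2) F} (hg : g ∈ maxCompact F) (u : List I) : ∃ g' ∈ maxCompact F,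
    coneVertex ϖ t (tri (ϖ⁻¹ ^ n) 0 1 * g) u = tri (ϖ⁻¹ ^ (n + u.length)) 0 1 * g' := by
  induction u with
  | nil => exact ⟨g, hg, rfl⟩
  | cons i u ih =>
    obtain ⟨g', hg', h⟩ := ih
    refine ⟨tri 1 (-(ϖ : F) ^ (n + u.length) * t i) 1 * g', mul_mem (tri_mem_maxCompact (by simp)
      ?_ (by simp)) hg', ?_⟩
    · rw [norm_mul, norm_neg, norm_pow]
      exact mul_le_one₀ (pow_le_one₀ (norm_nonneg _) hϖ.norm_lt_one.le) (norm_nonneg _) (ht i)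
    · rw [coneVertex, h, ← mul_assoc, ← mul_assoc, heckeRep, tri_inv, tri_mul, tri_mul]
      congr 1
      have hϖ0 := ϖ.ne_zero
      rw [List.length_cons, ← add_assoc, pow_succ']
      simp only [mul_one, mul_zero, zero_add, inv_one, add_zero, Units.val_one]
      congr 1
      push_cast
      rw [inv_pow]
      field_simp

include hσ hs S hcov in
-- At the vertex `i :: u` the neighbour `none` is the parent `u` and contributes `up`, while the
-- neighbours `some j` are the children and contribute `down`. Only vertices other than the top are
-- used, so `R` may equal the radius of the top.
lemma coneSolution {a : C} {R : ℝ} {h : Ind hϖ s k}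
    (hh : ∀ g, R < radius g → Bd 1 (toPoly k ((heckeSub hϖ s k a h).1 g))) {n : ℕ}
    (hn : R ≤ ‖(ϖ : F)‖⁻¹ ^ n) {g : GL (Fin 2) F} (hg : g ∈ maxCompact F) :
    ConeSolution (k σ) (σ ϖ) a (fun i => σ (t i)) fun u =>
      toPoly k (h.1 (coneVertex ϖ t (tri (ϖ⁻¹ ^ n) 0 1 * g) u)) := by
  have hp := norm_pos_iff.2 ϖ.ne_zero
  have hp1 : 1 < ‖(ϖ : F)‖⁻¹ := (one_lt_inv₀ hp).2 hϖ.norm_lt_one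
  have hrad : ∀ u : List I, radius (coneVertex ϖ t (tri (ϖ⁻¹ ^ n) 0 1 * g) u) =
      ‖(ϖ : F)‖⁻¹ ^ (n + u.length) := fun u => by
    obtain ⟨g', hg', h⟩ := coneVertex_eq hϖ S.spread.le_one n hg u
    rw [h, radius_mul_right (maxCompact_le_KZ hg'), radius_tri_pow hϖ]
  refine ⟨fun u => natDegree_toPoly_le hσ _, ?_, fun i u => ?_⟩
  · obtain ⟨R', -, hR'⟩ := exists_radius_le hϖ h
    obtain ⟨m, hm⟩ := pow_unbounded_of_one_lt R' hp1
    refine ⟨m, fun u hu => ?_⟩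
    rw [hR', map_zero]
    rw [hrad]
    exact hm.trans_le (pow_le_pow_right₀ hp1.le (by omega))
  · have h1 := hh (coneVertex ϖ t (tri (ϖ⁻¹ ^ n) 0 1 * g) (i :: u)) (by
      rw [hrad]
      refine hn.trans_lt (pow_lt_pow_right₀ hp1 ?_)
      rw [List.length_cons]; omega)
    have h2 : ∀ g, (heckeSub hϖ s k a h).1 g = ((heckePsi hϖ s k).operator h).1 g - a • h.1 g :=
      fun _ => HeckeKernel.subScalar_apply _ _ _ _
    rw [h2, operator_apply hϖ S hcov, Fintype.sum_option, map_sub, map_add, map_sum, map_smul,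
      Polynomial.smul_eq_C_mul] at h1
    simp only [toPoly_heckePsi_some hσ hϖ S.spread.le_one] at h1
    rw [coneVertex, toPoly_heckePsi_none hσ hϖ hs S.spread.le_one, add_sub_right_comm] at h1
    exact h1

/-- The restriction of a function to a ball. -/
def restrictBall (hϖ : IsUniformizer (ϖ : F)) (R : ℝ)
    (h : Ind hϖ s k) : Ind hϖ s k := by
  classical
  exact ⟨fun g => if radius g ≤ R then h.1 g else 0, fun κ hκ g => by
    change (if _ then _ else _) = rhoTwTensor hϖ s k κ (if _ then _ else _)
    rw [radius_mul_left hκ]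
    split_ifs
    · exact h.2.1 κ hκ g
    · rw [map_zero], h.2.2.subset (Set.image_mono fun g hg h0 => hg (by
      change (if _ then _ else _) = _
      rw [h0, ite_self]))⟩

lemma restrictBall_apply_of_lt {R : ℝ} (h : Ind hϖ s k)
    {g : GL (Fin 2) F} (hg : R < radius g) : (restrictBall hϖ R h).1 g = 0 :=
  if_neg (not_le.2 hg)

lemma restrictBall_apply_of_le {R : ℝ} (h : Ind hϖ s k)
    {g : GL (Fin 2) F} (hg : radius g ≤ R) : (restrictBall hϖ R h).1 g = h.1 g :=
  if_pos hg

end cone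

end BreuilSchneider

end

/-! ### Separatedness of the lattice. -/

noncomputable section

namespace BreuilSchneider

section integralImage

scoped instance instAddCommGroupCompactInd {C G V : Type*} [Field C] [Group G] [AddCommGroup V]
    [Module C V] (H : Subgroup G) (ρ : Representation C G V) : AddCommGroup (compactInd H ρ) :=
  Submodule.addCommGroup _

variable {C G V : Type*} [NormedField C] [IsUltrametricDist C] [Group G]
  [AddCommGroup V] [Module C V] {H : Subgroup G} {ρ : Representation C G V}

lemma exists_le_ker_of_notMem_pi {Q : Type*} {W : Submodule C (Q → V)} {v : Q → V} (h : v ∉ W) :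
    ∃ l : (Q → V) →ₗ[C] C, l v ≠ 0 ∧ W ≤ LinearMap.ker l :=
  Submodule.exists_le_ker_of_notMem h

lemma mem_integralImage {φ : HeckeKernel H ρ} {a : C} {L : Submodule (ringOfInt C) V}
    {v : φ.Quot a} : v ∈ integralImage φ a L ↔
      ∃ f : compactInd H ρ, (∀ g, f.1 g ∈ L) ∧ (φ.range a).mkQ f = v := by
  rfl

end integralImage

section separated

variable {p : ℕ} [Fact p.Prime] {F C : Type*}
  [NormedField F] [IsUltrametricDist F] [NormedAlgebra ℚ_[p] F] [FiniteDimensional ℚ_[p] F]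
  [NormedField C] [IsUltrametricDist C] [NormedAlgebra ℚ_[p] C] [FiniteDimensional ℚ_[p] C]
  {k : (F →ₐ[ℚ_[p]] C) → ℕ} {σ : F →ₐ[ℚ_[p]] C} (hσ : ∀ τ, k τ ≠ 0 ↔ τ = σ)
  {ϖ : Fˣ} (hϖ : IsUniformizer (ϖ : F)) {s : (F →ₐ[ℚ_[p]] C) → Cˣ}
  (hs : ∀ τ, (s τ : C) ^ 2 = τ ϖ) {q : ℕ} {I : Type*} [Fintype I] {t : I → F}
  (S : ResidueSystem p q (ϖ : F) t) (hcov : ∀ x : F, ‖x‖ ≤ 1 → ∃ i, ‖x - t i‖ < 1)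

include hϖ in
lemma exists_scalar (σ : F →ₐ[ℚ_[p]] C) (B : ℝ) : ∃ b : C, b ≠ 0 ∧ ‖b‖ ≤ 1 ∧ ‖b‖ * B ≤ 1 := by
  have hp := norm_pos_iff.2 ϖ.ne_zero
  obtain ⟨n, hn⟩ := exists_pow_lt_of_lt_one (y := ‖(ϖ : F)‖) (x := (max B 1)⁻¹) (by positivity)
    hϖ.norm_lt_one
  refine ⟨σ ϖ ^ n, pow_ne_zero _ ((map_ne_zero σ).2 ϖ.ne_zero), ?_, ?_⟩
  · rw [norm_pow, norm_algHom]
    exact pow_le_one₀ hp.le hϖ.norm_lt_one.le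
  · rw [norm_pow, norm_algHom]
    calc ‖(ϖ : F)‖ ^ n * B ≤ (max B 1)⁻¹ * max B 1 := by
          refine mul_le_mul_of_nonneg hn.le (le_max_left _ _) (by positivity) (by positivity)
      _ = 1 := inv_mul_cancel₀ (by positivity)

include hσ in
lemma mem_Theta_iff {a : C} {v : (heckePsi hϖ s k).Quot a} : v ∈ Theta hϖ s k a ↔
    ∃ f : Ind hϖ s k, (∀ g, Bd 1 (toPoly k (f.1 g))) ∧
      ((heckePsi hϖ s k).range a).mkQ f = v := by
  rw [Theta, mem_integralImage]
  simp only [mem_rhoLattice_iff hσ]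

include hσ hs in
lemma isLattice_Theta (a : C) : IsLattice (Theta hϖ s k a) := by
  intro v
  obtain ⟨f, rfl⟩ := Submodule.mkQ_surjective _ v
  obtain ⟨B, -, hB⟩ := exists_bd_toPoly hσ hϖ hs f
  obtain ⟨b, hb0, -, hb⟩ := exists_scalar hϖ σ B
  refine ⟨b, hb0, (mem_Theta_iff hσ hϖ).2 ⟨b • f, fun g => ?_, by rw [map_smul]⟩⟩
  change Bd 1 (toPoly k (b • f.1 g))
  rw [map_smul, Polynomial.smul_eq_C_mul]
  exact ((Bd.const le_rfl).mul (hB g)).mono hb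

include hσ hs S hcov in
-- By the Cartan decomposition every vertex is, up to the harmless action of `KZ`, the top of a
-- cone.
lemma bd_of_bd_heckeSub {a : C} {B : ℝ} (hB : ∀ P : List I → Polynomial C,
      ConeSolution (k σ) (σ ϖ) a (fun i => σ (t i)) P → ∀ u, Bd B (P u))
    {R : ℝ} {h : Ind hϖ s k}
    (hh : ∀ g, R < radius g → Bd 1 (toPoly k ((heckeSub hϖ s k a h).1 g)))
    (g : GL (Fin 2) F) (hg : R ≤ radius g) : Bd B (toPoly k (h.1 g)) := by
  obtain ⟨κ, hκ, n, g', hg', rfl⟩ := cartan hϖ g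
  rw [mul_assoc, radius_mul_left hκ, radius_mul_right (maxCompact_le_KZ hg'),
    radius_tri_pow hϖ] at hg
  have := hB _ (coneSolution hσ hϖ hs S hcov hh hg hg') []
  rw [mul_assoc, h.2.1 κ hκ]
  exact (bd_rhoTw_iff hσ hϖ hs hκ).2 this

include hσ hs S hcov in
-- With `h'` equal to `b` times the restriction of `h` to the ball, the difference is `b x + (T - a)
-- (b (h - h|_R))`. The last argument is integral by the uniform bound, and `T - a` preserves
-- integrality as `‖a‖ ≤ 1`.
lemma exists_sub_heckeSub {a : C} (ha : ‖a‖ ≤ 1) {B : ℝ} (hB0 : 0 ≤ B)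
    (hB : ∀ P : List I → Polynomial C,
      ConeSolution (k σ) (σ ϖ) a (fun i => σ (t i)) P → ∀ u, Bd B (P u))
    {b : C} (hb : ‖b‖ ≤ 1) (hbB : ‖b‖ * B ≤ 1) {R : ℝ} {f x h : Ind hϖ s k}
    (hf : ∀ g, R < radius g → f.1 g = 0) (hx : ∀ g, Bd 1 (toPoly k (x.1 g)))
    (hfx : f = x + heckeSub hϖ s k a h) :
    ∃ h' : Ind hϖ s k, (∀ g, R < radius g → h'.1 g = 0) ∧
      ∀ g, Bd 1 (toPoly k ((b • f - heckeSub hϖ s k a h').1 g)) := by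
  have h1 : ∀ g, R < radius g → Bd 1 (toPoly k ((heckeSub hϖ s k a h).1 g)) := fun g hg => by
    have h2 : (heckeSub hϖ s k a h).1 g = f.1 g - x.1 g := by
      rw [hfx]
      exact (add_sub_cancel_left (x.1 g) _).symm
    rw [h2, hf g hg, map_sub, map_zero]
    exact (Bd.zero zero_le_one).sub (hx g)
  have h2 := bd_of_bd_heckeSub hσ hϖ hs S hcov hB h1
  have h3 : ∀ g, Bd 1 (toPoly k ((b • (h - restrictBall hϖ R h)).1 g)) := fun g => by
    change Bd 1 (toPoly k (b • (h.1 g - (restrictBall hϖ R h).1 g)))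
    rw [map_smul, Polynomial.smul_eq_C_mul]
    refine ((Bd.const le_rfl).mul (?_ : Bd B _)).mono hbB
    rcases le_or_gt (radius g) R with hg | hg
    · rw [restrictBall_apply_of_le hϖ h hg, sub_self, map_zero]
      exact Bd.zero hB0
    · rw [restrictBall_apply_of_lt hϖ h hg, sub_zero]
      exact h2 g hg.le
  refine ⟨b • restrictBall hϖ R h, fun g hg => ?_, fun g => ?_⟩
  · change b • (restrictBall hϖ R h).1 g = 0
    rw [restrictBall_apply_of_lt hϖ h hg, smul_zero]
  · have h4 : b • f - heckeSub hϖ s k a (b • restrictBall hϖ R h) =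
        b • x + heckeSub hϖ s k a (b • (h - restrictBall hϖ R h)) := by
      rw [hfx]
      simp only [map_smul, map_sub, smul_add, smul_sub]
      abel
    rw [h4]
    change Bd 1 (toPoly k (b • x.1 g + _))
    rw [map_add, map_smul, Polynomial.smul_eq_C_mul]
    exact ((Bd.const hb).one_mul_left (hx g)).add (bd_heckeSub hσ hϖ S hcov ha h3 g)

include hσ in
/-- Linear functionals on finite products of `Vk k` are bounded on the standard lattice. -/
lemma exists_norm_le_of_bd {Q : Type*} [Fintype Q] (l : (Q → Vk k) →ₗ[C] C) :
    ∃ M : ℝ, ∀ v : Q → Vk k, (∀ x, Bd 1 (toPoly k (v x))) → ‖l v‖ ≤ M := by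
  classical
  refine ⟨∑ x : Q, ∑ i ∈ Finset.range (k σ + 1),
    ‖l (Pi.single x (ofPoly k σ (Polynomial.X ^ i)))‖, fun v hv => ?_⟩
  have h1 : ∀ x, v x = ∑ i ∈ Finset.range (k σ + 1),
      (toPoly k (v x)).coeff i • ofPoly k σ (Polynomial.X ^ i) := fun x => by
    apply toPoly_injective hσ
    rw [map_sum]
    conv_lhs => rw [(toPoly k (v x)).as_sum_range_C_mul_X_pow'
      (Nat.lt_succ_of_le (natDegree_toPoly_le hσ (v x)))]
    refine Finset.sum_congr rfl fun i hi => ?_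
    rw [map_smul, toPoly_ofPoly hσ, Polynomial.smul_eq_C_mul]
    rw [Polynomial.natDegree_X_pow]
    exact Nat.lt_succ_iff.1 (Finset.mem_range.1 hi)
  have h2 : l v = ∑ x : Q, ∑ i ∈ Finset.range (k σ + 1),
      (toPoly k (v x)).coeff i * l (Pi.single x (ofPoly k σ (Polynomial.X ^ i))) := by
    conv_lhs => rw [← Finset.univ_sum_single v]
    rw [map_sum]
    refine Finset.sum_congr rfl fun x _ => ?_
    conv_lhs => rw [h1 x]
    have : ∀ w : Vk k, (Pi.single x w : Q → Vk k) = LinearMap.single C (fun _ => Vk k) x w :=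
      fun _ => rfl
    rw [this, map_sum, map_sum]
    refine Finset.sum_congr rfl fun i _ => ?_
    rw [map_smul, map_smul, smul_eq_mul, this]
  rw [h2]
  refine (norm_sum_le _ _).trans (Finset.sum_le_sum fun x _ => (norm_sum_le _ _).trans
    (Finset.sum_le_sum fun i _ => ?_))
  rw [norm_mul]
  exact mul_le_of_le_one_left (norm_nonneg _) (hv x i)

include hσ hs S hcov in
-- After truncation the question concerns a subspace of a finite product of copies of `Vk k`. It is
-- cut out by linear forms, which are bounded on integral vectors, so a vector all of whose
-- multiples are integral modulo the subspace belongs to it.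
lemma isSeparated_Theta {a : C} (ha : ‖a‖ ≤ 1) {B : ℝ} (hB0 : 0 ≤ B)
    (hB : ∀ P : List I → Polynomial C,
      ConeSolution (k σ) (σ ϖ) a (fun i => σ (t i)) P → ∀ u, Bd B (P u)) :
    IsSeparated (Theta hϖ s k a) := by
  intro v hv
  obtain ⟨f, rfl⟩ := Submodule.mkQ_surjective _ v
  obtain ⟨R, hR0, hR⟩ := exists_radius_le hϖ f
  obtain ⟨b, hb0, hb, hbB⟩ := exists_scalar hϖ σ B
  have hstep : ∀ c : C, ∃ h' : Ind hϖ s k, (∀ g, R < radius g → h'.1 g = 0) ∧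
      ∀ g, Bd 1 (toPoly k ((b • c • f - heckeSub hϖ s k a h').1 g)) := fun c => by
    obtain ⟨x, hx, hxv⟩ := (mem_Theta_iff hσ hϖ).1 (hv c)
    rw [← map_smul, ← sub_eq_zero, ← map_sub, Submodule.mkQ_apply,
      Submodule.Quotient.mk_eq_zero] at hxv
    obtain ⟨h, hh⟩ := hxv
    refine exists_sub_heckeSub (h := -h) hσ hϖ hs S hcov ha hB0 hB hb hbB (fun g hg => ?_) hx ?_
    · change c • f.1 g = 0
      rw [hR g hg, smul_zero]
    · have hh' : heckeSub hϖ s k a h = x - c • f := hh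
      rw [map_neg, hh']
      abel
  have : ProperSpace F := FiniteDimensional.proper ℚ_[p] F
  -- One step beyond `R`, so that `T - a` maps functions on the ball of radius `R` to functions on
  -- the ball of radius `R'`.
  set R' := ‖(ϖ : F)‖⁻¹ * R with hR'
  have hfin := finite_ball hϖ R'
  let Q := ((fun g : GL (Fin 2) F => ((g⁻¹ : GL (Fin 2) F) : GL (Fin 2) F ⧸ KZ F)) ''
    {g | radius g ≤ R'} : Set _)
  have : Fintype Q := hfin.fintype
  let ev : Ind hϖ s k →ₗ[C] (Q → Vk k) :=
    { toFun := fun f x => f.1 x.1.out⁻¹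
      map_add' := fun _ _ => rfl
      map_smul' := fun _ _ => rfl }
  have hev : ∀ f : Ind hϖ s k, (∀ g, R' < radius g → f.1 g = 0) → ev f = 0 → f = 0 := by
    intro f hf h0
    refine Subtype.ext (funext fun g => ?_)
    rcases le_or_gt (radius g) R' with hg | hg
    · obtain ⟨κ, hκ⟩ := QuotientGroup.mk_out_eq_mul (KZ F) g⁻¹
      have h1 := congrFun h0 ⟨_, g, hg, rfl⟩
      change f.1 ((g⁻¹ : GL (Fin 2) F) : GL (Fin 2) F ⧸ KZ F).out⁻¹ = 0 at h1
      rw [hκ, mul_inv_rev, inv_inv, f.2.1 _ (inv_mem κ.2)] at h1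
      have h2 := congrArg (rhoTwTensor hϖ s k (κ : GL (Fin 2) F)) h1
      rw [map_zero, ← Module.End.mul_apply, ← map_mul, mul_inv_cancel, map_one] at h2
      exact h2
    · exact hf g hg
  let Y : Submodule C (Ind hϖ s k) :=
    { carrier := {h | ∀ g, R < radius g → h.1 g = 0}
      add_mem' := fun {x y} hx hy g hg => by
        change x.1 g + y.1 g = 0
        rw [hx g hg, hy g hg, add_zero]
      zero_mem' := fun _ _ => rfl
      smul_mem' := fun c x hx g hg => by
        change c • x.1 g = 0
        rw [hx g hg, smul_zero] }
  have hp := norm_pos_iff.2 ϖ.ne_zero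
  have hRR' : R ≤ R' := le_mul_of_one_le_left hR0 ((one_le_inv₀ hp).2 hϖ.norm_lt_one.le)
  by_cases hmem : ev f ∈ Y.map (ev ∘ₗ heckeSub hϖ s k a)
  · obtain ⟨h, hh, hfh⟩ := hmem
    have h1 : f - heckeSub hϖ s k a h = 0 := by
      refine hev _ (fun g hg => ?_) ?_
      · change f.1 g - (heckeSub hϖ s k a h).1 g = 0
        rw [hR g (hRR'.trans_lt hg), heckeSub_eq_zero hϖ S hcov hR0 hh g hg, sub_zero]
      · rw [map_sub, ← hfh, LinearMap.comp_apply]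
        exact sub_self (ev (heckeSub hϖ s k a h))
    rw [Submodule.mkQ_apply, Submodule.Quotient.mk_eq_zero]
    exact ⟨h, (sub_eq_zero.1 h1).symm⟩
  · exfalso
    -- The form `l` kills the truncated image of `T - a`, so its value at `b ϖ⁻ⁿ f` equals its value
    -- at an integral vector. That is bounded by `M` independently of `n`, a contradiction for large
    -- `n`.
    obtain ⟨l, hl, hle⟩ := exists_le_ker_of_notMem_pi (V := Vk k) hmem
    obtain ⟨M, hM⟩ := exists_norm_le_of_bd hσ l
    obtain ⟨n, hn⟩ := pow_unbounded_of_one_lt (M / (‖b‖ * ‖l (ev f)‖))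
      ((one_lt_inv₀ hp).2 hϖ.norm_lt_one)
    obtain ⟨h, hh, hb1⟩ := hstep ((σ ϖ)⁻¹ ^ n)
    have h1 := hM (ev (b • (σ ϖ)⁻¹ ^ n • f - heckeSub hϖ s k a h)) fun x => hb1 _
    have h2 : l (ev (heckeSub hϖ s k a h)) = 0 := hle ⟨h, hh, rfl⟩
    have h3 : l (ev (b • (σ ϖ)⁻¹ ^ n • f - heckeSub hϖ s k a h)) =
        b * ((σ ϖ)⁻¹ ^ n * l (ev f)) := by
      change (l ∘ₗ ev) _ = _
      rw [map_sub, LinearMap.comp_apply l ev (heckeSub hϖ s k a h), h2, sub_zero, map_smul,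
        map_smul]
      rfl
    rw [h3, norm_mul, norm_mul, norm_pow, norm_inv, norm_algHom] at h1
    rw [div_lt_iff₀ (mul_pos (norm_pos_iff.2 hb0) (norm_pos_iff.2 hl))] at hn
    refine absurd h1 (not_le.2 (hn.trans_eq ?_))
    ring

end separated

end BreuilSchneider

end

/-! ### Gauges of lattices, and compact induction as finitely supported functions. -/

noncomputable section

namespace BreuilSchneider

section gauge

variable {C G V : Type*} [NormedField C] [IsUltrametricDist C] [Group G]
  [AddCommGroup V] [Module C V]

lemma smul_mem_of_norm_le {L : Submodule (ringOfInt C) V} {c c' : C} (hc : ‖c‖ ≤ ‖c'‖) {v : V}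
    (hv : c' • v ∈ L) : c • v ∈ L := by
  by_cases h0 : c' = 0
  · have : c = 0 := by rwa [h0, norm_zero, norm_le_zero_iff] at hc
    rw [this, zero_smul]
    exact L.zero_mem
  · have h1 : ‖c * c'⁻¹‖ ≤ 1 := by
      rw [norm_mul, norm_inv, ← div_eq_mul_inv]
      exact div_le_one_of_le₀ hc (norm_nonneg _)
    have h2 : (⟨c * c'⁻¹, mem_ringOfInt.2 h1⟩ : ringOfInt C) • (c' • v) = c • v := by
      change (c * c'⁻¹) • c' • v = c • v
      rw [smul_smul, inv_mul_cancel_right₀ h0]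
    rw [← h2]
    exact L.smul_mem _ hv

/-- The gauge of a lattice. -/
def gauge (L : Submodule (ringOfInt C) V) (v : V) : ℝ :=
  sInf {x : ℝ | ∃ c : C, c ≠ 0 ∧ c • v ∈ L ∧ x = ‖c‖⁻¹}

lemma gauge_nonneg (L : Submodule (ringOfInt C) V) (v : V) : 0 ≤ gauge L v := by
  refine Real.sInf_nonneg ?_
  rintro _ ⟨c, -, -, rfl⟩
  positivity

lemma gauge_le {L : Submodule (ringOfInt C) V} {v : V} {c : C} (hc : c ≠ 0) (hv : c • v ∈ L) :
    gauge L v ≤ ‖c‖⁻¹ := by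
  refine csInf_le ⟨0, ?_⟩ ⟨c, hc, hv, rfl⟩
  rintro _ ⟨c, -, -, rfl⟩
  positivity

lemma exists_lt_of_gauge_lt {L : Submodule (ringOfInt C) V} (hL : IsLattice L) {v : V} {x : ℝ}
    (hx : gauge L v < x) : ∃ c : C, c ≠ 0 ∧ c • v ∈ L ∧ ‖c‖⁻¹ < x := by
  obtain ⟨c₀, h0, h1⟩ := hL v
  obtain ⟨_, ⟨c, hc, hv, rfl⟩, h⟩ := exists_lt_of_csInf_lt (s := {x : ℝ | ∃ c : C, c ≠ 0 ∧
    c • v ∈ L ∧ x = ‖c‖⁻¹}) ⟨_, c₀, h0, h1, rfl⟩ hx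
  exact ⟨c, hc, hv, h⟩

lemma gauge_smul_le {L : Submodule (ringOfInt C) V} (hL : IsLattice L) {c : C} (hc : c ≠ 0)
    (v : V) : gauge L (c • v) ≤ ‖c‖ * gauge L v := by
  have hc' := norm_pos_iff.2 hc
  refine le_of_forall_gt fun x hx => ?_
  obtain ⟨b, hb, hv, hbx⟩ := exists_lt_of_gauge_lt hL (v := v) (x := ‖c‖⁻¹ * x) (by
    rwa [inv_mul_eq_div, lt_div_iff₀ hc', mul_comm])
  refine (gauge_le (c := b * c⁻¹) (mul_ne_zero hb (inv_ne_zero hc)) ?_).trans_lt ?_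
  · rwa [smul_smul, inv_mul_cancel_right₀ hc]
  · rw [norm_mul, norm_inv, mul_inv, inv_inv, mul_comm]
    rwa [inv_mul_eq_div, lt_div_iff₀ hc', mul_comm] at hbx

/-- A `G`-stable separated lattice defines a `G`-invariant norm. -/
theorem admitsInvariantNorm_of_lattice {τ : Representation C G V}
    {L : Submodule (ringOfInt C) V} (hL : IsLattice L) (hsep : IsSeparated L)
    (hG : ∀ g, ∀ v ∈ L, τ g v ∈ L) (hC : ∃ c : C, c ≠ 0 ∧ ‖c‖ < 1) :
    AdmitsInvariantNorm τ := by
  have hzero : gauge L 0 = 0 := by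
    obtain ⟨c, hc0, hc1⟩ := hC
    refine le_antisymm (le_of_forall_pos_le_add fun ε hε => ?_) (gauge_nonneg L 0)
    obtain ⟨n, hn⟩ := exists_pow_lt_of_lt_one hε hc1
    rw [zero_add]
    refine (gauge_le (c := c⁻¹ ^ n) (pow_ne_zero _ (inv_ne_zero hc0)) ?_).trans ?_
    · rw [smul_zero]
      exact L.zero_mem
    · rw [norm_pow, norm_inv, inv_pow, inv_inv]
      exact hn.le
  refine ⟨gauge L, fun v => ⟨fun h => ?_, fun h => h ▸ hzero⟩, fun c v => ?_, fun v w => ?_,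
    fun g v => ?_⟩
  · refine hsep v fun c => ?_
    by_cases hc : c = 0
    · rw [hc, zero_smul]
      exact L.zero_mem
    · have hc' := norm_pos_iff.2 hc
      obtain ⟨b, hb, hbv, hbc⟩ := exists_lt_of_gauge_lt hL (v := v) (x := ‖c‖⁻¹) (by
        rw [h]; positivity)
      exact smul_mem_of_norm_le ((inv_lt_inv₀ (norm_pos_iff.2 hb) hc').1 hbc).le hbv
  · by_cases hc : c = 0
    · rw [hc, zero_smul, norm_zero, zero_mul, hzero]
    · refine le_antisymm (gauge_smul_le hL hc v) ?_
      have := gauge_smul_le hL (inv_ne_zero hc) (c • v)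
      rw [smul_smul, inv_mul_cancel₀ hc, one_smul, norm_inv] at this
      rwa [← le_inv_mul_iff₀ (norm_pos_iff.2 hc)]
  · refine le_of_forall_gt fun x hx => ?_
    obtain ⟨b, hb, hbv, hbx⟩ := exists_lt_of_gauge_lt hL ((le_max_left _ _).trans_lt hx)
    obtain ⟨c, hc, hcv, hcx⟩ := exists_lt_of_gauge_lt hL ((le_max_right _ _).trans_lt hx)
    -- The scalar of smaller norm brings both vectors into the lattice.
    rcases le_total ‖b‖ ‖c‖ with h | h
    · refine (gauge_le hb ?_).trans_lt hbx
      rw [smul_add]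
      exact L.add_mem hbv (smul_mem_of_norm_le h hcv)
    · refine (gauge_le hc ?_).trans_lt hcx
      rw [smul_add]
      exact L.add_mem (smul_mem_of_norm_le h hbv) hcv
  · have h1 : ∀ g v, (c : C) → c • v ∈ L → c • τ g v ∈ L := fun g v c hc => by
      rw [← map_smul]
      exact hG g _ hc
    unfold gauge
    congr 1
    ext x
    refine exists_congr fun c => and_congr_right fun _ => and_congr_left fun _ =>
      ⟨fun h => ?_, h1 g v c⟩
    have := h1 g⁻¹ _ c h
    rwa [← Module.End.mul_apply, ← map_mul, inv_mul_cancel, map_one] at this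

/-- Invariant norms are transported along equivariant isomorphisms. -/
lemma AdmitsInvariantNorm.of_equiv {W W' : Type*} [AddCommMonoid W] [Module C W]
    [AddCommMonoid W'] [Module C W'] {τ : Representation C G W} {τ' : Representation C G W'}
    (h : AdmitsInvariantNorm τ) (e : W' ≃ₗ[C] W) (he : ∀ g v, e (τ' g v) = τ g (e v)) :
    AdmitsInvariantNorm τ' := by
  obtain ⟨N, h1, h2, h3, h4⟩ := h
  refine ⟨fun v => N (e v), fun v => ?_, fun c v => ?_, fun v w => ?_, fun g v => ?_⟩
  · rw [h1, map_eq_zero_iff e e.injective]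
  · beta_reduce
    rw [map_smul, h2]
  · beta_reduce
    rw [map_add]
    exact h3 _ _
  · beta_reduce
    rw [he, h4]

lemma quotRep_mem_integralImage {H : Subgroup G} {ρ : Representation C G V} (φ : HeckeKernel H ρ)
    (a : C) (L : Submodule (ringOfInt C) V) (x : G) {v : φ.Quot a}
    (hv : v ∈ integralImage φ a L) : φ.quotRep a x v ∈ integralImage φ a L := by
  obtain ⟨f, hf, rfl⟩ := mem_integralImage.1 hv
  exact mem_integralImage.2 ⟨compactIndRep H ρ x f, fun g => hf _, rfl⟩

end gauge

section cosets

variable {C G V : Type*} [Field C] [Group G] [AddCommGroup V] [Module C V]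

/-- Compact induction as functions of finite support on `G ⧸ H`. -/
def cosetEquiv (H : Subgroup G) (ρ : Representation C G V) :
    compactInd H ρ ≃ₗ[C] (G ⧸ H →₀ V) where
  toFun f := Finsupp.ofSupportFinite
    -- Since `ρ` is defined on all of `G`, the vector `ρ g (f g⁻¹)` depends only on the coset of
    -- `g`.
    (fun c => Quotient.liftOn' c (fun g => ρ g (f.1 g⁻¹)) fun g g' h => by
      have h' := QuotientGroup.leftRel_apply.1 h
      obtain ⟨x, hx, rfl⟩ : ∃ x ∈ H, g' = g * x := ⟨_, h', by group⟩
      rw [mul_inv_rev, f.2.1 _ (inv_mem hx), ← Module.End.mul_apply, ← map_mul,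
        mul_inv_cancel_right]) (by
      refine f.2.2.subset fun c => ?_
      induction c using QuotientGroup.induction_on with
      | H g =>
        intro h
        refine ⟨g⁻¹, fun h0 => h ?_, congrArg _ (inv_inv g)⟩
        change ρ g (f.1 g⁻¹) = 0
        rw [h0, map_zero])
  map_add' f f' := by
    ext c
    induction c using QuotientGroup.induction_on with
    | H g => exact map_add (ρ g) (f.1 g⁻¹) (f'.1 g⁻¹)
  map_smul' c f := by
    ext x
    induction x using QuotientGroup.induction_on with
    | H g => exact map_smul (ρ g) c (f.1 g⁻¹)
  invFun u := ⟨fun g => ρ g (u ((g⁻¹ : G) : G ⧸ H)), fun h hh g => by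
      have : (((h * g)⁻¹ : G) : G ⧸ H) = ((g⁻¹ : G) : G ⧸ H) := by
        rw [QuotientGroup.eq]
        simpa using hh
      beta_reduce
      rw [this, map_mul, Module.End.mul_apply], by
      refine u.hasFiniteSupport.subset ?_
      rintro _ ⟨g, hg, rfl⟩ h0
      apply hg
      change ρ g (u _) = 0
      rw [h0, map_zero]⟩
  left_inv f := by
    refine Subtype.ext (funext fun g => ?_)
    change ρ g (ρ g⁻¹ (f.1 g⁻¹⁻¹)) = f.1 g
    rw [← Module.End.mul_apply, ← map_mul, mul_inv_cancel, map_one, inv_inv]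
    rfl
  right_inv u := by
    ext c
    induction c using QuotientGroup.induction_on with
    | H g =>
      change ρ g (ρ g⁻¹ (u ((g⁻¹⁻¹ : G) : G ⧸ H))) = u g
      rw [← Module.End.mul_apply, ← map_mul, mul_inv_cancel, map_one, inv_inv]
      rfl

lemma cosetEquiv_apply {H : Subgroup G} {ρ : Representation C G V} (f : compactInd H ρ) (g : G) :
    cosetEquiv H ρ f (g : G ⧸ H) = ρ g (f.1 g⁻¹) := rfl

lemma cosetEquiv_compactIndRep_smul {H : Subgroup G} {ρ : Representation C G V}
    (f : compactInd H ρ) (x : G) (c : G ⧸ H) :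
    cosetEquiv H ρ (compactIndRep H ρ x f) (x • c) = ρ x (cosetEquiv H ρ f c) := by
  induction c using QuotientGroup.induction_on with
  | H g =>
    change ρ (x * g) (f.1 ((x * g)⁻¹ * x)) = ρ x (ρ g (f.1 g⁻¹))
    rw [map_mul, Module.End.mul_apply, mul_inv_rev, inv_mul_cancel_right]

lemma compactIndRep_single {H : Subgroup G} {ρ : Representation C G V} (x : G) (c : G ⧸ H)
    (v : V) : compactIndRep H ρ x ((cosetEquiv H ρ).symm (Finsupp.single c v)) =
      (cosetEquiv H ρ).symm (Finsupp.single (x • c) (ρ x v)) := by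
  classical
  apply (cosetEquiv H ρ).injective
  rw [LinearEquiv.apply_symm_apply]
  ext c'
  obtain ⟨d, rfl⟩ : ∃ d, c' = x • d := ⟨x⁻¹ • c', by rw [smul_inv_smul]⟩
  rw [cosetEquiv_compactIndRep_smul, LinearEquiv.apply_symm_apply, Finsupp.single_apply,
    Finsupp.single_apply]
  simp only [smul_left_cancel_iff]
  split_ifs
  · rfl
  · rw [map_zero]

end cosets

end BreuilSchneider

end

/-! ### The spherical vector and its Hecke eigenvalue. -/

noncomputable section

namespace BreuilSchneider

section spherical

variable {F C : Type*} [NormedField F] [IsUltrametricDist F] [NormedField C] {ϖ : Fˣ}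
  (hϖ : IsUniformizer (ϖ : F))

/-- An entry of largest norm of a row vector. -/
def rowMax (c d : F) : F := open Classical in if ‖c‖ ≤ ‖d‖ then d else c

lemma norm_rowMax (c d : F) : ‖rowMax c d‖ = max ‖c‖ ‖d‖ := by
  unfold rowMax
  split_ifs with h
  · rw [max_eq_right h]
  · rw [max_eq_left (not_le.1 h).le]

lemma ord_congr {x y : F} (h : ‖x‖ = ‖y‖) : ord (ϖ : F) x = ord (ϖ : F) y := by
  unfold ord
  rw [h]

include hϖ in
lemma ord_zpow (n : ℤ) : ord (ϖ : F) ((ϖ ^ n : Fˣ) : F) = n := by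
  have h := norm_eq_zpow_ord hϖ (ϖ ^ n).ne_zero
  have h' : ‖(ϖ : F)‖ ^ n = ‖(ϖ : F)‖ ^ ord (ϖ : F) ((ϖ ^ n : Fˣ) : F) := by
    rw [← h, Units.val_zpow_eq_zpow_val, norm_zpow]
  exact (zpow_right_injective₀ (norm_pos_iff.2 ϖ.ne_zero) hϖ.norm_lt_one.ne h').symm

lemma det_ne_zero (g : GL (Fin 2) F) : (g : Matrix (Fin 2) (Fin 2) F).det ≠ 0 := g.det.ne_zero

include hϖ in
lemma ord_det_mul (g x : GL (Fin 2) F) :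
    ord (ϖ : F) ((g * x : GL (Fin 2) F) : Matrix (Fin 2) (Fin 2) F).det =
      ord (ϖ : F) (g : Matrix (Fin 2) (Fin 2) F).det +
        ord (ϖ : F) (x : Matrix (Fin 2) (Fin 2) F).det := by
  rw [Matrix.GeneralLinearGroup.coe_mul, Matrix.det_mul,
    ord_mul hϖ (det_ne_zero g) (det_ne_zero x)]

include hϖ in
lemma norm_le_of_norm_lt {x y : F} (h : ‖x‖ < ‖y‖) : ‖x‖ ≤ ‖(ϖ : F)‖ * ‖y‖ := by
  have hy : 0 < ‖y‖ := (norm_nonneg x).trans_lt h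
  have := hϖ.norm_le (x / y) (by rwa [norm_div, div_lt_one hy])
  rwa [norm_div, div_le_iff₀ hy] at this

lemma isOpen_maxCompact : IsOpen (maxCompact F : Set (GL (Fin 2) F)) := by
  have h : (maxCompact F : Set (GL (Fin 2) F)) =
      (⋂ i, ⋂ j, {g : GL (Fin 2) F | g i j ∈ Metric.closedBall (0 : F) 1}) ∩
        {g | (g : Matrix (Fin 2) (Fin 2) F).det ∈ Metric.sphere (0 : F) 1} := by
    ext g
    simp only [Set.mem_inter_iff, Set.mem_iInter, Set.mem_ofPred_eq, mem_closedBall_zero_iff,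
      mem_sphere_zero_iff_norm]
    exact ⟨fun hg => ⟨norm_le_one_of_mem_K hg, norm_det_of_mem_K hg⟩,
      fun hg => mem_K_of_norm_le hg.1 hg.2⟩
  rw [h]
  refine IsOpen.inter (isOpen_iInter_of_finite fun i => isOpen_iInter_of_finite fun j => ?_) ?_
  · exact (IsUltrametricDist.isOpen_closedBall _ one_ne_zero).preimage
      (Units.continuous_val.matrix_elem i j)
  · exact (IsUltrametricDist.isOpen_sphere _ one_ne_zero).preimage
      (Continuous.matrix_det Units.continuous_val)

lemma coe_mul_apply_one (g x : GL (Fin 2) F) (j : Fin 2) :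
    (g * x) 1 j = g 1 0 * x 0 j + g 1 1 * x 1 j := by
  rw [Matrix.GeneralLinearGroup.coe_mul, Matrix.mul_apply, Fin.sum_univ_two]

lemma row_le_of_mem {x : GL (Fin 2) F} (hx : x ∈ maxCompact F) (g : GL (Fin 2) F) :
    max ‖(g * x) 1 0‖ ‖(g * x) 1 1‖ ≤ max ‖g 1 0‖ ‖g 1 1‖ := by
  have h : ∀ j, ‖(g * x) 1 j‖ ≤ max ‖g 1 0‖ ‖g 1 1‖ := fun j => by
    rw [coe_mul_apply_one]
    refine (IsUltrametricDist.norm_add_le_max _ _).trans (max_le_max ?_ ?_)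
    · exact norm_mul_le_of_le_one_right le_rfl (norm_le_one_of_mem_K hx _ _)
    · exact norm_mul_le_of_le_one_right le_rfl (norm_le_one_of_mem_K hx _ _)
  exact max_le (h 0) (h 1)

lemma row_eq_of_mem {x : GL (Fin 2) F} (hx : x ∈ maxCompact F) (g : GL (Fin 2) F) :
    max ‖(g * x) 1 0‖ ‖(g * x) 1 1‖ = max ‖g 1 0‖ ‖g 1 1‖ := by
  refine le_antisymm (row_le_of_mem hx g) ?_
  have := row_le_of_mem (inv_mem hx) (g * x)
  rwa [mul_inv_cancel_right] at this

lemma row_pos (g : GL (Fin 2) F) : 0 < max ‖g 1 0‖ ‖g 1 1‖ := by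
  by_contra h
  rw [not_lt] at h
  have h0 : g 1 0 = 0 := norm_le_zero_iff.1 ((le_max_left _ _).trans h)
  have h1 : g 1 1 = 0 := norm_le_zero_iff.1 ((le_max_right _ _).trans h)
  apply g.det.ne_zero
  change (g : Matrix (Fin 2) (Fin 2) F).det = 0
  rw [Matrix.det_fin_two, h0, h1]
  ring

lemma rowMax_ne_zero (g : GL (Fin 2) F) : rowMax (g 1 0) (g 1 1) ≠ 0 := by
  rw [← norm_pos_iff, norm_rowMax]
  exact row_pos g

/-- The values of the spherical vector. -/
def sphVal (ϖ : Fˣ) (l₁ l₂ : Cˣ) (g : GL (Fin 2) F) : Cˣ :=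
  l₁ ^ (-ord (ϖ : F) (g : Matrix (Fin 2) (Fin 2) F).det) *
    (l₁ * l₂⁻¹) ^ ord (ϖ : F) (rowMax (g 1 0) (g 1 1))

variable (l₁ l₂ : Cˣ)

include hϖ in
lemma sphVal_mul_left (b g : GL (Fin 2) F) (hb : b 1 0 = 0) :
    sphVal ϖ l₁ l₂ (b * g) =
      l₁ ^ (-ord (ϖ : F) (b 0 0)) * l₂ ^ (-ord (ϖ : F) (b 1 1)) * sphVal ϖ l₁ l₂ g := by
  have hdet : (b : Matrix (Fin 2) (Fin 2) F).det = b 0 0 * b 1 1 := by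
    rw [Matrix.det_fin_two, hb, mul_zero, sub_zero]
  have h0 : b 0 0 * b 1 1 ≠ 0 := hdet ▸ b.det.ne_zero
  have h00 := left_ne_zero_of_mul h0
  have h11 := right_ne_zero_of_mul h0
  have hrow : ord (ϖ : F) (rowMax ((b * g) 1 0) ((b * g) 1 1)) =
      ord (ϖ : F) (b 1 1) + ord (ϖ : F) (rowMax (g 1 0) (g 1 1)) := by
    rw [← ord_mul hϖ h11 (rowMax_ne_zero g)]
    apply ord_congr
    rw [norm_rowMax, norm_mul, norm_rowMax, mul_max_of_nonneg _ _ (norm_nonneg _),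
      coe_mul_apply_one, coe_mul_apply_one, hb]
    simp
  rw [sphVal, sphVal, hrow, ord_det_mul hϖ, hdet, ord_mul hϖ h00 h11]
  rw [neg_add, neg_add, zpow_add, zpow_add, zpow_add, mul_zpow _ _ (ord (ϖ : F) (b 1 1)),
    inv_zpow', zpow_neg l₁ (ord (ϖ : F) (b 1 1))]
  refine Units.ext ?_
  push_cast
  field_simp

include hϖ in
lemma sphVal_mul_right {x : GL (Fin 2) F} (hx : x ∈ maxCompact F) (g : GL (Fin 2) F) :
    sphVal ϖ l₁ l₂ (g * x) = sphVal ϖ l₁ l₂ g := by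
  have h1 : ord (ϖ : F) (rowMax ((g * x) 1 0) ((g * x) 1 1)) =
      ord (ϖ : F) (rowMax (g 1 0) (g 1 1)) := by
    apply ord_congr
    rw [norm_rowMax, norm_rowMax, row_eq_of_mem hx]
  rw [sphVal, sphVal, h1, ord_det_mul hϖ, ord_eq_zero_of_norm hϖ (norm_det_of_mem_K hx), add_zero]

include hϖ in
lemma sphVal_mul_scalar (z : Fˣ) (g : GL (Fin 2) F) :
    sphVal ϖ l₁ l₂ (g * tri z 0 z) = (l₁ * l₂) ^ (-ord (ϖ : F) z) * sphVal ϖ l₁ l₂ g := by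
  rw [← tri_scalar_comm, sphVal_mul_left hϖ _ _ _ _ (by rw [coe_tri]; rfl), mul_zpow]
  rfl

include hϖ in
lemma sphVal_of_row_eq {g x : GL (Fin 2) F} (hx : ‖(x : Matrix (Fin 2) (Fin 2) F).det‖ = ‖(ϖ : F)‖)
    (h : max ‖(g * x) 1 0‖ ‖(g * x) 1 1‖ = max ‖g 1 0‖ ‖g 1 1‖) :
    sphVal ϖ l₁ l₂ (g * x) = l₁⁻¹ * sphVal ϖ l₁ l₂ g := by
  have h1 : ord (ϖ : F) (rowMax ((g * x) 1 0) ((g * x) 1 1)) =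
      ord (ϖ : F) (rowMax (g 1 0) (g 1 1)) := by
    apply ord_congr
    rw [norm_rowMax, norm_rowMax, h]
  rw [sphVal, sphVal, h1, ord_det_mul hϖ, ord_congr (y := (ϖ : F)) hx, ord_self hϖ, neg_add,
    zpow_add, zpow_neg_one, mul_comm _ l₁⁻¹, mul_assoc]

include hϖ in
lemma sphVal_of_row_mul {g x : GL (Fin 2) F}
    (hx : ‖(x : Matrix (Fin 2) (Fin 2) F).det‖ = ‖(ϖ : F)‖)
    (h : max ‖(g * x) 1 0‖ ‖(g * x) 1 1‖ = ‖(ϖ : F)‖ * max ‖g 1 0‖ ‖g 1 1‖) :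
    sphVal ϖ l₁ l₂ (g * x) = l₂⁻¹ * sphVal ϖ l₁ l₂ g := by
  have h1 : ord (ϖ : F) (rowMax ((g * x) 1 0) ((g * x) 1 1)) =
      1 + ord (ϖ : F) (rowMax (g 1 0) (g 1 1)) := by
    rw [← ord_self hϖ, ← ord_mul hϖ ϖ.ne_zero (rowMax_ne_zero g)]
    apply ord_congr
    rw [norm_mul, norm_rowMax, norm_rowMax, h]
  rw [sphVal, sphVal, h1, ord_det_mul hϖ, ord_congr (y := (ϖ : F)) hx, ord_self hϖ, neg_add,
    zpow_add, zpow_neg_one, zpow_add, zpow_one]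
  refine Units.ext ?_
  push_cast
  field_simp

include hϖ in
/-- The spherical vector is an eigenvector of the Hecke operator. -/
lemma sum_sphVal_heckeRep {I : Type*} [Fintype I] {t : I → F} (hsp : Spread t)
    (hcov : ∀ x : F, ‖x‖ ≤ 1 → ∃ i, ‖x - t i‖ < 1) (g : GL (Fin 2) F) :
    (l₁ : C) * l₂ * ∑ o : Option I, (sphVal ϖ l₁ l₂ (g * heckeRep ϖ t o) : C) =
      (l₁ + Fintype.card I * l₂) * sphVal ϖ l₁ l₂ g := by
  classical
  have hp := norm_pos_iff.2 ϖ.ne_zero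
  have hp1 := hϖ.norm_lt_one
  have hdet : ∀ o, ‖((heckeRep ϖ t o : GL (Fin 2) F) : Matrix (Fin 2) (Fin 2) F).det‖ =
      ‖(ϖ : F)‖ := fun o => by
    rcases o with _ | i
    · rw [heckeRep, det_tri, Units.val_one, one_mul]
    · rw [heckeRep, det_tri, Units.val_one, mul_one]
  set c := g 1 0 with hc
  set d := g 1 1 with hd
  have hsome : ∀ i, max ‖(g * heckeRep ϖ t (some i)) 1 0‖ ‖(g * heckeRep ϖ t (some i)) 1 1‖ =
      max (‖(ϖ : F)‖ * ‖c‖) ‖c * t i + d‖ := fun i => by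
    rw [coe_mul_apply_one, coe_mul_apply_one, heckeRep, coe_tri]
    simp [mul_comm, hc, hd]
  have hnone : max ‖(g * heckeRep ϖ t none) 1 0‖ ‖(g * heckeRep ϖ t none) 1 1‖ =
      max ‖c‖ (‖(ϖ : F)‖ * ‖d‖) := by
    rw [coe_mul_apply_one, coe_mul_apply_one, heckeRep, coe_tri]
    simp [mul_comm, hc, hd]
  have h10 := l₁.ne_zero
  have h20 := l₂.ne_zero
  rw [Fintype.sum_option]
  -- In either case exactly one of the `q + 1` neighbours scales the norm of the bottom row by `‖ϖ‖`
  -- and contributes `l₂⁻¹`, while the others preserve it and contribute `l₁⁻¹`. That neighbour is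
  -- `none` if `‖c‖ < ‖d‖`, and otherwise the `some i₀` for which `c t i₀ + d` is small.
  rcases lt_or_ge ‖c‖ ‖d‖ with hcd | hcd
  · have e1 : ∀ i, sphVal ϖ l₁ l₂ (g * heckeRep ϖ t (some i)) = l₁⁻¹ * sphVal ϖ l₁ l₂ g :=
      fun i => by
      refine sphVal_of_row_eq hϖ _ _ (hdet _) ?_
      have h1 : ‖c * t i‖ < ‖d‖ :=
        (norm_mul_le_of_le_one_right le_rfl (hsp.le_one i)).trans_lt hcd
      rw [hsome, add_comm, IsUltrametricDist.norm_add_eq_max_of_norm_ne_norm h1.ne',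
        max_eq_left h1.le, max_eq_right hcd.le, max_eq_right]
      exact (mul_le_of_le_one_left (norm_nonneg _) hp1.le).trans hcd.le
    have e2 : sphVal ϖ l₁ l₂ (g * heckeRep ϖ t none) = l₂⁻¹ * sphVal ϖ l₁ l₂ g := by
      refine sphVal_of_row_mul hϖ _ _ (hdet _) ?_
      rw [hnone, max_eq_right (norm_le_of_norm_lt hϖ hcd), ← hc, ← hd, max_eq_right hcd.le]
    simp only [e1, e2, Finset.sum_const, Finset.card_univ, nsmul_eq_mul, Units.val_mul,
      Units.val_inv_eq_inv_val]
    field_simp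
  · have hc0 : 0 < ‖c‖ := by
      have := row_pos g
      rwa [← hc, ← hd, max_eq_left hcd] at this
    obtain ⟨i₀, hi₀⟩ := hcov (-(d / c)) (by
      rw [norm_neg, norm_div]; exact div_le_one_of_le₀ hcd (norm_nonneg _))
    have hi₀' : ‖c * t i₀ + d‖ < ‖c‖ := by
      have h1 : c * t i₀ + d = -(c * (-(d / c) - t i₀)) := by
        field_simp [norm_pos_iff.1 hc0]
        ring
      rw [h1, norm_neg, norm_mul]
      exact mul_lt_of_lt_one_right hc0 hi₀
    have e0 : sphVal ϖ l₁ l₂ (g * heckeRep ϖ t (some i₀)) = l₂⁻¹ * sphVal ϖ l₁ l₂ g := by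
      refine sphVal_of_row_mul hϖ _ _ (hdet _) ?_
      rw [hsome, max_eq_left (norm_le_of_norm_lt hϖ hi₀'), ← hc, ← hd, max_eq_left hcd]
    have e1 : ∀ i, i ≠ i₀ →
        sphVal ϖ l₁ l₂ (g * heckeRep ϖ t (some i)) = l₁⁻¹ * sphVal ϖ l₁ l₂ g := fun i hi => by
      refine sphVal_of_row_eq hϖ _ _ (hdet _) ?_
      have h1 : c * t i + d = c * (t i - t i₀) + (c * t i₀ + d) := by ring
      have h2 : ‖c * (t i - t i₀)‖ = ‖c‖ := by rw [norm_mul, hsp.sub i i₀ hi, mul_one]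
      rw [hsome, h1, IsUltrametricDist.norm_add_eq_max_of_norm_ne_norm (by rw [h2]; exact hi₀'.ne'),
        h2, max_eq_left hi₀'.le, ← hc, ← hd, max_eq_left hcd, max_eq_right]
      exact mul_le_of_le_one_left (norm_nonneg _) hp1.le
    have e2 : sphVal ϖ l₁ l₂ (g * heckeRep ϖ t none) = l₁⁻¹ * sphVal ϖ l₁ l₂ g := by
      refine sphVal_of_row_eq hϖ _ _ (hdet _) ?_
      rw [hnone, ← hc, ← hd, max_eq_left hcd, max_eq_left]
      exact (mul_le_of_le_one_left (norm_nonneg _) hp1.le).trans hcd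
    rw [← Finset.add_sum_erase _ _ (Finset.mem_univ i₀), e0, e2, Finset.sum_congr rfl
      (fun i hi => by rw [e1 i (Finset.ne_of_mem_erase hi)]), Finset.sum_const,
      Finset.card_erase_of_mem (Finset.mem_univ _), Finset.card_univ, nsmul_eq_mul,
      Nat.cast_pred (Fintype.card_pos_iff.2 ⟨i₀⟩)]
    simp only [Units.val_mul, Units.val_inv_eq_inv_val]
    field_simp
    ring

/-- The spherical vector of the unramified principal series. -/
def spherical (hϖ : IsUniformizer (ϖ : F)) (l₁ l₂ : Cˣ) :
    smoothInd (nr (ϖ : F) l₁⁻¹) (nr (C := C) (ϖ : F) l₂⁻¹) :=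
  ⟨fun g => (sphVal ϖ l₁ l₂ g : C), maxCompact F, isOpen_maxCompact, fun b hb g u hu => by
    change (sphVal ϖ l₁ l₂ (b * g * u) : C) = _ * (sphVal ϖ l₁ l₂ g : C)
    rw [sphVal_mul_right hϖ _ _ hu, sphVal_mul_left hϖ _ _ _ _ hb, Units.val_mul, Units.val_mul, nr,
      nr, inv_zpow', inv_zpow']⟩

/-- The translates of the spherical vector, normalized so as to be indexed by cosets. -/
def sphCoset (hϖ : IsUniformizer (ϖ : F)) {l₁ l₂ S : Cˣ} (hS : S ^ 2 = l₁ * l₂)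
    (c : GL (Fin 2) F ⧸ KZ F) : smoothInd (nr (ϖ : F) l₁⁻¹) (nr (C := C) (ϖ : F) l₂⁻¹) :=
  Quotient.liftOn' c (fun x => ((S ^ ord (ϖ : F) (x : Matrix (Fin 2) (Fin 2) F).det : Cˣ) : C) •
    piRep (ϖ : F) l₁ l₂ x (spherical hϖ l₁ l₂)) fun x x' h => by
    have h' := QuotientGroup.leftRel_apply.1 h
    obtain ⟨κ, hκ, rfl⟩ : ∃ κ ∈ KZ F, x' = x * κ := ⟨_, h', by group⟩
    obtain ⟨z, κ, hκ', rfl⟩ := exists_of_mem_KZ hκ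
    refine Subtype.ext (funext fun g => ?_)
    change ((S ^ _ : Cˣ) : C) * (sphVal ϖ l₁ l₂ (g * x) : C) =
      ((S ^ _ : Cˣ) : C) * (sphVal ϖ l₁ l₂ (g * (x * (tri z 0 z * κ))) : C)
    -- Translation by a central `z` multiplies the spherical vector by a power of `l₁ l₂ = S ^ 2`,
    -- which the normalizing power of `S` cancels.
    rw [← mul_assoc x, ← mul_assoc g, ← mul_assoc g, sphVal_mul_right hϖ _ _ hκ',
      sphVal_mul_scalar hϖ, ord_det_mul hϖ, ord_det_mul hϖ,
      ord_eq_zero_of_norm hϖ (norm_det_of_mem_K hκ'), det_tri, ord_mul hϖ z.ne_zero z.ne_zero,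
      ← Units.val_mul, ← Units.val_mul, ← hS]
    congr 1
    rw [← mul_assoc]
    congr 1
    rw [add_zero, ← two_mul, zpow_add, mul_assoc, zpow_neg, zpow_mul]
    simp

lemma sphCoset_apply {S : Cˣ} (hS : S ^ 2 = l₁ * l₂) (x g : GL (Fin 2) F) :
    (sphCoset hϖ hS (x : GL (Fin 2) F ⧸ KZ F)).1 g =
      ((S ^ ord (ϖ : F) (x : Matrix (Fin 2) (Fin 2) F).det : Cˣ) : C) *
        (sphVal ϖ l₁ l₂ (g * x) : C) := rfl

end spherical

end BreuilSchneider

end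

/-! ### The spherical vector generates the principal series. -/

noncomputable section

namespace BreuilSchneider

section generation

variable {F C : Type*} [NormedField F] [IsUltrametricDist F] [NormedField C] {ϖ : Fˣ}
  (hϖ : IsUniformizer (ϖ : F)) (l₁ l₂ : Cˣ)

/-- The lower unipotent matrices. -/
def low (x : F) : GL (Fin 2) F where
  val := !![1, 0; x, 1]
  inv := !![1, 0; -x, 1]
  val_inv := by
    ext i j
    fin_cases i <;> fin_cases j <;> simp [Matrix.mul_apply, Fin.sum_univ_two]
  inv_val := by
    ext i j
    fin_cases i <;> fin_cases j <;> simp [Matrix.mul_apply, Fin.sum_univ_two]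

lemma coe_low (x : F) : (low x : Matrix (Fin 2) (Fin 2) F) = !![1, 0; x, 1] := rfl

lemma low_zero : low (0 : F) = 1 := by
  refine Units.ext ?_
  rw [coe_low]
  ext i j
  fin_cases i <;> fin_cases j <;> simp

lemma low_mul (x y : F) : low x * low y = low (x + y) := by
  refine Units.ext ?_
  rw [Units.val_mul, coe_low, coe_low, coe_low]
  ext i j
  fin_cases i <;> fin_cases j <;> simp [Matrix.mul_apply, Fin.sum_univ_two]

lemma tri_mul_low (a : Fˣ) (x : F) : tri a 0 1 * low x = low (x * (a⁻¹ : Fˣ)) * tri a 0 1 := by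
  refine Units.ext ?_
  rw [Units.val_mul, Units.val_mul, coe_low, coe_low, coe_tri]
  ext i j
  fin_cases i <;> fin_cases j <;> simp [Matrix.mul_apply, Fin.sum_univ_two]

lemma continuous_low : Continuous (low : F → GL (Fin 2) F) := by
  refine Units.continuous_iff.2 ⟨?_, ?_⟩
  · refine continuous_matrix fun i j => ?_
    change Continuous fun x : F => (!![1, 0; x, 1] : Matrix (Fin 2) (Fin 2) F) i j
    fin_cases i <;> fin_cases j <;> simp <;> fun_prop
  · refine continuous_matrix fun i j => ?_
    change Continuous fun x : F => (!![1, 0; -x, 1] : Matrix (Fin 2) (Fin 2) F) i j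
    fin_cases i <;> fin_cases j <;> simp <;> fun_prop

lemma low_mem_maxCompact {x : F} (hx : ‖x‖ ≤ 1) : low x ∈ maxCompact F := by
  obtain ⟨y, hy, h⟩ := exists_lower hx
  rwa [show low x = y from Units.ext h.symm]

include hϖ in
lemma exists_low_mem {U : Subgroup (GL (Fin 2) F)} (hU : IsOpen (U : Set (GL (Fin 2) F)))
    (κ : GL (Fin 2) F) : ∃ m : ℕ, ∀ x : F, ‖x‖ ≤ ‖(ϖ : F)‖ ^ m → κ * low x * κ⁻¹ ∈ U := by
  have hc : Continuous fun x : F => κ * low x * κ⁻¹ :=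
    (continuous_const.mul continuous_low).mul continuous_const
  have h0 : (U : Set (GL (Fin 2) F)) ∈ nhds (κ * low 0 * κ⁻¹) := by
    refine hU.mem_nhds ?_
    rw [low_zero, mul_one, mul_inv_cancel]
    exact one_mem U
  obtain ⟨ε, hε, h⟩ := Metric.mem_nhds_iff.1 (hc.continuousAt.preimage_mem_nhds h0)
  obtain ⟨m, hm⟩ := exists_pow_lt_of_lt_one hε hϖ.norm_lt_one
  refine ⟨m, fun x hx => h ?_⟩
  rw [mem_ball_zero_iff]
  exact hx.trans_lt hm

include hϖ in
lemma sphVal_low {z : F} (hz : ‖z‖ ≤ 1) : sphVal ϖ l₁ l₂ (low z) = 1 := by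
  rw [← one_mul (low z), sphVal_mul_right hϖ _ _ (low_mem_maxCompact hz), sphVal]
  simp only [Units.val_one, Matrix.det_one, ord_one hϖ, neg_zero, zpow_zero, one_mul]
  have : rowMax ((1 : Matrix (Fin 2) (Fin 2) F) 1 0) ((1 : Matrix (Fin 2) (Fin 2) F) 1 1) = 1 := by
    simp [rowMax]
  rw [this, ord_one hϖ, zpow_zero]

/-- The subspace generated by the spherical vector. -/
def sphSpan : Submodule C (smoothInd (nr (ϖ : F) l₁⁻¹) (nr (C := C) (ϖ : F) l₂⁻¹)) :=
  Submodule.span C (Set.range fun x => piRep (ϖ : F) l₁ l₂ x (spherical hϖ l₁ l₂))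

lemma piRep_mem_sphSpan (y : GL (Fin 2) F)
    {w : smoothInd (nr (ϖ : F) l₁⁻¹) (nr (C := C) (ϖ : F) l₂⁻¹)} (hw : w ∈ sphSpan hϖ l₁ l₂) :
    piRep (ϖ : F) l₁ l₂ y w ∈ sphSpan hϖ l₁ l₂ := by
  have : sphSpan hϖ l₁ l₂ ≤ (sphSpan hϖ l₁ l₂).comap (piRep (ϖ : F) l₁ l₂ y) := by
    refine Submodule.span_le.2 ?_
    rintro _ ⟨x, rfl⟩
    change piRep (ϖ : F) l₁ l₂ y (piRep (ϖ : F) l₁ l₂ x (spherical hϖ l₁ l₂)) ∈ sphSpan hϖ l₁ l₂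
    rw [← Module.End.mul_apply, ← map_mul]
    exact Submodule.subset_span ⟨y * x, rfl⟩
  exact this hw

/-- The translate by `diag(ϖ, 1)` multiplies the spherical vector by `l₁⁻¹` where the second entry
of the bottom row dominates and by `l₂⁻¹` elsewhere. Subtracting `l₂⁻¹` times the vector kills the
second part, and `l₁ ≠ l₂` keeps the first. -/
lemma exists_indicator (hl : l₁ ≠ l₂) (y : GL (Fin 2) F) : ∃ w ∈ sphSpan hϖ l₁ l₂, ∀ g,
    (‖(g * y) 1 0‖ ≤ ‖(g * y) 1 1‖ → w.1 g = sphVal ϖ l₁ l₂ (g * y)) ∧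
      (‖(g * y) 1 1‖ < ‖(g * y) 1 0‖ → w.1 g = 0) := by
  have hp1 := hϖ.norm_lt_one
  have hdet : ‖((tri ϖ 0 1 : GL (Fin 2) F) : Matrix (Fin 2) (Fin 2) F).det‖ = ‖(ϖ : F)‖ := by
    rw [det_tri, Units.val_one, mul_one]
  have hne : (l₁ : C)⁻¹ - (l₂ : C)⁻¹ ≠ 0 := by
    rw [sub_ne_zero]
    exact fun h => hl (Units.ext (inv_injective h))
  have hrow : ∀ g : GL (Fin 2) F, max ‖(g * tri ϖ 0 1) 1 0‖ ‖(g * tri ϖ 0 1) 1 1‖ =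
      max (‖(ϖ : F)‖ * ‖g 1 0‖) ‖g 1 1‖ := fun g => by
    rw [coe_mul_apply_one, coe_mul_apply_one, coe_tri]
    simp [mul_comm]
  refine ⟨piRep (ϖ : F) l₁ l₂ y (((l₁ : C)⁻¹ - (l₂ : C)⁻¹)⁻¹ •
    (piRep (ϖ : F) l₁ l₂ (tri ϖ 0 1) (spherical hϖ l₁ l₂) - (l₂ : C)⁻¹ • spherical hϖ l₁ l₂)),
    piRep_mem_sphSpan hϖ l₁ l₂ y (Submodule.smul_mem _ _ (Submodule.sub_mem _
      (Submodule.subset_span ⟨_, rfl⟩) (Submodule.smul_mem _ _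
      (Submodule.subset_span ⟨1, by beta_reduce; rw [map_one]; rfl⟩)))), fun g => ⟨fun h => ?_, fun h => ?_⟩⟩
  · change ((l₁ : C)⁻¹ - (l₂ : C)⁻¹)⁻¹ * ((sphVal ϖ l₁ l₂ (g * y * tri ϖ 0 1) : C) -
      (l₂ : C)⁻¹ * (sphVal ϖ l₁ l₂ (g * y) : C)) = _
    rw [sphVal_of_row_eq hϖ _ _ hdet, Units.val_mul, Units.val_inv_eq_inv_val, ← sub_mul,
      inv_mul_cancel_left₀ hne]
    rw [hrow, max_eq_right h, max_eq_right]
    exact (mul_le_of_le_one_left (norm_nonneg _) hp1.le).trans h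
  · change ((l₁ : C)⁻¹ - (l₂ : C)⁻¹)⁻¹ * ((sphVal ϖ l₁ l₂ (g * y * tri ϖ 0 1) : C) -
      (l₂ : C)⁻¹ * (sphVal ϖ l₁ l₂ (g * y) : C)) = _
    rw [sphVal_of_row_mul hϖ _ _ hdet, Units.val_mul, Units.val_inv_eq_inv_val, sub_self, mul_zero]
    rw [hrow, max_eq_left h.le, max_eq_left (norm_le_of_norm_lt hϖ h)]

include hϖ in
-- Under `hg` the matrix `g y` is an upper triangular `b` times `low z` with `z` integral. The
-- unipotent factor, conjugated by `y`, lies in the group that fixes `f`, so only the value at `y⁻¹`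
-- enters.
lemma apply_eq_of_row_le {U : Subgroup (GL (Fin 2) F)} {f : GL (Fin 2) F → C}
    (hf : ∀ b : GL (Fin 2) F, b 1 0 = 0 → ∀ g, ∀ u ∈ U,
      f (b * g * u) = nr (ϖ : F) l₁⁻¹ (b 0 0) * nr (ϖ : F) l₂⁻¹ (b 1 1) * f g)
    {y : GL (Fin 2) F} (hy : ∀ z : F, ‖z‖ ≤ 1 → y * low z * y⁻¹ ∈ U) {g : GL (Fin 2) F}
    (hg : ‖(g * y) 1 0‖ ≤ ‖(g * y) 1 1‖) : f g = f y⁻¹ * sphVal ϖ l₁ l₂ (g * y) := by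
  have h1 : 0 < ‖(g * y) 1 1‖ := by
    have := row_pos (g * y)
    rwa [max_eq_right hg] at this
  set z := (g * y) 1 0 / (g * y) 1 1 with hz
  have hz1 : ‖z‖ ≤ 1 := by
    rw [hz, norm_div]
    exact div_le_one_of_le₀ hg (norm_nonneg _)
  have hzd : (g * y) 1 1 * z = (g * y) 1 0 := mul_div_cancel₀ _ (norm_pos_iff.1 h1)
  set b := g * y * low (-z) with hb
  have hb0 : b 1 0 = 0 := by
    rw [hb, coe_mul_apply_one, coe_low]
    change (g * y) 1 0 * 1 + (g * y) 1 1 * -z = 0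
    rw [mul_neg, hzd, mul_one, add_neg_cancel]
  have e1 : b * low z = g * y := by
    rw [hb, mul_assoc, low_mul, neg_add_cancel, low_zero, mul_one]
  have e2 : b * y⁻¹ * (y * low z * y⁻¹) = g := by
    rw [mul_assoc, mul_assoc y, inv_mul_cancel_left, ← mul_assoc, e1, mul_inv_cancel_right]
  have e3 := hf b hb0 y⁻¹ _ (hy z hz1)
  rw [e2] at e3
  rw [e3, ← e1, sphVal_mul_left hϖ _ _ _ _ hb0, sphVal_low hϖ _ _ hz1, mul_one, nr, nr,
    inv_zpow', inv_zpow', ← Units.val_mul, mul_comm]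

/-- For the coordinate `c / d` of the bottom row of `g κ`, the condition describes the ball of
radius `‖ϖ‖ ^ j` about `ξ`. -/
lemma row_mul_low_tri (κ g : GL (Fin 2) F) (ξ : F) (j : ℕ) :
    (‖(g * (κ * low (-ξ) * tri (ϖ⁻¹ ^ j) 0 1)) 1 0‖ ≤
        ‖(g * (κ * low (-ξ) * tri (ϖ⁻¹ ^ j) 0 1)) 1 1‖) ↔
      ‖(g * κ) 1 0 - ξ * (g * κ) 1 1‖ ≤ ‖(ϖ : F)‖ ^ j * ‖(g * κ) 1 1‖ := by
  have hp : 0 < ‖(ϖ : F)‖ ^ j := pow_pos (norm_pos_iff.2 ϖ.ne_zero) _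
  rw [← mul_assoc, ← mul_assoc]
  simp only [coe_mul_apply_one _ (tri _ _ _), coe_mul_apply_one _ (low _)]
  have e0 : ((g * κ) 1 0 * 1 + (g * κ) 1 1 * -ξ) * ((ϖ⁻¹ ^ j : Fˣ) : F) +
      ((g * κ) 1 0 * 0 + (g * κ) 1 1 * 1) * 0 =
      ((g * κ) 1 0 - ξ * (g * κ) 1 1) * ((ϖ⁻¹ ^ j : Fˣ) : F) := by ring
  have e1 : ((g * κ) 1 0 * 1 + (g * κ) 1 1 * -ξ) * 0 +
      ((g * κ) 1 0 * 0 + (g * κ) 1 1 * 1) * ((1 : Fˣ) : F) = (g * κ) 1 1 := by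
    rw [Units.val_one]; ring
  change ‖((g * κ) 1 0 * 1 + (g * κ) 1 1 * -ξ) * ((ϖ⁻¹ ^ j : Fˣ) : F) +
      ((g * κ) 1 0 * 0 + (g * κ) 1 1 * 1) * 0‖ ≤ ‖((g * κ) 1 0 * 1 + (g * κ) 1 1 * -ξ) * 0 +
      ((g * κ) 1 0 * 0 + (g * κ) 1 1 * 1) * ((1 : Fˣ) : F)‖ ↔ _
  rw [e0, e1, norm_mul, Units.val_pow_eq_pow_val, Units.val_inv_eq_inv_val, norm_pow, norm_inv,
    inv_pow, ← div_eq_mul_inv, div_le_iff₀ hp, mul_comm (‖(ϖ : F)‖ ^ j)]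

open Classical in
/-- The restriction of an element of the principal series to a small ball is a multiple of a
translate of the indicator function of a ball, hence the restrictions to all balls are in the
span of the translates of the spherical vector. -/
lemma exists_restriction (hl : l₁ ≠ l₂) {I : Type*} [Fintype I] {t : I → F} (hsp : Spread t)
    (hcov : ∀ x : F, ‖x‖ ≤ 1 → ∃ i, ‖x - t i‖ < 1) {U : Subgroup (GL (Fin 2) F)}
    {f : GL (Fin 2) F → C}
    (hf : ∀ b : GL (Fin 2) F, b 1 0 = 0 → ∀ g, ∀ u ∈ U,
      f (b * g * u) = nr (ϖ : F) l₁⁻¹ (b 0 0) * nr (ϖ : F) l₂⁻¹ (b 1 1) * f g)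
    {κ : GL (Fin 2) F} {m : ℕ} (hκ : ∀ x : F, ‖x‖ ≤ ‖(ϖ : F)‖ ^ m → κ * low x * κ⁻¹ ∈ U) :
    ∀ n j : ℕ, j + n = m → ∀ ξ : F, ∃ w ∈ sphSpan hϖ l₁ l₂, ∀ g, w.1 g =
      if ‖(g * κ) 1 0 - ξ * (g * κ) 1 1‖ ≤ ‖(ϖ : F)‖ ^ j * ‖(g * κ) 1 1‖ then f g else 0 := by
  have hp := norm_pos_iff.2 ϖ.ne_zero
  intro n
  induction n with
  | zero =>
    rintro m' rfl ξ
    rw [add_zero] at hκ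
    set y := κ * low (-ξ) * tri (ϖ⁻¹ ^ m') 0 1 with hy
    have hyU : ∀ z : F, ‖z‖ ≤ 1 → y * low z * y⁻¹ ∈ U := fun z hz => by
      have e : y * low z * y⁻¹ = κ * low (z * (((ϖ⁻¹ ^ m')⁻¹ : Fˣ) : F)) * κ⁻¹ := by
        rw [mul_inv_eq_iff_eq_mul, hy, mul_assoc, tri_mul_low]
        have : low (-ξ) * low (z * (((ϖ⁻¹ ^ m')⁻¹ : Fˣ) : F)) =
            low (z * (((ϖ⁻¹ ^ m')⁻¹ : Fˣ) : F)) * low (-ξ) := by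
          rw [low_mul, low_mul, add_comm]
        simp only [← mul_assoc]
        rw [mul_assoc κ, this]
        simp only [← mul_assoc, inv_mul_cancel_right]
      rw [e]
      refine hκ _ ?_
      rw [inv_pow, inv_inv, Units.val_pow_eq_pow_val, norm_mul, norm_pow]
      exact mul_le_of_le_one_left (by positivity) hz
    obtain ⟨w, hw, hwg⟩ := exists_indicator hϖ l₁ l₂ hl y
    refine ⟨f y⁻¹ • w, Submodule.smul_mem _ _ hw, fun g => ?_⟩
    have hiff := row_mul_low_tri (ϖ := ϖ) κ g ξ m'
    rw [← hy] at hiff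
    change f y⁻¹ * w.1 g = _
    split_ifs with h
    · rw [(hwg g).1 (hiff.2 h), apply_eq_of_row_le hϖ l₁ l₂ hf hyU (hiff.2 h)]
    · rw [(hwg g).2 (not_le.1 fun h' => h (hiff.1 h')), mul_zero]
  | succ n ih =>
    intro j hj ξ
    -- A ball is the disjoint union of the `q` balls of the next smaller radius, centred at `ξ + ϖ ^
    -- j t i`.
    choose w hw hwg using fun i => ih (j + 1) (by omega) (ξ + (ϖ : F) ^ j * t i)
    refine ⟨∑ i, w i, Submodule.sum_mem _ fun i _ => hw i, fun g => ?_⟩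
    have e : (∑ i, w i).1 g = ∑ i, (w i).1 g := by
      rw [AddSubmonoidClass.coe_finsetSum, Finset.sum_apply]
    rw [e]
    simp only [hwg]
    set c := (g * κ) 1 0 with hc
    set d := (g * κ) 1 1 with hd
    have hsub : ∀ i, c - (ξ + (ϖ : F) ^ j * t i) * d = (c - ξ * d) - (ϖ : F) ^ j * t i * d :=
      fun i => by ring
    have hle : ∀ i, ‖(ϖ : F) ^ j * t i * d‖ ≤ ‖(ϖ : F)‖ ^ j * ‖d‖ := fun i => by
      rw [norm_mul, norm_mul, norm_pow]
      gcongr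
      exact mul_le_of_le_one_right (by positivity) (hsp.le_one i)
    have hle' : ‖(ϖ : F)‖ ^ (j + 1) * ‖d‖ ≤ ‖(ϖ : F)‖ ^ j * ‖d‖ := by
      gcongr ?_ * _
      exact pow_le_pow_of_le_one hp.le hϖ.norm_lt_one.le (Nat.le_succ j)
    split_ifs with h
    · have hd0 : 0 < ‖d‖ := by
        by_contra hd0
        have hd1 : ‖d‖ = 0 := le_antisymm (not_lt.1 hd0) (norm_nonneg _)
        have := row_pos (g * κ)
        rw [← hc, ← hd, hd1] at this
        rw [hd1, mul_zero, norm_eq_zero.1 hd1, mul_zero, sub_zero] at h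
        exact this.not_ge (max_le h le_rfl)
      obtain ⟨i₀, hi₀⟩ := hcov ((c - ξ * d) / ((ϖ : F) ^ j * d)) (by
        rw [norm_div, norm_mul, norm_pow]
        exact div_le_one_of_le₀ h (by positivity))
      have hi₀' : ‖c - (ξ + (ϖ : F) ^ j * t i₀) * d‖ ≤ ‖(ϖ : F)‖ ^ (j + 1) * ‖d‖ := by
        have hw0 : (ϖ : F) ^ j * d ≠ 0 :=
          mul_ne_zero (pow_ne_zero _ ϖ.ne_zero) (norm_pos_iff.1 hd0)
        have e1 : c - (ξ + (ϖ : F) ^ j * t i₀) * d =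
            ((c - ξ * d) / ((ϖ : F) ^ j * d) - t i₀) * ((ϖ : F) ^ j * d) := by
          rw [sub_mul, div_mul_cancel₀ _ hw0]
          ring
        rw [e1, norm_mul, norm_mul, norm_pow, pow_succ', mul_assoc]
        exact mul_le_mul_of_nonneg_right (hϖ.norm_le _ hi₀) (by positivity)
      rw [Finset.sum_eq_single i₀, if_pos hi₀']
      · intro i _ hi
        refine if_neg fun h' => ?_
        have e2 : (ϖ : F) ^ j * (t i - t i₀) * d =
            (c - (ξ + (ϖ : F) ^ j * t i₀) * d) - (c - (ξ + (ϖ : F) ^ j * t i) * d) := by ring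
        have e3 : ‖(ϖ : F) ^ j * (t i - t i₀) * d‖ ≤ ‖(ϖ : F)‖ ^ (j + 1) * ‖d‖ := by
          rw [e2]
          rw [sub_eq_add_neg]
          refine (IsUltrametricDist.norm_add_le_max _ _).trans (max_le hi₀' ?_)
          rwa [norm_neg]
        rw [norm_mul, norm_mul, norm_pow, hsp.sub i i₀ hi, mul_one, pow_succ] at e3
        have e4 : 0 < ‖(ϖ : F)‖ ^ j * ‖d‖ := by positivity
        nlinarith [hϖ.norm_lt_one]
      · exact fun h => absurd (Finset.mem_univ _) h
    · refine Finset.sum_eq_zero fun i _ => if_neg fun h' => h ?_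
      have e1 : c - ξ * d = (c - (ξ + (ϖ : F) ^ j * t i) * d) + (ϖ : F) ^ j * t i * d := by ring
      rw [e1]
      exact (IsUltrametricDist.norm_add_le_max _ _).trans (max_le (h'.trans hle') (hle i))

include hϖ in
/-- The spherical vector generates the principal series. -/
theorem sphSpan_eq_top (hl : l₁ ≠ l₂) {I : Type*} [Fintype I] {t : I → F} (hsp : Spread t)
    (hcov : ∀ x : F, ‖x‖ ≤ 1 → ∃ i, ‖x - t i‖ < 1) : sphSpan hϖ l₁ l₂ = ⊤ := by
  classical
  refine eq_top_iff.2 fun f _ => ?_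
  obtain ⟨U, hU, hf⟩ := f.2
  obtain ⟨s, -, hs⟩ := swap_mem_maxCompact (F := F)
  obtain ⟨m, hm⟩ := exists_low_mem hϖ hU 1
  obtain ⟨m', hm'⟩ := exists_low_mem hϖ hU s
  obtain ⟨w, hw, hwg⟩ := exists_restriction hϖ l₁ l₂ hl hsp hcov hf hm m 0 (zero_add m) 0
  -- The projective line is the unit ball together with the complementary ball about infinity. The
  -- latter is seen through the swap `s` and starts at radius `‖ϖ‖`, hence the index `1` and the
  -- depth `m' + 1`.
  obtain ⟨w', hw', hwg'⟩ := exists_restriction hϖ l₁ l₂ hl hsp hcov hf (m := m' + 1)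
    (fun x hx => hm' x (hx.trans (pow_le_pow_of_le_one (norm_nonneg _) hϖ.norm_lt_one.le
      (Nat.le_succ _)))) m' 1 (add_comm 1 m') 0
  have e : f = w + w' := by
    refine Subtype.ext (funext fun g => ?_)
    change f.1 g = w.1 g + w'.1 g
    have h0 : (g * s) 1 0 = g 1 1 := by
      rw [coe_mul_apply_one, hs]
      simp
    have h1 : (g * s) 1 1 = g 1 0 := by
      rw [coe_mul_apply_one, hs]
      simp
    rw [hwg, hwg', mul_one, zero_mul, zero_mul, sub_zero, sub_zero, pow_zero, one_mul, pow_one, h0,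
      h1]
    rcases le_or_gt ‖g 1 0‖ ‖g 1 1‖ with h | h
    · rw [if_pos h, if_neg, add_zero]
      intro h'
      have h2 := row_pos g
      rw [max_eq_right h] at h2
      have h3 : ‖g 1 1‖ ≤ ‖(ϖ : F)‖ * ‖g 1 1‖ := h'.trans (by gcongr)
      nlinarith [hϖ.norm_lt_one]
    · rw [if_neg (not_le.2 h), if_pos (norm_le_of_norm_lt hϖ h), zero_add]
  rw [e]
  exact Submodule.add_mem _ hw hw'

lemma span_sphCoset (hl : l₁ ≠ l₂) {I : Type*} [Fintype I] {t : I → F} (hsp : Spread t)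
    (hcov : ∀ x : F, ‖x‖ ≤ 1 → ∃ i, ‖x - t i‖ < 1) {S : Cˣ} (hS : S ^ 2 = l₁ * l₂) :
    Submodule.span C (Set.range (sphCoset hϖ hS)) = ⊤ := by
  refine eq_top_iff.2 ((sphSpan_eq_top hϖ l₁ l₂ hl hsp hcov).ge.trans (Submodule.span_le.2 ?_))
  rintro _ ⟨x, rfl⟩
  have h : piRep (ϖ : F) l₁ l₂ x (spherical hϖ l₁ l₂) =
      (((S ^ ord (ϖ : F) (x : Matrix (Fin 2) (Fin 2) F).det)⁻¹ : Cˣ) : C) •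
        sphCoset hϖ hS (x : GL (Fin 2) F ⧸ KZ F) := by
    change _ = _ • (_ • _)
    rw [smul_smul, Units.inv_mul, one_smul]
  change piRep (ϖ : F) l₁ l₂ x (spherical hϖ l₁ l₂) ∈ _
  rw [h]
  exact Submodule.smul_mem _ _ (Submodule.subset_span ⟨_, rfl⟩)

end generation

end BreuilSchneider

end

/-! ### The map from the compact induction to the tensor product. -/

noncomputable section

namespace BreuilSchneider

section sphMap

variable {F C : Type*} [NormedField F] [IsUltrametricDist F] [NormedField C] {ϖ : Fˣ}
  (hϖ : IsUniformizer (ϖ : F)) {l₁ l₂ S : Cˣ} (hS : S ^ 2 = l₁ * l₂)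
  {V : Type*} [AddCommGroup V] [Module C V] {ρ ρ' : Representation C (GL (Fin 2) F) V}
  (hρ : ∀ g : GL (Fin 2) F,
    ρ' g = ((S ^ (-ord (ϖ : F) (g : Matrix (Fin 2) (Fin 2) F).det) : Cˣ) : C) • ρ g)
  {φ : HeckeKernel (KZ F) ρ'}
  (hφ : ∀ g ∈ DoubleCoset.doubleCoset (alpha hϖ)⁻¹ (KZ F : Set (GL (Fin 2) F)) (KZ F),
    φ.toFun g = (S : C) • ρ' g)
  (hφ0 : ∀ g, φ.toFun g ≠ 0 →
    g ∈ DoubleCoset.doubleCoset (alpha hϖ)⁻¹ (KZ F : Set (GL (Fin 2) F)) (KZ F))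
  {I : Type*} [Fintype I] {t : I → F} (hsp : Spread t)
  (hcov : ∀ x : F, ‖x‖ ≤ 1 → ∃ i, ‖x - t i‖ < 1)

lemma inv_mem_doubleCoset {g : GL (Fin 2) F}
    (hg : g ∈ DoubleCoset.doubleCoset (alpha hϖ)⁻¹ (KZ F : Set (GL (Fin 2) F)) (KZ F)) :
    g⁻¹ ∈ DoubleCoset.doubleCoset (alpha hϖ)⁻¹ (KZ F : Set (GL (Fin 2) F)) (KZ F) := by
  obtain ⟨x, hx, y, hy, rfl⟩ := DoubleCoset.mem_doubleCoset.1 hg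
  obtain ⟨x', hx', y', hy', h⟩ := DoubleCoset.mem_doubleCoset.1 (alpha_mem_doubleCoset hϖ)
  refine DoubleCoset.mem_doubleCoset.2 ⟨y⁻¹ * x', mul_mem (inv_mem hy) hx', y' * x⁻¹,
    mul_mem hy' (inv_mem hx), ?_⟩
  have : (x * (alpha hϖ)⁻¹ * y)⁻¹ = y⁻¹ * alpha hϖ * x⁻¹ := by group
  rw [this]
  nth_rewrite 1 [h]
  group

include hφ hφ0 hsp hcov in
/-- The Hecke operator in terms of cosets. -/
lemma cosetEquiv_subScalar (a : C) (f : compactInd (KZ F) ρ') (g : GL (Fin 2) F) :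
    cosetEquiv (KZ F) ρ' (φ.subScalar a f) (g : GL (Fin 2) F ⧸ KZ F) =
      (S : C) • ∑ o : Option I, cosetEquiv (KZ F) ρ' f
        ((g * heckeRep ϖ t o : GL (Fin 2) F) : GL (Fin 2) F ⧸ KZ F) -
      a • cosetEquiv (KZ F) ρ' f (g : GL (Fin 2) F ⧸ KZ F) := by
  rw [cosetEquiv_apply, cosetEquiv_apply, HeckeKernel.subScalar_apply,
    φ.operator_apply_eq_sum (heckeRep ϖ t) (heckeRep_injective hϖ hsp.sub)
      (fun g hg => exists_heckeRep_eq hϖ hsp.le_one hcov (hφ0 g hg)), map_sub, map_sum, map_smul,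
    Finset.smul_sum]
  congr 1
  refine Finset.sum_congr rfl fun o _ => ?_
  rw [hφ _ (heckeRep_mem hϖ hsp.le_one o), LinearMap.smul_apply, map_smul, cosetEquiv_apply,
    map_mul, Module.End.mul_apply, mul_inv_rev]

include hsp hcov in
lemma sum_heckeRep_ite (v : V) (g : GL (Fin 2) F) [∀ o, Decidable
      ((heckeRep ϖ t o : GL (Fin 2) F ⧸ KZ F) = g)] [Decidable (g ∈ DoubleCoset.doubleCoset
        (alpha hϖ)⁻¹ (KZ F : Set (GL (Fin 2) F)) (KZ F))] :
    ∑ o : Option I, (if (heckeRep ϖ t o : GL (Fin 2) F ⧸ KZ F) = g then v else 0) =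
      if g ∈ DoubleCoset.doubleCoset (alpha hϖ)⁻¹ (KZ F : Set (GL (Fin 2) F)) (KZ F) then v
      else 0 := by
  split_ifs with hg
  · obtain ⟨o, ho⟩ := exists_heckeRep_eq hϖ hsp.le_one hcov hg
    rw [Finset.sum_eq_single o, if_pos ho]
    · exact fun o' _ ho' => if_neg fun h => ho' (heckeRep_injective hϖ hsp.sub (h.trans ho.symm))
    · exact fun h => absurd (Finset.mem_univ _) h
  · refine Finset.sum_eq_zero fun o _ => if_neg fun h => hg ?_
    obtain ⟨x, hx, y, hy, h'⟩ := DoubleCoset.mem_doubleCoset.1 (heckeRep_mem hϖ hsp.le_one o)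
    refine DoubleCoset.mem_doubleCoset.2 ⟨x, hx, y * ((heckeRep ϖ t o)⁻¹ * g),
      mul_mem hy (QuotientGroup.eq.1 h), ?_⟩
    rw [← mul_assoc, ← h', mul_inv_cancel_left]

include hφ hφ0 hsp hcov in
-- The double coset is stable under inversion, so `T` spreads a function at the base vertex to the
-- same neighbours over which it sums.
lemma subScalar_single_one (a : C) (v : V) :
    φ.subScalar a ((cosetEquiv (KZ F) ρ').symm
      (Finsupp.single ((1 : GL (Fin 2) F) : GL (Fin 2) F ⧸ KZ F) v)) =
      (cosetEquiv (KZ F) ρ').symm ((S : C) • ∑ o : Option I,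
        Finsupp.single (heckeRep ϖ t o : GL (Fin 2) F ⧸ KZ F) v -
          a • Finsupp.single ((1 : GL (Fin 2) F) : GL (Fin 2) F ⧸ KZ F) v) := by
  classical
  rw [LinearEquiv.eq_symm_apply]
  ext c
  induction c using QuotientGroup.induction_on with
  | H g =>
    rw [cosetEquiv_subScalar hϖ hφ hφ0 hsp hcov, LinearEquiv.apply_symm_apply, Finsupp.sub_apply,
      Finsupp.smul_apply, Finsupp.smul_apply, Finsupp.finsetSum_apply]
    congr 2
    simp only [Finsupp.single_apply]
    rw [sum_heckeRep_ite hϖ hsp hcov]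
    have e : ∀ o, (((1 : GL (Fin 2) F) : GL (Fin 2) F ⧸ KZ F) =
        ((g * heckeRep ϖ t o : GL (Fin 2) F) : GL (Fin 2) F ⧸ KZ F)) ↔
        (heckeRep ϖ t o : GL (Fin 2) F ⧸ KZ F) = ((g⁻¹ : GL (Fin 2) F) : GL (Fin 2) F ⧸ KZ F) :=
      fun o => by
        rw [QuotientGroup.eq, eq_comm, QuotientGroup.eq, inv_one, one_mul, inv_inv]
    simp only [e]
    rw [sum_heckeRep_ite hϖ hsp hcov]
    exact if_congr ⟨fun h => inv_inv g ▸ inv_mem_doubleCoset hϖ h, inv_mem_doubleCoset hϖ⟩ rfl rfl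

/-- The map from the compact induction to the tensor product with the principal series that is
given by the spherical vector. -/
def sphMap : compactInd (KZ F) ρ' →ₗ[C]
    V ⊗[C] smoothInd (nr (ϖ : F) l₁⁻¹) (nr (C := C) (ϖ : F) l₂⁻¹) :=
  (Finsupp.lsum C fun c => (TensorProduct.mk C V _).flip (sphCoset hϖ hS c)) ∘ₗ
    (cosetEquiv (KZ F) ρ').toLinearMap

lemma sphMap_single (c : GL (Fin 2) F ⧸ KZ F) (v : V) :
    sphMap hϖ hS ((cosetEquiv (KZ F) ρ').symm (Finsupp.single c v)) =
      v ⊗ₜ sphCoset hϖ hS c := by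
  change Finsupp.lsum C _ (cosetEquiv (KZ F) ρ' ((cosetEquiv (KZ F) ρ').symm _)) = _
  rw [LinearEquiv.apply_symm_apply, Finsupp.lsum_single]
  rfl

lemma sphCoset_smul (x : GL (Fin 2) F) (c : GL (Fin 2) F ⧸ KZ F) :
    sphCoset hϖ hS (x • c) =
      ((S ^ ord (ϖ : F) (x : Matrix (Fin 2) (Fin 2) F).det : Cˣ) : C) •
        piRep (ϖ : F) l₁ l₂ x (sphCoset hϖ hS c) := by
  induction c using QuotientGroup.induction_on with
  | H g =>
    refine Subtype.ext (funext fun y => ?_)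
    change ((S ^ ord (ϖ : F) ((x * g : GL (Fin 2) F) : Matrix (Fin 2) (Fin 2) F).det : Cˣ) : C) *
      (sphVal ϖ l₁ l₂ (y * (x * g)) : C) = ((S ^ _ : Cˣ) : C) * (((S ^ _ : Cˣ) : C) * (sphVal ϖ l₁ l₂ (y * x * g) : C))
    rw [ord_det_mul hϖ, zpow_add, Units.val_mul, mul_assoc, mul_assoc y]

lemma linearMap_ext_single {W : Type*} [AddCommMonoid W] [Module C W]
    {A B : compactInd (KZ F) ρ' →ₗ[C] W}
    (h : ∀ c v, A ((cosetEquiv (KZ F) ρ').symm (Finsupp.single c v)) =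
      B ((cosetEquiv (KZ F) ρ').symm (Finsupp.single c v))) : A = B := by
  have : A ∘ₗ (cosetEquiv (KZ F) ρ').symm.toLinearMap =
      B ∘ₗ (cosetEquiv (KZ F) ρ').symm.toLinearMap := Finsupp.lhom_ext h
  ext f : 1
  have := LinearMap.congr_fun this (cosetEquiv (KZ F) ρ' f)
  rwa [LinearMap.comp_apply, LinearMap.comp_apply, LinearEquiv.coe_coe,
    LinearEquiv.symm_apply_apply] at this

include hρ in
-- The power of `S` by which `ρ'` differs from `ρ` cancels the one that normalizes `sphCoset`.
lemma sphMap_equivariant (x : GL (Fin 2) F) (f : compactInd (KZ F) ρ') :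
    sphMap hϖ hS (compactIndRep (KZ F) ρ' x f) =
      ρ.tprod (piRep (ϖ : F) l₁ l₂) x (sphMap hϖ hS f) := by
  have : sphMap hϖ hS ∘ₗ compactIndRep (KZ F) ρ' x =
      ρ.tprod (piRep (ϖ : F) l₁ l₂) x ∘ₗ sphMap hϖ hS := by
    refine linearMap_ext_single fun c v => ?_
    rw [LinearMap.comp_apply, LinearMap.comp_apply, compactIndRep_single, sphMap_single,
      sphMap_single, Representation.tprod_apply, TensorProduct.map_tmul, sphCoset_smul, hρ,
      LinearMap.smul_apply, TensorProduct.smul_tmul_smul, ← Units.val_mul, ← zpow_add,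
      neg_add_cancel, zpow_zero, Units.val_one, one_smul]
  exact LinearMap.congr_fun this f

include hρ hφ hφ0 hsp hcov in
-- By equivariance it suffices to treat functions supported at the base vertex. There the claim is
-- the eigenvalue equation of the spherical vector: one factor `S` comes from `ψ`, another from the
-- normalization of the neighbours, and `S ^ 2 = l₁ l₂`.
lemma sphMap_subScalar {a : C} (ha : (l₁ : C) + Fintype.card I * l₂ = a)
    (f : compactInd (KZ F) ρ') : sphMap hϖ hS (φ.subScalar a f) = 0 := by
  have hone : ∀ v, sphMap hϖ hS (φ.subScalar a ((cosetEquiv (KZ F) ρ').symm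
      (Finsupp.single ((1 : GL (Fin 2) F) : GL (Fin 2) F ⧸ KZ F) v))) = 0 := fun v => by
    rw [subScalar_single_one hϖ hφ hφ0 hsp hcov]
    simp only [map_sub, map_smul, map_sum, sphMap_single]
    rw [← TensorProduct.tmul_sum, ← TensorProduct.tmul_smul, ← TensorProduct.tmul_smul,
      ← TensorProduct.tmul_sub]
    suffices h : (S : C) • ∑ o : Option I, sphCoset hϖ hS (heckeRep ϖ t o : GL (Fin 2) F ⧸ KZ F) -
        a • sphCoset hϖ hS ((1 : GL (Fin 2) F) : GL (Fin 2) F ⧸ KZ F) = 0 by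
      rw [h, TensorProduct.tmul_zero]
    refine Subtype.ext (funext fun g => ?_)
    have e1 : ∀ o, ord (ϖ : F) ((heckeRep ϖ t o : GL (Fin 2) F) : Matrix (Fin 2) (Fin 2) F).det =
        1 := fun o => by
      rcases o with _ | i
      · rw [heckeRep, det_tri, Units.val_one, one_mul, ord_self hϖ]
      · rw [heckeRep, det_tri, Units.val_one, mul_one, ord_self hϖ]
    have e2 : (∑ o : Option I, sphCoset hϖ hS (heckeRep ϖ t o : GL (Fin 2) F ⧸ KZ F)).1 g =
        S * ∑ o : Option I, (sphVal ϖ l₁ l₂ (g * heckeRep ϖ t o) : C) := by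
      rw [AddSubmonoidClass.coe_finsetSum, Finset.sum_apply, Finset.mul_sum]
      refine Finset.sum_congr rfl fun o _ => ?_
      rw [sphCoset_apply, e1, zpow_one]
    change (S : C) * (∑ o : Option I, sphCoset hϖ hS (heckeRep ϖ t o : GL (Fin 2) F ⧸ KZ F)).1 g -
      a * (sphCoset hϖ hS ((1 : GL (Fin 2) F) : GL (Fin 2) F ⧸ KZ F)).1 g = 0
    rw [e2, sphCoset_apply, Units.val_one, Matrix.det_one, ord_one hϖ, zpow_zero, Units.val_one,
      one_mul, mul_one, ← mul_assoc, ← Units.val_mul, ← pow_two, hS, Units.val_mul,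
      sum_sphVal_heckeRep hϖ l₁ l₂ hsp hcov, ha, sub_self]
  have : sphMap hϖ hS ∘ₗ φ.subScalar a = 0 := by
    refine linearMap_ext_single fun c v => ?_
    induction c using QuotientGroup.induction_on with
    | H g =>
      have e : (cosetEquiv (KZ F) ρ').symm (Finsupp.single (g : GL (Fin 2) F ⧸ KZ F) v) =
          compactIndRep (KZ F) ρ' g ((cosetEquiv (KZ F) ρ').symm
            (Finsupp.single ((1 : GL (Fin 2) F) : GL (Fin 2) F ⧸ KZ F) (ρ' g⁻¹ v))) := by
        rw [compactIndRep_single, ← Module.End.mul_apply, ← map_mul, mul_inv_cancel, map_one,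
          Module.End.one_apply]
        congr 2
        change (g : GL (Fin 2) F ⧸ KZ F) = ((g * 1 : GL (Fin 2) F) : GL (Fin 2) F ⧸ KZ F)
        rw [mul_one]
      have hcomm : ∀ f, φ.subScalar a (compactIndRep (KZ F) ρ' g f) =
          compactIndRep (KZ F) ρ' g (φ.subScalar a f) := fun f => by
        simp only [HeckeKernel.subScalar, LinearMap.sub_apply, LinearMap.smul_apply,
          LinearMap.id_apply, φ.operator_comm, map_sub, map_smul]
      rw [LinearMap.comp_apply, e, hcomm, sphMap_equivariant hϖ hS hρ, hone, map_zero]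
      rfl
  exact LinearMap.congr_fun this f

include hsp hcov in
lemma sphMap_surjective (hl : l₁ ≠ l₂) :
    Function.Surjective (sphMap hϖ hS : compactInd (KZ F) ρ' →ₗ[C] _) := by
  rw [← LinearMap.range_eq_top, eq_top_iff, ← TensorProduct.span_tmul_eq_top, Submodule.span_le]
  rintro _ ⟨v, w, rfl⟩
  have hw : w ∈ Submodule.span C (Set.range (sphCoset hϖ hS)) := by
    rw [span_sphCoset hϖ l₁ l₂ hl hsp hcov hS]
    trivial
  change v ⊗ₜ w ∈ LinearMap.range (sphMap hϖ hS : compactInd (KZ F) ρ' →ₗ[C] _)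
  induction hw using Submodule.span_induction with
  | mem w hw =>
    obtain ⟨c, rfl⟩ := hw
    exact ⟨_, sphMap_single hϖ hS c v⟩
  | zero =>
    rw [TensorProduct.tmul_zero]
    exact Submodule.zero_mem _
  | add w w' _ _ h h' =>
    rw [TensorProduct.tmul_add]
    exact Submodule.add_mem _ h h'
  | smul c w _ h =>
    rw [TensorProduct.tmul_smul]
    exact Submodule.smul_mem _ _ h

/-- Evaluating the second tensor factor at `g` turns membership in the kernel into one `V`-valued
linear relation for each `g`. -/
lemma sum_sphCoset_eq_zero {f : compactInd (KZ F) ρ'} (hf : sphMap hϖ hS f = 0)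
    (g : GL (Fin 2) F) :
    ((cosetEquiv (KZ F) ρ' f).sum fun c v => (sphCoset hϖ hS c).1 g • v) = 0 := by
  let ev : smoothInd (nr (ϖ : F) l₁⁻¹) (nr (C := C) (ϖ : F) l₂⁻¹) →ₗ[C] C :=
    LinearMap.proj g ∘ₗ Submodule.subtype _
  have h := congrArg ((TensorProduct.rid C V).toLinearMap ∘ₗ LinearMap.lTensor V ev) hf
  rw [map_zero] at h
  rw [← h]
  change _ = ((TensorProduct.rid C V).toLinearMap ∘ₗ LinearMap.lTensor V ev)
    ((cosetEquiv (KZ F) ρ' f).sum fun c v => v ⊗ₜ sphCoset hϖ hS c)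
  rw [map_finsuppSum]
  refine Finsupp.sum_congr fun c _ => ?_
  simp [ev]

end sphMap

end BreuilSchneider

end

/-! ### Vertices as discs, and the relations satisfied by kernel elements. -/

noncomputable section

namespace BreuilSchneider

section vertices

variable {F : Type*} [NormedField F] [IsUltrametricDist F] {ϖ : Fˣ}
  (hϖ : IsUniformizer (ϖ : F))

lemma norm_zpow_unit (n : ℤ) : ‖((ϖ ^ n : Fˣ) : F)‖ = ‖(ϖ : F)‖ ^ n := by
  rw [Units.val_zpow_eq_zpow_val, norm_zpow]

include hϖ in
lemma zpow_norm_lt_iff {m n : ℤ} : ‖(ϖ : F)‖ ^ m < ‖(ϖ : F)‖ ^ n ↔ n < m :=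
  zpow_lt_zpow_iff_right_of_lt_one₀ (norm_pos_iff.2 ϖ.ne_zero) hϖ.norm_lt_one

include hϖ in
lemma zpow_norm_le_iff {m n : ℤ} : ‖(ϖ : F)‖ ^ m ≤ ‖(ϖ : F)‖ ^ n ↔ n ≤ m :=
  zpow_le_zpow_iff_right_of_lt_one₀ (norm_pos_iff.2 ϖ.ne_zero) hϖ.norm_lt_one

include hϖ in
lemma zpow_norm_inj {m n : ℤ} : ‖(ϖ : F)‖ ^ m = ‖(ϖ : F)‖ ^ n ↔ m = n :=
  (zpow_right_injective₀ (norm_pos_iff.2 ϖ.ne_zero) hϖ.norm_lt_one.ne).eq_iff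

include hϖ in
lemma zpow_le_of_lt {x : F} {n : ℤ} (h : ‖(ϖ : F)‖ ^ n < ‖x‖) : ‖(ϖ : F)‖ ^ (n - 1) ≤ ‖x‖ := by
  have h1 := norm_le_of_norm_lt hϖ (x := ((ϖ ^ n : Fˣ) : F)) (y := x) (by rwa [norm_zpow_unit])
  rw [norm_zpow_unit] at h1
  rw [zpow_sub_one₀ (norm_pos_iff.2 ϖ.ne_zero).ne', ← div_eq_mul_inv,
    div_le_iff₀ (norm_pos_iff.2 ϖ.ne_zero), mul_comm]
  exact h1

/-- The vertices of the tree, as cosets. -/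
def vert (ϖ : Fˣ) (n : ℤ) (x : F) : GL (Fin 2) F ⧸ KZ F := (tri (ϖ ^ n) x 1 : GL (Fin 2) F)

lemma tri_inv_mul_tri (a a' : Fˣ) (x x' : F) :
    (tri a x 1)⁻¹ * tri a' x' 1 = tri (a⁻¹ * a') (((a⁻¹ : Fˣ) : F) * (x' - x)) 1 := by
  rw [tri_inv, tri_mul]
  congr 1
  · rw [inv_one, Units.val_one]; ring
  · rw [inv_one, one_mul]

include hϖ in
-- Vertices are discs in `F`: `vert ϖ n x` stands for the disc of radius `‖ϖ‖ ^ n` about `x`.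
-- Equality is detected by the radius of the quotient matrix.
lemma vert_eq_iff {n n' : ℤ} {x x' : F} :
    vert ϖ n x = vert ϖ n' x' ↔ n = n' ∧ ‖x - x'‖ ≤ ‖(ϖ : F)‖ ^ n := by
  have hp := norm_pos_iff.2 ϖ.ne_zero
  have hpn : 0 < ‖(ϖ : F)‖ ^ n := zpow_pos hp n
  have hB : ‖(((ϖ ^ n)⁻¹ : Fˣ) : F) * (x' - x)‖ = ‖x - x'‖ / ‖(ϖ : F)‖ ^ n := by
    rw [norm_mul, Units.val_inv_eq_inv_val, norm_inv, norm_zpow_unit, norm_sub_rev, inv_mul_eq_div]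
  unfold vert
  rw [QuotientGroup.eq, tri_inv_mul_tri]
  constructor
  · intro h
    have h1 := radius_of_mem_KZ h
    rw [radius_tri, Units.val_one, norm_one, mul_one] at h1
    set A := ‖(((ϖ ^ n)⁻¹ * ϖ ^ n' : Fˣ) : F)‖ with hA
    set B := ‖(((ϖ ^ n)⁻¹ : Fˣ) : F) * (x' - x)‖ with hB'
    have hA0 : 0 < A := norm_pos_iff.2 (Units.ne_zero _)
    have hAn : A = ‖(ϖ : F)‖ ^ (n' - n) := by
      rw [hA, ← zpow_neg, ← zpow_add, norm_zpow_unit, neg_add_eq_sub]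
    rw [div_eq_one_iff_eq hA0.ne'] at h1
    have hM1 : 1 ≤ max (max A B) 1 := le_max_right _ _
    have hMA : A ≤ max (max A B) 1 := (le_max_left _ _).trans (le_max_left _ _)
    have hMB : B ≤ max (max A B) 1 := (le_max_right _ _).trans (le_max_left _ _)
    have hM : max (max A B) 1 = 1 := by nlinarith
    rw [hM] at h1 hMB
    rw [one_pow, hAn, ← zpow_zero ‖(ϖ : F)‖, zpow_norm_inj hϖ] at h1
    refine ⟨by omega, ?_⟩
    rwa [hB, div_le_one hpn] at hMB
  · rintro ⟨rfl, h⟩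
    rw [inv_mul_cancel]
    refine maxCompact_le_KZ (tri_mem_maxCompact (by simp) ?_ (by simp))
    rwa [hB, div_le_one hpn]

lemma exists_tri_eq {g : GL (Fin 2) F} (hg : g 1 0 = 0) : ∃ a x d, g = tri a x d := by
  have hdet : (g : Matrix (Fin 2) (Fin 2) F).det = g 0 0 * g 1 1 := by
    rw [Matrix.det_fin_two, hg, mul_zero, sub_zero]
  have h0 : g 0 0 * g 1 1 ≠ 0 := hdet ▸ det_ne_zero g
  refine ⟨Units.mk0 _ (left_ne_zero_of_mul h0), g 0 1, Units.mk0 _ (right_ne_zero_of_mul h0),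
    Units.ext ?_⟩
  rw [coe_tri]
  ext i j
  fin_cases i <;> fin_cases j <;> simp [hg]

include hϖ in
-- The Iwasawa decomposition: an integral unipotent matrix, preceded if necessary by the swap, makes
-- `g` upper triangular.
lemma exists_vert (c : GL (Fin 2) F ⧸ KZ F) : ∃ n x, vert ϖ n x = c := by
  induction c using QuotientGroup.induction_on with
  | H g =>
    have key : ∀ g : GL (Fin 2) F, ‖g 1 0‖ ≤ ‖g 1 1‖ → ∃ n x,
        vert ϖ n x = (g : GL (Fin 2) F ⧸ KZ F) := by
      intro g hg
      have h1 : 0 < ‖g 1 1‖ := by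
        have := row_pos g
        rwa [max_eq_right hg] at this
      set z := g 1 0 / g 1 1 with hz
      have hz1 : ‖-z‖ ≤ 1 := by
        rw [norm_neg, hz, norm_div]
        exact div_le_one_of_le₀ hg (norm_nonneg _)
      have h0 : (g * low (-z)) 1 0 = 0 := by
        rw [coe_mul_apply_one, coe_low]
        change g 1 0 * 1 + g 1 1 * -z = 0
        rw [mul_neg, hz, mul_div_cancel₀ _ (norm_pos_iff.1 h1), mul_one, add_neg_cancel]
      obtain ⟨a, x, d, hgt⟩ := exists_tri_eq h0
      obtain ⟨u, hu, hua⟩ := exists_unit_mul_zpow hϖ (a * d⁻¹)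
      refine ⟨ord (ϖ : F) ((a * d⁻¹ : Fˣ) : F), x * (d⁻¹ : Fˣ), ?_⟩
      have e : g = tri (ϖ ^ ord (ϖ : F) ((a * d⁻¹ : Fˣ) : F)) (x * (d⁻¹ : Fˣ)) 1 *
          (tri u 0 1 * tri d 0 d * (low (-z))⁻¹) := by
        rw [← mul_assoc, eq_mul_inv_iff_mul_eq, hgt, tri_mul, tri_mul, ← mul_assoc,
          mul_comm _ u, ← hua, inv_mul_cancel_right]
        simp
      unfold vert
      rw [QuotientGroup.eq, inv_mul_eq_iff_eq_mul.2 e]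
      exact mul_mem (mul_mem (maxCompact_le_KZ (tri_mem_maxCompact hu (by simp) (by simp)))
        (tri_scalar_mem_KZ d)) (inv_mem (maxCompact_le_KZ (low_mem_maxCompact hz1)))
    rcases le_or_gt ‖g 1 0‖ ‖g 1 1‖ with h | h
    · exact key g h
    · obtain ⟨s, hsK, hs⟩ := swap_mem_maxCompact (F := F)
      have h0 : (g * s) 1 0 = g 1 1 := by
        rw [coe_mul_apply_one, hs]
        simp
      have h1 : (g * s) 1 1 = g 1 0 := by
        rw [coe_mul_apply_one, hs]
        simp
      obtain ⟨n, x, hx⟩ := key (g * s) (by rw [h0, h1]; exact h.le)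
      refine ⟨n, x, hx.trans ?_⟩
      rw [QuotientGroup.eq, mul_inv_rev, inv_mul_cancel_right]
      exact inv_mem (maxCompact_le_KZ hsK)

/-- The neighbours `some i` are the `q` maximal subdiscs; the neighbour `none` below is the next
larger disc. -/
lemma vert_heckeRep_some {I : Type*} (t : I → F) (n : ℤ) (x : F) (i : I) :
    ((tri (ϖ ^ n) x 1 * heckeRep ϖ t (some i) : GL (Fin 2) F) : GL (Fin 2) F ⧸ KZ F) =
      vert ϖ (n + 1) (x + ((ϖ ^ n : Fˣ) : F) * t i) := by
  rw [heckeRep, tri_mul, vert, zpow_add_one, Units.val_one, mul_one, mul_one, add_comm]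

lemma vert_heckeRep_none {I : Type*} (t : I → F) (n : ℤ) (x : F) :
    ((tri (ϖ ^ n) x 1 * heckeRep ϖ t none : GL (Fin 2) F) : GL (Fin 2) F ⧸ KZ F) =
      vert ϖ (n - 1) x := by
  rw [heckeRep, vert]
  have : tri (ϖ ^ n) x 1 * tri 1 0 ϖ = tri (ϖ ^ (n - 1)) x 1 * tri ϖ 0 ϖ := by
    rw [tri_mul, tri_mul, zpow_sub_one]
    simp
  rw [this]
  exact QuotientGroup.mk_mul_of_mem _ (tri_scalar_mem_KZ ϖ)

end vertices

section coefficients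

variable {F C : Type*} [NormedField F] [IsUltrametricDist F] [NormedField C] {ϖ : Fˣ}
  (hϖ : IsUniformizer (ϖ : F)) {l₁ l₂ S : Cˣ} (hS : S ^ 2 = l₁ * l₂)
  {V : Type*} [AddCommGroup V] [Module C V]

/-- A matrix with second row `(1, x)`. -/
def rowTest (x : F) : GL (Fin 2) F :=
  Matrix.GeneralLinearGroup.mkOfDetNeZero !![0, 1; 1, x] (by simp)

lemma sphCoset_vert_one (n : ℤ) (x : F) : (sphCoset hϖ hS (vert ϖ n x)).1 1 =
    ((S ^ n * l₁ ^ (-n) : Cˣ) : C) := by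
  have h : rowMax ((tri (ϖ ^ n) x 1 : GL (Fin 2) F) 1 0) ((tri (ϖ ^ n) x 1 : GL (Fin 2) F) 1 1) =
      1 := by
    rw [coe_tri]
    simp [rowMax]
  rw [vert, sphCoset_apply, one_mul, sphVal, h, ord_one hϖ, zpow_zero, mul_one, det_tri,
    Units.val_one, mul_one, ord_zpow hϖ, Units.val_mul]

/-- The exponent `m` is the level of the smallest disc that contains both the given disc and the
point `-y`. -/
lemma sphCoset_vert_rowTest (n m : ℤ) (x y : F)
    (h : max (‖(ϖ : F)‖ ^ n) ‖x + y‖ = ‖(ϖ : F)‖ ^ m) :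
    (sphCoset hϖ hS (vert ϖ n x)).1 (rowTest y) =
      ((S ^ n * l₁ ^ (-n) * (l₁ * l₂⁻¹) ^ m : Cˣ) : C) := by
  have hrow : ord (ϖ : F) (rowMax ((rowTest y * tri (ϖ ^ n) x 1) 1 0)
      ((rowTest y * tri (ϖ ^ n) x 1) 1 1)) = m := by
    rw [← ord_zpow hϖ m]
    apply ord_congr
    rw [norm_rowMax, norm_zpow_unit, ← h, coe_mul_apply_one, coe_mul_apply_one, coe_tri]
    change max ‖1 * ((ϖ ^ n : Fˣ) : F) + y * 0‖ ‖1 * x + y * ((1 : Fˣ) : F)‖ = _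
    rw [one_mul, mul_zero, add_zero, one_mul, Units.val_one, mul_one, norm_zpow_unit]
  have hdet : ord (ϖ : F) ((rowTest y : GL (Fin 2) F) : Matrix (Fin 2) (Fin 2) F).det = 0 := by
    refine ord_eq_zero_of_norm hϖ ?_
    change ‖(!![0, 1; 1, y] : Matrix (Fin 2) (Fin 2) F).det‖ = 1
    simp
  rw [vert, sphCoset_apply, sphVal, hrow, ord_det_mul hϖ, hdet, zero_add, det_tri,
    Units.val_one, mul_one, ord_zpow hϖ, ← Units.val_mul, mul_assoc]

include hϖ in
lemma exists_max_eq (n : ℤ) (x : F) : ∃ m : ℤ, max (‖(ϖ : F)‖ ^ n) ‖x‖ = ‖(ϖ : F)‖ ^ m := by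
  rcases max_choice (‖(ϖ : F)‖ ^ n) ‖x‖ with h | h
  · exact ⟨n, h⟩
  · have h0 : x ≠ 0 := by
      rintro rfl
      have h1 := le_max_left (‖(ϖ : F)‖ ^ n) ‖(0 : F)‖
      rw [h, norm_zero] at h1
      exact (zpow_pos (norm_pos_iff.2 ϖ.ne_zero) n).not_ge h1
    exact ⟨_, h.trans (norm_eq_zpow_ord hϖ h0)⟩

lemma sum_smul_eq_pair {Q : Type*} {u : Q →₀ V} {δ : Q → C} {c c' : Q} (hne : c ≠ c')
    (h : ∀ d, d ≠ c → d ≠ c' → δ d • u d = 0) :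
    (u.sum fun d v => δ d • v) = δ c • u c + δ c' • u c' := by
  refine Finset.sum_eq_add c c' hne (fun d _ hd => h d hd.1 hd.2) (fun hc => ?_) fun hc => ?_
  · simp [Finsupp.notMem_support_iff.1 hc]
  · simp [Finsupp.notMem_support_iff.1 hc]

lemma sum_smul_eq_single {Q : Type*} {u : Q →₀ V} {δ : Q → C} {c : Q}
    (h : ∀ d, d ≠ c → δ d • u d = 0) : (u.sum fun d v => δ d • v) = δ c • u c := by
  refine Finset.sum_eq_single c (fun d _ hd => h d hd) fun hc => ?_
  simp [Finsupp.notMem_support_iff.1 hc]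

lemma sum_sub_smul {Q : Type*} {u : Q →₀ V} {δ δ' : Q → C} (b : C)
    (h : (u.sum fun d v => δ d • v) = 0) (h' : (u.sum fun d v => δ' d • v) = 0) :
    (u.sum fun d v => (b * δ d - δ' d) • v) = 0 := by
  simp only [sub_smul, mul_smul]
  rw [Finsupp.sum_sub, h', sub_zero, ← Finsupp.smul_sum, h, smul_zero]

variable {u : GL (Fin 2) F ⧸ KZ F →₀ V}
  (hu : ∀ g, (u.sum fun c v => (sphCoset hϖ hS c).1 g • v) = 0) (hl : l₁ ≠ l₂)

include hu hl in
/-- In the kernel, the values at the outermost vertices only depend on the parents. -/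
lemma apply_vert_eq {N : ℤ} (hN : ∀ n x, N < n → u (vert ϖ n x) = 0) {x x' : F}
    (h : ‖x - x'‖ ≤ ‖(ϖ : F)‖ ^ (N - 1)) : u (vert ϖ N x) = u (vert ϖ N x') := by
  rcases le_or_gt ‖x - x'‖ (‖(ϖ : F)‖ ^ N) with hx | hx
  · rw [(vert_eq_iff hϖ).2 ⟨rfl, hx⟩]
  have hd : ‖x - x'‖ = ‖(ϖ : F)‖ ^ (N - 1) := le_antisymm h (zpow_le_of_lt hϖ hx)
  have hlt : ‖(ϖ : F)‖ ^ N < ‖(ϖ : F)‖ ^ (N - 1) := (zpow_norm_lt_iff hϖ).2 (by omega)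
  -- The relations tested at the points `x` and `x'` are subtracted; their weights differ only at
  -- the two discs in question.
  have hsum := sum_sub_smul 1 (hu (rowTest (-x))) (hu (rowTest (-x')))
  have hne : vert ϖ N x ≠ vert ϖ N x' := fun h' => hx.not_ge ((vert_eq_iff hϖ).1 h').2
  rw [sum_smul_eq_pair hne] at hsum
  · have e1 : max (‖(ϖ : F)‖ ^ N) ‖x + -x‖ = ‖(ϖ : F)‖ ^ N := by
      rw [add_neg_cancel, norm_zero]
      exact max_eq_left (zpow_pos (norm_pos_iff.2 ϖ.ne_zero) N).le
    have e2 : max (‖(ϖ : F)‖ ^ N) ‖x' + -x'‖ = ‖(ϖ : F)‖ ^ N := by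
      rw [add_neg_cancel, norm_zero]
      exact max_eq_left (zpow_pos (norm_pos_iff.2 ϖ.ne_zero) N).le
    have e3 : max (‖(ϖ : F)‖ ^ N) ‖x + -x'‖ = ‖(ϖ : F)‖ ^ (N - 1) := by
      rw [← sub_eq_add_neg, hd, max_eq_right hlt.le]
    have e4 : max (‖(ϖ : F)‖ ^ N) ‖x' + -x‖ = ‖(ϖ : F)‖ ^ (N - 1) := by
      rw [← sub_eq_add_neg, norm_sub_rev, hd, max_eq_right hlt.le]
    rw [sphCoset_vert_rowTest hϖ hS _ _ _ _ e1, sphCoset_vert_rowTest hϖ hS _ _ _ _ e2,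
      sphCoset_vert_rowTest hϖ hS _ _ _ _ e3, sphCoset_vert_rowTest hϖ hS _ _ _ _ e4] at hsum
    set α : Cˣ := S ^ N * l₁ ^ (-N) * (l₁ * l₂⁻¹) ^ N with hα
    set β : Cˣ := S ^ N * l₁ ^ (-N) * (l₁ * l₂⁻¹) ^ (N - 1) with hβ
    -- The two weights differ by the factor `l₁ / l₂`.
    have hαβ : (α : C) - β ≠ 0 := by
      rw [sub_ne_zero]
      intro h'
      have h1 : α = β := Units.ext h'
      rw [hα, hβ, mul_right_inj, zpow_sub_one, left_eq_mul, inv_eq_one, mul_inv_eq_one] at h1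
      exact hl h1
    have h2 : ((α : C) - β) • (u (vert ϖ N x) - u (vert ϖ N x')) = 0 := by
      rw [← hsum]
      module
    exact sub_eq_zero.1 ((smul_eq_zero.1 h2).resolve_left hαβ)
  · intro d hdx hdx'
    obtain ⟨n, y, rfl⟩ := exists_vert hϖ d
    rcases lt_or_ge N n with hn | hn
    · rw [hN n y hn, smul_zero]
    -- From any other disc of level at most `N`, the points `x` and `x'` are separated at the same
    -- level.
    have key : ∀ x x', ‖x - x'‖ = ‖(ϖ : F)‖ ^ (N - 1) → vert ϖ n y ≠ vert ϖ N x' →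
        ‖y + -x‖ ≤ max (‖(ϖ : F)‖ ^ n) ‖y + -x'‖ := by
      intro x x' hxx hy
      have e1 : y + -x = (y + -x') + (x' - x) := by ring
      rw [e1]
      refine (IsUltrametricDist.norm_add_le_max _ _).trans (max_le (le_max_right _ _) ?_)
      rw [norm_sub_rev, hxx]
      rcases eq_or_lt_of_le hn with rfl | hn'
      · refine le_max_of_le_right (zpow_le_of_lt hϖ ?_)
        rw [← sub_eq_add_neg]
        exact not_le.1 fun h' => hy ((vert_eq_iff hϖ).2 ⟨rfl, h'⟩)
      · exact le_max_of_le_left ((zpow_norm_le_iff hϖ).2 (by omega))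
    have h1 := key x x' hd hdx'
    have h2 := key x' x (by rw [norm_sub_rev, hd]) hdx
    have e : max (‖(ϖ : F)‖ ^ n) ‖y + -x‖ = max (‖(ϖ : F)‖ ^ n) ‖y + -x'‖ :=
      le_antisymm (max_le (le_max_left _ _) h1) (max_le (le_max_left _ _) h2)
    obtain ⟨m, hm⟩ := exists_max_eq hϖ n (y + -x)
    rw [sphCoset_vert_rowTest hϖ hS _ _ _ _ hm, sphCoset_vert_rowTest hϖ hS _ _ _ _ (e ▸ hm),
      one_mul, sub_self, zero_smul]

include hu hl in
-- The support consists of one disc of level `M` and its maximal subdiscs. Comparing the relation at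
-- the point `0` with that at infinity isolates the subdisc containing `0`; the values on the other
-- subdiscs agree with it by `apply_vert_eq`. A single disc remains, with nonzero weight.
lemma eq_zero_of_support {M : ℤ} (hM : ∀ n x, u (vert ϖ n x) ≠ 0 →
    M ≤ n ∧ n ≤ M + 1 ∧ ‖x‖ ≤ ‖(ϖ : F)‖ ^ M) : u = 0 := by
  have h0 : u (vert ϖ (M + 1) 0) = 0 := by
    -- At the remaining discs of the support the two relations have weights in the constant ratio
    -- `(l₁ / l₂) ^ M`, hence the scaling factor.
    have hsum := sum_sub_smul (((l₁ * l₂⁻¹) ^ (-M) : Cˣ) : C) (hu (rowTest 0)) (hu 1)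
    rw [sum_smul_eq_single (c := vert ϖ (M + 1) 0)] at hsum
    · refine (smul_eq_zero.1 hsum).resolve_left ?_
      rw [sphCoset_vert_rowTest hϖ hS (M + 1) (M + 1), sphCoset_vert_one, ← Units.val_mul,
        sub_eq_zero]
      · intro h'
        have h1 := Units.ext h'
        rw [mul_left_comm, mul_eq_left, ← zpow_add, neg_add_cancel_left, zpow_one,
          mul_inv_eq_one] at h1
        exact hl h1
      · rw [add_zero, norm_zero]
        exact max_eq_left (zpow_pos (norm_pos_iff.2 ϖ.ne_zero) _).le
    · intro d hd
      obtain ⟨n, y, rfl⟩ := exists_vert hϖ d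
      by_cases hy : u (vert ϖ n y) = 0
      · rw [hy, smul_zero]
      obtain ⟨h1, h2, h3⟩ := hM n y hy
      have e : max (‖(ϖ : F)‖ ^ n) ‖y + 0‖ = ‖(ϖ : F)‖ ^ M := by
        rw [add_zero]
        rcases eq_or_lt_of_le h1 with rfl | h1
        · exact max_eq_left h3
        · obtain rfl : n = M + 1 := by omega
          have h4 : ‖(ϖ : F)‖ ^ (M + 1) < ‖y‖ := not_le.1 fun h' =>
            hd ((vert_eq_iff hϖ).2 ⟨rfl, by rwa [sub_zero]⟩)
          have h5 := zpow_le_of_lt hϖ h4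
          rw [add_sub_cancel_right] at h5
          rw [max_eq_right h4.le]
          exact le_antisymm h3 h5
      rw [sphCoset_vert_rowTest hϖ hS _ _ _ _ e, sphCoset_vert_one, ← Units.val_mul,
        mul_left_comm, ← zpow_add, neg_add_cancel, zpow_zero, mul_one, sub_self, zero_smul]
  have h1 : ∀ x, u (vert ϖ (M + 1) x) = 0 := fun x => by
    by_contra hx
    refine hx ?_
    rw [apply_vert_eq hϖ hS hu hl (N := M + 1) (x' := 0), h0]
    · intro n y hn
      by_contra hy
      have := (hM n y hy).2.1
      omega
    · rw [sub_zero, add_sub_cancel_right]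
      exact (hM _ x hx).2.2
  have h2 : ∀ n x, u (vert ϖ n x) ≠ 0 → vert ϖ n x = vert ϖ M 0 := fun n x hx => by
    obtain ⟨h3, h4, h5⟩ := hM n x hx
    have h6 : n ≠ M + 1 := by
      rintro rfl
      exact hx (h1 x)
    obtain rfl : n = M := by omega
    exact (vert_eq_iff hϖ).2 ⟨rfl, by rwa [sub_zero]⟩
  have h3 : u (vert ϖ M 0) = 0 := by
    have hsum := hu 1
    rw [sum_smul_eq_single (c := vert ϖ M 0)] at hsum
    · refine (smul_eq_zero.1 hsum).resolve_left ?_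
      rw [sphCoset_vert_one]
      exact Units.ne_zero _
    · intro d hd
      obtain ⟨n, y, rfl⟩ := exists_vert hϖ d
      by_cases hy : u (vert ϖ n y) = 0
      · rw [hy, smul_zero]
      · exact absurd (h2 n y hy) hd
  ext c
  obtain ⟨n, y, rfl⟩ := exists_vert hϖ c
  by_contra hy
  have := h2 n y hy
  rw [this] at hy
  exact hy h3

include hϖ in
lemma exists_support_bound (u : GL (Fin 2) F ⧸ KZ F →₀ V) : ∃ M : ℤ, ∃ J : ℕ, ∀ n x,
    u (vert ϖ n x) ≠ 0 → M ≤ n ∧ n ≤ M + 1 + J ∧ ‖x‖ ≤ ‖(ϖ : F)‖ ^ M := by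
  choose lv pt hlp using exists_vert hϖ
  have h1 : ∀ᶠ M : ℤ in Filter.atBot, ∀ c ∈ u.support, M ≤ lv c ∧ ‖pt c‖ ≤ ‖(ϖ : F)‖ ^ M := by
    rw [Filter.eventually_all_finset]
    intro c _
    obtain ⟨m, hm⟩ := exists_max_eq hϖ 0 (pt c)
    filter_upwards [Filter.eventually_le_atBot (lv c), Filter.eventually_le_atBot m] with M h2 h3
    exact ⟨h2, (le_max_right _ _).trans (hm.le.trans ((zpow_norm_le_iff hϖ).2 h3))⟩
  obtain ⟨M, hM⟩ := h1.exists
  obtain ⟨J, hJ⟩ := (u.support.finite_toSet.image fun c => (lv c - M).toNat).bddAbove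
  refine ⟨M, J, fun n x hx => ?_⟩
  have hmem : vert ϖ n x ∈ u.support := Finsupp.mem_support_iff.2 hx
  obtain ⟨h2, h3⟩ := hM _ hmem
  have h4 : (lv (vert ϖ n x) - M).toNat ≤ J := hJ ⟨_, hmem, rfl⟩
  obtain ⟨h5, h6⟩ := (vert_eq_iff hϖ).1 (hlp (vert ϖ n x))
  rw [h5] at h2 h4 h6
  refine ⟨h2, by omega, ?_⟩
  have e : x = pt (vert ϖ n x) - (pt (vert ϖ n x) - x) := by ring
  rw [e, sub_eq_add_neg]
  refine (IsUltrametricDist.norm_add_le_max _ _).trans (max_le h3 ?_)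
  rw [norm_neg]
  exact h6.trans ((zpow_norm_le_iff hϖ).2 h2)

include hϖ in
/-- The function on the parents of the outermost vertices. -/
lemma exists_parent {N : ℤ}
    (hN : ∀ x x', ‖x - x'‖ ≤ ‖(ϖ : F)‖ ^ (N - 1) → u (vert ϖ N x) = u (vert ϖ N x')) :
    ∃ h : GL (Fin 2) F ⧸ KZ F →₀ V, (∀ x, h (vert ϖ (N - 1) x) = u (vert ϖ N x)) ∧
      ∀ n x, n ≠ N - 1 → h (vert ϖ n x) = 0 := by
  choose lv pt hlp using exists_vert hϖ
  have hlt : ‖(ϖ : F)‖ ^ N ≤ ‖(ϖ : F)‖ ^ (N - 1) := (zpow_norm_le_iff hϖ).2 (by omega)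
  refine ⟨Finsupp.ofSupportFinite (fun c => if lv c = N - 1 then u (vert ϖ N (pt c)) else 0)
    ((u.support.finite_toSet.image fun c => vert ϖ (N - 1) (pt c)).subset ?_), fun x => ?_,
    fun n x hn => ?_⟩
  · intro c hc
    rw [Function.mem_support] at hc
    have h1 : lv c = N - 1 := by
      by_contra h
      exact hc (if_neg h)
    rw [if_pos h1] at hc
    obtain ⟨h2, h3⟩ := (vert_eq_iff hϖ).1 (hlp (vert ϖ N (pt c)))
    refine ⟨vert ϖ N (pt c), Finsupp.mem_support_iff.2 hc, ?_⟩
    rw [h2] at h3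
    beta_reduce
    rw [(vert_eq_iff hϖ).2 ⟨rfl, h3.trans hlt⟩, ← h1, hlp]
  · obtain ⟨h2, h3⟩ := (vert_eq_iff hϖ).1 (hlp (vert ϖ (N - 1) x))
    change (if _ then _ else _) = _
    rw [if_pos h2]
    rw [h2] at h3
    exact hN _ _ h3
  · obtain ⟨h2, -⟩ := (vert_eq_iff hϖ).1 (hlp (vert ϖ n x))
    change (if _ then _ else _) = _
    rw [if_neg (by rwa [h2])]

end coefficients

end BreuilSchneider

end

/-! ### The kernel is the image of `T - a`. -/

noncomputable section

namespace BreuilSchneider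

section kernel

variable {F C : Type*} [NormedField F] [IsUltrametricDist F] [NormedField C] [IsUltrametricDist C]
  {ϖ : Fˣ} (hϖ : IsUniformizer (ϖ : F)) {l₁ l₂ S : Cˣ} (hS : S ^ 2 = l₁ * l₂)
  {V : Type*} [AddCommGroup V] [Module C V] {ρ ρ' : Representation C (GL (Fin 2) F) V}
  (hρ : ∀ g : GL (Fin 2) F,
    ρ' g = ((S ^ (-ord (ϖ : F) (g : Matrix (Fin 2) (Fin 2) F).det) : Cˣ) : C) • ρ g)
  {φ : HeckeKernel (KZ F) ρ'}
  (hφ : ∀ g ∈ DoubleCoset.doubleCoset (alpha hϖ)⁻¹ (KZ F : Set (GL (Fin 2) F)) (KZ F),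
    φ.toFun g = (S : C) • ρ' g)
  (hφ0 : ∀ g, φ.toFun g ≠ 0 →
    g ∈ DoubleCoset.doubleCoset (alpha hϖ)⁻¹ (KZ F : Set (GL (Fin 2) F)) (KZ F))
  {I : Type*} [Fintype I] {t : I → F} (hsp : Spread t)
  (hcov : ∀ x : F, ‖x‖ ≤ 1 → ∃ i, ‖x - t i‖ < 1)

include hφ hφ0 hsp hcov in
lemma cosetEquiv_subScalar_vert (a : C) (h : GL (Fin 2) F ⧸ KZ F →₀ V) (n : ℤ) (x : F) :
    cosetEquiv (KZ F) ρ' (φ.subScalar a ((cosetEquiv (KZ F) ρ').symm ((S : C)⁻¹ • h)))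
      (vert ϖ n x) = h (vert ϖ (n - 1) x) +
        ∑ i, h (vert ϖ (n + 1) (x + ((ϖ ^ n : Fˣ) : F) * t i)) -
          (a * (S : C)⁻¹) • h (vert ϖ n x) := by
  rw [vert, cosetEquiv_subScalar hϖ hφ hφ0 hsp hcov, LinearEquiv.apply_symm_apply,
    Fintype.sum_option]
  simp only [vert_heckeRep_some, vert_heckeRep_none, Finsupp.smul_apply]
  rw [← Finset.smul_sum, ← smul_add, smul_smul, mul_inv_cancel₀ S.ne_zero, one_smul, smul_smul]

include hρ hφ hφ0 hsp hcov in
-- Induction on the number of levels in the support. The values on the outermost level come from a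
-- function `h` on the parents, so subtracting `(T - a)` of that function erases the level; the
-- result stays in the kernel and its support reaches one level less.
lemma mem_range_of_sphMap_eq_zero (hl : l₁ ≠ l₂) {a : C} (ha : (l₁ : C) + Fintype.card I * l₂ = a)
    (M : ℤ) (J : ℕ) : ∀ f : compactInd (KZ F) ρ', sphMap hϖ hS f = 0 →
      (∀ n x, cosetEquiv (KZ F) ρ' f (vert ϖ n x) ≠ 0 →
        M ≤ n ∧ n ≤ M + 1 + J ∧ ‖x‖ ≤ ‖(ϖ : F)‖ ^ M) → f ∈ φ.range a := by
  induction J with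
  | zero =>
    intro f hf hM
    have h0 : cosetEquiv (KZ F) ρ' f = 0 :=
      eq_zero_of_support hϖ hS (sum_sphCoset_eq_zero hϖ hS hf) hl (M := M) (by simpa using hM)
    rw [(LinearEquiv.map_eq_zero_iff _).1 h0]
    exact Submodule.zero_mem _
  | succ J ih =>
    intro f hf hM
    push_cast at hM
    set N : ℤ := M + 1 + (J + 1) with hN
    set u := cosetEquiv (KZ F) ρ' f with hu
    have hMN : ∀ n x, N < n → u (vert ϖ n x) = 0 := fun n x hn => by
      by_contra h
      have := (hM n x h).2.1
      omega
    obtain ⟨h, h1, h2⟩ := exists_parent hϖ (u := u) (N := N) fun x x' hx =>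
      apply_vert_eq hϖ hS (sum_sphCoset_eq_zero hϖ hS hf) hl hMN hx
    -- The factor `S⁻¹` cancels the `S` by which `ψ` differs from `ρ'`.
    set f' := (cosetEquiv (KZ F) ρ').symm ((S : C)⁻¹ • h) with hf'
    have hval : ∀ n x, cosetEquiv (KZ F) ρ' (f - φ.subScalar a f') (vert ϖ n x) =
        u (vert ϖ n x) - (h (vert ϖ (n - 1) x) +
        ∑ i, h (vert ϖ (n + 1) (x + ((ϖ ^ n : Fˣ) : F) * t i)) -
          (a * (S : C)⁻¹) • h (vert ϖ n x)) := fun n x => by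
      rw [map_sub, Finsupp.sub_apply, hf', cosetEquiv_subScalar_vert hϖ hφ hφ0 hsp hcov]
    have hmem : f - φ.subScalar a f' ∈ φ.range a := by
      refine ih _ ?_ fun n x hx => ?_
      · rw [map_sub, hf, sphMap_subScalar hϖ hS hρ hφ hφ0 hsp hcov ha, sub_zero]
      rw [hval] at hx
      have hsupp : ∀ x, h (vert ϖ (N - 1) x) ≠ 0 → ‖x‖ ≤ ‖(ϖ : F)‖ ^ M := fun x hx =>
        (hM N x (by rwa [← h1])).2.2
      have hn : n < N := by
        by_contra hn
        apply hx
        rw [h2 n x (by omega), smul_zero, sub_zero, Finset.sum_eq_zero fun i _ => h2 _ _ (by omega),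
          add_zero]
        rcases eq_or_lt_of_le (not_lt.1 hn) with rfl | hn'
        · rw [h1, sub_self]
        · rw [h2 _ _ (by omega), hMN n x hn', sub_zero]
      -- A vertex that is new in the support lies at level `N - 1` or `N - 2`, which is at least
      -- `M`, and its disc is a parent of an outermost disc or contains one; so its centre stays in
      -- the disc of radius `‖ϖ‖ ^ M`.
      by_cases hun : u (vert ϖ n x) = 0
      · rw [hun, h2 (n - 1) x (by omega), zero_add, zero_sub, neg_ne_zero] at hx
        by_cases hn1 : n = N - 1
        · refine ⟨by omega, by omega, hsupp x fun h0 => hx ?_⟩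
          rw [hn1, h0, smul_zero, sub_zero]
          exact Finset.sum_eq_zero fun i _ => h2 _ _ (by omega)
        · rw [h2 n x hn1, smul_zero, sub_zero] at hx
          obtain ⟨i, -, hi⟩ := Finset.exists_ne_zero_of_sum_ne_zero hx
          have hn2 : n + 1 = N - 1 := by
            by_contra hn2
            exact hi (h2 _ _ hn2)
          rw [hn2] at hi
          refine ⟨by omega, by omega, ?_⟩
          have e : x = (x + ((ϖ ^ n : Fˣ) : F) * t i) + -(((ϖ ^ n : Fˣ) : F) * t i) := by ring
          rw [e]
          refine (IsUltrametricDist.norm_add_le_max _ _).trans (max_le (hsupp _ hi) ?_)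
          rw [norm_neg, norm_mul, norm_zpow_unit]
          refine (mul_le_of_le_one_right (zpow_nonneg (norm_nonneg _) _) (hsp.le_one i)).trans ?_
          exact (zpow_norm_le_iff hϖ).2 (by omega)
      · obtain ⟨h3, -, h5⟩ := hM n x hun
        exact ⟨h3, by omega, h5⟩
    have := Submodule.add_mem _ hmem (⟨f', rfl⟩ : φ.subScalar a f' ∈ φ.range a)
    rwa [sub_add_cancel] at this

include hρ hφ hφ0 hsp hcov in
/-- An invariant norm on the cokernel of `T - a` gives one on the tensor product with the
unramified principal series. -/
theorem admitsInvariantNorm_tprod (hl : l₁ ≠ l₂) {a : C}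
    (ha : (l₁ : C) + Fintype.card I * l₂ = a) (hS : S ^ 2 = l₁ * l₂)
    (hnorm : AdmitsInvariantNorm (φ.quotRep a)) :
    AdmitsInvariantNorm (ρ.tprod (piRep (ϖ : F) l₁ l₂)) := by
  have hle : φ.range a ≤ LinearMap.ker (sphMap hϖ hS) := by
    rintro _ ⟨f, rfl⟩
    exact sphMap_subScalar hϖ hS hρ hφ hφ0 hsp hcov ha f
  let E := (φ.range a).liftQ (sphMap hϖ hS) hle
  have hE : Function.Bijective E := by
    constructor
    · rw [← LinearMap.ker_eq_bot, Submodule.ker_liftQ_eq_bot]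
      intro f hf
      obtain ⟨M, J, hMJ⟩ := exists_support_bound hϖ (cosetEquiv (KZ F) ρ' f)
      exact mem_range_of_sphMap_eq_zero hϖ hS hρ hφ hφ0 hsp hcov hl ha M J f hf hMJ
    · intro w
      obtain ⟨f, rfl⟩ := sphMap_surjective hϖ hS hsp hcov hl (ρ' := ρ') w
      exact ⟨(φ.range a).mkQ f, rfl⟩
  let e := LinearEquiv.ofBijective E hE
  refine hnorm.of_equiv e.symm fun g w => ?_
  rw [LinearEquiv.symm_apply_eq]
  obtain ⟨v, rfl⟩ := e.surjective w
  rw [LinearEquiv.symm_apply_apply]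
  obtain ⟨f, rfl⟩ := Submodule.mkQ_surjective _ v
  exact (sphMap_equivariant hϖ hS hρ g f).symm

end kernel

end BreuilSchneider

end

/-! ### Assembly. -/

noncomputable section

namespace BreuilSchneider

section final

variable {p : ℕ} [Fact p.Prime] {F C : Type*}
    [NormedField F] [IsUltrametricDist F] [NormedAlgebra ℚ_[p] F] [FiniteDimensional ℚ_[p] F]
    [NormedField C] [IsUltrametricDist C] [NormedAlgebra ℚ_[p] C] [FiniteDimensional ℚ_[p] C]

/-- The local twists combine into the single character `S ^ (-v (det g))` with `S = ∏ s τ ^ k τ`,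
which is the form needed for `sphMap`. -/
lemma rhoTwTensor_eq_smul {ϖ : Fˣ} (hϖ : IsUniformizer (ϖ : F)) (s : (F →ₐ[ℚ_[p]] C) → Cˣ)
    (k : (F →ₐ[ℚ_[p]] C) → ℕ) (g : GL (Fin 2) F) :
    rhoTwTensor hϖ s k g =
      (((∏ τ, s τ ^ k τ : Cˣ) ^ (-ord (ϖ : F) (g : Matrix (Fin 2) (Fin 2) F).det) : Cˣ) : C) •
        rhoTensor k g := by
  rw [rhoTwTensor_apply, ← Units.coe_prod]
  congr 2
  refine Eq.trans (Finset.prod_congr rfl fun τ _ => ?_)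
    (Finset.prod_zpow (fun τ => s τ ^ k τ) Finset.univ _)
  change (s τ ^ (-ord (ϖ : F) (g : Matrix (Fin 2) (Fin 2) F).det)) ^ k τ = _
  rw [← zpow_natCast, ← zpow_natCast, zpow_comm]

lemma mem_doubleCoset_of_heckePsi_ne_zero {ϖ : Fˣ} (hϖ : IsUniformizer (ϖ : F)) (s : (F →ₐ[ℚ_[p]] C) → Cˣ)
    (k : (F →ₐ[ℚ_[p]] C) → ℕ) {g : GL (Fin 2) F}
    (hg : (heckePsi hϖ s k).toFun g ≠ 0) :
    g ∈ DoubleCoset.doubleCoset (alpha hϖ)⁻¹ (KZ F : Set (GL (Fin 2) F)) (KZ F) := by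
  by_contra h
  exact hg (if_neg h)


/-- If `Π_{k,a}` admits an invariant norm, then so does `ρ_k ⊗ π`. -/
lemma admitsInvariantNorm_rhoTensor_tprod {ϖ : Fˣ} (hϖ : IsUniformizer (ϖ : F))
    (s : (F →ₐ[ℚ_[p]] C) → Cˣ) (k : (F →ₐ[ℚ_[p]] C) → ℕ) {l₁ l₂ : Cˣ} {I : Type*} [Fintype I]
    {t : I → F} (hsp : Spread t) (hcov : ∀ x : F, ‖x‖ ≤ 1 → ∃ i, ‖x - t i‖ < 1) (hl : l₁ ≠ l₂)
    {a : C} (ha : (l₁ : C) + Fintype.card I * l₂ = a)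
    (hS : (∏ τ, s τ ^ k τ : Cˣ) ^ 2 = l₁ * l₂) (hnorm : AdmitsInvariantNorm (PiRep hϖ s k a)) :
    AdmitsInvariantNorm ((rhoTensor k).tprod (piRep (ϖ : F) l₁ l₂)) := by
  have key := admitsInvariantNorm_tprod hϖ (V := Vk k) (S := ∏ τ, s τ ^ k τ) (l₁ := l₁) (l₂ := l₂)
    (ρ := rhoTensor k) (ρ' := rhoTwTensor hϖ s k) (rhoTwTensor_eq_smul hϖ s k)
    (φ := heckePsi hϖ s k) (fun g hg => by rw [heckePsi_of_mem hϖ s hg]; simp)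
    (fun g hg => mem_doubleCoset_of_heckePsi_ne_zero hϖ s k hg) hsp hcov hl ha hS hnorm
  exact key
end final
end BreuilSchneider
end

theorem mainTheorem1 (p : ℕ) [Fact p.Prime] (F C : Type*)
    [NormedField F] [IsUltrametricDist F] [NormedAlgebra ℚ_[p] F] [FiniteDimensional ℚ_[p] F]
    [NormedField C] [IsUltrametricDist C] [NormedAlgebra ℚ_[p] C] [FiniteDimensional ℚ_[p] C]
    (hS : Nat.card (F →ₐ[ℚ_[p]] C) = Module.finrank ℚ_[p] F)
    (ϖ : F) (hϖ : BreuilSchneider.IsUniformizer ϖ)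
    (s : (F →ₐ[ℚ_[p]] C) → Cˣ) (hs : ∀ σ, (s σ : C) ^ 2 = σ ϖ)
    (k : (F →ₐ[ℚ_[p]] C) → ℕ) (σ : F →ₐ[ℚ_[p]] C) (hσ : ∀ τ, k τ ≠ 0 ↔ τ = σ)
    (q e d r : ℕ) (hq : q = BreuilSchneider.residueCard F)
    (he : (e : ℤ) = BreuilSchneider.ord ϖ (p : F))
    (hk : k σ = d * q + r) (hr : r < q) (a : C)
    (hcond :
      ((k σ : ℝ) ≤ (q : ℝ) ^ 2 / 2 ∧ (r : ℤ) < (q : ℤ) - d ∧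
        0 ≤ BreuilSchneider.vF ϖ a ∧ BreuilSchneider.vF ϖ a ≤ 1) ∨
      ((k σ : ℝ) ≤ (q : ℝ) ^ 2 / 2 ∧ 2 * BreuilSchneider.vF ϖ a - 1 ≤ (r : EReal) ∧
        (r : ℤ) < (q : ℤ) - d ∧
        1 ≤ BreuilSchneider.vF ϖ a ∧ BreuilSchneider.vF ϖ a ≤ (e : EReal)) ∨
      ((k σ : ℝ) ≤ min ((p : ℝ) * q - 1) ((q : ℝ) ^ 2 / 2) ∧ (d : ℤ) - 1 ≤ r ∧
        (d : EReal) ≤ BreuilSchneider.vF ϖ a)) :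
    (BreuilSchneider.IsLattice (BreuilSchneider.Theta hϖ s k a) ∧
      BreuilSchneider.IsSeparated (BreuilSchneider.Theta hϖ s k a)) ∧
    BreuilSchneider.AdmitsInvariantNorm (BreuilSchneider.PiRep hϖ s k a) ∧
    ∀ l₁ l₂ : Cˣ, (l₁ : C) * l₂ = ∏ τ : F →ₐ[ℚ_[p]] C, τ ϖ ^ k τ → (l₁ : C) + q * l₂ = a →
      (l₁ : C) * (l₂ : C)⁻¹ ≠ (q : C) ^ 2 → (l₁ : C) * (l₂ : C)⁻¹ ≠ 1 →
      BreuilSchneider.AdmitsInvariantNorm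
        ((BreuilSchneider.rhoTensor k).tprod (BreuilSchneider.piRep ϖ l₁ l₂)) := by
  obtain ⟨ϖ, rfl⟩ : ∃ u : Fˣ, (u : F) = ϖ := ⟨Units.mk0 ϖ hϖ.ne_zero, rfl⟩
  obtain ⟨_, t, S, hcov⟩ := BreuilSchneider.exists_residueSystem p hϖ
  rw [← hq] at S
  have h0 : (0 : EReal) ≤ BreuilSchneider.vF (ϖ : F) a := by
    rcases hcond with h | h | h
    · exact h.2.2.1
    · exact zero_le_one.trans h.2.2.2.1
    · exact le_trans (by positivity) h.2.2
  have ha : ‖a‖ ≤ 1 := by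
    rw [show (0 : EReal) = ((0 : ℕ) : EReal) by simp, BreuilSchneider.natCast_le_vF_iff hϖ,
      pow_zero] at h0
    exact h0
  obtain ⟨B, hB⟩ := BreuilSchneider.exists_cone_bound hϖ σ he
    (Nat.pos_of_ne_zero ((hσ σ).2 rfl)) hk hr a hcond (S.map σ)
  have hlat := BreuilSchneider.isLattice_Theta hσ hϖ hs a
  -- The bound is replaced by `max B 0` because the truncation argument needs it nonnegative.
  have hsep := BreuilSchneider.isSeparated_Theta hσ hϖ hs S hcov ha (le_max_right B 0)
    fun P hP u => (hB P hP u).mono (le_max_left _ _)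
  have hnorm : BreuilSchneider.AdmitsInvariantNorm (BreuilSchneider.PiRep hϖ s k a) :=
    BreuilSchneider.admitsInvariantNorm_of_lattice hlat hsep
      (fun g v hv => BreuilSchneider.quotRep_mem_integralImage _ a _ g hv)
      ⟨σ ϖ, (map_ne_zero σ).2 ϖ.ne_zero, by
        rw [BreuilSchneider.norm_algHom]
        exact hϖ.norm_lt_one⟩
  refine ⟨⟨hlat, hsep⟩, hnorm, fun l₁ l₂ hprod hsum _ hne => ?_⟩
  have hl : l₁ ≠ l₂ := by
    rintro rfl
    exact hne (mul_inv_cancel₀ l₁.ne_zero)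
  refine BreuilSchneider.admitsInvariantNorm_rhoTensor_tprod hϖ s k S.spread hcov hl ?_ ?_ hnorm
  · rw [S.card]
    exact hsum
  -- The square of `S = ∏ s τ ^ k τ` is `∏ τ ϖ ^ k τ`, the prescribed value of `l₁ l₂`.
  · refine Units.ext ?_
    rw [Units.val_pow_eq_pow_val, Units.val_mul, hprod, Units.coe_prod, ← Finset.prod_pow]
    refine Finset.prod_congr rfl fun τ _ => ?_
    rw [Units.val_pow_eq_pow_val, ← hs, ← pow_mul, ← pow_mul, mul_comm]
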